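/- Let $d\ge 1$, $T>0$, $D>0$ and $M(\xi)=(2\pi D)^{-d/2}e^{-|\xi|^2/(2D)}$ on $\mathbb R^d$. Kernels. Let $\omega^S\ge 0$ be in $W^{4,\infty}(\mathbb R^d)\cap L^1(\mathbb R^d)$ with $\int\omega^S=1$, $\int y\,\omega^S(y)\,dy=0$, $\int|y|^2\omega^S(y)\,dy<\infty$. Let $\omega^L\ge0$ be smooth, even and compactly supported, with $\int\omega^L=1$, $\int y\,\omega^L(y)\,dy=0$, $\int y_iy_j\,\omega^L(y)\,dy=\delta\,\delta_{i,j}$ for some $\delta>0$ and $\int|y|^3\omega^L(y)\,dy<\infty$; put $\omega^L_\alpha(x)=\alpha^{-d}\omega^L(x/\alpha)$. Initial datum. Let $f^0\ge 0$ be a measurable function on $\mathbb R^d\times\mathbb R^d$, $\varrho^0=\int f^0\,d\xi$, with $$\int_{\mathbb R^{2d}}(1+|x|+|\xi|^2+|\log f^0|)\,f^0\,dx\,d\xi<\infty,\qquad \sup_{0<\alpha\le1}\frac1{\alpha^2}\int_{\mathbb R^{2d}}\omega^L_\alpha(y)\,[\varrho^0\star\omega^S(x)-\varrho^0\star\omega^S(x-y)]^2\,dx\,dy<\infty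 .$$ Equation. For $\varepsilon\in(0,1)$ and $\alpha\in(0,1]$, let $f_\varepsilon\ge0$ be a solution on $(0,T)\times\mathbb R^d\times\mathbb R^d$, in the class $L^\infty(0,T;L^1(\mathbb R^{2d}))$ and in the sense of distributions (with test functions in $C_c^\infty([0,T)\times\mathbb R^{2d})$, so that the initial condition is included), of $$\varepsilon^2\partial_tf_\varepsilon+\varepsilon\,\xi\cdot\nabla_xf_\varepsilon+\varepsilon F_\varepsilon\cdot\nabla_\xi f_\varepsilon=\varrho_\varepsilon M-f_\varepsilon,\qquad f_\varepsilon(0,\cdot,\cdot)=f^0,\qquad \varrho_\varepsilon(t,x)=\int f_\varepsilon(t,x,\xi)\,d\xi,$$ $$F_\varepsilon=-\nabla\Phi^S_\varepsilon-\nabla\Phi^L_\varepsilon,\qquad \Phi^S_\varepsilon=\frac1{\alpha^2}\,\omega^S\star\omega^S\star\varrho_\varepsilon,\qquad \Phi^L_\varepsilon=-\frac1{\alpha^2}\,\omega^L_\alpha\star\omega^S\star\omega^S\star\varrho_\varepsilon,$$ where the convolutions and $\nabla=\nabla_x$ are in the variable $x$. The flux is $J_\varepsilon(t,x)=\int\frac{\xi}{\varepsilon}f_\varepsilon(t,x,\xi)\,d\xi$.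 Theorem. There is a constant $C$, depending only on $d,T,D,\omega^S,\omega^L,f^0$ (not on $\varepsilon$, $\alpha$ or the solution), such that for all $\varepsilon\in(0,1)$, all $\alpha\in(0,1]$ and every such solution $f_\varepsilon$, the following quantities are bounded by $C$: - (A) the norms of $f_\varepsilon$ in $L^\infty_tL^1_{x,\xi}$ and of $\varrho_\varepsilon$ in $L^\infty_tL^1_x$; - (B) the norms of $f_\varepsilon|\log f_\varepsilon|$ and $f_\varepsilon|\xi|^2$ in $L^\infty_tL^1_{x,\xi}$; - (C) the norm of $\varrho_\varepsilon|\log\varrho_\varepsilon|$ in $L^\infty_tL^1_x$; - (D) the norm of $\varepsilon^{-2}(\varrho_\varepsilon M-f_\varepsilon)(\log(\varrho_\varepsilon M)-\log f_\varepsilon)$ in $L^1_{t,x,\xi}$ (this function is $0$ where both $\varrho_\varepsilon M$ and $f_\varepsilon$ vanish and $+\infty$ where exactly one of them vanishes); - (E) the norm of $(\varrho_\varepsilon M-f_\varepsilon)/\varepsilon$ in $L^1_{t,x,\xi}$; - (F) the norms of $J_\varepsilon$ and of $|J_\varepsilon|\,\bigl(\log\bigl((\log\max(|J_\varepsilon|,e))^{1/2}\bigr)\bigr)^{1/2}$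 in $L^1_{t,x}$; - (G) the norms of $f_\varepsilon|x|$ in $L^\infty_tL^1_{x,\xi}$ and of $\varrho_\varepsilon|x|$ in $L^\infty_tL^1_x$. Here $t$ ranges over $(0,T)$ and $x,\xi$ over $\mathbb R^d$. Moreover, the families $\{\varrho_\varepsilon\}$ and $\{J_\varepsilon\}$, taken over all $\varepsilon\in(0,1)$, all $\alpha\in(0,1]$ and all such solutions, are relatively weakly compact in $L^1((0,T)\times\mathbb R^d)$: every sequence in the family has a subsequence converging weakly in $L^1$ (i.e. against every function of $L^\infty$) to an element of $L^1$. -/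

import Mathlib

open MeasureTheory Set Filter Topology
open scoped NNReal ENNReal Convolution ContDiff

noncomputable section

namespace VCH

/-- The space `ℝ^d` with its Euclidean norm, used for positions `x` and velocities `ξ`. -/
abbrev E (d : ℕ) : Type := EuclideanSpace ℝ (Fin d)

variable {d : ℕ}

/-- The space-time measure `dt dx` on `(0,T) × ℝ^d`. -/
def timeSpace (d : ℕ) (T : ℝ) : Measure (ℝ × E d) :=
  (volume.restrict (Ioo 0 T)).prod volume

/-- The measure `dt dx dξ` on `(0,T) × ℝ^d × ℝ^d`. -/
def timePhase (d : ℕ) (T : ℝ) : Measure (ℝ × E d × E d) :=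
  (volume.restrict (Ioo 0 T)).prod volume

/-- The Maxwellian `M(ξ) = (2πD)^{-d/2} exp(-|ξ|²/(2D))`. -/
def maxwellian (D : ℝ) (ξ : E d) : ℝ :=
  (1 / (2 * Real.pi * D)) ^ ((d : ℝ) / 2) * Real.exp (-(‖ξ‖ ^ 2 / (2 * D)))

/-- Assumptions on the short-range kernel `ω^S`: it is nonnegative, has unit mass, zero mean and
finite second moment, and lies in `W^{4,∞}`, that is, it is `C³`, bounded with its derivatives up
to order three, and its third derivative is Lipschitz. -/
structure IsShortRangeKernel (w : E d → ℝ) : Prop where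
  nonneg : ∀ y, 0 ≤ w y
  contDiff : ContDiff ℝ 3 w
  bounded : ∃ K : ℝ, ∀ k : ℕ, k ≤ 3 → ∀ y, ‖iteratedFDeriv ℝ k w y‖ ≤ K
  lipschitz : ∃ K : ℝ≥0, LipschitzWith K (iteratedFDeriv ℝ 3 w)
  integrable : Integrable w
  integral_eq_one : ∫ y, w y = 1
  mean_eq_zero : ∫ y, w y • y = 0
  secondMoment : Integrable (fun y => ‖y‖ ^ 2 * w y)

/-- Assumptions on the long-range kernel `ω^L`: smooth, nonnegative, symmetric, compactly
supported, with unit mass, zero mean, covariance `δ · Id` with `δ > 0`, finite third moment. -/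
structure IsLongRangeKernel (w : E d → ℝ) (δ : ℝ) : Prop where
  delta_pos : 0 < δ
  contDiff : ContDiff ℝ ∞ w
  nonneg : ∀ y, 0 ≤ w y
  symmetric : ∀ y, w (-y) = w y
  compactSupport : HasCompactSupport w
  integral_eq_one : ∫ y, w y = 1
  mean_eq_zero : ∫ y, w y • y = 0
  covariance : ∀ i j : Fin d, ∫ y : E d, y i * y j * w y = if i = j then δ else 0
  thirdMoment : Integrable (fun y => w y * ‖y‖ ^ 3)

/-- The rescaled kernel `ω_α(x) = α^{-d} ω(x/α)`. -/
def rescale (α : ℝ) (w : E d → ℝ) (x : E d) : ℝ :=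
  1 / α ^ d * w (α⁻¹ • x)

/-- The macroscopic density `∫ g(x,ξ) dξ` of a phase-space density `g`. -/
def density (g : E d → E d → ℝ) (x : E d) : ℝ :=
  ∫ ξ, g x ξ

/-- The flux `∫ (ξ/ε) g(x,ξ) dξ`. -/
def flux (ε : ℝ) (g : E d → E d → ℝ) (x : E d) : E d :=
  ∫ ξ, (g x ξ / ε) • ξ

/-- The short-range potential `Φ^S = α⁻² ω^S ⋆ ω^S ⋆ ρ`. -/
def potentialS (α : ℝ) (ωS ρ : E d → ℝ) (x : E d) : ℝ :=
  1 / α ^ 2 * (ωS ⋆ (ωS ⋆ ρ)) x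

/-- The long-range potential `Φ^L = -α⁻² ω^L_α ⋆ ω^S ⋆ ω^S ⋆ ρ`. -/
def potentialL (α : ℝ) (ωL ωS ρ : E d → ℝ) (x : E d) : ℝ :=
  -(1 / α ^ 2 * (rescale α ωL ⋆ (ωS ⋆ (ωS ⋆ ρ))) x)

/-- The force field `F = F^L + F^S = -∇Φ^L - ∇Φ^S` generated by the density `ρ`. -/
def force (α : ℝ) (ωL ωS ρ : E d → ℝ) (x : E d) : E d :=
  -gradient (potentialL α ωL ωS ρ) x - gradient (potentialS α ωS ρ) x

/-- Assumptions on the initial datum: nonnegative, with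
`∫ (1 + |x| + |ξ|² + |log f⁰|) f⁰ dx dξ < ∞`. -/
structure IsInitialDatum (f0 : E d → E d → ℝ) : Prop where
  measurable : Measurable (fun p : E d × E d => f0 p.1 p.2)
  nonneg : ∀ x ξ, 0 ≤ f0 x ξ
  integrable : Integrable (fun p : E d × E d =>
    (1 + ‖p.1‖ + ‖p.2‖ ^ 2 + |Real.log (f0 p.1 p.2)|) * f0 p.1 p.2)

/-- `α⁻² ∫∫ ω^L_α(y) [(ρ ⋆ ω^S)(x) - (ρ ⋆ ω^S)(x-y)]² dx dy`, as an extended nonnegative real. -/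
def interactionEnergy (α : ℝ) (ωL ωS ρ : E d → ℝ) : ℝ≥0∞ :=
  ENNReal.ofReal (1 / α ^ 2) * ∫⁻ p : E d × E d,
    ENNReal.ofReal (rescale α ωL p.2 * ((ρ ⋆ ωS) p.1 - (ρ ⋆ ωS) (p.1 - p.2)) ^ 2)

/-- `f` is a nonnegative solution on `(0,T)`, in the sense of distributions and in the class
`L^∞(0,T; L¹(ℝ^d × ℝ^d))`, of
`ε² ∂ₜf + ε ξ·∇ₓf + ε F·∇_ξ f = ρ M - f`, `ρ = ∫ f dξ`, `f(0) = f0`.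
Test functions are the (restrictions to `t ≥ 0` of) smooth functions with compact support in
`(-∞,T) × ℝ^d × ℝ^d`, and the derivative of `φ` below in the direction `(ε², ε ξ, ε F)` is
`ε² ∂ₜφ + ε ξ·∇ₓφ + ε F·∇_ξ φ`. -/
structure IsSolution (T D ε α : ℝ) (ωL ωS : E d → ℝ) (f0 : E d → E d → ℝ)
    (f : ℝ → E d → E d → ℝ) : Prop where
  measurable : Measurable (fun p : ℝ × E d × E d => f p.1 p.2.1 p.2.2)
  nonneg : ∀ t x ξ, 0 ≤ f t x ξ
  bounded : ∃ K : ℝ≥0, ∀ᵐ t ∂(volume.restrict (Ioo 0 T)),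
    ∫⁻ p : E d × E d, ENNReal.ofReal (f t p.1 p.2) ≤ K
  weak : ∀ φ : ℝ × E d × E d → ℝ, ContDiff ℝ ∞ φ → HasCompactSupport φ →
    tsupport φ ⊆ Iio T ×ˢ univ →
    (∫ p, (f p.1 p.2.1 p.2.2 *
          fderiv ℝ φ p (ε ^ 2, ε • p.2.2, ε • force α ωL ωS (density (f p.1)) p.2.1)
        + (density (f p.1) p.2.1 * maxwellian D p.2.2 - f p.1 p.2.1 p.2.2) * φ p)
        ∂(timePhase d T))
      + ε ^ 2 * ∫ q : E d × E d, f0 q.1 q.2 * φ (0, q.1, q.2) = 0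

/-- `(a - b)(log a - log b)` for `a, b ≥ 0`, with the conventions `log 0 = -∞` and value `0` at
`a = b = 0`: the value is `+∞` when exactly one of `a`, `b` vanishes. -/
def entropyProduction (a b : ℝ) : ℝ≥0∞ :=
  open Classical in
  if (a = 0 ↔ b = 0) then ENNReal.ofReal ((a - b) * (Real.log a - Real.log b)) else ⊤

/-- The function `log^{1/2} log^{1/2} max(s,e)`, with `log^{1/2} s = (log s)^{1/2}`. -/
def sqrtLogSqrtLog (s : ℝ) : ℝ :=
  √(Real.log (√(Real.log (max s (Real.exp 1)))))

/-- Relative weak (sequential) compactness in `L¹(μ)` of a set `S` of functions: all members are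
in `L¹`, and every sequence in `S` has a subsequence which converges weakly in `L¹` (that is,
against every function of `L^∞`) to some element of `L¹`. -/
def IsWeaklyPrecompactL1 {Ω G : Type*} [MeasurableSpace Ω] [NormedAddCommGroup G]
    [NormedSpace ℝ G] (μ : Measure Ω) (S : Set (Ω → G)) : Prop :=
  (∀ u ∈ S, Integrable u μ) ∧
  ∀ u : ℕ → Ω → G, (∀ n, u n ∈ S) →
    ∃ σ : ℕ → ℕ, StrictMono σ ∧ ∃ v : Ω → G, Integrable v μ ∧
      ∀ ψ : Ω → ℝ, MemLp ψ ⊤ μ →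
        Tendsto (fun n => ∫ z, ψ z • u (σ n) z ∂μ) atTop (𝓝 (∫ z, ψ z • v z ∂μ))

/-- The estimates on one solution `f`, with bound `C`. -/
structure UniformEstimates (T D ε : ℝ) (f : ℝ → E d → E d → ℝ) (C : ℝ≥0) : Prop where
  mass_f : ∀ᵐ t ∂(volume.restrict (Ioo 0 T)),
    ∫⁻ p : E d × E d, ENNReal.ofReal (f t p.1 p.2) ≤ C
  mass_rho : ∀ᵐ t ∂(volume.restrict (Ioo 0 T)),
    ∫⁻ x, ENNReal.ofReal (density (f t) x) ≤ C
  entropy_f : ∀ᵐ t ∂(volume.restrict (Ioo 0 T)),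
    ∫⁻ p : E d × E d, ENNReal.ofReal (f t p.1 p.2 * |Real.log (f t p.1 p.2)|) ≤ C
  kinetic : ∀ᵐ t ∂(volume.restrict (Ioo 0 T)),
    ∫⁻ p : E d × E d, ENNReal.ofReal (f t p.1 p.2 * ‖p.2‖ ^ 2) ≤ C
  entropy_rho : ∀ᵐ t ∂(volume.restrict (Ioo 0 T)),
    ∫⁻ x, ENNReal.ofReal (density (f t) x * |Real.log (density (f t) x)|) ≤ C
  dissipation : ∫⁻ p, ENNReal.ofReal (1 / ε ^ 2) *
      entropyProduction (density (f p.1) p.2.1 * maxwellian D p.2.2) (f p.1 p.2.1 p.2.2)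
      ∂(timePhase d T) ≤ C
  deviation : ∫⁻ p, ENNReal.ofReal
      |(density (f p.1) p.2.1 * maxwellian D p.2.2 - f p.1 p.2.1 p.2.2) / ε|
      ∂(timePhase d T) ≤ C
  flux_L1 : ∫⁻ p, ENNReal.ofReal ‖flux ε (f p.1) p.2‖ ∂(timeSpace d T) ≤ C
  flux_log : ∫⁻ p, ENNReal.ofReal
      (‖flux ε (f p.1) p.2‖ * sqrtLogSqrtLog ‖flux ε (f p.1) p.2‖) ∂(timeSpace d T) ≤ C
  position_f : ∀ᵐ t ∂(volume.restrict (Ioo 0 T)),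
    ∫⁻ p : E d × E d, ENNReal.ofReal (f t p.1 p.2 * ‖p.1‖) ≤ C
  position_rho : ∀ᵐ t ∂(volume.restrict (Ioo 0 T)),
    ∫⁻ x, ENNReal.ofReal (density (f t) x * ‖x‖) ≤ C

end VCH

end

noncomputable section

namespace VCH

section

/-! ### Functions of time -/

/-! The key point is a bound on the force that is uniform in α. The force is the convolution of ω^S
⋆ ρ with the kernel α⁻²(ω^L_α ⋆ ∇ω^S − ∇ω^S). Because ω^L is even, the difference is half the mean,
against ω^L_α(y), of the second differences of ∇ω^S with step y. These are O(|y|²), since the third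
derivative of ω^S is bounded, and their mean is O(α²), which cancels the singular factor. Hence |F|
≤ B with B depending only on the kernels and the mass (`exists_force_bound`), and the equation may
be treated as a kinetic equation with a given force, bounded and Lipschitz in x (`IsKinetic`).

Formally, the estimates then run as follows. Mass is conserved. Relaxation damps the kinetic energy
at rate ε⁻², which dominates the work of the force, of size ε⁻¹; the energy therefore stays below a
threshold independent of ε (`ae_energy_le`). The first moment in x grows by at most the L¹ norm of
J. In the entropy relative to M, the force contributes ε⁻¹ ∫ F·ξ f / D. Since Mξ has zero mean, f
may be replaced there by f − ρM, and (a − b)² ≤ (a − b)(log a − log b)(a + b) together with Young's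
inequality absorbs this term into half of the dissipation, up to second moments in ξ
(`ae_entropy_rate_le`). Finally |J|² ≤ C Δ ρ at almost every (t,x), where Δ is the local dissipation
(`sq_norm_flux_le`). The entropy is bounded below by minus the moment in x, so the dissipation is at
most C + 2∫|J|, while ∫|J| is at most C plus a quarter of the dissipation: the loop closes in
`dissipation_toReal_le`. The remaining bounds follow from these.

Since f is only an L¹ solution in the sense of distributions, these computations are justified by
renormalization. The phase-space field (ξ/ε, F/ε) is Lipschitz and divergence free, so the
commutators of transport and mollification vanish in L¹ (`tendsto_lintegral_commutator`). This gives
the equation for Γ(ξ,f) when Γ has bounded derivative in f (`IsTransport.renormalized`,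
`IsTransport.renormalized_of_bounded`). Energy, position and entropy are truncated accordingly, and
Fatou's lemma removes the truncations.

For weak compactness, ρ has uniformly small mass where ρ or |x| is large, by the entropy and
position bounds, and so has |J| by |J|² ≤ CΔρ. Away from that set both families are bounded in L² of
a set of finite measure, so weak compactness in Hilbert spaces and a diagonal argument apply
(`exists_subseq_tendsto_integral_smul`). -/

theorem ae_eq_primitive_of_weak {T a₀ : ℝ} (hT : 0 < T) {a b : ℝ → ℝ}
    (ha : IntegrableOn a (Ioo 0 T)) (hb : IntegrableOn b (Ioo 0 T))
    (h : ∀ θ : ℝ → ℝ, ContDiff ℝ ∞ θ → HasCompactSupport θ → tsupport θ ⊆ Iio T →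
      (∫ t in Ioo 0 T, (a t * deriv θ t + b t * θ t)) + a₀ * θ 0 = 0) :
    ∀ᵐ t ∂(volume.restrict (Ioo 0 T)), a t = a₀ + ∫ s in (0 : ℝ)..t, b s := by
  have hbi : IntervalIntegrable b volume 0 T := by
    rw [intervalIntegrable_iff_integrableOn_Ioo_of_le hT.le]; exact hb
  set B : ℝ → ℝ := fun t => a₀ + ∫ s in (0 : ℝ)..t, b s with hB
  have hBac : AbsolutelyContinuousOnInterval B 0 T := by
    refine AbsolutelyContinuousOnInterval.add (f := fun _ => a₀) ?_ ?_
    · exact ((LipschitzWith.const a₀).lipschitzOnWith).absolutelyContinuousOnInterval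
    · exact hbi.absolutelyContinuousOnInterval_intervalIntegral (by simp)
  have hBd : ∀ᵐ t, t ∈ uIcc 0 T → HasDerivAt B (b t) t := by
    filter_upwards [hbi.ae_hasDerivAt_integral] with t ht htT
    exact (ht htT 0 (by simp)).const_add a₀
  have hBint : IntegrableOn B (Ioo 0 T) :=
    (hBac.continuousOn.integrableOn_compact isCompact_uIcc).mono_set
      (by rw [uIcc_of_le hT.le]; exact Ioo_subset_Icc_self)
  have key := isOpen_Ioo.ae_eq_zero_of_integral_contDiff_smul_eq_zero
    (U := Ioo 0 T) (μ := volume) (f := fun t => a t - B t) (ha.sub hBint).locallyIntegrableOn ?_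
  · rw [ae_restrict_iff' measurableSet_Ioo]
    filter_upwards [key] with t ht htT
    have := ht htT
    simp only [hB] at this; linarith
  intro g hg hgc hgs
  obtain ⟨T', hT', hgT'⟩ : ∃ T' < T, ∀ t, T' ≤ t → g t = 0 := by
    rcases (tsupport g).eq_empty_or_nonempty with he | hne
    · exact ⟨T - 1, by linarith, fun t _ => by
        rw [tsupport_eq_empty_iff] at he; simp [he]⟩
    · obtain ⟨m, hm, hmax⟩ := hgc.isCompact.exists_isMaxOn hne continuousOn_id
      have hmT : m < T := (hgs hm).2
      refine ⟨(m + T) / 2, by linarith, fun t ht => ?_⟩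
      by_contra h0
      have : t ≤ m := hmax (subset_tsupport g h0)
      linarith
  set θ₀ : ℝ → ℝ := fun t => ∫ s in T..t, g s with hθ₀
  have hθd : ∀ t, HasDerivAt θ₀ (g t) t := fun t =>
    (hg.continuous.integral_hasStrictDerivAt T t).hasDerivAt
  have hθsm : ContDiff ℝ ∞ θ₀ := by
    rw [contDiff_infty_iff_deriv]
    refine ⟨fun t => (hθd t).differentiableAt, ?_⟩
    rw [show deriv θ₀ = g from funext fun t => (hθd t).deriv]; exact hg
  have hθz : ∀ t, T' ≤ t → θ₀ t = 0 := by
    intro t ht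
    refine intervalIntegral.integral_zero_ae (Eventually.of_forall fun s hs => hgT' s ?_)
    rcases le_total T t with h1 | h1
    · rw [uIoc_of_le h1] at hs; linarith [hs.1]
    · rw [uIoc_of_ge h1] at hs; linarith [hs.1]
  -- To the left of the support of g the primitive is a constant, in general nonzero. The bump gives
  -- it compact support without changing it near [0,T]; its value at 0 is what brings in the initial
  -- datum.
  let κ : ContDiffBump (0 : ℝ) := ⟨T + 1, T + 2, by linarith, by linarith⟩
  have hκ1 : ∀ t ∈ Ioo (-(T + 1)) (T + 1), κ t = 1 := by
    intro t ht
    refine κ.one_of_mem_closedBall ?_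
    rw [mem_closedBall_zero_iff, Real.norm_eq_abs, abs_le]
    exact ⟨ht.1.le, ht.2.le⟩
  set θ : ℝ → ℝ := fun t => θ₀ t * κ t with hθ
  have hθ1 : ∀ t ∈ Ioo (-(T + 1)) (T + 1), θ t = θ₀ t := fun t ht => by
    simp [hθ, hκ1 t ht]
  have hder : ∀ t ∈ Ioo (-(T + 1)) (T + 1), HasDerivAt θ (g t) t := fun t ht =>
    (hθd t).congr_of_eventuallyEq (by
      filter_upwards [isOpen_Ioo.mem_nhds ht] with s hs using hθ1 s hs)
  have hθsm' : ContDiff ℝ ∞ θ := hθsm.mul κ.contDiff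
  have hw := h θ hθsm' κ.hasCompactSupport.mul_left ?_
  swap
  · have hsub : Function.support θ ⊆ Iic T' := by
      intro t ht
      by_contra h0
      exact ht (by simp [hθ, hθz t (not_le.mp h0).le])
    exact (closure_minimal hsub isClosed_Iic).trans (Iic_subset_Iio.mpr hT')
  have hθac : AbsolutelyContinuousOnInterval θ 0 T :=
    (hθsm'.contDiffOn.of_le (by simp)).absolutelyContinuousOnInterval
  have hparts := hBac.integral_mul_deriv_eq_deriv_mul hθac
  have hT0 : θ T = 0 := by rw [hθ1 T ⟨by linarith, by linarith⟩]; exact hθz T hT'.le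
  have hB0 : B 0 = a₀ := by simp [hB]
  have e1 : ∫ t in (0 : ℝ)..T, deriv B t * θ t = ∫ t in Ioo 0 T, b t * θ t := by
    rw [← integral_Ioc_eq_integral_Ioo, ← intervalIntegral.integral_of_le hT.le]
    refine intervalIntegral.integral_congr_ae ?_
    filter_upwards [hBd] with t ht htT
    rw [(ht (uIoc_subset_uIcc htT)).deriv]
  have hmem : ∀ t ∈ Ioo 0 T, t ∈ Ioo (-(T + 1)) (T + 1) := fun t ht =>
    ⟨by linarith [ht.1], by linarith [ht.2]⟩
  have e2 : ∫ t in (0 : ℝ)..T, B t * deriv θ t = ∫ t in Ioo 0 T, B t * g t := by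
    rw [intervalIntegral.integral_of_le hT.le, integral_Ioc_eq_integral_Ioo]
    exact setIntegral_congr_fun measurableSet_Ioo fun t ht => by
      simp only [(hder t (hmem t ht)).deriv]
  have hθb : ∃ C, ∀ t, ‖θ t‖ ≤ C :=
    (κ.hasCompactSupport.mul_left (f := θ₀)).exists_bound_of_continuous hθsm'.continuous
  obtain ⟨C, hC⟩ := hθb
  obtain ⟨Cg, hCg⟩ := hgc.exists_bound_of_continuous hg.continuous
  have i1 : IntegrableOn (fun t => b t * θ t) (Ioo 0 T) :=
    hb.mul_bdd hθsm'.continuous.aestronglyMeasurable (ae_of_all _ hC)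
  have i2 : IntegrableOn (fun t => a t * g t) (Ioo 0 T) :=
    ha.mul_bdd hg.continuous.aestronglyMeasurable (ae_of_all _ hCg)
  have i3 : IntegrableOn (fun t => B t * g t) (Ioo 0 T) :=
    hBint.mul_bdd hg.continuous.aestronglyMeasurable (ae_of_all _ hCg)
  have e3 : ∫ t in Ioo 0 T, (a t * deriv θ t + b t * θ t)
      = (∫ t in Ioo 0 T, a t * g t) + ∫ t in Ioo 0 T, b t * θ t := by
    rw [← integral_add i2 i1]
    exact setIntegral_congr_fun measurableSet_Ioo fun t ht => by
      simp only [(hder t (hmem t ht)).deriv]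
  have e4 : ∫ x, g x • (a x - B x) = ∫ t in Ioo 0 T, g t • (a t - B t) := by
    refine (setIntegral_eq_integral_of_forall_compl_eq_zero fun t ht => ?_).symm
    have : g t = 0 := by
      by_contra h0; exact ht (hgs (subset_tsupport g h0))
    simp [this]
  have e5 : ∫ t in Ioo 0 T, g t • (a t - B t)
      = (∫ t in Ioo 0 T, a t * g t) - ∫ t in Ioo 0 T, B t * g t := by
    rw [← integral_sub i2 i3]
    congr 1; ext t; simp only [smul_eq_mul]; ring
  rw [e1, e2, hT0, hB0] at hparts
  rw [e3] at hw
  rw [e4, e5, hparts]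
  linarith

/-- N is only measurable and bounded in time, so the primitive is Lipschitz rather than C¹. Its
composition with the Lipschitz function Γ is absolutely continuous, and the chain rule at almost
every time is enough to recover it. -/
theorem comp_primitive_eq {T t y₀ K : ℝ} (ht : t ∈ Icc 0 T) {N : ℝ → ℝ} {Γ A : ℝ → ℝ}
    (hN : IntervalIntegrable N volume 0 T) (hNb : ∀ᵐ s, s ∈ Ioo 0 T → |N s| ≤ K)
    (hΓ : ∀ s, HasDerivAt Γ (A s) s) {C : ℝ≥0} (hA : ∀ s, |A s| ≤ C) :
    Γ (y₀ + ∫ s in (0 : ℝ)..t, N s)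
      = Γ y₀ + ∫ s in (0 : ℝ)..t, A (y₀ + ∫ r in (0 : ℝ)..s, N r) * N s := by
  obtain ⟨ht0, htT⟩ := ht
  have hT0 : 0 ≤ T := ht0.trans htT
  set y : ℝ → ℝ := fun s => y₀ + ∫ r in (0 : ℝ)..s, N r with hy
  have hsub : ∀ {u v}, 0 ≤ u → u ≤ T → 0 ≤ v → v ≤ T → IntervalIntegrable N volume u v := by
    intro u v h1 h2 h3 h4
    refine hN.mono_set ?_
    rw [uIcc_of_le hT0]
    exact fun x hx => ⟨(le_min h1 h3).trans hx.1, hx.2.trans (max_le h2 h4)⟩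
  have hK : ∀ᵐ s, s ∈ Ioc 0 T → ‖N s‖ ≤ K := by
    have : ∀ᵐ s : ℝ, s ≠ T := by simp [ae_iff, measure_singleton]
    filter_upwards [hNb, this] with s hs h1 h2
    exact hs ⟨h2.1, lt_of_le_of_ne h2.2 h1⟩
  have hlip : LipschitzOnWith (Real.toNNReal K) y (uIcc 0 t) := by
    rw [uIcc_of_le ht0]
    refine LipschitzOnWith.of_dist_le_mul fun u hu v hv => ?_
    rw [Real.dist_eq, Real.dist_eq]
    simp only [hy, add_sub_add_left_eq_sub]
    rw [intervalIntegral.integral_interval_sub_left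
      (hsub le_rfl hT0 hu.1 (hu.2.trans htT)) (hsub le_rfl hT0 hv.1 (hv.2.trans htT))]
    have hle : ‖∫ r in v..u, N r‖ ≤ K * |u - v| := by
      refine intervalIntegral.norm_integral_le_of_norm_le_const_ae ?_
      filter_upwards [hK] with s hs h1
      refine hs ⟨(le_min hv.1 hu.1).trans_lt h1.1, h1.2.trans (max_le ?_ ?_)⟩
      exacts [hv.2.trans htT, hu.2.trans htT]
    exact hle.trans (mul_le_mul_of_nonneg_right (Real.le_coe_toNNReal K) (abs_nonneg _))
  have hΓlip : LipschitzWith C Γ := by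
    refine lipschitzWith_of_nnnorm_deriv_le (fun s => (hΓ s).differentiableAt) fun s => ?_
    rw [(hΓ s).deriv, ← NNReal.coe_le_coe, coe_nnnorm]; exact hA s
  have hac : AbsolutelyContinuousOnInterval (Γ ∘ y) 0 t :=
    (hΓlip.comp_lipschitzOnWith hlip).absolutelyContinuousOnInterval
  have h1 := hac.integral_deriv_eq_sub
  have h2 : ∫ s in (0 : ℝ)..t, deriv (Γ ∘ y) s = ∫ s in (0 : ℝ)..t, A (y s) * N s := by
    refine intervalIntegral.integral_congr_ae ?_
    filter_upwards [(hsub le_rfl hT0 ht0 htT).ae_hasDerivAt_integral] with s hs hst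
    have := (hs (uIoc_subset_uIcc hst) 0 (by simp)).const_add y₀
    exact ((hΓ (y s)).comp s this).deriv
  rw [h2] at h1
  have h3 : y 0 = y₀ := by simp [hy]
  simp only [Function.comp_apply, h3] at h1
  change Γ (y t) = _
  linarith

/-- After the last time at which the level M was respected, the rate is nonpositive, so M cannot be
exceeded. The bound obtained is insensitive to the size of q, which will be of order ε⁻². -/
theorem primitive_le_of_barrier {T y₀ M : ℝ} {q : ℝ → ℝ} (hq : IntervalIntegrable q volume 0 T)
    (h0 : y₀ ≤ M)
    (hle : ∀ᵐ s, s ∈ Ioo 0 T → M < (y₀ + ∫ r in (0 : ℝ)..s, q r) → q s ≤ 0)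
    {t : ℝ} (ht : t ∈ Ioo 0 T) : y₀ + ∫ r in (0 : ℝ)..t, q r ≤ M := by
  set y : ℝ → ℝ := fun s => y₀ + ∫ r in (0 : ℝ)..s, q r with hy
  by_contra! hcon
  have hT0 : 0 ≤ T := ht.1.le.trans ht.2.le
  have hcont : ContinuousOn y (Icc 0 T) := by
    have := intervalIntegral.continuousOn_primitive_interval' hq (a := 0) (by simp)
    rw [uIcc_of_le hT0] at this
    exact continuousOn_const.add this
  set S : Set ℝ := Icc 0 t ∩ y ⁻¹' Iic M with hS
  have hSc : IsClosed S :=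
    (hcont.mono (Icc_subset_Icc_right ht.2.le)).preimage_isClosed_of_isClosed isClosed_Icc
      isClosed_Iic
  have hSn : S.Nonempty := ⟨0, ⟨le_rfl, ht.1.le⟩, by simp [hy, h0]⟩
  have hSb : BddAbove S := ⟨t, fun x hx => hx.1.2⟩
  set r := sSup S with hr
  have hrS : r ∈ S := hSc.csSup_mem hSn hSb
  have hgt : ∀ s ∈ Ioc r t, M < y s := by
    intro s hs
    by_contra! h
    exact absurd (le_csSup hSb ⟨⟨hrS.1.1.trans hs.1.le, hs.2⟩, h⟩) (not_le.mpr hs.1)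
  have hsub : ∀ {u v}, 0 ≤ u → u ≤ T → 0 ≤ v → v ≤ T → IntervalIntegrable q volume u v := by
    intro u v h1 h2 h3 h4
    refine hq.mono_set ?_
    rw [uIcc_of_le hT0]
    exact fun x hx => ⟨(le_min h1 h3).trans hx.1, hx.2.trans (max_le h2 h4)⟩
  have hdiff : y t - y r = ∫ s in r..t, q s := by
    simp only [hy, add_sub_add_left_eq_sub]
    rw [intervalIntegral.integral_interval_sub_left
      (hsub le_rfl hT0 ht.1.le ht.2.le) (hsub le_rfl hT0 hrS.1.1 (hrS.1.2.trans ht.2.le))]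
  have hneg : ∫ s in r..t, q s ≤ 0 := by
    rw [intervalIntegral.integral_of_le hrS.1.2]
    refine setIntegral_nonpos_of_ae_restrict ?_
    rw [EventuallyLE, ae_restrict_iff' measurableSet_Ioc]
    filter_upwards [hle] with s hs h1
    exact hs ⟨hrS.1.1.trans_lt h1.1, h1.2.trans_lt ht.2⟩ (hgt s h1)
  have : y r ≤ M := hrS.2
  have : M < y t := hcon
  linarith

end

section

set_option linter.unusedSectionVars false

/-! ### Mollifiers -/

section Mollifier

variable {V : Type*} [NormedAddCommGroup V] [NormedSpace ℝ V] [FiniteDimensional ℝ V]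
  [MeasureSpace V] [BorelSpace V] [(volume : Measure V).IsAddHaarMeasure]

/-- Translations are continuous in `L¹`. -/
theorem tendsto_lintegral_translate {f : V → ℝ} (hf : Integrable f) :
    Tendsto (fun w : V => ∫⁻ z, ‖f (z - w) - f z‖ₑ) (𝓝 0) (𝓝 0) := by
  have hfL : MemLp f 1 := memLp_one_iff_integrable.mpr hf
  let F : Lp ℝ 1 (volume : Measure V) := hfL.toLp f
  let g : C(V, C(V, V)) := (ContinuousMap.mk (fun a : V × V => a.2 - a.1) (by fun_prop)).curry
  have hgm : ∀ w, MeasurePreserving (g w) (volume : Measure V) volume := fun w =>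
    measurePreserving_sub_right volume w
  have hc : Continuous fun w => Lp.compMeasurePreserving (g w) (hgm w) F :=
    continuous_const.compMeasurePreservingLp g.continuous hgm (by simp)
  have h1 : Tendsto (fun w => ‖Lp.compMeasurePreserving (g w) (hgm w) F - F‖ₑ) (𝓝 0) (𝓝 0) := by
    have h0 : Lp.compMeasurePreserving (g 0) (hgm 0) F = F := by
      ext1
      filter_upwards [Lp.coeFn_compMeasurePreserving F (hgm 0)] with z hz
      rw [hz]; simp [g]
    have := ((hc.sub continuous_const).enorm (f := fun w =>
      Lp.compMeasurePreserving (g w) (hgm w) F - F)).tendsto 0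
    rwa [h0, sub_self, enorm_zero] at this
  refine h1.congr fun w => ?_
  rw [Lp.enorm_def, eLpNorm_one_eq_lintegral_enorm]
  refine lintegral_congr_ae ?_
  have hF := hfL.coeFn_toLp
  filter_upwards [Lp.coeFn_sub (Lp.compMeasurePreserving (g w) (hgm w) F) F,
    Lp.coeFn_compMeasurePreserving F (hgm w), hF, (hgm w).quasiMeasurePreserving.ae hF]
    with z h1 h2 h3 h4
  rw [h1, Pi.sub_apply, h2, Function.comp_apply, h4, h3]
  simp [g]

/-- By Fubini the double integral is a mean of L¹ moduli of translation over |w| ≤ 2/(n+1). The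
kernels need bounded mass, not unit mass: the statement serves for mollification and, with kernel
|w| |∇moll(w)|, for the commutator. -/
theorem tendsto_lintegral_kernel {f : V → ℝ} (hf : Integrable f) {k : ℕ → V → ℝ≥0∞}
    (hk : ∀ n, Measurable (k n)) {C : ℝ≥0} (hkC : ∀ n, ∫⁻ w, k n w ≤ C)
    (hks : ∀ (n : ℕ) w, 2 / ((n : ℝ) + 1) < ‖w‖ → k n w = 0) :
    Tendsto (fun n => ∫⁻ z, ∫⁻ w, ‖f (z - w) - f z‖ₑ * k n w) atTop (𝓝 0) := by
  have hswap : ∀ n, ∫⁻ z, ∫⁻ w, ‖f (z - w) - f z‖ₑ * k n w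
      = ∫⁻ w, (∫⁻ z, ‖f (z - w) - f z‖ₑ) * k n w := by
    intro n
    rw [lintegral_lintegral_swap]
    · refine lintegral_congr fun w => ?_
      rw [lintegral_mul_const'']
      refine (AEStronglyMeasurable.sub ?_ hf.aestronglyMeasurable).enorm
      exact hf.aestronglyMeasurable.comp_measurePreserving (measurePreserving_sub_right volume w)
    · refine AEMeasurable.mul ?_ ((hk n).comp measurable_snd).aemeasurable
      refine (AEStronglyMeasurable.sub ?_ hf.aestronglyMeasurable.comp_fst).enorm
      exact hf.aestronglyMeasurable.comp_quasiMeasurePreserving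
        (quasiMeasurePreserving_sub volume volume)
  simp_rw [hswap]
  rw [ENNReal.tendsto_atTop_zero]
  intro ε hε
  obtain ⟨η, hη, hηC⟩ : ∃ η : ℝ≥0∞, 0 < η ∧ η * C ≤ ε := by
    refine ⟨ε / (C + 1), ENNReal.div_pos hε.ne' (by simp), ?_⟩
    calc ε / (C + 1) * C ≤ ε / (C + 1) * (C + 1) := by gcongr; exact le_self_add
      _ ≤ ε := by rw [ENNReal.div_mul_cancel (by simp) (by simp)]
  have h1 := (tendsto_lintegral_translate hf).eventually (gt_mem_nhds hη)
  obtain ⟨r, hr, hball⟩ := Metric.eventually_nhds_iff.mp h1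
  obtain ⟨N, hN⟩ := exists_nat_gt (2 / r)
  refine ⟨N, fun n hn => ?_⟩
  have hsmall : 2 / ((n : ℝ) + 1) < r := by
    have : (N : ℝ) ≤ n := by exact_mod_cast hn
    rw [div_lt_comm₀ (by positivity) hr]; linarith
  calc ∫⁻ w, (∫⁻ z, ‖f (z - w) - f z‖ₑ) * k n w ≤ ∫⁻ w, η * k n w := by
        refine lintegral_mono fun w => ?_
        by_cases hw : 2 / ((n : ℝ) + 1) < ‖w‖
        · simp [hks n w hw]
        · have : dist w 0 < r := by rw [dist_zero_right]; linarith [not_lt.mp hw]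
          gcongr
          exact (hball this).le
    _ = η * ∫⁻ w, k n w := lintegral_const_mul _ (hk n)
    _ ≤ η * C := by gcongr; exact hkC n
    _ ≤ ε := hηC

variable (V) in
/-- Bump functions at the origin with radii `1/(n+1)` and `2/(n+1)`. -/
def bump (n : ℕ) : ContDiffBump (0 : V) :=
  ⟨1 / ((n : ℝ) + 1), 2 / ((n : ℝ) + 1), by positivity,
    div_lt_div_of_pos_right one_lt_two (by positivity)⟩

/-- A sequence of mollifiers. -/
def moll (n : ℕ) : V → ℝ := (bump V n).normed volume

theorem moll_nonneg (n : ℕ) (w : V) : 0 ≤ moll n w := (bump V n).nonneg_normed w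

theorem contDiff_moll (n : ℕ) : ContDiff ℝ ∞ (moll n : V → ℝ) := (bump V n).contDiff_normed

theorem hasCompactSupport_moll (n : ℕ) : HasCompactSupport (moll n : V → ℝ) :=
  (bump V n).hasCompactSupport_normed

theorem integral_moll (n : ℕ) : ∫ w : V, moll n w = 1 := (bump V n).integral_normed

theorem integrable_moll (n : ℕ) : Integrable (moll n : V → ℝ) := (bump V n).integrable_normed

theorem moll_eq_zero (n : ℕ) {w : V} (hw : 2 / ((n : ℝ) + 1) < ‖w‖) : moll n w = 0 := by
  by_contra h
  have : w ∈ Function.support ((bump V n).normed volume) := h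
  rw [ContDiffBump.support_normed_eq, mem_ball_zero_iff] at this
  exact absurd this (not_lt.mpr hw.le)

theorem fderiv_moll_eq_zero (n : ℕ) {w : V} (hw : 2 / ((n : ℝ) + 1) < ‖w‖) :
    fderiv ℝ (moll n) w = 0 := by
  by_contra h
  have : w ∈ tsupport (moll n : V → ℝ) := support_fderiv_subset ℝ h
  have h2 := (bump V n).tsupport_normed_eq (μ := volume)
  rw [moll, h2, mem_closedBall_zero_iff] at this
  exact absurd this (not_le.mpr hw)

theorem continuous_fderiv_moll (n : ℕ) : Continuous (fderiv ℝ (moll n : V → ℝ)) :=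
  (contDiff_moll n).continuous_fderiv (by simp)

theorem hasCompactSupport_fderiv_moll (n : ℕ) :
    HasCompactSupport (fderiv ℝ (moll n : V → ℝ)) :=
  (hasCompactSupport_moll n).fderiv ℝ

theorem exists_norm_fderiv_moll_le (V : Type*) [NormedAddCommGroup V] [NormedSpace ℝ V]
    [FiniteDimensional ℝ V] [MeasureSpace V] [BorelSpace V]
    [(volume : Measure V).IsAddHaarMeasure] (n : ℕ) :
    ∃ C, ∀ w : V, ‖fderiv ℝ (moll n) w‖ ≤ C :=
  (hasCompactSupport_fderiv_moll n).exists_bound_of_continuous (continuous_fderiv_moll n)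

theorem exists_norm_mul_fderiv_moll_le (V : Type*) [NormedAddCommGroup V] [NormedSpace ℝ V]
    [FiniteDimensional ℝ V] [MeasureSpace V] [BorelSpace V]
    [(volume : Measure V).IsAddHaarMeasure] (n : ℕ) :
    ∃ C, ∀ w : V, ‖w‖ * ‖fderiv ℝ (moll n) w‖ ≤ C := by
  have h : HasCompactSupport fun w : V => ‖w‖ * ‖fderiv ℝ (moll n) w‖ :=
    (hasCompactSupport_fderiv_moll n).norm.mul_left
  have hc : Continuous fun w : V => ‖w‖ * ‖fderiv ℝ (moll n) w‖ :=
    continuous_norm.mul (continuous_fderiv_moll n).norm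
  obtain ⟨C, hC⟩ := h.exists_bound_of_continuous hc
  exact ⟨C, fun w => (le_abs_self _).trans (hC w)⟩

theorem isNegInvariant_volume : (volume : Measure V).IsNegInvariant := inferInstance

theorem moll_eq (n : ℕ) (w : V) :
    moll n w = bump V 0 (((n : ℝ) + 1) • w) / ∫ x, bump V n x := by
  rw [moll, ContDiffBump.normed_def, ContDiffBump.apply, ContDiffBump.apply]
  congr 2
  · simp only [bump]; field_simp
  · simp [bump]

/-- The quantity is scale invariant: the factor |w| compensates the extra factor n+1 produced by
differentiating the rescaled bump, so the integral does not depend on n. -/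
theorem lintegral_norm_mul_fderiv_moll (V : Type*) [NormedAddCommGroup V] [NormedSpace ℝ V]
    [FiniteDimensional ℝ V] [MeasureSpace V] [BorelSpace V]
    [(volume : Measure V).IsAddHaarMeasure] :
    ∃ C : ℝ≥0, ∀ n, ∫⁻ w : V, ENNReal.ofReal (‖w‖ * ‖fderiv ℝ (moll n) w‖) ≤ C := by
  set φ : V → ℝ := fun x => bump V 0 x
  have hφ : ContDiff ℝ 1 φ := (bump V 0).contDiff
  have hφd : Continuous (fderiv ℝ φ) := hφ.continuous_fderiv one_ne_zero
  set k : V → ℝ := fun w => ‖w‖ * ‖fderiv ℝ φ w‖ with hk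
  have hkc : Continuous k := by fun_prop
  have hki : Integrable k := hkc.integrable_of_hasCompactSupport
    (((bump V 0).hasCompactSupport.fderiv ℝ).norm.mul_left)
  have hI : ∀ n, 0 < ∫ x, bump V n x := fun n => (bump V n).integral_pos
  have hIn : ∀ n : ℕ, ∫ x, bump V n x
      = (((n : ℝ) + 1) ^ Module.finrank ℝ V)⁻¹ * ∫ x, φ x := by
    intro n
    have h1 : ∀ x, bump V n x = φ (((n : ℝ) + 1) • x) := by
      intro x
      have := moll_eq n x
      rw [moll, ContDiffBump.normed_def, div_left_inj' (hI n).ne'] at this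
      exact this
    simp_rw [h1]
    rw [Measure.integral_comp_smul_of_nonneg _ _ _ (hR := by positivity), smul_eq_mul]
  refine ⟨Real.toNNReal ((∫ w, k w) / ∫ x, φ x), fun n => ?_⟩
  have hpt : ∀ w : V, ‖w‖ * ‖fderiv ℝ (moll n) w‖
      = k (((n : ℝ) + 1) • w) * (∫ x, bump V n x)⁻¹ := by
    intro w
    have h1 : (moll n : V → ℝ)
        = fun w => (∫ x, bump V n x)⁻¹ • φ (((n : ℝ) + 1) • w) := by
      ext w; rw [moll_eq, smul_eq_mul, div_eq_inv_mul]
    have h2 : fderiv ℝ (moll n) w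
        = (∫ x, bump V n x)⁻¹ • ((n : ℝ) + 1) • fderiv ℝ φ (((n : ℝ) + 1) • w) := by
      rw [h1, fderiv_fun_const_smul _, fderiv_comp_smul]
      exact (hφ.differentiable one_ne_zero).differentiableAt.comp _
        (differentiableAt_id.const_smul _)
    have h3 : (0 : ℝ) < (n : ℝ) + 1 := by positivity
    simp only [hk]
    rw [h2, norm_smul, norm_smul, norm_smul, Real.norm_of_nonneg (inv_nonneg.mpr (hI n).le),
      Real.norm_of_nonneg h3.le]
    ring
  simp_rw [hpt]
  rw [← ofReal_integral_eq_lintegral_ofReal, integral_mul_const,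
    Measure.integral_comp_smul_of_nonneg _ _ _ (hR := by positivity), hIn, smul_eq_mul]
  · refine le_of_eq ?_
    rw [ENNReal.ofReal]
    have h3 : (0 : ℝ) < (n : ℝ) + 1 := by positivity
    have h4 := (bump V 0).integral_pos (μ := volume)
    congr 2
    field_simp
  · exact ((integrable_comp_smul_iff volume k (by positivity)).mpr hki).mul_const _
  · exact ae_of_all _ fun w => mul_nonneg (by positivity) (inv_nonneg.mpr (hI n).le)

/-- The regularization of a function by the `n`-th mollifier. -/
def regularize (n : ℕ) (f : V → ℝ) (z : V) : ℝ := ∫ z', f z' * moll n (z - z')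

theorem regularize_eq_convolution (n : ℕ) (f : V → ℝ) :
    regularize n f = f ⋆[ContinuousLinearMap.lsmul ℝ ℝ, volume] moll n := by
  ext z; simp [regularize, convolution_lsmul]

theorem regularize_eq (n : ℕ) (f : V → ℝ) (z : V) :
    regularize n f z = ∫ w, f (z - w) * moll n w := by
  rw [regularize, ← integral_sub_left_eq_self _ volume z]; simp

theorem contDiff_regularize (n : ℕ) {f : V → ℝ} (hf : Integrable f) :
    ContDiff ℝ ∞ (regularize n f) := by
  rw [regularize_eq_convolution]
  exact (hasCompactSupport_moll n).contDiff_convolution_right _ hf.locallyIntegrable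
    (contDiff_moll n)

theorem fderiv_regularize_apply (n : ℕ) {f : V → ℝ} (hf : Integrable f) (z v : V) :
    fderiv ℝ (regularize n f) z v = ∫ z', f z' * fderiv ℝ (moll n) (z - z') v := by
  have h := (hasCompactSupport_moll n).hasFDerivAt_convolution_right (𝕜 := ℝ)
    (ContinuousLinearMap.lsmul ℝ ℝ) hf.locallyIntegrable
    ((contDiff_moll n).of_le (by simp)) z
  rw [regularize_eq_convolution, h.fderiv, convolution_precompR_apply]
  · simp [convolution_lsmul]
  · exact hf.locallyIntegrable
  · exact (hasCompactSupport_moll n).fderiv ℝ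
  · exact (contDiff_moll n).continuous_fderiv (by simp)

theorem ae_tendsto_regularize {f : V → ℝ} (hf : Integrable f) :
    ∀ᵐ z, Tendsto (fun n => regularize n f z) atTop (𝓝 (f z)) := by
  have h := ContDiffBump.ae_convolution_tendsto_right_of_locallyIntegrable
    (φ := fun n => bump V n) (l := atTop) (K := 2) (μ := volume) (g := f) ?_ ?_
    hf.locallyIntegrable
  · filter_upwards [h] with z hz
    refine hz.congr fun n => ?_
    rw [regularize_eq, convolution_lsmul]
    simp [moll, mul_comm]
  · have := tendsto_one_div_add_atTop_nhds_zero_nat (𝕜 := ℝ)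
    have h2 := this.const_mul 2
    simp only [mul_zero] at h2
    refine h2.congr fun n => ?_
    simp [bump, div_eq_mul_inv]
  · exact Eventually.of_forall fun n => by simp only [bump]; apply le_of_eq; ring

theorem integrable_regularize (n : ℕ) {f : V → ℝ} (hf : Integrable f) :
    Integrable (regularize n f) := by
  rw [regularize_eq_convolution]
  exact hf.integrable_convolution _ (integrable_moll n)

theorem integral_abs_regularize_le (n : ℕ) {f : V → ℝ} (hf : Integrable f) :
    ∫ z, |regularize n f z| ≤ ∫ z, |f z| := by
  have h1 : ∀ z, |regularize n f z| ≤ regularize n (fun z => |f z|) z := by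
    intro z
    refine (abs_integral_le_integral_abs).trans (le_of_eq ?_)
    refine integral_congr_ae (ae_of_all _ fun z' => ?_)
    simp only [abs_mul, abs_of_nonneg (moll_nonneg n (z - z'))]
  refine (integral_mono (integrable_regularize n hf).abs (integrable_regularize n hf.abs) h1).trans
    (le_of_eq ?_)
  rw [regularize_eq_convolution, integral_convolution _ hf.abs (integrable_moll n)]
  simp [integral_moll]

theorem tendsto_lintegral_regularize_sub {f : V → ℝ} (hf : Integrable f) :
    Tendsto (fun n => ∫⁻ z, ‖regularize n f z - f z‖ₑ) atTop (𝓝 0) := by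
  have hm : ∀ n, Measurable fun w : V => ENNReal.ofReal (moll n w) := fun n =>
    (contDiff_moll n).continuous.measurable.ennreal_ofReal
  have h := tendsto_lintegral_kernel hf (k := fun n w => ENNReal.ofReal (moll n w)) hm
    (C := 1) (fun n => ?_) (fun n w hw => by simp [moll_eq_zero n hw])
  · refine tendsto_of_tendsto_of_tendsto_of_le_of_le tendsto_const_nhds h (fun _ => bot_le)
      fun n => lintegral_mono_ae ?_
    have hbd : ∃ C, ∀ w : V, ‖moll n w‖ ≤ C :=
      (hasCompactSupport_moll n).exists_bound_of_continuous (contDiff_moll n).continuous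
    obtain ⟨C, hC⟩ := hbd
    refine ae_of_all _ fun z => ?_
    have hi : Integrable fun w => f (z - w) * moll n w :=
      (hf.comp_sub_left z).mul_bdd (contDiff_moll n).continuous.aestronglyMeasurable
        (ae_of_all _ hC)
    have : regularize n f z - f z = ∫ w, (f (z - w) - f z) * moll n w := by
      simp_rw [sub_mul]
      rw [integral_sub hi ((integrable_moll n).const_mul _), ← regularize_eq,
        integral_const_mul, integral_moll, mul_one]
    rw [this]
    refine (enorm_integral_le_lintegral_enorm _).trans (lintegral_mono fun w => ?_)
    rw [enorm_mul, Real.enorm_of_nonneg (moll_nonneg n w)]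
  · rw [← ofReal_integral_eq_lintegral_ofReal (integrable_moll n)
      (ae_of_all _ (moll_nonneg n)), integral_moll]
    simp

end Mollifier

end

section

/-! ### Renormalization at a fixed time -/

variable {d : ℕ}

instance : (volume : Measure (E d × E d)).IsAddHaarMeasure :=
  Measure.prod.instIsAddHaarMeasure volume volume

instance : (volume : Measure (E d × E d)).IsNegInvariant := isNegInvariant_volume

/-- The phase space velocity `(a ξ, F(x))`. -/
def vel (a : ℝ) (F : E d → E d) (z : E d × E d) : E d × E d := (a • z.2, F z.1)

theorem integral_fderiv_apply_eq_zero {V : Type*} [NormedAddCommGroup V] [NormedSpace ℝ V]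
    [FiniteDimensional ℝ V] [MeasurableSpace V] [BorelSpace V] (μ : Measure V)
    [μ.IsAddHaarMeasure] {P : V → ℝ} (hP : ContDiff ℝ 1 P) (hc : HasCompactSupport P) (v : V) :
    ∫ x, fderiv ℝ P x v ∂μ = 0 := by
  have hd : Continuous (fderiv ℝ P) := hP.continuous_fderiv one_ne_zero
  have hi : Integrable (fun x => fderiv ℝ P x v) μ :=
    (hd.clm_apply continuous_const).integrable_of_hasCompactSupport (hc.fderiv_apply ℝ v)
  have h := integral_mul_fderiv_eq_neg_fderiv_mul_of_integrable (μ := μ) (v := v)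
    (f := fun _ : V => (1 : ℝ)) (g := P) (by simp) (by simpa using hi)
    (by simpa using hP.continuous.integrable_of_hasCompactSupport hc)
    (fun x _ => differentiableAt_const _) (fun x _ => hP.differentiable one_ne_zero x)
  simpa using h

/-- The field `(a ξ, F(x))` is divergence free. -/
theorem integral_fderiv_vel_eq_zero {a : ℝ} {F : E d → E d} (hF : Continuous F)
    {P : E d × E d → ℝ} (hP : ContDiff ℝ 1 P) (hc : HasCompactSupport P) :
    ∫ z, fderiv ℝ P z (vel a F z) = 0 := by
  have hd : Continuous (fderiv ℝ P) := hP.continuous_fderiv one_ne_zero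
  have hcd : HasCompactSupport (fderiv ℝ P) := hc.fderiv ℝ
  have hsupp : ∀ v : E d × E d → E d × E d, HasCompactSupport fun z => fderiv ℝ P z (v z) := by
    intro v
    refine hcd.mono fun z hz => ?_
    intro h0
    exact hz (by simp [h0])
  have i1 : Integrable fun z : E d × E d => fderiv ℝ P z (a • z.2, 0) :=
    (hd.clm_apply (by fun_prop)).integrable_of_hasCompactSupport (hsupp _)
  have i2 : Integrable fun z : E d × E d => fderiv ℝ P z (0, F z.1) :=
    (hd.clm_apply (by fun_prop)).integrable_of_hasCompactSupport (hsupp _)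
  have hsplit : ∀ z, fderiv ℝ P z (vel a F z)
      = fderiv ℝ P z (a • z.2, 0) + fderiv ℝ P z (0, F z.1) := by
    intro z; rw [← map_add]; simp [vel]
  simp_rw [hsplit]
  have hdP : Differentiable ℝ P := hP.differentiable one_ne_zero
  -- With ξ frozen, aξ is a constant direction in x; with x frozen, F(x) is a constant direction in
  -- ξ. Each half is integrated first in the variable along which it is constant.
  rw [integral_add i1 i2, Measure.volume_eq_prod, integral_prod_symm _ i1, integral_prod _ i2]
  have h1 : ∀ ξ : E d, ∫ x, fderiv ℝ P (x, ξ) (a • ξ, 0) = 0 := by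
    intro ξ
    have hcomp : ContDiff ℝ 1 fun x : E d => P (x, ξ) := hP.comp (contDiff_prodMk_left ξ)
    have hcs : HasCompactSupport fun x : E d => P (x, ξ) := by
      refine HasCompactSupport.intro (hc.isCompact.image continuous_fst) fun x hx => ?_
      by_contra h0
      exact hx ⟨(x, ξ), subset_tsupport P h0, rfl⟩
    rw [← integral_fderiv_apply_eq_zero volume hcomp hcs (a • ξ)]
    refine integral_congr_ae (ae_of_all _ fun x => ?_)
    have := HasFDerivAt.comp (g := P) (f := fun e => (e, ξ)) x (hdP (x, ξ)).hasFDerivAt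
      (hasFDerivAt_prodMk_left x ξ)
    have h2 := this.fderiv
    simp only [Function.comp_def] at h2
    simp only [h2, ContinuousLinearMap.comp_apply, ContinuousLinearMap.inl_apply]
  have h2 : ∀ x : E d, ∫ ξ, fderiv ℝ P (x, ξ) (0, F x) = 0 := by
    intro x
    have hcomp : ContDiff ℝ 1 fun ξ : E d => P (x, ξ) := hP.comp (contDiff_prodMk_right x)
    have hcs : HasCompactSupport fun ξ : E d => P (x, ξ) := by
      refine HasCompactSupport.intro (hc.isCompact.image continuous_snd) fun ξ hx => ?_
      by_contra h0
      exact hx ⟨(x, ξ), subset_tsupport P h0, rfl⟩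
    rw [← integral_fderiv_apply_eq_zero volume hcomp hcs (F x)]
    refine integral_congr_ae (ae_of_all _ fun ξ => ?_)
    have := HasFDerivAt.comp (g := P) (f := fun e => (x, e)) ξ (hdP (x, ξ)).hasFDerivAt
      (hasFDerivAt_prodMk_right x ξ)
    have h2 := this.fderiv
    simp only [Function.comp_def] at h2
    simp [h2]
  simp [h1, h2]

theorem norm_vel_sub_le {a : ℝ} {F : E d → E d} {L : ℝ≥0} (hF : LipschitzWith L F)
    (z z' : E d × E d) : ‖vel a F z' - vel a F z‖ ≤ (|a| + L) * ‖z' - z‖ := by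
  have h1 : ‖z'.1 - z.1‖ ≤ ‖z' - z‖ := by simpa using norm_fst_le (z' - z)
  have h2 : ‖z'.2 - z.2‖ ≤ ‖z' - z‖ := by simpa using norm_snd_le (z' - z)
  refine norm_prod_le_iff.mpr ⟨?_, ?_⟩
  · simp only [vel, Prod.fst_sub, ← smul_sub, norm_smul, Real.norm_eq_abs]
    have := L.coe_nonneg
    nlinarith [abs_nonneg a, norm_nonneg (z' - z), mul_nonneg this (norm_nonneg (z' - z)),
      mul_le_mul_of_nonneg_left h2 (abs_nonneg a)]
  · simp only [vel, Prod.snd_sub]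
    have h3 := hF.norm_sub_le z'.1 z.1
    nlinarith [mul_nonneg (abs_nonneg a) (norm_nonneg (z' - z)),
      mul_le_mul_of_nonneg_left h1 L.coe_nonneg]

theorem continuous_vel {a : ℝ} {F : E d → E d} (hF : Continuous F) : Continuous (vel a F) := by
  unfold vel; fun_prop

/-- The commutator of regularization and transport. -/
def commutator (n : ℕ) (a : ℝ) (F : E d → E d) (f : E d × E d → ℝ) (z : E d × E d) : ℝ :=
  ∫ z', f z' * fderiv ℝ (moll n) (z - z') (vel a F z' - vel a F z)

theorem norm_kernel_le {a : ℝ} {F : E d → E d} {L : ℝ≥0} (hF : LipschitzWith L F) (n : ℕ)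
    (z z' : E d × E d) :
    ‖fderiv ℝ (moll n) (z - z') (vel a F z' - vel a F z)‖
      ≤ (|a| + L) * (‖z - z'‖ * ‖fderiv ℝ (moll n) (z - z')‖) := by
  refine (ContinuousLinearMap.le_opNorm _ _).trans ?_
  have := norm_vel_sub_le (a := a) hF z z'
  rw [norm_sub_rev z' z] at this
  calc _ ≤ ‖fderiv ℝ (moll n) (z - z')‖ * ((|a| + L) * ‖z - z'‖) := by gcongr
    _ = _ := by ring

theorem measurable_kernel {a : ℝ} {F : E d → E d} (hF : Continuous F) (n : ℕ) :
    Continuous fun p : (E d × E d) × (E d × E d) =>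
      fderiv ℝ (moll n) (p.1 - p.2) (vel a F p.2 - vel a F p.1) := by
  have h1 : Continuous (fderiv ℝ (moll n : E d × E d → ℝ)) :=
    continuous_fderiv_moll n
  have h2 := continuous_vel (a := a) hF
  fun_prop

theorem integrable_commutator_integrand {a : ℝ} {F : E d → E d} {L : ℝ≥0}
    (hF : LipschitzWith L F) (n : ℕ) {f : E d × E d → ℝ} (hf : Integrable f) (z : E d × E d) :
    Integrable fun z' => f z' * fderiv ℝ (moll n) (z - z') (vel a F z' - vel a F z) := by
  obtain ⟨C, hC⟩ := exists_norm_mul_fderiv_moll_le (E d × E d) n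
  refine hf.mul_bdd (c := (|a| + L) * C) ?_ (ae_of_all _ fun z' => ?_)
  · exact ((measurable_kernel hF.continuous n).comp (Continuous.prodMk_right z)).aestronglyMeasurable
  · exact (norm_kernel_le hF n z z').trans (by gcongr; exact hC _)

theorem fderiv_moll_sub (n : ℕ) (z z' v : E d × E d) :
    fderiv ℝ (fun y => moll n (z - y)) z' v = - fderiv ℝ (moll n) (z - z') v := by
  have hd : Differentiable ℝ (moll n : E d × E d → ℝ) :=
    (contDiff_moll n).differentiable (by simp)
  have := (hd (z - z')).hasFDerivAt.comp z' ((hasFDerivAt_id z').const_sub z)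
  have h2 := this.fderiv
  simp only [Function.comp_def] at h2
  simp [h2]

/-- The velocity at z' is written as the velocity at z plus an increment. The first part
differentiates the regularization of f at z; the increment produces the commutator. -/
theorem commutator_eq {a : ℝ} {F : E d → E d} {L : ℝ≥0} (hF : LipschitzWith L F) (n : ℕ)
    {f : E d × E d → ℝ} (hf : Integrable f) (z : E d × E d) :
    ∫ z', f z' * fderiv ℝ (fun y => moll n (z - y)) z' (vel a F z')
      = - fderiv ℝ (regularize n f) z (vel a F z) - commutator n a F f z := by
  have h1 := fderiv_moll_sub (d := d) n z
  rw [fderiv_regularize_apply n hf, commutator, ← integral_neg, ← integral_sub]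
  · refine integral_congr_ae (ae_of_all _ fun z' => ?_)
    simp only [h1, map_sub]; ring
  · obtain ⟨C, hC⟩ := exists_norm_fderiv_moll_le (E d × E d) n
    refine (hf.mul_bdd (c := C * ‖vel a F z‖) ?_ (ae_of_all _ fun z' => ?_)).neg
    · have h1 : Continuous (fderiv ℝ (moll n : E d × E d → ℝ)) :=
        continuous_fderiv_moll n
      exact (by fun_prop : Continuous fun z' : E d × E d =>
        fderiv ℝ (moll n) (z - z') (vel a F z)).aestronglyMeasurable
    · exact (ContinuousLinearMap.le_opNorm _ _).trans (by gcongr; exact hC _)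
  · exact integrable_commutator_integrand hF n hf z

theorem measurable_commutator {a : ℝ} {F : E d → E d} (hF : Continuous F) (n : ℕ)
    {f : E d × E d → ℝ} (hf : Measurable f) : StronglyMeasurable (commutator n a F f) := by
  refine StronglyMeasurable.integral_prod_right
    (f := fun z z' => f z' * fderiv ℝ (moll n) (z - z') (vel a F z' - vel a F z)) ?_
  exact ((hf.comp measurable_snd).mul (measurable_kernel hF n).measurable).stronglyMeasurable

/-- The field is divergence free, so the same integral with f(z') replaced by the constant f(z)
vanishes. After subtraction only increments of f remain, and these are small in L¹. -/
theorem commutator_eq_sub {a : ℝ} {F : E d → E d} {L : ℝ≥0} (hF : LipschitzWith L F) (n : ℕ)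
    {f : E d × E d → ℝ} (hf : Integrable f) (z : E d × E d) :
    commutator n a F f z
      = ∫ w, (f (z - w) - f z) * fderiv ℝ (moll n) w (vel a F (z - w) - vel a F z) := by
  have hz : ∫ z', f z * fderiv ℝ (moll n) (z - z') (vel a F z' - vel a F z) = 0 := by
    have hcd : ContDiff ℝ 1 fun y : E d × E d => moll n (z - y) :=
      ((contDiff_moll n).of_le (by simp)).comp (contDiff_const.sub contDiff_id)
    have hcs : HasCompactSupport fun y : E d × E d => moll n (z - y) :=
      (hasCompactSupport_moll n).comp_homeomorph (Homeomorph.subLeft z)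
    have h0 := integral_fderiv_vel_eq_zero (a := a) hF.continuous hcd hcs
    have h0' := integral_fderiv_apply_eq_zero volume hcd hcs (vel a F z)
    have h1 := fderiv_moll_sub (d := d) n z
    have hdc : Continuous (fderiv ℝ (fun y : E d × E d => moll n (z - y))) :=
      hcd.continuous_fderiv one_ne_zero
    have hsupp : ∀ v : E d × E d → E d × E d, HasCompactSupport fun z' =>
        fderiv ℝ (fun y : E d × E d => moll n (z - y)) z' (v z') := by
      intro v
      refine (hcs.fderiv ℝ).mono fun z' hz h0 => hz (by simp [h0])
    have hv := continuous_vel (a := a) hF.continuous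
    have i1 : Integrable fun z' => fderiv ℝ (fun y : E d × E d => moll n (z - y)) z' (vel a F z') :=
      (hdc.clm_apply hv).integrable_of_hasCompactSupport (hsupp _)
    have i2 : Integrable fun z' => fderiv ℝ (fun y : E d × E d => moll n (z - y)) z' (vel a F z) :=
      (hdc.clm_apply continuous_const).integrable_of_hasCompactSupport (hsupp _)
    rw [integral_const_mul]
    have : ∫ z', fderiv ℝ (moll n) (z - z') (vel a F z' - vel a F z) = 0 := by
      have e : ∀ z', fderiv ℝ (moll n) (z - z') (vel a F z' - vel a F z)
          = fderiv ℝ (fun y : E d × E d => moll n (z - y)) z' (vel a F z)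
            - fderiv ℝ (fun y : E d × E d => moll n (z - y)) z' (vel a F z') := by
        intro z'; rw [h1, h1, map_sub]; ring
      simp_rw [e]
      rw [integral_sub i2 i1, h0, h0', sub_zero]
    rw [this, mul_zero]
  have i := integrable_commutator_integrand (a := a) hF n hf z
  have i0 : Integrable fun z' => f z * fderiv ℝ (moll n) (z - z') (vel a F z' - vel a F z) := by
    have hc : Continuous fun z' =>
        fderiv ℝ (moll n) (z - z') (vel a F z' - vel a F z) :=
      (measurable_kernel hF.continuous n).comp (Continuous.prodMk_right z)
    refine (hc.integrable_of_hasCompactSupport ?_).const_mul _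
    have := (hasCompactSupport_fderiv_moll (V := E d × E d) n).comp_homeomorph
      (Homeomorph.subLeft z)
    refine this.mono fun z' hz h0 => hz ?_
    have h0 : fderiv ℝ (moll n) (z - z') = 0 := h0
    simp [h0]
  have e : commutator n a F f z = ∫ z', (f z' - f z) *
      fderiv ℝ (moll n) (z - z') (vel a F z' - vel a F z) := by
    simp_rw [sub_mul]
    rw [integral_sub i i0, hz, sub_zero]; rfl
  rw [e, ← integral_sub_left_eq_self _ volume z]
  simp

/-- The DiPerna–Lions commutator lemma for a Lipschitz field: the increment of the velocity yields a
factor |w|, which balances the gradient of the mollifier, and the increments of f tend to zero in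
L¹. -/
theorem tendsto_lintegral_commutator {a : ℝ} {F : E d → E d} {L : ℝ≥0} (hF : LipschitzWith L F)
    {f : E d × E d → ℝ} (hf : Integrable f) :
    Tendsto (fun n => ∫⁻ z, ‖commutator n a F f z‖ₑ) atTop (𝓝 0) := by
  obtain ⟨C, hC⟩ := lintegral_norm_mul_fderiv_moll (E d × E d)
  have hm : ∀ n, Measurable fun w : E d × E d =>
      ENNReal.ofReal (|a| + L) * ENNReal.ofReal (‖w‖ * ‖fderiv ℝ (moll n) w‖) := by
    intro n
    have h1 : Continuous (fderiv ℝ (moll n : E d × E d → ℝ)) :=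
        continuous_fderiv_moll n
    exact (continuous_norm.mul h1.norm).measurable.ennreal_ofReal.const_mul _
  have h := tendsto_lintegral_kernel hf (k := fun n w =>
    ENNReal.ofReal (|a| + L) * ENNReal.ofReal (‖w‖ * ‖fderiv ℝ (moll n) w‖)) hm
    (C := Real.toNNReal (|a| + L) * C) (fun n => ?_)
    (fun n w hw => by simp [fderiv_moll_eq_zero n hw])
  · refine tendsto_of_tendsto_of_tendsto_of_le_of_le tendsto_const_nhds h (fun _ => bot_le)
      fun n => lintegral_mono fun z => ?_
    simp only
    rw [commutator_eq_sub hF n hf]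
    refine (enorm_integral_le_lintegral_enorm _).trans (lintegral_mono fun w => ?_)
    rw [enorm_mul]
    gcongr
    rw [← ENNReal.ofReal_mul (by positivity), ← ofReal_norm]
    refine ENNReal.ofReal_le_ofReal ?_
    have := norm_kernel_le (a := a) hF n z (z - w)
    simpa using this
  · have hm' : Measurable fun w : E d × E d => ENNReal.ofReal (‖w‖ * ‖fderiv ℝ (moll n) w‖) := by
      have h1 : Continuous (fderiv ℝ (moll n : E d × E d → ℝ)) :=
        continuous_fderiv_moll n
      exact (continuous_norm.mul h1.norm).measurable.ennreal_ofReal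
    rw [lintegral_const_mul _ hm', ENNReal.coe_mul]
    exact mul_le_mul' le_rfl (hC n)

/-- The constant is chosen before F, n and f. This uniformity provides the domination needed when
the limit in n is taken under the time integral, where F and f vary with time. -/
theorem lintegral_commutator_le (a : ℝ) (L : ℝ≥0) : ∃ C : ℝ≥0, ∀ (F : E d → E d),
    LipschitzWith L F → ∀ (n : ℕ) (f : E d × E d → ℝ), Measurable f →
      ∫⁻ z, ‖commutator n a F f z‖ₑ ≤ C * ∫⁻ z, ‖f z‖ₑ := by
  obtain ⟨C, hC⟩ := lintegral_norm_mul_fderiv_moll (E d × E d)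
  refine ⟨Real.toNNReal (|a| + L) * C, fun F hF n f hf => ?_⟩
  have h1 : Continuous (fderiv ℝ (moll n : E d × E d → ℝ)) :=
    continuous_fderiv_moll n
  set k : E d × E d → ℝ≥0∞ := fun w => ENNReal.ofReal (‖w‖ * ‖fderiv ℝ (moll n) w‖)
  have hk : Measurable k := (continuous_norm.mul h1.norm).measurable.ennreal_ofReal
  calc ∫⁻ z, ‖commutator n a F f z‖ₑ
      ≤ ∫⁻ z, ∫⁻ z', ‖f z'‖ₑ * (ENNReal.ofReal (|a| + L) * k (z - z')) := by
        refine lintegral_mono fun z => (enorm_integral_le_lintegral_enorm _).trans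
          (lintegral_mono fun z' => ?_)
        rw [enorm_mul]
        gcongr
        rw [← ENNReal.ofReal_mul (by positivity), ← ofReal_norm]
        exact ENNReal.ofReal_le_ofReal (norm_kernel_le hF n z z')
    _ = ∫⁻ z', ‖f z'‖ₑ * (ENNReal.ofReal (|a| + L) * ∫⁻ w, k w) := by
        rw [lintegral_lintegral_swap]
        · refine lintegral_congr fun z' => ?_
          rw [lintegral_const_mul _ (by fun_prop), lintegral_const_mul _ (by fun_prop),
            lintegral_sub_right_eq_self (fun w => k w)]
        · exact Measurable.aemeasurable (by fun_prop)
    _ = (ENNReal.ofReal (|a| + L) * ∫⁻ w, k w) * ∫⁻ z', ‖f z'‖ₑ := by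
        rw [lintegral_mul_const _ (by fun_prop), mul_comm]
    _ ≤ _ := by
        rw [ENNReal.coe_mul]
        gcongr
        · exact le_rfl
        · exact hC n

end

/-! ### Renormalization functions -/

section

theorem integrable_fun_sub {α : Type*} [MeasurableSpace α] {μ : Measure α} {f g : α → ℝ}
    (hf : Integrable f μ) (hg : Integrable g μ) : Integrable (fun x => f x - g x) μ :=
  hf.sub hg

variable {d : ℕ}

/-- A renormalization function `Γ(ξ,s)` with partial derivatives `G` in `ξ` and `A` in `s`:
`A` is bounded, and `G` is Lipschitz in `s`. -/
structure IsRenorm (Γ A : E d → ℝ → ℝ) (G : E d → ℝ → E d →L[ℝ] ℝ) (C : ℝ≥0) (w : E d → ℝ) :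
    Prop where
  contDiff : ContDiff ℝ 1 (fun q : E d × ℝ => Γ q.1 q.2)
  fderiv_eq : ∀ ξ s v r, fderiv ℝ (fun q : E d × ℝ => Γ q.1 q.2) (ξ, s) (v, r) = G ξ s v + A ξ s * r
  zero : ∀ ξ, Γ ξ 0 = 0
  zero_left : ∀ ξ, G ξ 0 = 0
  bound : ∀ ξ s, |A ξ s| ≤ C
  lipschitz : ∀ ξ s s', ‖G ξ s - G ξ s'‖ ≤ w ξ * |s - s'|
  weight_continuous : Continuous w
  weight_nonneg : ∀ ξ, 0 ≤ w ξ

namespace IsRenorm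

variable {Γ A : E d → ℝ → ℝ} {G : E d → ℝ → E d →L[ℝ] ℝ} {C : ℝ≥0} {w : E d → ℝ}

theorem hasDerivAt (h : IsRenorm Γ A G C w) (ξ : E d) (s : ℝ) : HasDerivAt (Γ ξ) (A ξ s) s := by
  have h1 := (h.contDiff.differentiable one_ne_zero (ξ, s)).hasFDerivAt.comp_hasDerivAt s
    (((hasDerivAt_const s ξ).prodMk (hasDerivAt_id s)))
  have h2 := h.fderiv_eq ξ s 0 1
  simp only [map_zero, zero_add, mul_one] at h2
  rw [h2] at h1
  exact h1

theorem continuous_uncurry (h : IsRenorm Γ A G C w) : Continuous fun q : E d × ℝ => Γ q.1 q.2 :=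
  h.contDiff.continuous

theorem continuous_left (h : IsRenorm Γ A G C w) :
    Continuous fun q : (E d × ℝ) × E d => G q.1.1 q.1.2 q.2 := by
  have h1 := h.contDiff.continuous_fderiv one_ne_zero
  have h2 : Continuous fun q : (E d × ℝ) × E d =>
      fderiv ℝ (fun q : E d × ℝ => Γ q.1 q.2) q.1 (q.2, 0) := by fun_prop
  refine h2.congr fun q => ?_
  have := h.fderiv_eq q.1.1 q.1.2 q.2 0
  simpa using this

theorem continuous_right (h : IsRenorm Γ A G C w) : Continuous fun q : E d × ℝ => A q.1 q.2 := by
  have h1 := h.contDiff.continuous_fderiv one_ne_zero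
  have h2 : Continuous fun q : E d × ℝ =>
      fderiv ℝ (fun q : E d × ℝ => Γ q.1 q.2) q (0, 1) := by fun_prop
  refine h2.congr fun q => ?_
  have := h.fderiv_eq q.1 q.2 0 1
  simpa using this

theorem abs_sub_le (h : IsRenorm Γ A G C w) (ξ : E d) (s s' : ℝ) :
    |Γ ξ s - Γ ξ s'| ≤ C * |s - s'| := by
  have hl : LipschitzWith C (Γ ξ) := by
    refine lipschitzWith_of_nnnorm_deriv_le (fun s => (h.hasDerivAt ξ s).differentiableAt)
      fun s => ?_
    rw [(h.hasDerivAt ξ s).deriv, ← NNReal.coe_le_coe, coe_nnnorm]; exact h.bound ξ s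
  exact hl.dist_le_mul s s'

theorem abs_le (h : IsRenorm Γ A G C w) (ξ : E d) (s : ℝ) : |Γ ξ s| ≤ C * |s| := by
  simpa [h.zero] using h.abs_sub_le ξ s 0

theorem norm_left_le (h : IsRenorm Γ A G C w) (ξ : E d) (s : ℝ) : ‖G ξ s‖ ≤ w ξ * |s| := by
  simpa [h.zero_left] using h.lipschitz ξ s 0

end IsRenorm

/-- The time derivative of the regularized solution at a point. -/
def transportRate (n : ℕ) (a : ℝ) (F : E d → E d) (f S : E d × E d → ℝ) (z : E d × E d) : ℝ :=
  ∫ z', (f z' * fderiv ℝ (fun y => moll n (z - y)) z' (vel a F z') + S z' * moll n (z - z'))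

theorem hasCompactSupport_moll_sub (n : ℕ) (z : E d × E d) :
    HasCompactSupport fun y : E d × E d => moll n (z - y) :=
  (hasCompactSupport_moll n).comp_homeomorph (Homeomorph.subLeft z)

theorem contDiff_moll_sub (n : ℕ) (z : E d × E d) :
    ContDiff ℝ ∞ fun y : E d × E d => moll n (z - y) :=
  (contDiff_moll n).comp (contDiff_const.sub contDiff_id)

theorem exists_abs_fderiv_vel_le {χ : E d × E d → ℝ} (hχ : ContDiff ℝ 1 χ)
    (hc : HasCompactSupport χ) (a B : ℝ) :
    ∃ C, 0 ≤ C ∧ ∀ z v, ‖v‖ ≤ B → |fderiv ℝ χ z (a • z.2, v)| ≤ C := by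
  have h1 : Continuous fun z => ‖fderiv ℝ χ z‖ * (|a| * ‖z.2‖ + |B|) := by
    have := hχ.continuous_fderiv one_ne_zero
    fun_prop
  have h2 : HasCompactSupport fun z => ‖fderiv ℝ χ z‖ * (|a| * ‖z.2‖ + |B|) :=
    (hc.fderiv ℝ).norm.mul_right
  obtain ⟨C, hC⟩ := h2.exists_bound_of_continuous h1
  refine ⟨C, (norm_nonneg _).trans (hC 0), fun z v hv => ?_⟩
  refine le_trans ?_ ((le_abs_self _).trans (hC z))
  refine ((fderiv ℝ χ z).le_opNorm (a • z.2, v)).trans ?_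
  gcongr
  refine norm_prod_le_iff.mpr ⟨?_, ?_⟩
  · rw [norm_smul, Real.norm_eq_abs]; linarith [abs_nonneg B]
  · exact hv.trans ((le_abs_self B).trans (le_add_of_nonneg_left (by positivity)))

theorem transportRate_eq {a B : ℝ} {F : E d → E d} {L : ℝ≥0} (hF : LipschitzWith L F)
    (hB : ∀ x, ‖F x‖ ≤ B) (n : ℕ) {f S : E d × E d → ℝ} (hf : Integrable f) (hS : Integrable S)
    (z : E d × E d) :
    transportRate n a F f S z
      = - fderiv ℝ (regularize n f) z (vel a F z) - commutator n a F f z + regularize n S z := by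
  rw [← commutator_eq hF n hf z, transportRate, regularize, integral_add]
  · obtain ⟨C, -, hC⟩ := exists_abs_fderiv_vel_le ((contDiff_moll_sub n z).of_le (by simp))
      (hasCompactSupport_moll_sub n z) a B
    refine hf.mul_bdd (c := C) ?_ (ae_of_all _ fun z' => hC z' _ (hB z'.1))
    have h1 : Continuous (fderiv ℝ fun y : E d × E d => moll n (z - y)) :=
      (contDiff_moll_sub n z).continuous_fderiv (by simp)
    exact (h1.clm_apply (continuous_vel hF.continuous)).aestronglyMeasurable
  · obtain ⟨C, hC⟩ := (hasCompactSupport_moll_sub n z).exists_bound_of_continuous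
      (contDiff_moll_sub n z).continuous
    exact hS.mul_bdd (contDiff_moll_sub n z).continuous.aestronglyMeasurable (ae_of_all _ hC)

/-! ### Limit of the renormalized rate at a fixed time -/

section FixedTime

variable {Γ A : E d → ℝ → ℝ} {G : E d → ℝ → E d →L[ℝ] ℝ} {C : ℝ≥0} {w : E d → ℝ}

/-- The regularized renormalized rate, tested with `χ`. -/
theorem integral_renorm_transportRate (hΓ : IsRenorm Γ A G C w) {a B : ℝ} {F : E d → E d}
    {L : ℝ≥0} (hF : LipschitzWith L F) (hB : ∀ x, ‖F x‖ ≤ B) (n : ℕ) {f S : E d × E d → ℝ}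
    (hf : Integrable f) (hS : Integrable S) (hcomm : Integrable (commutator n a F f))
    {χ : E d × E d → ℝ} (hχ : ContDiff ℝ 1 χ) (hχc : HasCompactSupport χ) :
    ∫ z, χ z * (A z.2 (regularize n f z) * transportRate n a F f S z)
      = (∫ z, Γ z.2 (regularize n f z) * fderiv ℝ χ z (vel a F z))
        + (∫ z, χ z * G z.2 (regularize n f z) (F z.1))
        - (∫ z, χ z * A z.2 (regularize n f z) * commutator n a F f z)
        + ∫ z, χ z * A z.2 (regularize n f z) * regularize n S z := by
  set u := regularize n f with hu
  have hus : ContDiff ℝ 1 u := (contDiff_regularize n hf).of_le (by simp)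
  have huc : Continuous u := hus.continuous
  have hud : Continuous (fderiv ℝ u) := hus.continuous_fderiv one_ne_zero
  have hχd : Continuous (fderiv ℝ χ) := hχ.continuous_fderiv one_ne_zero
  have hv := continuous_vel (a := a) hF.continuous
  have hFc := hF.continuous
  have hΓc := hΓ.continuous_uncurry
  have hAc := hΓ.continuous_right
  have hGc := hΓ.continuous_left
  have hΓu : ContDiff ℝ 1 fun z : E d × E d => Γ z.2 (u z) :=
    hΓ.contDiff.comp (contDiff_snd.prodMk hus)
  have hP : ContDiff ℝ 1 fun z : E d × E d => χ z * Γ z.2 (u z) := hχ.mul hΓu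
  -- Integration by parts along the divergence-free field removes the gradient of u, which has no
  -- bound as n grows. The derivative falls on χ and on the explicit dependence of Γ on ξ, the
  -- latter giving the term with G.
  have h0 := integral_fderiv_vel_eq_zero (a := a) hFc hP hχc.mul_right
  have hder : ∀ z v, fderiv ℝ (fun z : E d × E d => χ z * Γ z.2 (u z)) z v
      = Γ z.2 (u z) * fderiv ℝ χ z v + χ z * (G z.2 (u z) v.2 + A z.2 (u z) * fderiv ℝ u z v) := by
    intro z v
    have e1 := HasFDerivAt.comp (g := fun q : E d × ℝ => Γ q.1 q.2)
      (f := fun z : E d × E d => (z.2, u z)) z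
      (hΓ.contDiff.differentiable one_ne_zero (z.2, u z)).hasFDerivAt
      (hasFDerivAt_snd.prodMk (hus.differentiable one_ne_zero z).hasFDerivAt)
    have e2 := (hχ.differentiable one_ne_zero z).hasFDerivAt.fun_mul e1
    simp only [Function.comp_apply] at e2
    rw [e2.fderiv]
    simp only [add_apply, smul_apply, smul_eq_mul,
      ContinuousLinearMap.comp_apply, ContinuousLinearMap.prod_apply,
      ContinuousLinearMap.coe_snd', hΓ.fderiv_eq]
    ring
  have cs : ∀ {h : E d × E d → ℝ}, HasCompactSupport fun z => χ z * h z := fun {h} =>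
    hχc.mul_right
  have csd : HasCompactSupport fun z => Γ z.2 (u z) * fderiv ℝ χ z (vel a F z) := by
    refine (hχc.fderiv ℝ).mono fun z hz h0 => hz (by simp [h0])
  have i1 : Integrable fun z => Γ z.2 (u z) * fderiv ℝ χ z (vel a F z) := by
    refine Continuous.integrable_of_hasCompactSupport ?_ csd
    exact (hΓc.comp (continuous_snd.prodMk huc)).mul (hχd.clm_apply hv)
  have cG : Continuous fun z : E d × E d => G z.2 (u z) (F z.1) :=
    hGc.comp ((continuous_snd.prodMk huc).prodMk (hFc.comp continuous_fst))
  have cA : Continuous fun z : E d × E d => A z.2 (u z) :=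
    hAc.comp (continuous_snd.prodMk huc)
  have i2 : Integrable fun z => χ z * G z.2 (u z) (F z.1) :=
    (hχ.continuous.mul cG).integrable_of_hasCompactSupport cs
  have i3 : Integrable fun z => χ z * (A z.2 (u z) * fderiv ℝ u z (vel a F z)) :=
    (hχ.continuous.mul (cA.mul (hud.clm_apply hv))).integrable_of_hasCompactSupport cs
  obtain ⟨K, hK⟩ := (cs (h := fun z => A z.2 (u z))).exists_bound_of_continuous
    (hχ.continuous.mul cA)
  have i4 : Integrable fun z => χ z * A z.2 (u z) * commutator n a F f z :=
    hcomm.bdd_mul (hχ.continuous.mul cA).aestronglyMeasurable (ae_of_all _ hK)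
  have i5 : Integrable fun z => χ z * A z.2 (u z) * regularize n S z :=
    (integrable_regularize n hS).bdd_mul (hχ.continuous.mul cA).aestronglyMeasurable
      (ae_of_all _ hK)
  have h1 : (∫ z, Γ z.2 (u z) * fderiv ℝ χ z (vel a F z)) + (∫ z, χ z * G z.2 (u z) (F z.1))
      + ∫ z, χ z * (A z.2 (u z) * fderiv ℝ u z (vel a F z)) = 0 := by
    rw [← h0, ← integral_add i1 i2, ← integral_add (i1.fun_add i2) i3]
    refine integral_congr_ae (ae_of_all _ fun z => ?_)
    simp only [hder]
    simp only [vel]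
    ring
  have h2 : ∫ z, χ z * (A z.2 (u z) * transportRate n a F f S z)
      = - (∫ z, χ z * (A z.2 (u z) * fderiv ℝ u z (vel a F z)))
        - (∫ z, χ z * A z.2 (u z) * commutator n a F f z)
        + ∫ z, χ z * A z.2 (u z) * regularize n S z := by
    rw [← integral_neg, ← integral_sub i3.fun_neg i4, ← integral_add (integrable_fun_sub i3.fun_neg i4) i5]
    refine integral_congr_ae (ae_of_all _ fun z => ?_)
    simp only [transportRate_eq hF hB n hf hS z]
    ring
  rw [h2]
  linarith

theorem tendsto_integral_of_abs_sub_le {α : Type*} [MeasurableSpace α] {μ : Measure α}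
    {H : ℕ → α → ℝ} {H₀ : α → ℝ} {v : ℕ → α → ℝ} {K : ℝ≥0} (hi : Integrable H₀ μ)
    (hn : ∀ n, Integrable (H n) μ) (hle : ∀ n z, |H n z - H₀ z| ≤ K * |v n z|)
    (hv : Tendsto (fun n => ∫⁻ z, ‖v n z‖ₑ ∂μ) atTop (𝓝 0)) :
    Tendsto (fun n => ∫ z, H n z ∂μ) atTop (𝓝 (∫ z, H₀ z ∂μ)) := by
  refine tendsto_integral_of_L1 H₀ hi.1 (Eventually.of_forall hn) ?_
  have h1 : Tendsto (fun n => (K : ℝ≥0∞) * ∫⁻ z, ‖v n z‖ₑ ∂μ) atTop (𝓝 0) := by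
    have := ENNReal.Tendsto.const_mul (a := (K : ℝ≥0∞)) hv (Or.inr (by simp))
    rwa [mul_zero] at this
  refine tendsto_of_tendsto_of_tendsto_of_le_of_le tendsto_const_nhds h1 (fun _ => bot_le)
    fun n => ?_
  simp only
  rw [← lintegral_const_mul' _ _ (by simp)]
  refine lintegral_mono fun z => ?_
  rw [← ofReal_norm, ← ofReal_norm, ← ENNReal.ofReal_coe_nnreal,
    ← ENNReal.ofReal_mul (by positivity)]
  exact ENNReal.ofReal_le_ofReal (hle n z)

theorem integrable_commutator {a : ℝ} {F : E d → E d} {L : ℝ≥0} (hF : LipschitzWith L F)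
    (n : ℕ) {f : E d × E d → ℝ} (hfm : Measurable f) (hf : Integrable f) :
    Integrable (commutator n a F f) := by
  obtain ⟨C, hC⟩ := lintegral_commutator_le (d := d) a L
  refine ⟨(measurable_commutator hF.continuous n hfm).aestronglyMeasurable, ?_⟩
  exact (hC F hF n f hfm).trans_lt (ENNReal.mul_lt_top (by simp) hf.2)

/-- After the integration by parts, the terms with Γ and G are Lipschitz in the regularized
function, with constants uniform on the support of χ; the commutator term disappears; only the
source term requires pointwise convergence. -/
theorem tendsto_renorm_transportRate (hΓ : IsRenorm Γ A G C w) {a B : ℝ} {F : E d → E d}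
    {L : ℝ≥0} (hF : LipschitzWith L F) (hB : ∀ x, ‖F x‖ ≤ B) {f S : E d × E d → ℝ}
    (hfm : Measurable f) (hf : Integrable f) (hS : Integrable S)
    {χ : E d × E d → ℝ} (hχ : ContDiff ℝ 1 χ) (hχc : HasCompactSupport χ) :
    Tendsto (fun n => ∫ z, χ z * (A z.2 (regularize n f z) * transportRate n a F f S z)) atTop
      (𝓝 (∫ z, Γ z.2 (f z) * fderiv ℝ χ z (vel a F z)
        + χ z * (G z.2 (f z) (F z.1) + A z.2 (f z) * S z))) := by
  simp_rw [fun n => integral_renorm_transportRate hΓ hF hB n hf hS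
    (integrable_commutator (a := a) hF n hfm hf) hχ hχc]
  have hB0 : 0 ≤ B := (norm_nonneg _).trans (hB 0)
  have hχd : Continuous (fderiv ℝ χ) := hχ.continuous_fderiv one_ne_zero
  have hv := continuous_vel (a := a) hF.continuous
  have hFc := hF.continuous
  obtain ⟨K1, hK10, hK1⟩ := exists_abs_fderiv_vel_le hχ hχc a B
  obtain ⟨K2, hK2⟩ := hχc.exists_bound_of_continuous hχ.continuous
  have hK20 : 0 ≤ K2 := (norm_nonneg _).trans (hK2 0)
  obtain ⟨K3, hK3⟩ := (hχc.mul_right (f' := fun z : E d × E d => w z.2)).exists_bound_of_continuous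
    (hχ.continuous.mul (hΓ.weight_continuous.comp continuous_snd))
  have hK30 : 0 ≤ K3 := (norm_nonneg _).trans (hK3 0)
  have mΓ : ∀ {u : E d × E d → ℝ}, AEStronglyMeasurable u volume →
      AEStronglyMeasurable (fun z => Γ z.2 (u z)) volume := fun hu =>
    hΓ.continuous_uncurry.comp_aestronglyMeasurable
      (continuous_snd.aestronglyMeasurable.prodMk hu)
  have mA : ∀ {u : E d × E d → ℝ}, AEStronglyMeasurable u volume →
      AEStronglyMeasurable (fun z => A z.2 (u z)) volume := fun hu =>
    hΓ.continuous_right.comp_aestronglyMeasurable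
      (continuous_snd.aestronglyMeasurable.prodMk hu)
  have mG : ∀ {u : E d × E d → ℝ}, AEStronglyMeasurable u volume →
      AEStronglyMeasurable (fun z => G z.2 (u z) (F z.1)) volume := fun hu =>
    hΓ.continuous_left.comp_aestronglyMeasurable
      ((continuous_snd.aestronglyMeasurable.prodMk hu).prodMk
        (hFc.comp continuous_fst).aestronglyMeasurable)
  have iΓ : ∀ {u : E d × E d → ℝ}, Integrable u →
      Integrable fun z => Γ z.2 (u z) * fderiv ℝ χ z (vel a F z) := by
    intro u hu
    refine (hu.norm.const_mul (C * K1)).mono' ((mΓ hu.1).mul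
      (hχd.clm_apply hv).aestronglyMeasurable) (ae_of_all _ fun z => ?_)
    rw [norm_mul]
    calc _ ≤ (C * |u z|) * K1 :=
          mul_le_mul (hΓ.abs_le _ _) (hK1 z _ (hB z.1)) (abs_nonneg _) (by positivity)
      _ = _ := by rw [Real.norm_eq_abs]; ring
  have hwle : ∀ z : E d × E d, |χ z| * w z.2 ≤ K3 := fun z => by
    have := hK3 z
    rwa [Pi.mul_apply, norm_mul, Real.norm_eq_abs, Real.norm_of_nonneg (hΓ.weight_nonneg _)] at this
  have iG : ∀ {u : E d × E d → ℝ}, Integrable u →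
      Integrable fun z => χ z * G z.2 (u z) (F z.1) := by
    intro u hu
    refine (hu.norm.const_mul (K3 * B)).mono' (hχ.continuous.aestronglyMeasurable.mul
      (mG hu.1)) (ae_of_all _ fun z => ?_)
    rw [norm_mul]
    calc _ ≤ |χ z| * (w z.2 * |u z| * B) := by
          gcongr
          · exact le_rfl
          · exact ((G z.2 (u z)).le_opNorm _).trans (mul_le_mul (hΓ.norm_left_le _ _) (hB _)
              (norm_nonneg _) (mul_nonneg (hΓ.weight_nonneg _) (abs_nonneg _)))
      _ = (|χ z| * w z.2) * (B * |u z|) := by ring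
      _ ≤ K3 * (B * |u z|) := by gcongr; exact hwle z
      _ = _ := by rw [Real.norm_eq_abs]; ring
  have bA : ∀ (u : E d × E d → ℝ) z, ‖χ z * A z.2 (u z)‖ ≤ K2 * C := by
    intro u z
    rw [norm_mul]
    exact mul_le_mul (hK2 z) (hΓ.bound _ _) (norm_nonneg _) hK20
  have iA : ∀ {u v : E d × E d → ℝ}, Integrable u → Integrable v →
      Integrable fun z => χ z * A z.2 (u z) * v z := fun {u v} hu hv =>
    hv.bdd_mul (hχ.continuous.aestronglyMeasurable.mul (mA hu.1)) (ae_of_all _ (bA u))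
  have ir := fun n => integrable_regularize n hf
  have irS := fun n => integrable_regularize n hS
  have T1 : Tendsto (fun n => ∫ z, Γ z.2 (regularize n f z) * fderiv ℝ χ z (vel a F z)) atTop
      (𝓝 (∫ z, Γ z.2 (f z) * fderiv ℝ χ z (vel a F z))) := by
    refine tendsto_integral_of_abs_sub_le (K := C * Real.toNNReal K1) (iΓ hf)
      (fun n => iΓ (ir n)) (fun n z => ?_) (tendsto_lintegral_regularize_sub hf)
    rw [← sub_mul, abs_mul, NNReal.coe_mul, Real.coe_toNNReal _ hK10]
    calc _ ≤ (C * |regularize n f z - f z|) * K1 :=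
          mul_le_mul (hΓ.abs_sub_le _ _ _) (hK1 z _ (hB z.1)) (abs_nonneg _) (by positivity)
      _ = _ := by ring
  have T2 : Tendsto (fun n => ∫ z, χ z * G z.2 (regularize n f z) (F z.1)) atTop
      (𝓝 (∫ z, χ z * G z.2 (f z) (F z.1))) := by
    refine tendsto_integral_of_abs_sub_le (K := Real.toNNReal (K3 * B)) (iG hf)
      (fun n => iG (ir n)) (fun n z => ?_) (tendsto_lintegral_regularize_sub hf)
    rw [← mul_sub, abs_mul, Real.coe_toNNReal _ (by positivity), ← sub_apply]
    calc _ ≤ |χ z| * (w z.2 * |regularize n f z - f z| * B) := by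
          gcongr
          exact (ContinuousLinearMap.le_opNorm _ _).trans (mul_le_mul (hΓ.lipschitz _ _ _) (hB _)
              (norm_nonneg _) (mul_nonneg (hΓ.weight_nonneg _) (abs_nonneg _)))
      _ = (|χ z| * w z.2) * (B * |regularize n f z - f z|) := by ring
      _ ≤ K3 * (B * |regularize n f z - f z|) := by gcongr; exact hwle z
      _ = _ := by ring
  have T3 : Tendsto (fun n => ∫ z, χ z * A z.2 (regularize n f z) * commutator n a F f z) atTop
      (𝓝 0) := by
    have := tendsto_integral_of_abs_sub_le (K := Real.toNNReal K2 * C) (H₀ := fun _ => (0 : ℝ))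
      (integrable_zero _ _ _)
      (fun n => iA (ir n) (integrable_commutator (a := a) hF n hfm hf)) (fun n z => ?_)
      (tendsto_lintegral_commutator (a := a) hF hf)
    · simpa using this
    · rw [sub_zero, abs_mul, NNReal.coe_mul, Real.coe_toNNReal _ hK20]
      gcongr
      exact bA _ z
  have T4 : Tendsto (fun n => ∫ z, χ z * A z.2 (regularize n f z) * regularize n S z) atTop
      (𝓝 (∫ z, χ z * A z.2 (f z) * S z)) := by
    have hS1 : Tendsto (fun n => ∫ z, χ z * A z.2 (regularize n f z) *
        (regularize n S z - S z)) atTop (𝓝 0) := by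
      have := tendsto_integral_of_abs_sub_le (K := Real.toNNReal K2 * C)
        (H₀ := fun _ => (0 : ℝ)) (integrable_zero _ _ _)
        (fun n => iA (ir n) (integrable_fun_sub (irS n) hS)) (fun n z => ?_)
        (tendsto_lintegral_regularize_sub hS)
      · simpa using this
      · rw [sub_zero, abs_mul, NNReal.coe_mul, Real.coe_toNNReal _ hK20]
        gcongr
        exact bA _ z
    -- A is merely bounded and continuous, so the L¹ distance gives nothing here; almost everywhere
    -- convergence of the mollified f and domination by |S| do.
    have hS2 : Tendsto (fun n => ∫ z, χ z * A z.2 (regularize n f z) * S z) atTop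
        (𝓝 (∫ z, χ z * A z.2 (f z) * S z)) := by
      refine tendsto_integral_of_dominated_convergence (fun z => K2 * C * ‖S z‖)
        (fun n => (iA (ir n) hS).1) (hS.norm.const_mul _) (fun n => ae_of_all _ fun z => ?_) ?_
      · rw [norm_mul]
        gcongr
        exact bA _ z
      · filter_upwards [ae_tendsto_regularize hf] with z hz
        have := (hΓ.continuous_right.tendsto (z.2, f z)).comp (tendsto_const_nhds.prodMk_nhds hz)
        exact (this.const_mul (χ z)).mul_const (S z)
    have := hS1.add hS2
    rw [zero_add] at this
    refine this.congr fun n => ?_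
    rw [← integral_add (iA (ir n) (integrable_fun_sub (irS n) hS)) (iA (ir n) hS)]
    refine integral_congr_ae (ae_of_all _ fun z => ?_)
    ring
  have := ((T1.add T2).sub T3).add T4
  have e : ∫ z, (Γ z.2 (f z) * fderiv ℝ χ z (vel a F z)
        + χ z * (G z.2 (f z) (F z.1) + A z.2 (f z) * S z))
      = (∫ z, Γ z.2 (f z) * fderiv ℝ χ z (vel a F z)) + (∫ z, χ z * G z.2 (f z) (F z.1)) - 0
        + ∫ z, χ z * A z.2 (f z) * S z := by
    rw [sub_zero, ← integral_add (iΓ hf) (iG hf),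
      ← integral_add ((iΓ hf).fun_add (iG hf)) (iA hf hS)]
    refine integral_congr_ae (ae_of_all _ fun z => ?_)
    simp only; ring
  rw [e]
  exact this

/-- The constant depends on χ, B and L but on none of n, F, f, S. Applied to the time slices of a
solution it gives a constant dominating function on a bounded time interval. -/
theorem abs_renorm_transportRate_le (hΓ : IsRenorm Γ A G C w) (a B : ℝ) (L : ℝ≥0)
    {χ : E d × E d → ℝ} (hχ : ContDiff ℝ 1 χ) (hχc : HasCompactSupport χ) :
    ∃ K, 0 ≤ K ∧ ∀ (F : E d → E d), LipschitzWith L F → (∀ x, ‖F x‖ ≤ B) →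
      ∀ (n : ℕ) (f S : E d × E d → ℝ), Measurable f → Integrable f → Integrable S →
      |∫ z, χ z * (A z.2 (regularize n f z) * transportRate n a F f S z)|
        ≤ K * ((∫ z, |f z|) + ∫ z, |S z|) := by
  obtain ⟨K1, hK10, hK1⟩ := exists_abs_fderiv_vel_le hχ hχc a B
  obtain ⟨K2, hK2⟩ := hχc.exists_bound_of_continuous hχ.continuous
  have hK20 : 0 ≤ K2 := (norm_nonneg _).trans (hK2 0)
  obtain ⟨K3, hK3⟩ := (hχc.mul_right (f' := fun z : E d × E d => w z.2)).exists_bound_of_continuous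
    (hχ.continuous.mul (hΓ.weight_continuous.comp continuous_snd))
  have hK30 : 0 ≤ K3 := (norm_nonneg _).trans (hK3 0)
  obtain ⟨Cc, hCc⟩ := lintegral_commutator_le (d := d) a L
  refine ⟨C * K1 + K3 * |B| + K2 * C * Cc + K2 * C, by positivity, ?_⟩
  intro F hF hB n f S hfm hf hS
  rw [integral_renorm_transportRate hΓ hF hB n hf hS (integrable_commutator hF n hfm hf) hχ hχc]
  have hB0 : 0 ≤ B := (norm_nonneg _).trans (hB 0)
  have hwle : ∀ z : E d × E d, |χ z| * w z.2 ≤ K3 := fun z => by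
    have := hK3 z
    rwa [Pi.mul_apply, norm_mul, Real.norm_eq_abs,
      Real.norm_of_nonneg (hΓ.weight_nonneg _)] at this
  have bA : ∀ (u : E d × E d → ℝ) z, |χ z * A z.2 (u z)| ≤ K2 * C := by
    intro u z
    rw [abs_mul]
    exact mul_le_mul (hK2 z) (hΓ.bound _ _) (abs_nonneg _) hK20
  have habs : ∀ {h v : E d × E d → ℝ} {k : ℝ}, Integrable v → (∀ z, |h z| ≤ k * |v z|) →
      |∫ z, h z| ≤ k * ∫ z, |v z| := by
    intro h v k hv hle
    rw [← integral_const_mul]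
    exact norm_integral_le_of_norm_le (f := h) (hv.abs.const_mul k) (ae_of_all _ hle)
  have ir := integrable_regularize n hf
  have irS := integrable_regularize n hS
  have hr := integral_abs_regularize_le n hf
  have hrS := integral_abs_regularize_le n hS
  have b1 := habs (h := fun z => Γ z.2 (regularize n f z) * fderiv ℝ χ z (vel a F z))
    (k := C * K1) ir fun z => by
      rw [abs_mul]
      calc _ ≤ (C * |regularize n f z|) * K1 :=
            mul_le_mul (hΓ.abs_le _ _) (hK1 z _ (hB z.1)) (abs_nonneg _) (by positivity)
        _ = _ := by ring
  have b2 := habs (h := fun z => χ z * G z.2 (regularize n f z) (F z.1)) (k := K3 * |B|) ir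
    fun z => by
      rw [abs_mul, abs_of_nonneg hB0]
      calc _ ≤ |χ z| * (w z.2 * |regularize n f z| * B) := by
            gcongr
            exact ((G z.2 (regularize n f z)).le_opNorm _).trans (mul_le_mul
              (hΓ.norm_left_le _ _) (hB _) (norm_nonneg _)
              (mul_nonneg (hΓ.weight_nonneg _) (abs_nonneg _)))
        _ = (|χ z| * w z.2) * (B * |regularize n f z|) := by ring
        _ ≤ K3 * (B * |regularize n f z|) := by gcongr; exact hwle z
        _ = _ := by ring
  have b3 := habs (h := fun z => χ z * A z.2 (regularize n f z) * commutator n a F f z)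
    (k := K2 * C) (integrable_commutator hF n hfm hf) fun z => by
      rw [abs_mul]; gcongr; exact bA _ z
  have b4 := habs (h := fun z => χ z * A z.2 (regularize n f z) * regularize n S z)
    (k := K2 * C) irS fun z => by
      rw [abs_mul]; gcongr; exact bA _ z
  have hcm : ∫ z, |commutator n a F f z| ≤ Cc * ∫ z, |f z| := by
    have h1 := hCc F hF n f hfm
    have h2 : ∀ {g : E d × E d → ℝ}, Integrable g →
        ∫⁻ z, ‖g z‖ₑ = ENNReal.ofReal (∫ z, |g z|) := fun {g} hg => by
      rw [ofReal_integral_eq_lintegral_ofReal hg.abs (ae_of_all _ fun _ => abs_nonneg _)]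
      simp_rw [← Real.norm_eq_abs, ofReal_norm]
    rw [h2 (integrable_commutator hF n hfm hf), h2 hf, ← ENNReal.ofReal_coe_nnreal,
      ← ENNReal.ofReal_mul (by positivity)] at h1
    exact (ENNReal.ofReal_le_ofReal_iff (by positivity)).mp h1
  have hf0 : 0 ≤ ∫ z, |f z| := integral_nonneg fun _ => abs_nonneg _
  have hS0 : 0 ≤ ∫ z, |S z| := integral_nonneg fun _ => abs_nonneg _
  have c1 : (C * K1) * ∫ z, |regularize n f z| ≤ (C * K1) * ∫ z, |f z| := by gcongr
  have c2 : (K3 * |B|) * ∫ z, |regularize n f z| ≤ (K3 * |B|) * ∫ z, |f z| := by gcongr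
  have c3 : (K2 * C) * ∫ z, |commutator n a F f z| ≤ (K2 * C) * (Cc * ∫ z, |f z|) := by gcongr
  have c4 : (K2 * C) * ∫ z, |regularize n S z| ≤ (K2 * C) * ∫ z, |S z| := by gcongr
  have p1 : 0 ≤ (K2 * C) * ∫ z, |f z| := by positivity
  have p2 : 0 ≤ (C * K1 + K3 * |B| + K2 * C * Cc) * ∫ z, |S z| := by positivity
  refine (abs_add_le _ _).trans ?_
  have t1 := abs_sub (((∫ z, Γ z.2 (regularize n f z) * fderiv ℝ χ z (vel a F z))
        + (∫ z, χ z * G z.2 (regularize n f z) (F z.1))))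
        (∫ z, χ z * A z.2 (regularize n f z) * commutator n a F f z)
  have t2 := abs_add_le (∫ z, Γ z.2 (regularize n f z) * fderiv ℝ χ z (vel a F z))
        (∫ z, χ z * G z.2 (regularize n f z) (F z.1))
  nlinarith

end FixedTime

end

section

variable {d : ℕ}

/-! ### Weak solutions of transport equations and their renormalization -/

/-- `g` is a weak solution of `∂ₜ g + a ξ·∇ₓ g + F·∇_ξ g = S` on `(0,T)` with initial datum `g₀`,
where `F` is bounded by `B` and `L`-Lipschitz in `x`, and `g`, `S` are bounded by `K` in `L¹`. -/
structure IsTransport (T a B K : ℝ) (L : ℝ≥0) (F : ℝ → E d → E d) (g S : ℝ → E d × E d → ℝ)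
    (g₀ : E d × E d → ℝ) : Prop where
  g_meas : Measurable fun p : ℝ × (E d × E d) => g p.1 p.2
  S_meas : Measurable fun p : ℝ × (E d × E d) => S p.1 p.2
  F_meas : Measurable fun p : ℝ × E d => F p.1 p.2
  g₀_meas : Measurable g₀
  g₀_int : Integrable g₀
  g_bound : ∀ᵐ t ∂(volume.restrict (Ioo 0 T)), Integrable (g t) ∧ ∫ z, |g t z| ≤ K
  S_bound : ∀ᵐ t ∂(volume.restrict (Ioo 0 T)), Integrable (S t) ∧ ∫ z, |S t z| ≤ K
  F_bound : ∀ᵐ t ∂(volume.restrict (Ioo 0 T)), (∀ x, ‖F t x‖ ≤ B) ∧ LipschitzWith L (F t)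
  eq : ∀ ψ : E d × E d → ℝ, ContDiff ℝ ∞ ψ → HasCompactSupport ψ →
    ∀ᵐ t ∂(volume.restrict (Ioo 0 T)), ∫ z, g t z * ψ z = (∫ z, g₀ z * ψ z)
      + ∫ s in (0 : ℝ)..t, ∫ z, (g s z * fderiv ℝ ψ z (vel a (F s) z) + S s z * ψ z)

/-- At fixed n the value of the regularized solution at a point thus has a bounded rate of change,
as the chain rule in time requires. The constant c may depend on n. The number 2 bounds the outer
radius of every mollifier, so that |z'| ≤ |z| + 2 wherever the kernel lives. -/
theorem exists_abs_transportRate_le (n : ℕ) : ∃ c, 0 ≤ c ∧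
    ∀ {a B : ℝ} {F : E d → E d} {f S : E d × E d → ℝ} (z : E d × E d), (∀ x, ‖F x‖ ≤ B) →
      Integrable f → Integrable S →
      |transportRate n a F f S z|
        ≤ c * ((|a| * (‖z‖ + 2) + B) * (∫ z', |f z'|) + ∫ z', |S z'|) := by
  obtain ⟨c1, hc1⟩ := exists_norm_fderiv_moll_le (E d × E d) n
  obtain ⟨c2, hc2⟩ := (hasCompactSupport_moll (V := E d × E d) n).exists_bound_of_continuous
    (contDiff_moll n).continuous
  refine ⟨max c1 c2, ((norm_nonneg _).trans (hc1 0)).trans (le_max_left _ _), ?_⟩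
  intro a B F f S z hB hf hS
  have hB0 : 0 ≤ B := (norm_nonneg _).trans (hB 0)
  rw [mul_add, ← integral_const_mul, ← integral_const_mul, ← integral_const_mul,
    ← integral_add ((hf.abs.const_mul _).const_mul _) (hS.abs.const_mul _)]
  refine norm_integral_le_of_norm_le (f := fun z' => f z' * fderiv ℝ (fun y => moll n (z - y)) z'
    (vel a F z') + S z' * moll n (z - z')) (((hf.abs.const_mul _).const_mul _).add
    (hS.abs.const_mul _)) (ae_of_all _ fun z' => ?_)
  rw [fderiv_moll_sub]
  refine (norm_add_le _ _).trans (add_le_add ?_ ?_)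
  · rw [norm_mul, norm_neg, Real.norm_eq_abs (f z')]
    have hc0 : 0 ≤ max c1 c2 := ((norm_nonneg _).trans (hc1 0)).trans (le_max_left _ _)
    by_cases hz : 2 / ((n : ℝ) + 1) < ‖z - z'‖
    · rw [fderiv_moll_eq_zero n hz]
      simp only [zero_apply, norm_zero, mul_zero]
      positivity
    · have h2 : 2 / ((n : ℝ) + 1) ≤ 2 := div_le_self (by norm_num) (by simp)
      have h3 : ‖z'‖ ≤ ‖z‖ + 2 := by
        have := norm_sub_norm_le z' z
        rw [norm_sub_rev] at this
        linarith [not_lt.mp hz]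
      have hv : ‖vel a F z'‖ ≤ |a| * (‖z‖ + 2) + B := by
        refine norm_prod_le_iff.mpr ⟨?_, ?_⟩
        · simp only [vel, norm_smul, Real.norm_eq_abs]
          have : ‖z'.2‖ ≤ ‖z‖ + 2 := (norm_snd_le z').trans h3
          have := mul_le_mul_of_nonneg_left this (abs_nonneg a)
          linarith
        · have : 0 ≤ |a| * (‖z‖ + 2) := by positivity
          simp only [vel]
          linarith [hB z'.1]
      calc _ ≤ |f z'| * (‖fderiv ℝ (moll n) (z - z')‖ * ‖vel a F z'‖) := by
            gcongr; exact ContinuousLinearMap.le_opNorm _ _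
        _ ≤ |f z'| * (max c1 c2 * (|a| * (‖z‖ + 2) + B)) := by
            gcongr; exact (hc1 _).trans (le_max_left _ _)
        _ = _ := by ring
  · rw [norm_mul, mul_comm, Real.norm_eq_abs (S z')]
    gcongr
    exact (hc2 _).trans (le_max_right _ _)

namespace IsTransport

variable {T a B K : ℝ} {L : ℝ≥0} {F : ℝ → E d → E d} {g S : ℝ → E d × E d → ℝ}
  {g₀ : E d × E d → ℝ}

theorem measurable_regularize {g : ℝ → E d × E d → ℝ}
    (hg : Measurable fun p : ℝ × (E d × E d) => g p.1 p.2) (n : ℕ) :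
    Measurable fun p : ℝ × (E d × E d) => regularize n (g p.1) p.2 := by
  have hm : Measurable (moll n : E d × E d → ℝ) := (contDiff_moll n).continuous.measurable
  refine (StronglyMeasurable.integral_prod_right (f := fun (p : ℝ × (E d × E d)) z' =>
    g p.1 z' * moll n (p.2 - z')) ?_).measurable
  refine Measurable.stronglyMeasurable ?_
  exact (hg.comp ((measurable_fst.comp measurable_fst).prodMk measurable_snd)).mul
    (hm.comp ((measurable_snd.comp measurable_fst).sub measurable_snd))

theorem measurable_transportRate (h : IsTransport T a B K L F g S g₀) (n : ℕ) :
    Measurable fun p : ℝ × (E d × E d) => transportRate n a (F p.1) (g p.1) (S p.1) p.2 := by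
  have hm : Measurable (moll n : E d × E d → ℝ) := (contDiff_moll n).continuous.measurable
  have hd : Continuous fun q : (E d × E d) × (E d × E d) => fderiv ℝ (moll n) q.1 q.2 := by
    have := continuous_fderiv_moll (V := E d × E d) n
    fun_prop
  refine (StronglyMeasurable.integral_prod_right (f := fun (p : ℝ × (E d × E d)) z' =>
    g p.1 z' * fderiv ℝ (fun y => moll n (p.2 - y)) z' (vel a (F p.1) z')
      + S p.1 z' * moll n (p.2 - z')) ?_).measurable
  refine Measurable.stronglyMeasurable ?_
  simp only [fderiv_moll_sub]
  have m1 : Measurable fun q : (ℝ × (E d × E d)) × (E d × E d) => (q.1.1, q.2) :=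
    (measurable_fst.comp measurable_fst).prodMk measurable_snd
  have m2 : Measurable fun q : (ℝ × (E d × E d)) × (E d × E d) => q.1.2 - q.2 :=
    (measurable_snd.comp measurable_fst).sub measurable_snd
  have m3 : Measurable fun q : (ℝ × (E d × E d)) × (E d × E d) => vel a (F q.1.1) q.2 := by
    unfold vel
    refine Measurable.prodMk (by fun_prop) ?_
    exact h.F_meas.comp ((measurable_fst.comp measurable_fst).prodMk
      (measurable_fst.comp measurable_snd))
  exact ((h.g_meas.comp m1).mul ((hd.measurable.comp (m2.prodMk m3)).neg)).add
    ((h.S_meas.comp m1).mul (hm.comp m2))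

variable {Γ A : E d → ℝ → ℝ} {G : E d → ℝ → E d →L[ℝ] ℝ} {C : ℝ≥0} {w : E d → ℝ}

/-- Regularizing at z amounts to testing the equation with the mollifier centred at z. The primitive
y of the resulting rate is a jointly measurable representative, and for it the chain rule holds at
every time and every point. -/
theorem ae_regularize_renorm (h : IsTransport T a B K L F g S g₀) (hΓ : IsRenorm Γ A G C w)
    (hT : 0 < T) (n : ℕ) :
    ∃ y : ℝ → E d × E d → ℝ, Measurable (fun p : ℝ × (E d × E d) => y p.1 p.2) ∧
      (∀ᵐ t ∂(volume.restrict (Ioo 0 T)), ∀ᵐ z, regularize n (g t) z = y t z) ∧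
      ∀ z, ∀ t ∈ Ioo 0 T, Γ z.2 (y t z) = Γ z.2 (regularize n g₀ z)
        + ∫ s in Ioc 0 t, A z.2 (regularize n (g s) z)
          * transportRate n a (F s) (g s) (S s) z := by
  set N : ℝ → E d × E d → ℝ := fun s z => transportRate n a (F s) (g s) (S s) z with hN
  have hNm : Measurable fun p : ℝ × (E d × E d) => N p.1 p.2 := h.measurable_transportRate n
  obtain ⟨c, hc0, hc⟩ := exists_abs_transportRate_le (d := d) n
  have hNb : ∀ z, ∀ᵐ s ∂(volume.restrict (Ioo 0 T)),
      |N s z| ≤ c * ((|a| * (‖z‖ + 2) + |B|) * |K| + |K|) := by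
    intro z
    filter_upwards [h.g_bound, h.S_bound, h.F_bound] with s h1 h2 h3
    refine (hc z h3.1 h1.1 h2.1).trans ?_
    gcongr
    · exact le_abs_self B
    · exact h1.2.trans (le_abs_self K)
    · exact h2.2.trans (le_abs_self K)
  have hNi : ∀ z, IntegrableOn (fun s => N s z) (Ioo 0 T) := fun z =>
    Measure.integrableOn_of_bounded (by simp) (hNm.comp measurable_prodMk_right).aestronglyMeasurable
      (hNb z)
  have hNii : ∀ z, IntervalIntegrable (fun s => N s z) volume 0 T := fun z => by
    rw [intervalIntegrable_iff_integrableOn_Ioo_of_le hT.le]; exact hNi z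
  set y : ℝ → E d × E d → ℝ := fun t z => regularize n g₀ z + ∫ s in Ioc 0 t, N s z with hy
  have hreg0 : Measurable (regularize n g₀) := (contDiff_regularize n h.g₀_int).continuous.measurable
  have hym : Measurable fun p : ℝ × (E d × E d) => y p.1 p.2 := by
    refine (hreg0.comp measurable_snd).add ?_
    have e : ∀ p : ℝ × (E d × E d), ∫ s in Ioc 0 p.1, N s p.2
        = ∫ s, if 0 < s ∧ s ≤ p.1 then N s p.2 else 0 := by
      intro p
      rw [← integral_indicator measurableSet_Ioc]
      refine integral_congr_ae (ae_of_all _ fun s => ?_)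
      simp [indicator, mem_Ioc]
    simp_rw [e]
    refine (StronglyMeasurable.integral_prod_right (f := fun (p : ℝ × (E d × E d)) s =>
      if 0 < s ∧ s ≤ p.1 then N s p.2 else 0) (Measurable.stronglyMeasurable ?_)).measurable
    refine Measurable.ite ?_ (hNm.comp (measurable_snd.prodMk
      (measurable_snd.comp measurable_fst))) measurable_const
    exact (measurableSet_lt measurable_const measurable_snd).inter
      (measurableSet_le measurable_snd (measurable_fst.comp measurable_fst))
  have hae : ∀ z, ∀ᵐ t ∂(volume.restrict (Ioo 0 T)), regularize n (g t) z = y t z := by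
    intro z
    filter_upwards [h.eq _ (contDiff_moll_sub n z) (hasCompactSupport_moll_sub n z),
      ae_restrict_mem measurableSet_Ioo] with t ht htT
    rw [intervalIntegral.integral_of_le htT.1.le] at ht
    exact ht
  refine ⟨y, hym, ?_, ?_⟩
  -- The exceptional times depend on z. Fubini on the measurable set of coincidence turns this into:
  -- for almost every time, for almost every z.
  · have hset : MeasurableSet {p : ℝ × (E d × E d) | regularize n (g p.1) p.2 = y p.1 p.2} :=
      measurableSet_eq_fun (measurable_regularize h.g_meas n) hym
    exact (Measure.ae_ae_comm hset).mpr (ae_of_all _ hae)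
  · intro z t ht
    have h1 := comp_primitive_eq (T := T) (t := t) (y₀ := regularize n g₀ z)
      (Γ := Γ z.2) (A := A z.2) ⟨ht.1.le, ht.2.le⟩ (hNii z)
      ((ae_restrict_iff' measurableSet_Ioo).mp (hNb z)) (hΓ.hasDerivAt z.2) (hΓ.bound z.2)
    rw [intervalIntegral.integral_of_le ht.1.le, intervalIntegral.integral_of_le ht.1.le] at h1
    rw [show y t z = regularize n g₀ z + ∫ s in Ioc 0 t, N s z from rfl, h1]
    congr 1
    refine setIntegral_congr_ae measurableSet_Ioc ?_
    filter_upwards [(ae_restrict_iff' measurableSet_Ioo).mp (hae z)] with s hs hst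
    rw [hs ⟨hst.1, hst.2.trans_lt ht.2⟩, intervalIntegral.integral_of_le hst.1.le]

theorem ae_integral_regularize_renorm (h : IsTransport T a B K L F g S g₀)
    (hΓ : IsRenorm Γ A G C w) (hT : 0 < T) (n : ℕ) {χ : E d × E d → ℝ} (hχ : Continuous χ)
    (hχc : HasCompactSupport χ) :
    ∀ᵐ t ∂(volume.restrict (Ioo 0 T)),
      ∫ z, χ z * Γ z.2 (regularize n (g t) z) = (∫ z, χ z * Γ z.2 (regularize n g₀ z))
        + ∫ s in Ioc 0 t, ∫ z, χ z * (A z.2 (regularize n (g s) z)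
          * transportRate n a (F s) (g s) (S s) z) := by
  obtain ⟨y, hym, hy1, hy2⟩ := h.ae_regularize_renorm hΓ hT n
  obtain ⟨c, hc0, hc⟩ := exists_abs_transportRate_le (d := d) n
  filter_upwards [hy1, ae_restrict_mem measurableSet_Ioo] with t ht htT
  have hrm := measurable_regularize h.g_meas n
  have hNm := h.measurable_transportRate n
  have hΓc := hΓ.continuous_uncurry
  have hAc := hΓ.continuous_right
  set R : ℝ → E d × E d → ℝ := fun s z => χ z * (A z.2 (regularize n (g s) z)
          * transportRate n a (F s) (g s) (S s) z) with hR
  have hRm : Measurable fun p : ℝ × (E d × E d) => R p.1 p.2 :=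
    (hχ.measurable.comp measurable_snd).mul
      ((hAc.measurable.comp ((measurable_snd.comp measurable_snd).prodMk hrm)).mul hNm)
  set W : E d × E d → ℝ := fun z =>
    |χ z| * (C * (c * ((|a| * (‖z‖ + 2) + |B|) * |K| + |K|))) with hW
  have hWi : Integrable W := by
    refine Continuous.integrable_of_hasCompactSupport (by fun_prop) ?_
    exact hχc.norm.mul_right
  have hRb : ∀ᵐ s ∂(volume.restrict (Ioc 0 t)), ∀ z, ‖R s z‖ ≤ W z := by
    rw [ae_restrict_iff' measurableSet_Ioc]
    filter_upwards [(ae_restrict_iff' measurableSet_Ioo).mp h.g_bound,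
      (ae_restrict_iff' measurableSet_Ioo).mp h.S_bound,
      (ae_restrict_iff' measurableSet_Ioo).mp h.F_bound] with s h1 h2 h3 hst z
    have hs : s ∈ Ioo 0 T := ⟨hst.1, hst.2.trans_lt htT.2⟩
    simp only [hR, hW, norm_mul, Real.norm_eq_abs]
    gcongr
    · exact hΓ.bound _ _
    · refine (hc z (h3 hs).1 (h1 hs).1 (h2 hs).1).trans ?_
      gcongr
      · exact le_abs_self B
      · exact (h1 hs).2.trans (le_abs_self K)
      · exact (h2 hs).2.trans (le_abs_self K)
  have hRi : Integrable (fun p : ℝ × (E d × E d) => R p.1 p.2)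
      ((volume.restrict (Ioc 0 t)).prod volume) := by
    have hWi2 : Integrable (fun p : ℝ × (E d × E d) => W p.2)
        ((volume.restrict (Ioc 0 t)).prod volume) := hWi.comp_snd _
    refine hWi2.mono' hRm.aestronglyMeasurable ?_
    rw [Measure.ae_prod_iff_ae_ae]
    · filter_upwards [hRb] with s hs using ae_of_all _ hs
    · exact measurableSet_le hRm.norm (by fun_prop)
  have e1 : ∫ z, χ z * Γ z.2 (regularize n (g t) z) = ∫ z, χ z * Γ z.2 (y t z) := by
    refine integral_congr_ae ?_
    filter_upwards [ht] with z hz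
    rw [hz]
  have e2 : ∀ z, χ z * Γ z.2 (y t z) = χ z * Γ z.2 (regularize n g₀ z)
      + ∫ s in Ioc 0 t, R s z := by
    intro z
    rw [hy2 z t htT, mul_add, ← integral_const_mul]
  rw [e1]
  simp_rw [e2]
  rw [integral_add]
  · congr 1
    exact (integral_integral_swap hRi).symm
  · have hu := (contDiff_regularize n h.g₀_int).continuous
    refine Continuous.integrable_of_hasCompactSupport ?_ hχc.mul_right
    exact hχ.mul (hΓc.comp (continuous_snd.prodMk hu))
  · exact hRi.integral_prod_right

/-- The renormalized equation, tested with a compactly supported function of `(x,ξ)`. -/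
theorem renormalized (h : IsTransport T a B K L F g S g₀) (hΓ : IsRenorm Γ A G C w) (hT : 0 < T)
    {χ : E d × E d → ℝ} (hχ : ContDiff ℝ 1 χ) (hχc : HasCompactSupport χ) :
    ∀ᵐ t ∂(volume.restrict (Ioo 0 T)),
      ∫ z, χ z * Γ z.2 (g t z) = (∫ z, χ z * Γ z.2 (g₀ z))
        + ∫ s in Ioc 0 t, ∫ z, (Γ z.2 (g s z) * fderiv ℝ χ z (vel a (F s) z)
            + χ z * (G z.2 (g s z) (F s z.1) + A z.2 (g s z) * S s z)) := by
  have hall := ae_all_iff.mpr fun n => h.ae_integral_regularize_renorm hΓ hT n hχ.continuous hχc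
  have hgm : ∀ t, Measurable (g t) := fun t => h.g_meas.comp measurable_prodMk_left
  obtain ⟨K2, hK2⟩ := hχc.exists_bound_of_continuous hχ.continuous
  have hK20 : 0 ≤ K2 := (norm_nonneg _).trans (hK2 0)
  have hlim : ∀ {f : E d × E d → ℝ}, Integrable f →
      Tendsto (fun n => ∫ z, χ z * Γ z.2 (regularize n f z)) atTop
        (𝓝 (∫ z, χ z * Γ z.2 (f z))) := by
    intro f hf
    have i : ∀ {u : E d × E d → ℝ}, Integrable u → Integrable fun z => χ z * Γ z.2 (u z) := by
      intro u hu
      refine (hu.norm.const_mul (K2 * C)).mono' (hχ.continuous.aestronglyMeasurable.mul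
        (hΓ.continuous_uncurry.comp_aestronglyMeasurable
          (continuous_snd.aestronglyMeasurable.prodMk hu.1))) (ae_of_all _ fun z => ?_)
      rw [norm_mul, mul_assoc]
      exact mul_le_mul (hK2 z) (hΓ.abs_le _ _) (norm_nonneg _) hK20
    refine tendsto_integral_of_abs_sub_le (K := Real.toNNReal K2 * C) (i hf)
      (fun n => i (integrable_regularize n hf)) (fun n z => ?_)
      (tendsto_lintegral_regularize_sub hf)
    rw [← mul_sub, abs_mul, NNReal.coe_mul, Real.coe_toNNReal _ hK20, mul_assoc]
    exact mul_le_mul (hK2 z) (hΓ.abs_sub_le _ _ _) (abs_nonneg _) hK20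
  obtain ⟨K3, hK30, hK3⟩ := abs_renorm_transportRate_le hΓ a B L hχ hχc
  filter_upwards [hall, h.g_bound, ae_restrict_mem measurableSet_Ioo] with t ht hgt htT
  have L1 := hlim hgt.1
  have L2 := hlim h.g₀_int
  have L3 : Tendsto (fun n => ∫ s in Ioc 0 t, ∫ z, χ z * (A z.2 (regularize n (g s) z)
          * transportRate n a (F s) (g s) (S s) z)) atTop
      (𝓝 (∫ s in Ioc 0 t, ∫ z, (Γ z.2 (g s z) * fderiv ℝ χ z (vel a (F s) z)
            + χ z * (G z.2 (g s z) (F s z.1) + A z.2 (g s z) * S s z)))) := by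
    have hs : ∀ᵐ s ∂(volume.restrict (Ioc 0 t)), (Integrable (g s) ∧ ∫ z, |g s z| ≤ K) ∧
        (Integrable (S s) ∧ ∫ z, |S s z| ≤ K) ∧ (∀ x, ‖F s x‖ ≤ B) ∧ LipschitzWith L (F s) := by
      have : Ioc 0 t ⊆ Ioo 0 T := fun s hs => ⟨hs.1, hs.2.trans_lt htT.2⟩
      filter_upwards [ae_restrict_of_ae_restrict_of_subset this h.g_bound,
        ae_restrict_of_ae_restrict_of_subset this h.S_bound,
        ae_restrict_of_ae_restrict_of_subset this h.F_bound] with s h1 h2 h3 using ⟨h1, h2, h3⟩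
    refine tendsto_integral_of_dominated_convergence (fun _ => K3 * (K + K)) (fun n => ?_)
      (integrable_const _) (fun n => ?_) ?_
    -- The limit under the time integral is by dominated convergence, with the constant K3 (K + K)
    -- from the uniform bound on the renormalized rate.
    · refine (StronglyMeasurable.integral_prod_right (f := fun (s : ℝ) (z : E d × E d) =>
        χ z * (A z.2 (regularize n (g s) z) * transportRate n a (F s) (g s) (S s) z))
        (Measurable.stronglyMeasurable ?_)).aestronglyMeasurable
      exact (hχ.continuous.measurable.comp measurable_snd).mul
        ((hΓ.continuous_right.measurable.comp ((measurable_snd.comp measurable_snd).prodMk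
          (measurable_regularize h.g_meas n))).mul (h.measurable_transportRate n))
    · filter_upwards [hs] with s ⟨h1, h2, h3⟩
      refine (hK3 (F s) h3.2 h3.1 n (g s) (S s) (hgm s) h1.1 h2.1).trans ?_
      gcongr
      exacts [h1.2, h2.2]
    · filter_upwards [hs] with s ⟨h1, h2, h3⟩
      exact tendsto_renorm_transportRate hΓ h3.2 h3.1 (hgm s) h1.1 h2.1 hχ hχc
  exact tendsto_nhds_unique (L1.congr ht) (L2.add L3)

end IsTransport

end

/-! ### Removal of the cutoff in phase space -/

section

variable {d : ℕ}

/-- Cutoff functions on phase space, equal to one on large balls. -/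
def cutoff (d n : ℕ) (z : E d × E d) : ℝ := bump (E d × E d) 0 (((n : ℝ) + 1)⁻¹ • z)

theorem contDiff_cutoff (n : ℕ) : ContDiff ℝ 1 (cutoff d n) :=
  (bump (E d × E d) 0).contDiff.comp (contDiff_const_smul _)

theorem hasCompactSupport_cutoff (n : ℕ) : HasCompactSupport (cutoff d n) := by
  have h : ((n : ℝ) + 1)⁻¹ ≠ 0 := by positivity
  exact (bump (E d × E d) 0).hasCompactSupport.comp_homeomorph (Homeomorph.smulOfNeZero _ h)

theorem abs_cutoff_le (n : ℕ) (z : E d × E d) : |cutoff d n z| ≤ 1 := by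
  rw [cutoff, abs_of_nonneg (ContDiffBump.nonneg _)]; exact ContDiffBump.le_one _

theorem cutoff_eq_one (n : ℕ) {z : E d × E d} (hz : ‖z‖ ≤ (n : ℝ) + 1) : cutoff d n z = 1 := by
  refine ContDiffBump.one_of_mem_closedBall _ ?_
  have h : (0 : ℝ) < (n : ℝ) + 1 := by positivity
  rw [mem_closedBall_zero_iff, norm_smul, norm_inv, Real.norm_of_nonneg h.le, bump]
  rw [inv_mul_le_iff₀ h]
  simpa using hz

theorem fderiv_cutoff_eq_zero (n : ℕ) {z : E d × E d} (hz : ‖z‖ < (n : ℝ) + 1) :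
    fderiv ℝ (cutoff d n) z = 0 := by
  have : cutoff d n =ᶠ[𝓝 z] fun _ => 1 := by
    filter_upwards [(isOpen_lt continuous_norm continuous_const).mem_nhds hz] with y hy
    exact cutoff_eq_one n (le_of_lt hy)
  rw [this.fderiv_eq]; simp

/-- The gradient of the cutoff is O(1/(n+1)) and is supported in |z| ≤ 2(n+1), where the velocity is
O(n+1): the linear growth of the field is compensated exactly. -/
theorem exists_abs_fderiv_cutoff_vel_le (d : ℕ) (a B : ℝ) : ∃ c, 0 ≤ c ∧
    ∀ (F : E d → E d), (∀ x, ‖F x‖ ≤ B) →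
      ∀ n z, |fderiv ℝ (cutoff d n) z (vel a F z)| ≤ c := by
  set φ : E d × E d → ℝ := fun z => bump (E d × E d) 0 z
  have hφ : ContDiff ℝ 1 φ := (bump (E d × E d) 0).contDiff
  have hφc : HasCompactSupport φ := (bump (E d × E d) 0).hasCompactSupport
  obtain ⟨c, hc⟩ := (hφc.fderiv ℝ).exists_bound_of_continuous (hφ.continuous_fderiv one_ne_zero)
  have hc0 : 0 ≤ c := (norm_nonneg _).trans (hc 0)
  refine ⟨c * (|a| * 2 + |B|), by positivity, fun F hB n z => ?_⟩
  have h0 : (0 : ℝ) < (n : ℝ) + 1 := by positivity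
  have e : fderiv ℝ (cutoff d n) z = ((n : ℝ) + 1)⁻¹ • fderiv ℝ φ (((n : ℝ) + 1)⁻¹ • z) := by
    have : cutoff d n = fun z => φ (((n : ℝ) + 1)⁻¹ • z) := rfl
    rw [this, fderiv_comp_smul]
  rw [e]
  by_cases hz : 2 * ((n : ℝ) + 1) < ‖z‖
  · have : fderiv ℝ φ (((n : ℝ) + 1)⁻¹ • z) = 0 := by
      by_contra h
      have hmem : ((n : ℝ) + 1)⁻¹ • z ∈ tsupport φ := support_fderiv_subset ℝ h
      have h2 := (bump (E d × E d) 0).tsupport_eq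
      have hmem' : ((n : ℝ) + 1)⁻¹ • z ∈ Metric.closedBall (0 : E d × E d) (bump (E d × E d) 0).rOut := by
        rw [← h2]; exact hmem
      rw [mem_closedBall_zero_iff, norm_smul, norm_inv, Real.norm_of_nonneg h0.le,
        inv_mul_le_iff₀ h0] at hmem'
      simp only [bump] at hmem'
      norm_num at hmem'
      linarith
    rw [this]; simp; positivity
  · have hz' := not_lt.mp hz
    have hv : ‖vel a F z‖ ≤ ((n : ℝ) + 1) * (|a| * 2 + |B|) := by
      refine norm_prod_le_iff.mpr ⟨?_, ?_⟩
      · simp only [vel, norm_smul, Real.norm_eq_abs]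
        have h1 : ‖z.2‖ ≤ 2 * ((n : ℝ) + 1) := (norm_snd_le z).trans hz'
        have := mul_le_mul_of_nonneg_left h1 (abs_nonneg a)
        have h3 : 0 ≤ ((n : ℝ) + 1) * |B| := by positivity
        nlinarith
      · simp only [vel]
        have h1 := (hB z.1).trans (le_abs_self B)
        have h2 : |B| ≤ ((n : ℝ) + 1) * |B| := by
          have : (1 : ℝ) ≤ (n : ℝ) + 1 := by simp
          nlinarith [abs_nonneg B]
        have h3 : 0 ≤ ((n : ℝ) + 1) * (|a| * 2) := by positivity
        nlinarith
    rw [smul_apply, smul_eq_mul, abs_mul, abs_inv, abs_of_pos h0]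
    calc ((n : ℝ) + 1)⁻¹ * |fderiv ℝ φ (((n : ℝ) + 1)⁻¹ • z) (vel a F z)|
        ≤ ((n : ℝ) + 1)⁻¹ * (c * (((n : ℝ) + 1) * (|a| * 2 + |B|))) := by
          gcongr
          exact ((fderiv ℝ φ (((n : ℝ) + 1)⁻¹ • z)).le_opNorm _).trans
            (mul_le_mul (hc _) hv (norm_nonneg _) hc0)
      _ = _ := by field_simp

namespace IsTransport

variable {T a B K : ℝ} {L : ℝ≥0} {F : ℝ → E d → E d} {g S : ℝ → E d × E d → ℝ}
  {g₀ : E d × E d → ℝ}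
variable {Γ A : E d → ℝ → ℝ} {G : E d → ℝ → E d →L[ℝ] ℝ} {C : ℝ≥0} {w : E d → ℝ}

/-- The renormalized equation, tested with a bounded function of `x`. -/
theorem renormalized_of_bounded (h : IsTransport T a B K L F g S g₀) (hΓ : IsRenorm Γ A G C w)
    (hT : 0 < T) {ψ : E d → ℝ} (hψ : ContDiff ℝ 1 ψ) {Kψ : ℝ} (hψb : ∀ x, |ψ x| ≤ Kψ)
    {W : E d → ℝ} {K' : ℝ} (hwW : ∀ ξ, w ξ ≤ W ξ) (hψW : ∀ x ξ, |fderiv ℝ ψ x (a • ξ)| ≤ W ξ)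
    (hWg : ∀ᵐ t ∂(volume.restrict (Ioo 0 T)), Integrable (fun z : E d × E d => W z.2 * |g t z|) ∧
      ∫ z : E d × E d, W z.2 * |g t z| ≤ K') :
    ∀ᵐ t ∂(volume.restrict (Ioo 0 T)),
      ∫ z : E d × E d, ψ z.1 * Γ z.2 (g t z) = (∫ z : E d × E d, ψ z.1 * Γ z.2 (g₀ z))
        + ∫ s in Ioc 0 t, ∫ z : E d × E d, (Γ z.2 (g s z) * fderiv ℝ ψ z.1 (a • z.2)
            + ψ z.1 * (G z.2 (g s z) (F s z.1) + A z.2 (g s z) * S s z)) := by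
  have hW0 : ∀ ξ, 0 ≤ W ξ := fun ξ => (hΓ.weight_nonneg ξ).trans (hwW ξ)
  have hKψ0 : 0 ≤ Kψ := (abs_nonneg _).trans (hψb 0)
  set χ : ℕ → E d × E d → ℝ := fun n z => ψ z.1 * cutoff d n z with hχdef
  have hχ : ∀ n, ContDiff ℝ 1 (χ n) := fun n => (hψ.comp contDiff_fst).mul (contDiff_cutoff n)
  have hχc : ∀ n, HasCompactSupport (χ n) := fun n => (hasCompactSupport_cutoff n).mul_left
  have hχb : ∀ n z, |χ n z| ≤ Kψ := fun n z => by
    rw [hχdef, abs_mul]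
    calc _ ≤ Kψ * 1 := mul_le_mul (hψb _) (abs_cutoff_le n z) (abs_nonneg _) hKψ0
      _ = Kψ := mul_one _
  have hχlim : ∀ z, Tendsto (fun n => χ n z) atTop (𝓝 (ψ z.1)) := by
    intro z
    obtain ⟨N, hN⟩ := exists_nat_gt ‖z‖
    refine tendsto_const_nhds.congr' ?_
    filter_upwards [eventually_ge_atTop N] with n hn
    have : (N : ℝ) ≤ n := by exact_mod_cast hn
    rw [hχdef]
    simp only
    rw [cutoff_eq_one n (by linarith), mul_one]
  have hder : ∀ n z (Fs : E d → E d), fderiv ℝ (χ n) z (vel a Fs z)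
      = cutoff d n z * fderiv ℝ ψ z.1 (a • z.2) + ψ z.1 * fderiv ℝ (cutoff d n) z (vel a Fs z) := by
    intro n z Fs
    have e1 := HasFDerivAt.comp (g := ψ) (f := Prod.fst) z
      (hψ.differentiable one_ne_zero z.1).hasFDerivAt hasFDerivAt_fst
    have e2 := e1.fun_mul ((contDiff_cutoff n).differentiable one_ne_zero z).hasFDerivAt
    simp only [Function.comp_apply] at e2
    rw [hχdef]
    simp only
    rw [e2.fderiv]
    simp [vel]
    ring
  obtain ⟨c, hc0, hc⟩ := exists_abs_fderiv_cutoff_vel_le d a B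
  have hΓc := hΓ.continuous_uncurry
  have hAc := hΓ.continuous_right
  have hGc := hΓ.continuous_left
  have hψd : Continuous (fderiv ℝ ψ) := hψ.continuous_fderiv one_ne_zero
  have hall := ae_all_iff.mpr fun n => h.renormalized hΓ hT (hχ n) (hχc n)
  have hgm : ∀ t, Measurable (g t) := fun t => h.g_meas.comp measurable_prodMk_left
  have hSm : ∀ t, Measurable (S t) := fun t => h.S_meas.comp measurable_prodMk_left
  set Q : ℕ → ℝ → E d × E d → ℝ := fun n s z =>
    Γ z.2 (g s z) * fderiv ℝ (χ n) z (vel a (F s) z)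
      + χ n z * (G z.2 (g s z) (F s z.1) + A z.2 (g s z) * S s z) with hQ
  have hQm : ∀ n, Measurable fun p : ℝ × (E d × E d) => Q n p.1 p.2 := by
    intro n
    have m2 : Measurable fun p : ℝ × (E d × E d) => p.2.2 := measurable_snd.comp measurable_snd
    have mF : Measurable fun p : ℝ × (E d × E d) => F p.1 p.2.1 :=
      h.F_meas.comp (measurable_fst.prodMk (measurable_fst.comp measurable_snd))
    have mv : Measurable fun p : ℝ × (E d × E d) => vel a (F p.1) p.2 := by
      unfold vel
      exact (m2.const_smul a).prodMk mF
    have mΓ := hΓc.measurable.comp (m2.prodMk h.g_meas)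
    have mA := hAc.measurable.comp (m2.prodMk h.g_meas)
    have mG := hGc.measurable.comp ((m2.prodMk h.g_meas).prodMk mF)
    have hdc : Continuous fun q : (E d × E d) × (E d × E d) => fderiv ℝ (χ n) q.1 q.2 := by
      have := (hχ n).continuous_fderiv one_ne_zero
      fun_prop
    have mχ := (hχ n).continuous.measurable.comp (measurable_snd : Measurable
      (Prod.snd : ℝ × (E d × E d) → _))
    exact (mΓ.mul (hdc.measurable.comp (measurable_snd.prodMk mv))).add
      (mχ.mul (mG.add (mA.mul h.S_meas)))
  -- A dominating function independent of n. The first term comes from differentiating the cutoff,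
  -- the second, with the weight W, from differentiating ψ along aξ and from G, the third from the
  -- source.
  set D : ℝ → E d × E d → ℝ := fun s z => C * (Kψ * c) * |g s z|
    + (C + Kψ * |B|) * (W z.2 * |g s z|) + Kψ * C * |S s z| with hD
  have hQD : ∀ n s z, (∀ x, ‖F s x‖ ≤ B) → ‖Q n s z‖ ≤ D s z := by
    intro n s z hB
    have hB0 : 0 ≤ B := (norm_nonneg _).trans (hB 0)
    have q1 : |fderiv ℝ (χ n) z (vel a (F s) z)| ≤ W z.2 + Kψ * c := by
      rw [hder]
      refine (abs_add_le _ _).trans (add_le_add ?_ ?_)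
      · rw [abs_mul]
        calc _ ≤ 1 * W z.2 := mul_le_mul (abs_cutoff_le n z) (hψW _ _) (abs_nonneg _) zero_le_one
          _ = _ := one_mul _
      · rw [abs_mul]
        exact mul_le_mul (hψb _) (hc _ hB n z) (abs_nonneg _) hKψ0
    have q2 : |G z.2 (g s z) (F s z.1)| ≤ W z.2 * |g s z| * B := by
      refine ((G z.2 (g s z)).le_opNorm _).trans (mul_le_mul ?_ (hB _) (norm_nonneg _) ?_)
      · exact (hΓ.norm_left_le _ _).trans (by gcongr; exact hwW _)
      · exact mul_nonneg (hW0 _) (abs_nonneg _)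
    have q3 : |A z.2 (g s z) * S s z| ≤ C * |S s z| := by
      rw [abs_mul]; gcongr; exact hΓ.bound _ _
    calc ‖Q n s z‖ ≤ |Γ z.2 (g s z)| * |fderiv ℝ (χ n) z (vel a (F s) z)|
          + |χ n z| * (|G z.2 (g s z) (F s z.1)| + |A z.2 (g s z) * S s z|) := by
          rw [hQ, Real.norm_eq_abs]
          refine (abs_add_le _ _).trans ?_
          rw [abs_mul, abs_mul]
          gcongr
          exact abs_add_le _ _
      _ ≤ (C * |g s z|) * (W z.2 + Kψ * c) + Kψ * (W z.2 * |g s z| * B + C * |S s z|) := by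
          gcongr
          · exact hΓ.abs_le _ _
          · exact hχb n z
      _ = D s z := by rw [hD, abs_of_nonneg hB0]; ring
  have hDi : ∀ s, Integrable (g s) → Integrable (S s) →
      Integrable (fun z : E d × E d => W z.2 * |g s z|) → Integrable (D s) := fun s h1 h2 h3 =>
    ((h1.abs.const_mul _).add (h3.const_mul _)).add (h2.abs.const_mul _)
  set Q0 : ℝ → E d × E d → ℝ := fun s z => Γ z.2 (g s z) * fderiv ℝ ψ z.1 (a • z.2)
    + ψ z.1 * (G z.2 (g s z) (F s z.1) + A z.2 (g s z) * S s z) with hQ0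
  -- As soon as n exceeds |z| the cutoff equals one near z, so the sequence is eventually constant.
  have hQlim : ∀ s z, Tendsto (fun n => Q n s z) atTop (𝓝 (Q0 s z)) := by
    intro s z
    obtain ⟨N, hN⟩ := exists_nat_gt ‖z‖
    refine tendsto_const_nhds.congr' ?_
    filter_upwards [eventually_ge_atTop N] with n hn
    have : (N : ℝ) ≤ n := by exact_mod_cast hn
    rw [hQ, hQ0]
    simp only [hder, fderiv_cutoff_eq_zero n (show ‖z‖ < (n : ℝ) + 1 by linarith)]
    simp only [hχdef, cutoff_eq_one n (show ‖z‖ ≤ (n : ℝ) + 1 by linarith)]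
    simp
  have hlim : ∀ {f : E d × E d → ℝ}, Measurable f → Integrable f →
      Tendsto (fun n => ∫ z, χ n z * Γ z.2 (f z)) atTop (𝓝 (∫ z : E d × E d, ψ z.1 * Γ z.2 (f z))) := by
    intro f hfm hf
    refine tendsto_integral_of_dominated_convergence (fun z => Kψ * (C * |f z|)) (fun n => ?_)
      ((hf.abs.const_mul _).const_mul _) (fun n => ae_of_all _ fun z => ?_)
      (ae_of_all _ fun z => (hχlim z).mul_const _)
    · exact ((hχ n).continuous.measurable.mul
        (hΓc.measurable.comp (measurable_snd.prodMk hfm))).aestronglyMeasurable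
    · rw [norm_mul]
      exact mul_le_mul (hχb n z) (hΓ.abs_le _ _) (norm_nonneg _) hKψ0
  filter_upwards [hall, h.g_bound, ae_restrict_mem measurableSet_Ioo] with t ht hgt htT
  have L1 := hlim (hgm t) hgt.1
  have L2 := hlim h.g₀_meas h.g₀_int
  have hs : ∀ᵐ s ∂(volume.restrict (Ioc 0 t)), (Integrable (g s) ∧ ∫ z, |g s z| ≤ K) ∧
      (Integrable (S s) ∧ ∫ z, |S s z| ≤ K) ∧ (∀ x, ‖F s x‖ ≤ B) ∧
      (Integrable (fun z : E d × E d => W z.2 * |g s z|) ∧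
        ∫ z : E d × E d, W z.2 * |g s z| ≤ K') := by
    have : Ioc 0 t ⊆ Ioo 0 T := fun s hs => ⟨hs.1, hs.2.trans_lt htT.2⟩
    filter_upwards [ae_restrict_of_ae_restrict_of_subset this h.g_bound,
      ae_restrict_of_ae_restrict_of_subset this h.S_bound,
      ae_restrict_of_ae_restrict_of_subset this h.F_bound,
      ae_restrict_of_ae_restrict_of_subset this hWg] with s h1 h2 h3 h4 using ⟨h1, h2, h3.1, h4⟩
  have L3 : Tendsto (fun n => ∫ s in Ioc 0 t, ∫ z, Q n s z) atTop
      (𝓝 (∫ s in Ioc 0 t, ∫ z, Q0 s z)) := by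
    refine tendsto_integral_of_dominated_convergence
      (fun _ => C * (Kψ * c) * K + (C + Kψ * |B|) * K' + Kψ * C * K) (fun n => ?_)
      (integrable_const _) (fun n => ?_) ?_
    · exact (StronglyMeasurable.integral_prod_right (f := fun (s : ℝ) (z : E d × E d) => Q n s z)
        (hQm n).stronglyMeasurable).aestronglyMeasurable
    · filter_upwards [hs] with s ⟨h1, h2, h3, h4⟩
      refine (norm_integral_le_of_norm_le (hDi s h1.1 h2.1 h4.1)
        (ae_of_all _ fun z => hQD n s z h3)).trans ?_
      rw [hD, integral_add ((h1.1.abs.const_mul _).fun_add (h4.1.const_mul _)) (h2.1.abs.const_mul _),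
        integral_add (h1.1.abs.const_mul _) (h4.1.const_mul _), integral_const_mul,
        integral_const_mul, integral_const_mul]
      gcongr
      exacts [h1.2, h4.2, h2.2]
    · filter_upwards [hs] with s ⟨h1, h2, h3, h4⟩
      exact tendsto_integral_of_dominated_convergence (D s)
        (fun n => ((hQm n).comp measurable_prodMk_left).aestronglyMeasurable)
        (hDi s h1.1 h2.1 h4.1) (fun n => ae_of_all _ fun z => hQD n s z h3)
        (ae_of_all _ fun z => hQlim s z)
  exact tendsto_nhds_unique (L1.congr ht) (L2.add L3)

end IsTransport

end

section

variable {d : ℕ}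

/-! ### The force field -/

theorem integral_rescale_mul {α : ℝ} (hα : 0 < α) (w h : E d → ℝ) :
    ∫ y, rescale α w y * h y = ∫ y, w y * h (α • y) := by
  have h1 := Measure.integral_comp_smul_of_nonneg (volume : Measure (E d))
    (fun y => w y * h (α • y)) α⁻¹ (hR := (inv_pos.mpr hα).le)
  rw [finrank_euclideanSpace_fin, smul_eq_mul] at h1
  have h2 : ∀ y, rescale α w y * h y = 1 / α ^ d * (w (α⁻¹ • y) * h (α • α⁻¹ • y)) := by
    intro y; rw [rescale, smul_inv_smul₀ hα.ne']; ring
  simp_rw [h2]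
  have h3 : α ^ d ≠ 0 := by positivity
  rw [integral_const_mul, h1, inv_pow, inv_inv, one_div, inv_mul_cancel_left₀ h3]

theorem integrable_rescale_mul {α : ℝ} (hα : 0 < α) {w h : E d → ℝ}
    (hi : Integrable fun y => w y * h (α • y)) : Integrable fun y => rescale α w y * h y := by
  have h2 : (fun y => rescale α w y * h y)
      = fun y => 1 / α ^ d * (w (α⁻¹ • y) * h (α • α⁻¹ • y)) := by
    ext y; rw [rescale, smul_inv_smul₀ hα.ne']; ring
  rw [h2]
  exact ((integrable_comp_smul_iff volume (fun y => w y * h (α • y)) (inv_pos.mpr hα).ne').mpr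
    hi).const_mul _

/-- Differentiation of a convolution of a `C¹` bounded function with an integrable one. -/
theorem hasFDerivAt_integral_sub {w g : E d → ℝ} {w' : E d → E d →L[ℝ] ℝ} {K : ℝ}
    (hw : ∀ x, HasFDerivAt w (w' x) x) (hw' : Continuous w') (hK : ∀ x, |w x| ≤ K)
    (hK' : ∀ x, ‖w' x‖ ≤ K) (hg : Integrable g) (x : E d) :
    HasFDerivAt (fun x => ∫ u, w (x - u) * g u) (∫ u, g u • w' (x - u)) x := by
  have hwc : Continuous w := continuous_iff_continuousAt.mpr fun x => (hw x).continuousAt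
  refine hasFDerivAt_integral_of_dominated_of_fderiv_le (bound := fun u => K * |g u|)
    (F' := fun x u => g u • w' (x - u)) (s := univ) univ_mem ?_ ?_ ?_ ?_ ?_ ?_
  · exact Eventually.of_forall fun x =>
      ((hwc.comp (continuous_const.sub continuous_id)).aestronglyMeasurable.mul hg.1)
  · exact hg.bdd_mul (c := K) (hwc.comp (continuous_const.sub continuous_id)).aestronglyMeasurable
      (ae_of_all _ fun u => hK _)
  · exact hg.1.smul (hw'.comp (continuous_const.sub continuous_id)).aestronglyMeasurable
  · refine ae_of_all _ fun u y _ => ?_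
    rw [norm_smul, mul_comm, Real.norm_eq_abs]
    gcongr
    exact hK' _
  · exact hg.abs.const_mul K
  · refine ae_of_all _ fun u y _ => ?_
    have h1 := HasFDerivAt.comp (g := w) (f := fun y => y - u) y (hw (y - u))
      ((hasFDerivAt_id y).sub_const u)
    have h2 := h1.mul_const (g u)
    exact h2

theorem continuous_integral_smul_sub {g : E d → ℝ} {w' : E d → E d →L[ℝ] ℝ} {K : ℝ}
    (hw' : Continuous w') (hK' : ∀ x, ‖w' x‖ ≤ K) (hg : Integrable g) :
    Continuous fun x => ∫ u, g u • w' (x - u) := by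
  refine continuous_of_dominated (bound := fun u => K * |g u|) (fun x => ?_) (fun x => ?_)
    (hg.abs.const_mul K) (ae_of_all _ fun u => ?_)
  · exact hg.1.smul (hw'.comp (continuous_const.sub continuous_id)).aestronglyMeasurable
  · refine ae_of_all _ fun u => ?_
    rw [norm_smul, mul_comm, Real.norm_eq_abs]
    gcongr
    exact hK' _
  · exact (hw'.comp (continuous_id.sub continuous_const)).const_smul (g u)

theorem norm_integral_smul_sub_le {g : E d → ℝ} {w' : E d → E d →L[ℝ] ℝ} {K : ℝ}
    (hK' : ∀ x, ‖w' x‖ ≤ K) (hg : Integrable g) (x : E d) :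
    ‖∫ u, g u • w' (x - u)‖ ≤ K * ∫ u, |g u| := by
  rw [← integral_const_mul]
  refine norm_integral_le_of_norm_le (f := fun u => g u • w' (x - u)) (hg.abs.const_mul K)
    (ae_of_all _ fun u => ?_)
  rw [norm_smul, mul_comm, Real.norm_eq_abs]
  gcongr
  exact hK' _

theorem lipschitzWith_fderiv_of_norm_iteratedFDeriv_le {G : Type*} [NormedAddCommGroup G]
    [NormedSpace ℝ G] {f : E d → G} (hf : ContDiff ℝ 2 f) {K : ℝ≥0}
    (h : ∀ x, ‖iteratedFDeriv ℝ 2 f x‖ ≤ K) : LipschitzWith K (fderiv ℝ f) := by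
  have hf1 : ContDiff ℝ 1 (fderiv ℝ f) := hf.fderiv_right (by norm_num)
  refine lipschitzWith_of_nnnorm_fderiv_le (𝕜 := ℝ) (hf1.differentiable (by norm_num)) fun x => ?_
  have := h x
  rwa [← norm_iteratedFDeriv_fderiv, ← norm_iteratedFDeriv_fderiv,
    norm_iteratedFDeriv_zero] at this

namespace IsShortRangeKernel

variable {w : E d → ℝ}

/-- Only the last bound has content. The first difference z ↦ ∇w(z+y) − ∇w(z) is Lipschitz with
constant K|y|, because the third derivative of w is bounded by K. The second difference is its
increment between z − y and z, which yields a second factor |y|. -/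
theorem exists_bound (hw : IsShortRangeKernel w) : ∃ K : ℝ≥0, (∀ x, |w x| ≤ K) ∧
    (∀ x, ‖fderiv ℝ w x‖ ≤ K) ∧ LipschitzWith K (fderiv ℝ w) ∧
    ∀ z y, ‖fderiv ℝ w (z + y) + fderiv ℝ w (z - y) - (2 : ℝ) • fderiv ℝ w z‖ ≤ K * ‖y‖ ^ 2 := by
  obtain ⟨K, hK⟩ := hw.bounded
  have hK0 : 0 ≤ K := (norm_nonneg _).trans (hK 0 (by norm_num) 0)
  lift K to ℝ≥0 using hK0
  have hw1 : ContDiff ℝ 2 (fderiv ℝ w) := hw.contDiff.fderiv_right (by norm_num)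
  have hw2 : ContDiff ℝ 1 (fderiv ℝ (fderiv ℝ w)) := hw1.fderiv_right (by norm_num)
  have b0 : ∀ x, |w x| ≤ K := fun x => by simpa using hK 0 (by norm_num) x
  have b1 : ∀ x, ‖fderiv ℝ w x‖ ≤ K := fun x => by
    have := hK 1 (by norm_num) x
    rwa [← norm_iteratedFDeriv_fderiv, norm_iteratedFDeriv_zero] at this
  have b2 : ∀ x, ‖fderiv ℝ (fderiv ℝ w) x‖ ≤ K := fun x => by
    have := hK 2 (by norm_num) x
    rwa [← norm_iteratedFDeriv_fderiv, ← norm_iteratedFDeriv_fderiv,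
      norm_iteratedFDeriv_zero] at this
  have l1 : LipschitzWith K (fderiv ℝ w) :=
    lipschitzWith_of_nnnorm_fderiv_le (𝕜 := ℝ) (hw1.differentiable (by norm_num)) b2
  have l2 : LipschitzWith K (fderiv ℝ (fderiv ℝ w)) :=
    lipschitzWith_fderiv_of_norm_iteratedFDeriv_le hw1 fun x => by
      rw [norm_iteratedFDeriv_fderiv]; exact hK 3 (by norm_num) x
  refine ⟨K, b0, b1, l1, fun z y => ?_⟩
  set q : E d → E d →L[ℝ] ℝ := fun z => fderiv ℝ w (z + y) - fderiv ℝ w z with hq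
  have hd1 : Differentiable ℝ (fderiv ℝ w) := hw1.differentiable (by norm_num)
  have hqd : ∀ z, HasFDerivAt q
      (fderiv ℝ (fderiv ℝ w) (z + y) - fderiv ℝ (fderiv ℝ w) z) z := by
    intro z
    exact ((hd1 (z + y)).hasFDerivAt.comp z ((hasFDerivAt_id z).add_const y)).sub
      (hd1 z).hasFDerivAt
  have hql : LipschitzWith (K * ‖y‖₊) q := by
    refine lipschitzWith_of_nnnorm_fderiv_le (𝕜 := ℝ) (fun z => (hqd z).differentiableAt)
      fun z => ?_
    rw [(hqd z).fderiv, ← NNReal.coe_le_coe]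
    have := l2.norm_sub_le (z + y) z
    simpa using this
  have := hql.norm_sub_le z (z - y)
  simp only [hq, NNReal.coe_mul, coe_nnnorm] at this
  rw [sub_add_cancel, sub_sub_cancel] at this
  calc _ = ‖fderiv ℝ w (z + y) - fderiv ℝ w z - (fderiv ℝ w z - fderiv ℝ w (z - y))‖ := by
        congr 1; rw [two_smul]; abel
    _ ≤ _ := this
    _ = _ := by ring

end IsShortRangeKernel

theorem IsLongRangeKernel.integrable {w : E d → ℝ} {δ : ℝ} (hw : IsLongRangeKernel w δ) :
    Integrable w :=
  hw.contDiff.continuous.integrable_of_hasCompactSupport hw.compactSupport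

/-- The kernel of the force field, as a linear form. -/
def forceKernel (α : ℝ) (ωL ωS : E d → ℝ) (z : E d) : E d →L[ℝ] ℝ :=
  (1 / α ^ 2) • ((∫ y, rescale α ωL y • fderiv ℝ ωS (z - y)) - fderiv ℝ ωS z)

theorem integrable_rescale {α : ℝ} (hα : 0 < α) {w : E d → ℝ} (hw : Integrable w) :
    Integrable (rescale α w) := by
  have := integrable_rescale_mul (h := fun _ => (1 : ℝ)) hα (w := w) (by simpa using hw)
  simpa using this

theorem integral_rescale {α : ℝ} (hα : 0 < α) (w : E d → ℝ) :
    ∫ y, rescale α w y = ∫ y, w y := by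
  have := integral_rescale_mul hα w (fun _ => (1 : ℝ))
  simpa using this

theorem rescale_nonneg {α : ℝ} (hα : 0 < α) {w : E d → ℝ} (hw : ∀ y, 0 ≤ w y) (y : E d) :
    0 ≤ rescale α w y := mul_nonneg (by positivity) (hw _)

/-- Evenness of ω^L cancels the first-order term of ω^L_α ⋆ ∇ω^S − ∇ω^S. The second-order remainder
is O(α²) and compensates α⁻². Only the sup bound has to be uniform in α; the Lipschitz constant may
depend on α, since it is used solely to justify renormalization. -/
theorem exists_forceKernel_bound {ωL ωS : E d → ℝ} {δ : ℝ} (hωL : IsLongRangeKernel ωL δ)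
    (hωS : IsShortRangeKernel ωS) :
    ∃ K : ℝ, 0 ≤ K ∧ ∀ α ∈ Ioc (0 : ℝ) 1, (∀ z, ‖forceKernel α ωL ωS z‖ ≤ K) ∧
      ∃ L : ℝ≥0, LipschitzWith L (forceKernel α ωL ωS) := by
  obtain ⟨K, b0, b1, l1, b2⟩ := hωS.exists_bound
  have hc : Continuous (fderiv ℝ ωS) := hωS.contDiff.continuous_fderiv (by norm_num)
  have hLi := hωL.integrable
  have hLi2 : Integrable fun y => ωL y * ‖y‖ ^ 2 := by
    refine Continuous.integrable_of_hasCompactSupport ?_ hωL.compactSupport.mul_right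
    exact hωL.contDiff.continuous.mul (by fun_prop)
  have hI0 : 0 ≤ ∫ y, ωL y * ‖y‖ ^ 2 := integral_nonneg fun y => mul_nonneg (hωL.nonneg y) (by positivity)
  refine ⟨K * ∫ y, ωL y * ‖y‖ ^ 2, by positivity, fun α hα => ?_⟩
  have hα0 := hα.1
  have hr := integrable_rescale hα0 hLi
  have hr0 := rescale_nonneg hα0 hωL.nonneg
  have hr1 : ∫ y, rescale α ωL y = 1 := by rw [integral_rescale hα0, hωL.integral_eq_one]
  have hint : ∀ z, Integrable fun y => rescale α ωL y • fderiv ℝ ωS (z - y) := fun z =>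
    hr.smul_bdd (K : ℝ) (hc.comp (continuous_const.sub continuous_id)).aestronglyMeasurable
      (ae_of_all _ fun y => b1 _)
  have hsymm : ∀ y, rescale α ωL (-y) = rescale α ωL y := fun y => by
    rw [rescale, rescale, smul_neg, hωL.symmetric]
  have hint' : ∀ z, Integrable fun y => rescale α ωL y • fderiv ℝ ωS (z + y) := fun z =>
    hr.smul_bdd (K : ℝ) (hc.comp (continuous_const.add continuous_id)).aestronglyMeasurable
      (ae_of_all _ fun y => b1 _)
  constructor
  · intro z
    have e1 : ∫ y, rescale α ωL y • fderiv ℝ ωS (z + y)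
        = ∫ y, rescale α ωL y • fderiv ℝ ωS (z - y) := by
      rw [← integral_neg_eq_self]
      simp_rw [hsymm, sub_eq_add_neg]
    -- Adding the integral over y to the one over −y turns the difference into a mean of centred
    -- second differences.
    have e2 : (2 : ℝ) • ((∫ y, rescale α ωL y • fderiv ℝ ωS (z - y)) - fderiv ℝ ωS z)
        = ∫ y, rescale α ωL y • (fderiv ℝ ωS (z + y) + fderiv ℝ ωS (z - y)
            - (2 : ℝ) • fderiv ℝ ωS z) := by
      simp_rw [smul_sub, smul_add]
      rw [integral_sub ((hint' z).add (hint z)) ((hr.smul_const _)), integral_add (hint' z) (hint z), e1, integral_smul_const,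
        hr1, one_smul, two_smul ℝ (∫ y, rescale α ωL y • fderiv ℝ ωS (z - y))]
    have hi2 : Integrable fun y => rescale α ωL y * (K * ‖y‖ ^ 2) := by
      refine integrable_rescale_mul hα0 ?_
      refine (hLi2.const_mul (K * α ^ 2)).congr (ae_of_all _ fun y => ?_)
      simp only [norm_smul, Real.norm_eq_abs, mul_pow, sq_abs]; ring
    have e3 : ‖(2 : ℝ) • ((∫ y, rescale α ωL y • fderiv ℝ ωS (z - y)) - fderiv ℝ ωS z)‖
        ≤ α ^ 2 * (K * ∫ y, ωL y * ‖y‖ ^ 2) := by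
      rw [e2]
      refine (norm_integral_le_of_norm_le hi2 (ae_of_all _ fun y => ?_)).trans (le_of_eq ?_)
      · rw [norm_smul, Real.norm_of_nonneg (hr0 y)]
        gcongr
        · exact hr0 y
        · exact b2 z y
      · rw [integral_rescale_mul hα0, ← mul_assoc, ← integral_const_mul]
        refine integral_congr_ae (ae_of_all _ fun y => ?_)
        simp only [norm_smul, Real.norm_eq_abs, mul_pow, sq_abs]; ring
    rw [norm_smul, Real.norm_ofNat] at e3
    rw [forceKernel, norm_smul, Real.norm_of_nonneg (by positivity), one_div, inv_mul_le_iff₀ (by positivity)]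
    have := norm_nonneg ((∫ y, rescale α ωL y • fderiv ℝ ωS (z - y)) - fderiv ℝ ωS z)
    linarith
  · refine ⟨Real.toNNReal (1 / α ^ 2 * (K + K)), LipschitzWith.of_dist_le_mul fun x y => ?_⟩
    rw [dist_eq_norm, dist_eq_norm, Real.coe_toNNReal _ (by positivity)]
    have e : forceKernel α ωL ωS x - forceKernel α ωL ωS y = (1 / α ^ 2) •
        ((∫ u, rescale α ωL u • (fderiv ℝ ωS (x - u) - fderiv ℝ ωS (y - u)))
          - (fderiv ℝ ωS x - fderiv ℝ ωS y)) := by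
      simp_rw [smul_sub (rescale α ωL _)]
      rw [integral_sub (hint x) (hint y), forceKernel, forceKernel]
      module
    rw [e, norm_smul, Real.norm_of_nonneg (by positivity), mul_assoc]
    gcongr
    refine (norm_sub_le _ _).trans ?_
    rw [add_mul]
    refine add_le_add ?_ (l1.norm_sub_le x y)
    have : ‖∫ u, rescale α ωL u • (fderiv ℝ ωS (x - u) - fderiv ℝ ωS (y - u))‖
        ≤ ∫ u, rescale α ωL u * (K * ‖x - y‖) := by
      refine norm_integral_le_of_norm_le (hr.mul_const _) (ae_of_all _ fun u => ?_)
      rw [norm_smul, Real.norm_of_nonneg (hr0 u)]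
      have := l1.norm_sub_le (x - u) (y - u)
      rw [sub_sub_sub_cancel_right] at this
      gcongr
      exact hr0 u
    rwa [integral_mul_const, hr1, one_mul] at this

theorem convolution_short_eq {ωS g : E d → ℝ} (x : E d) :
    (ωS ⋆[ContinuousLinearMap.lsmul ℝ ℝ, volume] g) x = ∫ u, ωS (x - u) * g u := by
  rw [convolution_lsmul_swap]; rfl

/-- The force is the convolution of its kernel with `ωS ⋆ ρ`. -/
theorem force_eq {ωL ωS : E d → ℝ} {δ : ℝ} (hωL : IsLongRangeKernel ωL δ)
    (hωS : IsShortRangeKernel ωS) {α : ℝ} (hα : 0 < α) {ρ : E d → ℝ} (hρ : Integrable ρ) (x : E d) :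
    force α ωL ωS ρ x = (InnerProductSpace.toDual ℝ (E d)).symm
      (∫ u, (∫ u', ωS (u - u') * ρ u') • forceKernel α ωL ωS (x - u)) := by
  obtain ⟨K, b0, b1, l1, b2⟩ := hωS.exists_bound
  have hc : Continuous (fderiv ℝ ωS) := hωS.contDiff.continuous_fderiv (by norm_num)
  have hdS : ∀ x, HasFDerivAt ωS (fderiv ℝ ωS x) x := fun x =>
    (hωS.contDiff.differentiable (by norm_num) x).hasFDerivAt
  have hLi := hωL.integrable
  set g : E d → ℝ := fun u => ∫ u', ωS (u - u') * ρ u' with hg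
  have hgeq : (ωS ⋆[ContinuousLinearMap.lsmul ℝ ℝ, volume] ρ) = g := by
    ext u; exact convolution_short_eq u
  have hgi : Integrable g := by
    rw [← hgeq]; exact hωS.integrable.integrable_convolution _ hρ
  set P : E d → ℝ := fun x => ∫ u, ωS (x - u) * g u with hP
  have hPeq : (ωS ⋆[ContinuousLinearMap.lsmul ℝ ℝ, volume] g) = P := by
    ext u; exact convolution_short_eq u
  set P' : E d → E d →L[ℝ] ℝ := fun x => ∫ u, g u • fderiv ℝ ωS (x - u) with hP'
  have hPd : ∀ x, HasFDerivAt P (P' x) x := fun x =>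
    hasFDerivAt_integral_sub hdS hc b0 b1 hgi x
  have hP'c : Continuous P' := continuous_integral_smul_sub hc b1 hgi
  have hP'b : ∀ x, ‖P' x‖ ≤ K * ∫ u, |g u| := norm_integral_smul_sub_le b1 hgi
  have hPb : ∀ x, |P x| ≤ K * ∫ u, |g u| := by
    intro x
    rw [← integral_const_mul]
    refine norm_integral_le_of_norm_le (f := fun u => ωS (x - u) * g u) (hgi.abs.const_mul _)
      (ae_of_all _ fun u => ?_)
    rw [norm_mul]
    gcongr
    · exact b0 _
    · exact le_rfl
  set r := rescale α ωL with hr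
  have hri : Integrable r := integrable_rescale hα hLi
  have hQ : ∀ x, HasFDerivAt (fun x => ∫ u, P (x - u) * r u) (∫ u, r u • P' (x - u)) x := fun x =>
    hasFDerivAt_integral_sub hPd hP'c hPb hP'b hri x
  have hQeq : ∀ x, (r ⋆[ContinuousLinearMap.lsmul ℝ ℝ, volume] P) x = ∫ u, P (x - u) * r u := by
    intro x
    rw [convolution_lsmul]
    simp_rw [smul_eq_mul, mul_comm]
  have hL : HasGradientAt (potentialL α ωL ωS ρ)
      ((InnerProductSpace.toDual ℝ (E d)).symm (-((1 / α ^ 2) • ∫ u, r u • P' (x - u)))) x := by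
    rw [hasGradientAt_iff_hasFDerivAt, LinearIsometryEquiv.apply_symm_apply]
    have e : potentialL α ωL ωS ρ = fun x => -(1 / α ^ 2 * ∫ u, P (x - u) * r u) := by
      ext x; rw [potentialL, hgeq, hPeq, hQeq]
    rw [e]
    exact ((hQ x).const_mul _).fun_neg
  have hS : HasGradientAt (potentialS α ωS ρ)
      ((InnerProductSpace.toDual ℝ (E d)).symm ((1 / α ^ 2) • P' x)) x := by
    rw [hasGradientAt_iff_hasFDerivAt, LinearIsometryEquiv.apply_symm_apply]
    have e : potentialS α ωS ρ = fun x => 1 / α ^ 2 * P x := by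
      ext x; rw [potentialS, hgeq, hPeq]
    rw [e]
    exact (hPd x).const_mul _
  rw [force, hL.gradient, hS.gradient, ← map_neg, ← map_sub, neg_neg]
  congr 1
  have hswap : ∫ y, r y • P' (x - y) = ∫ u, g u • ∫ y, r y • fderiv ℝ ωS (x - u - y) := by
    have e1 : ∀ y, r y • P' (x - y) = ∫ u, (r y * g u) • fderiv ℝ ωS (x - y - u) := by
      intro y
      rw [hP', ← integral_smul]
      simp_rw [smul_smul]
    have e2 : ∀ u, g u • ∫ y, r y • fderiv ℝ ωS (x - u - y)
        = ∫ y, (r y * g u) • fderiv ℝ ωS (x - y - u) := by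
      intro u
      rw [← integral_smul]
      refine integral_congr_ae (ae_of_all _ fun y => ?_)
      simp only [smul_smul]
      rw [mul_comm, sub_right_comm]
    simp_rw [e1, e2]
    refine integral_integral_swap ?_
    have hrg : Integrable (fun p : E d × E d => r p.1 * g p.2) (volume.prod volume) :=
      hri.mul_prod hgi
    exact hrg.smul_bdd (K : ℝ)
      (hc.comp ((continuous_const.sub continuous_fst).sub continuous_snd)).aestronglyMeasurable
      (ae_of_all _ fun p => b1 _)
  rw [hswap, hP', ← smul_sub, ← integral_sub]
  · rw [← integral_smul]
    refine integral_congr_ae (ae_of_all _ fun u => ?_)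
    simp only [forceKernel]
    rw [← smul_sub, smul_comm]
  · have hcc := continuous_integral_smul_sub hc b1 hri
    refine hgi.smul_bdd (K * ∫ u, |r u|) ?_ (ae_of_all _ fun u => norm_integral_smul_sub_le b1 hri _)
    exact (hcc.comp (continuous_const.sub continuous_id)).aestronglyMeasurable
  · exact hgi.smul_bdd (K : ℝ) (hc.comp (continuous_const.sub continuous_id)).aestronglyMeasurable
      (ae_of_all _ fun u => b1 _)

theorem integral_abs_short_conv_le {ωS : E d → ℝ} (hωS : IsShortRangeKernel ωS) {ρ : E d → ℝ}
    (hρ : Integrable ρ) :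
    Integrable (fun u => ∫ u', ωS (u - u') * ρ u') ∧
      ∫ u, |∫ u', ωS (u - u') * ρ u'| ≤ ∫ u, |ρ u| := by
  have hgeq : ∀ ρ : E d → ℝ, (fun u => ∫ u', ωS (u - u') * ρ u')
      = (ωS ⋆[ContinuousLinearMap.lsmul ℝ ℝ, volume] ρ) := by
    intro ρ; ext u; exact (convolution_short_eq u).symm
  have hgi : ∀ {ρ : E d → ℝ}, Integrable ρ → Integrable (fun u => ∫ u', ωS (u - u') * ρ u') := by
    intro ρ hρ
    rw [hgeq]; exact hωS.integrable.integrable_convolution _ hρ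
  refine ⟨hgi hρ, ?_⟩
  have h1 : ∫ u, |∫ u', ωS (u - u') * ρ u'| ≤ ∫ u, ∫ u', ωS (u - u') * |ρ u'| := by
    refine integral_mono (hgi hρ).abs (hgi hρ.abs) fun u => ?_
    refine abs_integral_le_integral_abs.trans (le_of_eq ?_)
    refine integral_congr_ae (ae_of_all _ fun u' => ?_)
    simp only [abs_mul, abs_of_nonneg (hωS.nonneg _)]
  refine h1.trans (le_of_eq ?_)
  rw [hgeq, integral_convolution _ hωS.integrable hρ.abs]
  simp [hωS.integral_eq_one]

/-- Uniform bound and Lipschitz bound of the force field. -/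
theorem exists_force_bound {ωL ωS : E d → ℝ} {δ : ℝ} (hωL : IsLongRangeKernel ωL δ)
    (hωS : IsShortRangeKernel ωS) (m : ℝ) (hm : 0 ≤ m) :
    ∃ B : ℝ, 0 ≤ B ∧ ∀ α ∈ Ioc (0 : ℝ) 1, ∃ L : ℝ≥0, ∀ ρ : E d → ℝ, Integrable ρ →
      ∫ x, |ρ x| ≤ m → (∀ x, ‖force α ωL ωS ρ x‖ ≤ B) ∧ LipschitzWith L (force α ωL ωS ρ) := by
  obtain ⟨K, hK0, hK⟩ := exists_forceKernel_bound hωL hωS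
  refine ⟨K * m, by positivity, fun α hα => ?_⟩
  obtain ⟨hb, L, hL⟩ := hK α hα
  refine ⟨L * Real.toNNReal m, fun ρ hρ hρm => ?_⟩
  obtain ⟨hgi, hgm⟩ := integral_abs_short_conv_le hωS hρ
  have hgm' := hgm.trans hρm
  have hi : ∀ x, Integrable fun u => (∫ u', ωS (u - u') * ρ u') • forceKernel α ωL ωS (x - u) :=
    fun x => hgi.smul_bdd (K : ℝ)
      (hL.continuous.comp (continuous_const.sub continuous_id)).aestronglyMeasurable
      (ae_of_all _ fun u => hb _)
  constructor
  · intro x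
    rw [force_eq hωL hωS hα.1 hρ, LinearIsometryEquiv.norm_map]
    exact (norm_integral_smul_sub_le hb hgi x).trans (by gcongr)
  · refine LipschitzWith.of_dist_le_mul fun x y => ?_
    rw [dist_eq_norm, dist_eq_norm, force_eq hωL hωS hα.1 hρ, force_eq hωL hωS hα.1 hρ, ← map_sub,
      LinearIsometryEquiv.norm_map, ← integral_sub (hi x) (hi y), NNReal.coe_mul,
      Real.coe_toNNReal _ hm]
    refine (norm_integral_le_of_norm_le (hgi.abs.mul_const (L * ‖x - y‖))
      (ae_of_all _ fun u => ?_)).trans ?_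
    · have e : (∫ u', ωS (u - u') * ρ u') • forceKernel α ωL ωS (x - u)
          - (∫ u', ωS (u - u') * ρ u') • forceKernel α ωL ωS (y - u)
          = (∫ u', ωS (u - u') * ρ u') •
            (forceKernel α ωL ωS (x - u) - forceKernel α ωL ωS (y - u)) := by module
      rw [e, norm_smul, Real.norm_eq_abs]
      have := hL.norm_sub_le (x - u) (y - u)
      rw [sub_sub_sub_cancel_right] at this
      gcongr
    · rw [integral_mul_const, mul_comm, mul_right_comm]
      gcongr

/-- Joint measurability of the force generated by a measurable family of integrable densities. -/
theorem exists_measurable_force {ωL ωS : E d → ℝ} {δ : ℝ} (hωL : IsLongRangeKernel ωL δ)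
    (hωS : IsShortRangeKernel ωS) {α : ℝ} (hα : α ∈ Ioc (0 : ℝ) 1) {ρ : ℝ → E d → ℝ}
    (hρ : Measurable fun p : ℝ × E d => ρ p.1 p.2) :
    ∃ F : ℝ → E d → E d, Measurable (fun p : ℝ × E d => F p.1 p.2) ∧
      ∀ t, Integrable (ρ t) → F t = force α ωL ωS (ρ t) := by
  obtain ⟨K, hK0, hK⟩ := exists_forceKernel_bound hωL hωS
  obtain ⟨hb, L, hL⟩ := hK α hα
  -- The convolution formula is taken as definition at every time, which gives joint measurability
  -- directly. It is known to coincide with the force only where the density is integrable, that is,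
  -- at almost every time.
  refine ⟨fun t x => (InnerProductSpace.toDual ℝ (E d)).symm
      (∫ u, (∫ u', ωS (u - u') * ρ t u') • forceKernel α ωL ωS (x - u)), ?_, fun t ht => ?_⟩
  · have hS : Measurable ωS := hωS.contDiff.continuous.measurable
    have m1 : StronglyMeasurable fun p : ℝ × E d => ∫ u', ωS (p.2 - u') * ρ p.1 u' := by
      refine StronglyMeasurable.integral_prod_right (f := fun (p : ℝ × E d) u' =>
        ωS (p.2 - u') * ρ p.1 u') (Measurable.stronglyMeasurable ?_)
      exact (hS.comp ((measurable_snd.comp measurable_fst).sub measurable_snd)).mul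
        (hρ.comp ((measurable_fst.comp measurable_fst).prodMk measurable_snd))
    have m2 : StronglyMeasurable fun p : ℝ × E d =>
        ∫ u, (∫ u', ωS (u - u') * ρ p.1 u') • forceKernel α ωL ωS (p.2 - u) := by
      refine StronglyMeasurable.integral_prod_right (f := fun (p : ℝ × E d) u =>
        (∫ u', ωS (u - u') * ρ p.1 u') • forceKernel α ωL ωS (p.2 - u)) ?_
      have h1 : StronglyMeasurable fun q : (ℝ × E d) × E d =>
          ∫ u', ωS (q.2 - u') * ρ q.1.1 u' :=
        m1.comp_measurable ((measurable_fst.comp measurable_fst).prodMk measurable_snd)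
      have h2 : StronglyMeasurable fun q : (ℝ × E d) × E d => forceKernel α ωL ωS (q.1.2 - q.2) :=
        hL.continuous.stronglyMeasurable.comp_measurable
          ((measurable_snd.comp measurable_fst).sub measurable_snd)
      exact h1.smul h2
    exact ((InnerProductSpace.toDual ℝ (E d)).symm.continuous.comp_stronglyMeasurable m2).measurable
  · ext1 x
    exact (force_eq hωL hωS hα.1 ht x).symm

end

section

variable {d : ℕ}

/-! ### A truncated entropy function -/

/-- Truncation of a real number to the interval `[1/k, k]`. -/
def clamp (k s : ℝ) : ℝ := max k⁻¹ (min s k)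

/-- A `C¹` approximation, with bounded derivative `log (clamp k s)`, of `s log s - s`. -/
def entropyTrunc (k s : ℝ) : ℝ := s * Real.log (clamp k s) - clamp k s + k⁻¹

section clamp

variable {k : ℝ}

theorem inv_le_clamp (k s : ℝ) : k⁻¹ ≤ clamp k s := le_max_left _ _

theorem clamp_pos (hk : 1 ≤ k) (s : ℝ) : 0 < clamp k s :=
  (inv_pos.mpr (by linarith)).trans_le (inv_le_clamp k s)

theorem inv_le_self_of_one_le (hk : 1 ≤ k) : k⁻¹ ≤ k := (inv_le_one_of_one_le₀ hk).trans hk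

theorem clamp_le (hk : 1 ≤ k) (s : ℝ) : clamp k s ≤ k :=
  max_le (inv_le_self_of_one_le hk) (min_le_right _ _)

theorem clamp_of_le {s : ℝ} (hs : s ≤ k⁻¹) : clamp k s = k⁻¹ :=
  max_eq_left ((min_le_left _ _).trans hs)

theorem clamp_of_mem {s : ℝ} (h1 : k⁻¹ ≤ s) (h2 : s ≤ k) : clamp k s = s := by
  rw [clamp, min_eq_left h2, max_eq_right h1]

theorem clamp_of_ge (hk : 1 ≤ k) {s : ℝ} (h : k ≤ s) : clamp k s = k := by
  rw [clamp, min_eq_right h, max_eq_right (inv_le_self_of_one_le hk)]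

theorem clamp_mono : Monotone (clamp k) := fun _ _ h => max_le_max le_rfl (min_le_min h le_rfl)

theorem abs_clamp_sub_le (k s s' : ℝ) : |clamp k s - clamp k s'| ≤ |s - s'| := by
  refine (abs_max_sub_max_le_max _ _ _ _).trans (max_le (by simp) ?_)
  exact (abs_min_sub_min_le_max _ _ _ _).trans (by simp)

theorem continuous_clamp : Continuous (clamp k) := by unfold clamp; fun_prop

theorem abs_log_clamp_le (hk : 1 ≤ k) (s : ℝ) : |Real.log (clamp k s)| ≤ Real.log k := by
  rw [abs_le, ← Real.log_inv]
  exact ⟨Real.log_le_log (inv_pos.mpr (by linarith)) (inv_le_clamp k s),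
    Real.log_le_log (clamp_pos hk s) (clamp_le hk s)⟩

theorem continuous_log_clamp (hk : 1 ≤ k) : Continuous fun s => Real.log (clamp k s) :=
  continuous_clamp.log fun s => (clamp_pos hk s).ne'

theorem log_sub_log_le {a b : ℝ} (ha : 0 < a) (hb : 0 < b) :
    b * (Real.log a - Real.log b) ≤ a - b := by
  have := Real.log_le_sub_one_of_pos (div_pos ha hb)
  rw [Real.log_div ha.ne' hb.ne'] at this
  calc b * (Real.log a - Real.log b) ≤ b * (a / b - 1) := by gcongr
    _ = a - b := by field_simp

/-- For s > 0 the function c ↦ s log c − c increases up to c = s and decreases afterwards; for s ≤ 0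
it decreases. Its maximum over [1/k, k] is therefore attained at the clamp. Thus `entropyTrunc` is,
up to a constant, a supremum of affine functions of s, hence convex, with slope log (clamp k s). -/
theorem clamp_variational (hk : 1 ≤ k) {c : ℝ} (h1 : k⁻¹ ≤ c) (h2 : c ≤ k) (s : ℝ) :
    s * Real.log c - c ≤ s * Real.log (clamp k s) - clamp k s := by
  have hk0 : 0 < k⁻¹ := inv_pos.mpr (by linarith)
  have hc : 0 < c := hk0.trans_le h1
  have h3 := log_sub_log_le hc (clamp_pos hk s)
  have h4 : (s - clamp k s) * (Real.log c - Real.log (clamp k s)) ≤ 0 := by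
    rcases le_total s k⁻¹ with h | h
    · rw [clamp_of_le h]
      exact mul_nonpos_of_nonpos_of_nonneg (by linarith)
        (sub_nonneg.mpr (Real.log_le_log hk0 h1))
    rcases le_total s k with h' | h'
    · rw [clamp_of_mem h h']; simp
    · rw [clamp_of_ge hk h']
      exact mul_nonpos_of_nonneg_of_nonpos (by linarith) (sub_nonpos.mpr (Real.log_le_log hc h2))
  nlinarith

theorem entropyTrunc_sub_ge (hk : 1 ≤ k) (s s' : ℝ) :
    (s' - s) * Real.log (clamp k s) ≤ entropyTrunc k s' - entropyTrunc k s := by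
  have := clamp_variational hk (inv_le_clamp k s) (clamp_le hk s) s'
  unfold entropyTrunc
  linarith

/-- The subgradient inequalities at s and at s' confine the remainder to at most the increment of
the slope times |s' − s|. Continuity of the slope suffices, with no case distinction at the corners
1/k and k. -/
theorem hasDerivAt_entropyTrunc (hk : 1 ≤ k) (s : ℝ) :
    HasDerivAt (entropyTrunc k) (Real.log (clamp k s)) s := by
  rw [hasDerivAt_iff_isLittleO]
  have hb : ∀ s', ‖entropyTrunc k s' - entropyTrunc k s - (s' - s) • Real.log (clamp k s)‖
      ≤ ‖(Real.log (clamp k s') - Real.log (clamp k s)) * (s' - s)‖ := by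
    intro s'
    have h1 := entropyTrunc_sub_ge hk s s'
    have h2 := entropyTrunc_sub_ge hk s' s
    rw [Real.norm_eq_abs, Real.norm_eq_abs, smul_eq_mul, abs_of_nonneg (by linarith)]
    exact (by linarith : _ ≤ (Real.log (clamp k s') - Real.log (clamp k s)) * (s' - s)).trans
      (le_abs_self _)
  refine Asymptotics.IsBigO.trans_isLittleO (g := fun s' =>
    (Real.log (clamp k s') - Real.log (clamp k s)) * (s' - s))
    (.of_bound 1 (Eventually.of_forall fun s' => by simpa using hb s')) ?_
  have h3 : (fun s' => Real.log (clamp k s') - Real.log (clamp k s)) =o[𝓝 s] fun _ => (1 : ℝ) := by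
    rw [Asymptotics.isLittleO_one_iff]
    have := ((continuous_log_clamp hk).tendsto s).sub_const (Real.log (clamp k s))
    simpa using this
  simpa using h3.mul_isBigO (Asymptotics.isBigO_refl (fun s' => s' - s) (𝓝 s))

theorem contDiff_entropyTrunc (hk : 1 ≤ k) : ContDiff ℝ 1 (entropyTrunc k) := by
  rw [contDiff_one_iff_deriv]
  refine ⟨fun s => (hasDerivAt_entropyTrunc hk s).differentiableAt, ?_⟩
  rw [show deriv (entropyTrunc k) = fun s => Real.log (clamp k s) from
    funext fun s => (hasDerivAt_entropyTrunc hk s).deriv]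
  exact continuous_log_clamp hk

theorem clamp_zero (hk : 1 ≤ k) : clamp k 0 = k⁻¹ :=
  clamp_of_le (inv_nonneg.mpr (by linarith))

theorem entropyTrunc_zero (hk : 1 ≤ k) : entropyTrunc k 0 = 0 := by
  rw [entropyTrunc, clamp_zero hk]; ring

theorem sub_exp_neg_le {c : ℝ} (hc : 0 < c) (a : ℝ) : c - Real.exp (-a) ≤ c * (Real.log c + a) := by
  have := log_sub_log_le (Real.exp_pos (-a)) hc
  rw [Real.log_exp] at this
  linarith

/-- The bound does not depend on k. Used with a = |x| and s = f/M, it bounds the truncated entropy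
below by the first moment in position and an integrable function. -/
theorem le_entropyTrunc (hk : 1 ≤ k) {s a : ℝ} (hs : 0 ≤ s) (ha : 0 ≤ a) :
    -(s * a) - Real.exp (-a) ≤ entropyTrunc k s := by
  have hk0 : 0 < k⁻¹ := inv_pos.mpr (by linarith)
  have hke : k⁻¹ ≤ 1 := inv_le_one_of_one_le₀ hk
  unfold entropyTrunc
  rcases le_total s k⁻¹ with h | h
  · rw [clamp_of_le h]
    rcases hs.eq_or_lt with rfl | hs'
    · simp; positivity
    have h1 := sub_exp_neg_le hs' a
    have h2 : s * Real.log s ≤ s * Real.log k⁻¹ :=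
      mul_le_mul_of_nonneg_left (Real.log_le_log hs' h) hs
    linarith
  rcases le_total s k with h' | h'
  · rw [clamp_of_mem h h']
    have h1 := sub_exp_neg_le (hk0.trans_le h) a
    linarith
  · rw [clamp_of_ge hk h']
    have h1 := sub_exp_neg_le (by linarith : 0 < k) a
    have h2 : 0 ≤ Real.log k + a := add_nonneg (Real.log_nonneg hk) ha
    nlinarith

theorem abs_entropyTrunc_le (hk : 1 ≤ k) {s : ℝ} (hs : 0 ≤ s) :
    |entropyTrunc k s| ≤ s * |Real.log s| + s := by
  have hk0 : 0 < k⁻¹ := inv_pos.mpr (by linarith)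
  unfold entropyTrunc
  rcases le_total s k⁻¹ with h | h
  · rw [clamp_of_le h]
    rcases hs.eq_or_lt with rfl | hs'
    · simp
    have h2 : Real.log s ≤ Real.log k⁻¹ := Real.log_le_log hs' h
    rw [Real.log_inv] at h2 ⊢
    have h3 := Real.log_nonneg hk
    rw [abs_of_nonpos (by linarith : Real.log s ≤ 0), abs_of_nonpos (by nlinarith)]
    nlinarith
  rcases le_total s k with h' | h'
  · rw [clamp_of_mem h h', abs_le]
    have h1 := mul_le_mul_of_nonneg_left (le_abs_self (Real.log s)) hs
    have h2 := mul_le_mul_of_nonneg_left (neg_abs_le (Real.log s)) hs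
    constructor <;> linarith
  · rw [clamp_of_ge hk h']
    have h1 := Real.log_nonneg hk
    have h2 : Real.log k ≤ Real.log s := Real.log_le_log (by linarith) h'
    have h4 : k⁻¹ ≤ 1 := inv_le_one_of_one_le₀ hk
    rw [abs_of_nonneg (h1.trans h2), abs_le]
    constructor <;> nlinarith

theorem clamp_eventually_eq {s : ℝ} (hs : 0 < s) :
    ∀ᶠ n : ℕ in atTop, clamp ((n : ℝ) + 1) s = s := by
  have h1 : ∀ᶠ n : ℕ in atTop, s ≤ (n : ℝ) + 1 ∧ s⁻¹ ≤ (n : ℝ) + 1 := by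
    have := tendsto_natCast_atTop_atTop (R := ℝ)
    filter_upwards [this.eventually_ge_atTop s, this.eventually_ge_atTop s⁻¹] with n h h'
    constructor <;> linarith
  filter_upwards [h1] with n hn
  exact clamp_of_mem (inv_le_of_inv_le₀ hs hn.2) hn.1

theorem tendsto_entropyTrunc {s : ℝ} (hs : 0 ≤ s) :
    Tendsto (fun n : ℕ => entropyTrunc ((n : ℝ) + 1) s) atTop (𝓝 (s * Real.log s - s)) := by
  rcases hs.eq_or_lt with rfl | hs'
  · refine tendsto_const_nhds.congr fun n => ?_
    rw [entropyTrunc_zero (by linarith [n.cast_nonneg (α := ℝ)])]; simp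
  · have h1 : Tendsto (fun n : ℕ => s * Real.log s - s + ((n : ℝ) + 1)⁻¹) atTop
        (𝓝 (s * Real.log s - s + 0)) :=
      tendsto_const_nhds.add (by simpa using tendsto_one_div_add_atTop_nhds_zero_nat (𝕜 := ℝ))
    rw [add_zero] at h1
    refine h1.congr' ?_
    filter_upwards [clamp_eventually_eq hs'] with n hn
    rw [entropyTrunc, hn]

/-- The truncated entropy dissipation controls the square of the increment of `clamp`. -/
theorem sq_clamp_sub_le (hk : 1 ≤ k) {a b : ℝ} (ha : 0 ≤ a) (hb : 0 ≤ b) :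
    (clamp k a - clamp k b) ^ 2
      ≤ (a - b) * (Real.log (clamp k a) - Real.log (clamp k b)) * (a + b) := by
  wlog hab : b ≤ a generalizing a b
  · have := this hb ha (le_of_not_ge hab)
    calc _ = (clamp k b - clamp k a) ^ 2 := by ring
      _ ≤ _ := this
      _ = _ := by ring
  rcases le_total a k⁻¹ with h | h
  · rw [clamp_of_le h, clamp_of_le (hab.trans h)]; simp
  have h1 : clamp k b ≤ clamp k a := clamp_mono hab
  have h2 := abs_clamp_sub_le k a b
  rw [abs_of_nonneg (by linarith), abs_of_nonneg (by linarith)] at h2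
  have h3 := log_sub_log_le (clamp_pos hk b) (clamp_pos hk a)
  -- False below 1/k, whence the separate case above, in which both clamps equal 1/k.
  have h4 : clamp k a ≤ a := max_le h (min_le_left _ _)
  have h5 : Real.log (clamp k b) ≤ Real.log (clamp k a) := Real.log_le_log (clamp_pos hk b) h1
  have h6 : clamp k a - clamp k b ≤ (Real.log (clamp k a) - Real.log (clamp k b)) * (a + b) := by
    nlinarith
  calc (clamp k a - clamp k b) ^ 2 = (clamp k a - clamp k b) * (clamp k a - clamp k b) := sq _
    _ ≤ (a - b) * ((Real.log (clamp k a) - Real.log (clamp k b)) * (a + b)) := by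
        apply mul_le_mul h2 h6 (by linarith) (by linarith)
    _ = _ := by ring

theorem clamp_mul_log_nonneg (hk : 1 ≤ k) (a b : ℝ) :
    0 ≤ (a - b) * (Real.log (clamp k a) - Real.log (clamp k b)) := by
  rcases le_total a b with h | h
  · exact mul_nonneg_of_nonpos_of_nonpos (by linarith)
      (sub_nonpos.mpr (Real.log_le_log (clamp_pos hk a) (clamp_mono h)))
  · exact mul_nonneg (by linarith)
      (sub_nonneg.mpr (Real.log_le_log (clamp_pos hk b) (clamp_mono h)))

end clamp

/-! ### Elementary inequalities -/

/-- The negative part of s log s is at most s a + exp(−a). With a = |x| this converts a bound on the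
signed entropy into one on its absolute value, at the cost of a moment. -/
theorem mul_abs_log_le {s a : ℝ} (hs : 0 ≤ s) (ha : 0 ≤ a) :
    s * |Real.log s| ≤ s * Real.log s + 2 * (s * a + Real.exp (-a)) := by
  rcases hs.eq_or_lt with rfl | hs'
  · simp; positivity
  rcases le_total 0 (Real.log s) with h | h
  · rw [abs_of_nonneg h]
    have : 0 ≤ s * a := by positivity
    have := Real.exp_pos (-a)
    linarith
  · rw [abs_of_nonpos h]
    have := sub_exp_neg_le hs' a
    linarith

/-- Convexity of `s log s - s`. -/
theorem mul_log_sub_le {s r : ℝ} (hs : 0 ≤ s) (hr : 0 < r) :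
    s * Real.log r - r ≤ s * Real.log s - s := by
  rcases hs.eq_or_lt with rfl | hs'
  · simpa using hr.le
  have := log_sub_log_le hr hs'
  linarith

/-- The slope of the logarithm between a and b is at least 1/max(a,b), hence at least 1/(a+b). This
is what gives the dissipation quadratic control of ρM − f, to be used through Cauchy–Schwarz. -/
theorem sq_sub_le_mul_log {a b : ℝ} (ha : 0 < a) (hb : 0 < b) :
    (a - b) ^ 2 ≤ (a - b) * (Real.log a - Real.log b) * (a + b) := by
  wlog hab : b ≤ a generalizing a b
  · have := this hb ha (le_of_not_ge hab)
    calc _ = (b - a) ^ 2 := by ring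
      _ ≤ _ := this
      _ = _ := by ring
  have h3 := log_sub_log_le hb ha
  have h5 : Real.log b ≤ Real.log a := Real.log_le_log hb hab
  have : a - b ≤ (Real.log a - Real.log b) * (a + b) := by nlinarith
  nlinarith

/-- The entropy duality inequality. -/
theorem mul_le_entropy_add {h r y : ℝ} (hh : 0 < h) (hr : 0 < r) :
    y * h ≤ (r - h) * (Real.log r - Real.log h) + r * Real.exp y := by
  have h1 := log_sub_log_le (mul_pos hr (Real.exp_pos y)) hh
  rw [Real.log_mul hr.ne' (Real.exp_pos y).ne', Real.log_exp] at h1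
  have h2 := log_sub_log_le hh hr
  nlinarith

theorem two_mul_le_add_of_sq_le {j p q : ℝ} (hp : 0 ≤ p) (hq : 0 ≤ q) (h : j ^ 2 ≤ p * q) :
    2 * j ≤ p + q := by
  nlinarith [sq_nonneg (p - q), sq_nonneg (p + q - 2 * j)]

end

section

variable {d : ℕ}

/-! ### The Maxwellian -/

section maxwellian

variable {D : ℝ}

theorem maxwellian_pos (hD : 0 < D) (ξ : E d) : 0 < maxwellian D ξ := by
  unfold maxwellian
  have := Real.pi_pos
  positivity

theorem integral_exp_neg_mul_sq {b : ℝ} (hb : 0 < b) :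
    ∫ ξ : E d, Real.exp (-(b * ‖ξ‖ ^ 2)) = (Real.pi / b) ^ ((d : ℝ) / 2) := by
  have := GaussianFourier.integral_rexp_neg_mul_sq_norm (V := E d) hb
  simpa using this

theorem integrable_exp_neg_mul_sq {b : ℝ} (hb : 0 < b) :
    Integrable fun ξ : E d => Real.exp (-(b * ‖ξ‖ ^ 2)) := by
  refine Integrable.of_integral_ne_zero ?_
  rw [integral_exp_neg_mul_sq hb]
  have := Real.pi_pos
  positivity

theorem maxwellian_eq (D : ℝ) : maxwellian (d := d) D = fun ξ =>
    (1 / (2 * Real.pi * D)) ^ ((d : ℝ) / 2) * Real.exp (-(1 / (2 * D) * ‖ξ‖ ^ 2)) := by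
  ext ξ; rw [maxwellian]; congr 3; ring

theorem integrable_maxwellian (hD : 0 < D) : Integrable (maxwellian (d := d) D) := by
  rw [maxwellian_eq]
  exact (integrable_exp_neg_mul_sq (by positivity)).const_mul _

theorem integral_maxwellian (hD : 0 < D) : ∫ ξ, maxwellian (d := d) D ξ = 1 := by
  have := Real.pi_pos
  rw [maxwellian_eq, integral_const_mul, integral_exp_neg_mul_sq (by positivity),
    ← Real.mul_rpow (by positivity) (by positivity)]
  rw [show 1 / (2 * Real.pi * D) * (Real.pi / (1 / (2 * D))) = 1 by field_simp, Real.one_rpow]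

theorem contDiff_maxwellian (D : ℝ) : ContDiff ℝ ∞ (maxwellian (d := d) D) := by
  unfold maxwellian
  exact contDiff_const.mul (((contDiff_norm_sq ℝ).div_const _).neg.exp)

theorem continuous_maxwellian (D : ℝ) : Continuous (maxwellian (d := d) D) :=
  (contDiff_maxwellian D).continuous

theorem hasFDerivAt_maxwellian (ξ : E d) :
    HasFDerivAt (maxwellian (d := d) D) (-(maxwellian D ξ / D) • innerSL ℝ ξ) ξ := by
  have h1 : HasFDerivAt (fun ξ : E d => ‖ξ‖ ^ 2) (2 • innerSL ℝ ξ) ξ := by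
    simpa using (hasStrictFDerivAt_norm_sq ξ).hasFDerivAt
  have h2 := (((h1.mul_const (1 / (2 * D))).fun_neg.exp).const_mul
    ((1 / (2 * Real.pi * D)) ^ ((d : ℝ) / 2)))
  have h3 : maxwellian (d := d) D = fun ξ => (1 / (2 * Real.pi * D)) ^ ((d : ℝ) / 2) *
      Real.exp (-(‖ξ‖ ^ 2 * (1 / (2 * D)))) := by
    ext ξ; rw [maxwellian]; congr 3; ring
  rw [h3]
  refine h2.congr_fderiv ?_
  ext v
  simp only [smul_apply, nsmul_eq_mul, smul_eq_mul, innerSL_apply_apply,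
    Nat.cast_ofNat, neg_apply]
  ring

/-- Half of the Gaussian decay is spent on the exponential and half is kept. This rate reappears in
the entropy duality bound for the second moment in ξ. -/
theorem integrable_exp_mul_maxwellian (hD : 0 < D) :
    Integrable fun ξ : E d => Real.exp (‖ξ‖ ^ 2 / (4 * D)) * maxwellian D ξ := by
  have : (fun ξ : E d => Real.exp (‖ξ‖ ^ 2 / (4 * D)) * maxwellian D ξ) = fun ξ =>
      (1 / (2 * Real.pi * D)) ^ ((d : ℝ) / 2) * Real.exp (-(1 / (4 * D) * ‖ξ‖ ^ 2)) := by
    ext ξ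
    rw [maxwellian, mul_left_comm, ← Real.exp_add]
    congr 2
    field_simp
    ring
  rw [this]
  exact (integrable_exp_neg_mul_sq (by positivity)).const_mul _

theorem integrable_sq_mul_maxwellian (hD : 0 < D) :
    Integrable fun ξ : E d => ‖ξ‖ ^ 2 * maxwellian D ξ := by
  refine ((integrable_exp_mul_maxwellian hD).const_mul (4 * D)).mono'
    (by have := continuous_maxwellian (d := d) D; fun_prop) (ae_of_all _ fun ξ => ?_)
  rw [Real.norm_of_nonneg (mul_nonneg (by positivity) (maxwellian_pos hD ξ).le), ← mul_assoc]
  refine mul_le_mul_of_nonneg_right ?_ (maxwellian_pos hD ξ).le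
  have h := Real.add_one_le_exp (‖ξ‖ ^ 2 / (4 * D))
  have h2 : 4 * D * (‖ξ‖ ^ 2 / (4 * D)) = ‖ξ‖ ^ 2 := by field_simp
  nlinarith

theorem norm_le_one_add_sq (ξ : E d) : ‖ξ‖ ≤ 1 + ‖ξ‖ ^ 2 := by nlinarith [sq_nonneg (‖ξ‖ - 1)]

theorem integrable_smul_maxwellian (hD : 0 < D) :
    Integrable fun ξ : E d => maxwellian D ξ • ξ := by
  refine ((integrable_maxwellian hD).add (integrable_sq_mul_maxwellian hD)).mono'
    (by have := continuous_maxwellian (d := d) D; fun_prop) (ae_of_all _ fun ξ => ?_)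
  rw [norm_smul, Real.norm_of_nonneg (maxwellian_pos hD ξ).le, Pi.add_apply]
  nlinarith [norm_le_one_add_sq ξ, (maxwellian_pos hD ξ)]

theorem integral_smul_maxwellian (D : ℝ) : ∫ ξ : E d, maxwellian D ξ • ξ = 0 := by
  have h := integral_neg_eq_self (fun ξ : E d => maxwellian D ξ • ξ) volume
  have h2 : ∀ ξ : E d, maxwellian D (-ξ) • (-ξ) = -(maxwellian D ξ • ξ) := by
    intro ξ; rw [maxwellian, maxwellian, norm_neg, smul_neg]
  simp_rw [h2] at h
  rw [integral_neg] at h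
  have h3 : (2 : ℝ) • ∫ ξ : E d, maxwellian D ξ • ξ = 0 := by
    rw [two_smul]; nth_rewrite 1 [← h]; exact neg_add_cancel _
  exact (smul_eq_zero.mp h3).resolve_left two_ne_zero

theorem log_maxwellian (hD : 0 < D) (ξ : E d) : Real.log (maxwellian D ξ) =
    (d : ℝ) / 2 * Real.log (1 / (2 * Real.pi * D)) - ‖ξ‖ ^ 2 / (2 * D) := by
  have := Real.pi_pos
  rw [maxwellian, Real.log_mul (by positivity) (Real.exp_pos _).ne', Real.log_exp,
    Real.log_rpow (by positivity)]
  ring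

theorem abs_log_maxwellian_le (hD : 0 < D) (ξ : E d) : |Real.log (maxwellian D ξ)| ≤
    |(d : ℝ) / 2 * Real.log (1 / (2 * Real.pi * D))| + ‖ξ‖ ^ 2 / (2 * D) := by
  rw [log_maxwellian hD]
  refine (abs_sub _ _).trans (le_of_eq ?_)
  rw [abs_of_nonneg (by positivity : 0 ≤ ‖ξ‖ ^ 2 / (2 * D))]

end maxwellian

theorem integrable_exp_neg_norm : Integrable fun x : E d => Real.exp (-‖x‖) := by
  have h1 : Integrable fun x : E d => (1 + ‖x‖) ^ (-((d : ℝ) + 1)) :=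
    integrable_one_add_norm (by simp)
  have h2 : ∀ x : E d, Real.exp (-‖x‖) ≤
      ((d + 1).factorial * Real.exp 1) * (1 + ‖x‖) ^ (-((d : ℝ) + 1)) := by
    intro x
    have h3 := Real.pow_div_factorial_le_exp (1 + ‖x‖) (by positivity) (d + 1)
    have h4 : (1 + ‖x‖) ^ (-((d : ℝ) + 1)) = ((1 + ‖x‖) ^ (d + 1))⁻¹ := by
      rw [Real.rpow_neg (by positivity)]
      norm_cast
    rw [h4, Real.exp_neg, ← div_eq_mul_inv, inv_eq_one_div, div_le_div_iff₀ (Real.exp_pos _) (by positivity)]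
    rw [div_le_iff₀ (by positivity), Real.exp_add] at h3
    linarith
  refine (h1.const_mul ((d + 1).factorial * Real.exp 1)).mono' (by fun_prop) (ae_of_all _ fun x => ?_)
  rw [Real.norm_of_nonneg (Real.exp_pos _).le]
  exact h2 x

/-! ### Renormalization functions -/

theorem smul_sub_smul_dual (a b : ℝ) (L : E d →L[ℝ] ℝ) : a • L - b • L = (a - b) • L := by module

/-- The primitive variable `s ↦ ψ(ξ) s`. -/
theorem isRenorm_linear {ψ : E d → ℝ} (hψ : ContDiff ℝ 1 ψ) {K : ℝ≥0} (hK : ∀ ξ, |ψ ξ| ≤ K)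
    {w : E d → ℝ} (hw : Continuous w) (hψw : ∀ ξ, ‖fderiv ℝ ψ ξ‖ ≤ w ξ) :
    IsRenorm (fun ξ s => ψ ξ * s) (fun ξ _ => ψ ξ) (fun ξ s => s • fderiv ℝ ψ ξ) K w where
  contDiff := (hψ.comp contDiff_fst).mul contDiff_snd
  fderiv_eq ξ s v r := by
    have h1 : HasFDerivAt (fun q : E d × ℝ => ψ q.1)
        ((fderiv ℝ ψ ξ).comp (ContinuousLinearMap.fst ℝ (E d) ℝ)) (ξ, s) :=
      HasFDerivAt.comp (g := ψ) (f := Prod.fst) (ξ, s)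
        (hψ.differentiable (by norm_num) ξ).hasFDerivAt hasFDerivAt_fst
    have h2 := h1.fun_mul (hasFDerivAt_snd (𝕜 := ℝ) (E := E d) (F := ℝ) (p := (ξ, s)))
    rw [h2.fderiv]
    simp
    ring
  zero ξ := mul_zero _
  zero_left ξ := zero_smul _ _
  bound ξ s := hK ξ
  lipschitz ξ s s' := by
    rw [smul_sub_smul_dual, norm_smul, mul_comm, Real.norm_eq_abs]
    gcongr
    exact hψw ξ
  weight_continuous := hw
  weight_nonneg ξ := (norm_nonneg _).trans (hψw ξ)

/-- The truncated relative entropy density `M β(s / M)`. -/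
theorem isRenorm_entropy {D : ℝ} (hD : 0 < D) {k : ℝ} (hk : 1 ≤ k) :
    IsRenorm (d := d) (fun ξ s => maxwellian D ξ * entropyTrunc k (s / maxwellian D ξ))
      (fun ξ s => Real.log (clamp k (s / maxwellian D ξ)))
      (fun ξ s => (maxwellian D ξ * (clamp k (s / maxwellian D ξ) - k⁻¹) / D) • innerSL ℝ ξ)
      (Real.toNNReal (Real.log k)) (fun ξ => ‖ξ‖ / D) where
  contDiff := by
    have h1 : ContDiff ℝ 1 fun q : E d × ℝ => maxwellian D q.1 :=
      ((contDiff_maxwellian D).comp contDiff_fst).of_le (by exact_mod_cast le_top)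
    exact h1.mul ((contDiff_entropyTrunc hk).comp
      (contDiff_snd.div h1 fun q => (maxwellian_pos hD _).ne'))
  -- Writing η = s/M and β for the truncated entropy, the ξ-derivative of M β(s/M) is ∇M (β − ηβ'),
  -- with ∇M = −Mξ/D and β − ηβ' = 1/k − clamp k η. The normalization of β at zero makes both Γ and
  -- G vanish at s = 0.
  fderiv_eq ξ s v r := by
    have hM := (maxwellian_pos hD ξ).ne'
    have h1 : HasFDerivAt (fun q : E d × ℝ => maxwellian D q.1)
        ((-(maxwellian D ξ / D) • innerSL ℝ ξ).comp (ContinuousLinearMap.fst ℝ (E d) ℝ)) (ξ, s) :=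
      HasFDerivAt.comp (g := maxwellian D) (f := Prod.fst) (ξ, s) (hasFDerivAt_maxwellian ξ)
        hasFDerivAt_fst
    have h2 := (hasFDerivAt_snd (𝕜 := ℝ) (E := E d) (F := ℝ) (p := (ξ, s))).fun_mul
      ((hasDerivAt_inv hM).comp_hasFDerivAt (ξ, s) h1)
    have h3 := h1.fun_mul ((hasDerivAt_entropyTrunc hk (s * (maxwellian D ξ)⁻¹)).comp_hasFDerivAt
      (ξ, s) h2)
    simp only [div_eq_mul_inv s]
    simp only [div_eq_mul_inv]
    have h4 := h3.fderiv
    simp only [Function.comp_def] at h4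
    erw [h4]
    simp only [entropyTrunc, add_apply, smul_apply, ContinuousLinearMap.comp_apply,
      ContinuousLinearMap.coe_fst', ContinuousLinearMap.coe_snd', smul_eq_mul, innerSL_apply_apply]
    field_simp
    ring
  zero ξ := by simp [entropyTrunc_zero hk]
  zero_left ξ := by simp [clamp_zero hk]
  bound ξ s := by
    rw [Real.coe_toNNReal _ (Real.log_nonneg hk)]
    exact abs_log_clamp_le hk _
  lipschitz ξ s s' := by
    have hM := maxwellian_pos hD ξ
    rw [smul_sub_smul_dual, norm_smul, innerSL_apply_norm, Real.norm_eq_abs,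
      show maxwellian D ξ * (clamp k (s / maxwellian D ξ) - k⁻¹) / D
        - maxwellian D ξ * (clamp k (s' / maxwellian D ξ) - k⁻¹) / D
        = maxwellian D ξ / D * (clamp k (s / maxwellian D ξ) - clamp k (s' / maxwellian D ξ)) by ring,
      abs_mul, abs_of_pos (div_pos hM hD)]
    have h1 := abs_clamp_sub_le k (s / maxwellian D ξ) (s' / maxwellian D ξ)
    rw [← sub_div, abs_div, abs_of_pos hM, le_div_iff₀ hM] at h1
    calc maxwellian D ξ / D * |clamp k (s / maxwellian D ξ) - clamp k (s' / maxwellian D ξ)| * ‖ξ‖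
        = ‖ξ‖ / D * (|clamp k (s / maxwellian D ξ) - clamp k (s' / maxwellian D ξ)|
          * maxwellian D ξ) := by ring
      _ ≤ ‖ξ‖ / D * |s - s'| := by gcongr
  weight_continuous := by fun_prop
  weight_nonneg ξ := by positivity

end

section

variable {d : ℕ}

/-! ### Solutions as weak solutions of a transport equation -/

theorem integrable_density {g : E d → E d → ℝ} (hg : Integrable fun z : E d × E d => g z.1 z.2) :
    Integrable (density g) := hg.integral_prod_left

theorem integral_density {g : E d → E d → ℝ} (hg : Integrable fun z : E d × E d => g z.1 z.2) :
    ∫ x, density g x = ∫ z : E d × E d, g z.1 z.2 := (integral_prod _ hg).symm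

theorem density_nonneg {g : E d → E d → ℝ} (hg : ∀ x ξ, 0 ≤ g x ξ) (x : E d) : 0 ≤ density g x :=
  integral_nonneg fun ξ => hg x ξ

theorem integrable_density_mul {g : E d → E d → ℝ}
    (hg : Integrable fun z : E d × E d => g z.1 z.2) {φ : E d → ℝ} (hφ : Integrable φ) :
    Integrable fun z : E d × E d => density g z.1 * φ z.2 :=
  (integrable_density hg).mul_prod hφ

theorem integral_density_mul {g : E d → E d → ℝ}
    (hg : Integrable fun z : E d × E d => g z.1 z.2) (φ : E d → ℝ) :
    ∫ z : E d × E d, density g z.1 * φ z.2 = (∫ z : E d × E d, g z.1 z.2) * ∫ ξ, φ ξ := by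
  rw [← integral_density hg]
  exact integral_prod_mul (density g) φ

/-- The relaxation operator `ρ M - g`. -/
def collision (D : ℝ) (g : E d → E d → ℝ) (z : E d × E d) : ℝ :=
  density g z.1 * maxwellian D z.2 - g z.1 z.2

section collision

variable {D : ℝ} {g : E d → E d → ℝ}

theorem integrable_collision (hD : 0 < D) (hg : Integrable fun z : E d × E d => g z.1 z.2) :
    Integrable (collision D g) :=
  (integrable_density_mul hg (integrable_maxwellian hD)).sub hg

theorem integral_abs_collision_le (hD : 0 < D) (hg : Integrable fun z : E d × E d => g z.1 z.2)
    (hg0 : ∀ x ξ, 0 ≤ g x ξ) :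
    ∫ z, |collision D g z| ≤ 2 * ∫ z : E d × E d, g z.1 z.2 := by
  have h1 := integrable_density_mul hg (integrable_maxwellian hD)
  calc ∫ z, |collision D g z|
      ≤ ∫ z : E d × E d, (density g z.1 * maxwellian D z.2 + g z.1 z.2) := by
        refine integral_mono (integrable_collision hD hg).abs (h1.add hg) fun z => ?_
        have h2 := mul_nonneg (density_nonneg hg0 z.1) (maxwellian_pos hD z.2).le
        have h3 := hg0 z.1 z.2
        simp only [collision, abs_le]
        constructor <;> linarith
    _ = _ := by
        rw [integral_add h1 hg, integral_density_mul hg, integral_maxwellian hD]; ring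

/-- M has unit mass, so relaxation conserves the mass at each position and is invisible to functions
of x alone. -/
theorem integral_mul_collision (hD : 0 < D) (hg : Integrable fun z : E d × E d => g z.1 z.2)
    {φ : E d → ℝ} (hφm : Measurable φ) {K : ℝ} (hφ : ∀ x, |φ x| ≤ K) :
    ∫ z, φ z.1 * collision D g z = 0 := by
  have hc := integrable_collision hD hg
  have hi : Integrable fun z : E d × E d => φ z.1 * collision D g z :=
    hc.bdd_mul (c := K) (hφm.comp measurable_fst).aestronglyMeasurable (ae_of_all _ fun z => hφ _)
  rw [Measure.volume_eq_prod] at hi ⊢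
  rw [integral_prod _ hi]
  rw [Measure.volume_eq_prod] at hg
  have : ∀ᵐ x : E d, ∫ ξ, φ x * collision D g (x, ξ) = 0 := by
    filter_upwards [hg.prod_right_ae] with x hx
    rw [integral_const_mul]
    simp only [collision]
    rw [integral_sub ((integrable_maxwellian hD).const_mul _) hx, integral_const_mul,
      integral_maxwellian hD]
    simp [density]
  rw [integral_congr_ae this]
  simp

end collision

/-- Integrability on `(0,T) × Y` from a bound uniform in time. -/
theorem integrable_prod_of_bound {Y : Type*} [MeasurableSpace Y] {ν : Measure Y} [SFinite ν]
    {T K : ℝ} {G : Type*} [NormedAddCommGroup G] [NormedSpace ℝ G] {u : ℝ × Y → G}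
    (hu : StronglyMeasurable u)
    (h : ∀ᵐ t ∂(volume.restrict (Ioo 0 T)), Integrable (fun y => u (t, y)) ν ∧
      ∫ y, ‖u (t, y)‖ ∂ν ≤ K) :
    Integrable u ((volume.restrict (Ioo 0 T)).prod ν) := by
  rw [integrable_prod_iff hu.aestronglyMeasurable]
  refine ⟨h.mono fun t ht => ht.1, ?_⟩
  refine (integrable_const K).mono' hu.norm.integral_prod_right'.aestronglyMeasurable ?_
  filter_upwards [h] with t ht
  rw [Real.norm_of_nonneg (integral_nonneg fun _ => norm_nonneg _)]
  exact ht.2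

theorem measurable_density {f : ℝ → E d → E d → ℝ}
    (hf : Measurable fun p : ℝ × E d × E d => f p.1 p.2.1 p.2.2) :
    Measurable fun p : ℝ × E d => density (f p.1) p.2 := by
  refine (StronglyMeasurable.integral_prod_right (f := fun (p : ℝ × E d) ξ => f p.1 p.2 ξ)
    (Measurable.stronglyMeasurable ?_)).measurable
  exact hf.comp ((measurable_fst.comp measurable_fst).prodMk
    ((measurable_snd.comp measurable_fst).prodMk measurable_snd))

theorem measurable_collision (D : ℝ) {f : ℝ → E d → E d → ℝ}
    (hf : Measurable fun p : ℝ × E d × E d => f p.1 p.2.1 p.2.2) :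
    Measurable fun p : ℝ × E d × E d => collision D (f p.1) p.2 := by
  have h1 := (measurable_density hf).comp
    (measurable_fst.prodMk (measurable_fst.comp measurable_snd) :
      Measurable fun p : ℝ × E d × E d => (p.1, p.2.1))
  have h2 := (continuous_maxwellian (d := d) D).measurable.comp
    (measurable_snd.comp measurable_snd : Measurable fun p : ℝ × E d × E d => p.2.2)
  exact (h1.mul h2).sub hf

namespace IsInitialDatum

variable {f0 : E d → E d → ℝ}

theorem integrable_self (h : IsInitialDatum f0) : Integrable fun z : E d × E d => f0 z.1 z.2 := by
  refine h.integrable.mono' h.measurable.aestronglyMeasurable (ae_of_all _ fun z => ?_)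
  rw [Real.norm_of_nonneg (h.nonneg _ _)]
  have : 0 ≤ (‖z.1‖ + ‖z.2‖ ^ 2 + |Real.log (f0 z.1 z.2)|) * f0 z.1 z.2 :=
    mul_nonneg (by positivity) (h.nonneg _ _)
  linarith

end IsInitialDatum

namespace IsSolution

variable {T D ε α δ m B : ℝ} {ωL ωS : E d → ℝ} {f0 : E d → E d → ℝ} {f : ℝ → E d → E d → ℝ}

theorem measurable_slice (h : IsSolution T D ε α ωL ωS f0 f) (t : ℝ) :
    Measurable fun z : E d × E d => f t z.1 z.2 := h.measurable.comp measurable_prodMk_left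

theorem integrable_of_le (h : IsSolution T D ε α ωL ωS f0 f) {t : ℝ} {K : ℝ≥0}
    (ht : ∫⁻ p : E d × E d, ENNReal.ofReal (f t p.1 p.2) ≤ K) :
    Integrable (fun z : E d × E d => f t z.1 z.2) ∧ ∫ z : E d × E d, f t z.1 z.2 ≤ K := by
  have hm := (h.measurable_slice t).aestronglyMeasurable (μ := volume)
  have h0 : 0 ≤ᵐ[volume] fun z : E d × E d => f t z.1 z.2 := ae_of_all _ fun z => h.nonneg _ _ _
  refine ⟨⟨hm, ?_⟩, ?_⟩
  · rw [hasFiniteIntegral_iff_ofReal h0]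
    exact ht.trans_lt ENNReal.coe_lt_top
  · rw [integral_eq_lintegral_of_nonneg_ae h0 hm]
    exact ENNReal.toReal_le_coe_of_le_coe ht

theorem exists_mass_bound (h : IsSolution T D ε α ωL ωS f0 f) : ∃ K : ℝ≥0,
    ∀ᵐ t ∂(volume.restrict (Ioo 0 T)), Integrable (fun z : E d × E d => f t z.1 z.2) ∧
      ∫ z : E d × E d, f t z.1 z.2 ≤ K := by
  obtain ⟨K, hK⟩ := h.bounded
  exact ⟨K, hK.mono fun t ht => h.integrable_of_le ht⟩

/-- A solution is a weak solution of a transport equation with bounded Lipschitz force. -/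
theorem isTransport (h : IsSolution T D ε α ωL ωS f0 f) (hT : 0 < T) (hD : 0 < D) (hε : 0 < ε)
    (hf0 : IsInitialDatum f0) {F : ℝ → E d → E d} (hFm : Measurable fun p : ℝ × E d => F p.1 p.2)
    (hF : ∀ t, Integrable (density (f t)) → F t = force α ωL ωS (density (f t))) {L : ℝ≥0}
    (hm : ∀ᵐ t ∂(volume.restrict (Ioo 0 T)), Integrable (fun z : E d × E d => f t z.1 z.2) ∧
      ∫ z : E d × E d, f t z.1 z.2 ≤ m)
    (hFb : ∀ ρ : E d → ℝ, Integrable ρ → ∫ x, |ρ x| ≤ m →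
      (∀ x, ‖force α ωL ωS ρ x‖ ≤ B) ∧ LipschitzWith L (force α ωL ωS ρ)) :
    IsTransport T ε⁻¹ (ε⁻¹ * B) (max m ((ε ^ 2)⁻¹ * (2 * m))) (Real.toNNReal ε⁻¹ * L)
      (fun t x => ε⁻¹ • F t x) (fun t z => f t z.1 z.2)
      (fun t z => (ε ^ 2)⁻¹ * collision D (f t) z) (fun z => f0 z.1 z.2) := by
  have hεi : 0 ≤ ε⁻¹ := inv_nonneg.mpr hε.le
  have hFt : ∀ᵐ t ∂(volume.restrict (Ioo 0 T)), F t = force α ωL ωS (density (f t)) ∧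
      (∀ x, ‖F t x‖ ≤ B) ∧ LipschitzWith L (F t) := by
    filter_upwards [hm] with t ht
    have h1 := integrable_density ht.1
    have h2 : ∫ x, |density (f t) x| ≤ m := by
      simp_rw [abs_of_nonneg (density_nonneg (h.nonneg t) _)]
      rw [integral_density ht.1]; exact ht.2
    rw [hF t h1]
    exact ⟨rfl, hFb _ h1 h2⟩
  have hFb' : ∀ᵐ t ∂(volume.restrict (Ioo 0 T)), (∀ x, ‖ε⁻¹ • F t x‖ ≤ ε⁻¹ * B) ∧
      LipschitzWith (Real.toNNReal ε⁻¹ * L) (fun x => ε⁻¹ • F t x) := by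
    filter_upwards [hFt] with t ht
    refine ⟨fun x => ?_, ?_⟩
    · rw [norm_smul, Real.norm_of_nonneg hεi]
      exact mul_le_mul_of_nonneg_left (ht.2.1 x) hεi
    · refine LipschitzWith.of_dist_le_mul fun x y => ?_
      rw [dist_eq_norm, ← smul_sub, norm_smul, Real.norm_of_nonneg hεi, NNReal.coe_mul,
        Real.coe_toNNReal _ hεi, mul_assoc]
      exact mul_le_mul_of_nonneg_left (ht.2.2.dist_le_mul x y |>.trans' (by rw [dist_eq_norm])) hεi
  have hgb : ∀ᵐ t ∂(volume.restrict (Ioo 0 T)), Integrable (fun z : E d × E d => f t z.1 z.2) ∧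
      ∫ z : E d × E d, |f t z.1 z.2| ≤ max m ((ε ^ 2)⁻¹ * (2 * m)) := by
    filter_upwards [hm] with t ht
    simp_rw [abs_of_nonneg (h.nonneg t _ _)]
    exact ⟨ht.1, ht.2.trans (le_max_left _ _)⟩
  have hSb : ∀ᵐ t ∂(volume.restrict (Ioo 0 T)),
      Integrable (fun z => (ε ^ 2)⁻¹ * collision D (f t) z) ∧
      ∫ z, |(ε ^ 2)⁻¹ * collision D (f t) z| ≤ max m ((ε ^ 2)⁻¹ * (2 * m)) := by
    filter_upwards [hm] with t ht
    refine ⟨(integrable_collision hD ht.1).const_mul _, le_max_of_le_right ?_⟩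
    simp_rw [abs_mul, abs_of_pos (by positivity : 0 < (ε ^ 2)⁻¹)]
    rw [integral_const_mul]
    gcongr
    exact (integral_abs_collision_le hD ht.1 (h.nonneg t)).trans (by linarith [ht.2])
  have hSm : Measurable fun p : ℝ × (E d × E d) => (ε ^ 2)⁻¹ * collision D (f p.1) p.2 :=
    (measurable_collision D h.measurable).const_mul _
  refine ⟨h.measurable, hSm, hFm.const_smul ε⁻¹, hf0.measurable, hf0.integrable_self, hgb, hSb, hFb',
    fun ψ hψ hψc => ?_⟩
  obtain ⟨c1, hc1⟩ := hψc.exists_bound_of_continuous hψ.continuous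
  obtain ⟨c2, -, hc2⟩ := exists_abs_fderiv_vel_le (hψ.of_le (by exact_mod_cast le_top)) hψc ε⁻¹
    (ε⁻¹ * B)
  have hψ' : Continuous (fderiv ℝ ψ) := hψ.continuous_fderiv (by simp)
  have hvm : Measurable fun p : ℝ × (E d × E d) =>
      fderiv ℝ ψ p.2 (vel ε⁻¹ (fun x => ε⁻¹ • F p.1 x) p.2) := by
    have h1 : Continuous fun q : (E d × E d) × (E d × E d) => fderiv ℝ ψ q.1 q.2 := by fun_prop
    refine h1.measurable.comp (measurable_snd.prodMk ?_)
    refine Measurable.prodMk (by fun_prop) ?_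
    exact (hFm.comp (measurable_fst.prodMk (measurable_fst.comp measurable_snd))).const_smul ε⁻¹
  have hψm : Measurable fun p : ℝ × (E d × E d) => ψ p.2 := hψ.continuous.measurable.comp
    measurable_snd
  set K := max m ((ε ^ 2)⁻¹ * (2 * m)) with hK
  -- slice bounds
  have hI1 : ∀ᵐ t ∂(volume.restrict (Ioo 0 T)),
      Integrable (fun z : E d × E d => f t z.1 z.2 * ψ z) ∧
        |∫ z : E d × E d, f t z.1 z.2 * ψ z| ≤ c1 * K := by
    filter_upwards [hgb] with t ht
    have hi : Integrable (fun z : E d × E d => f t z.1 z.2 * ψ z) :=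
      ht.1.mul_bdd (c := c1) hψ.continuous.aestronglyMeasurable (ae_of_all _ hc1)
    refine ⟨hi, ?_⟩
    refine (norm_integral_le_of_norm_le (f := fun z : E d × E d => f t z.1 z.2 * ψ z)
      (ht.1.abs.const_mul c1) (ae_of_all _ fun z => ?_)).trans ?_
    · rw [norm_mul, mul_comm, Real.norm_eq_abs (f _ _ _)]
      gcongr
      exact hc1 z
    · rw [integral_const_mul]
      exact mul_le_mul_of_nonneg_left ht.2 ((norm_nonneg _).trans (hc1 0))
  have hI2 : ∀ᵐ t ∂(volume.restrict (Ioo 0 T)),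
      Integrable (fun z : E d × E d => f t z.1 z.2 *
        fderiv ℝ ψ z (vel ε⁻¹ (fun x => ε⁻¹ • F t x) z) + (ε ^ 2)⁻¹ * collision D (f t) z * ψ z) ∧
        |∫ z : E d × E d, (f t z.1 z.2 * fderiv ℝ ψ z (vel ε⁻¹ (fun x => ε⁻¹ • F t x) z)
          + (ε ^ 2)⁻¹ * collision D (f t) z * ψ z)| ≤ c2 * K + c1 * K := by
    filter_upwards [hgb, hSb, hFb'] with t ht ht2 ht3
    have hb1 : ∀ z : E d × E d, |fderiv ℝ ψ z (vel ε⁻¹ (fun x => ε⁻¹ • F t x) z)| ≤ c2 := fun z =>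
      hc2 z _ (ht3.1 z.1)
    have hi1 : Integrable (fun z : E d × E d => f t z.1 z.2 *
        fderiv ℝ ψ z (vel ε⁻¹ (fun x => ε⁻¹ • F t x) z)) :=
      ht.1.mul_bdd (c := c2) (hvm.comp measurable_prodMk_left).aestronglyMeasurable
        (ae_of_all _ hb1)
    have hi2 : Integrable (fun z : E d × E d => (ε ^ 2)⁻¹ * collision D (f t) z * ψ z) :=
      ht2.1.mul_bdd (c := c1) hψ.continuous.aestronglyMeasurable (ae_of_all _ hc1)
    refine ⟨hi1.add hi2, ?_⟩
    have hc20 : 0 ≤ c2 := (abs_nonneg _).trans (hb1 0)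
    have hc10 : 0 ≤ c1 := (norm_nonneg _).trans (hc1 0)
    refine (norm_integral_le_of_norm_le (f := fun z : E d × E d => f t z.1 z.2 *
        fderiv ℝ ψ z (vel ε⁻¹ (fun x => ε⁻¹ • F t x) z) + (ε ^ 2)⁻¹ * collision D (f t) z * ψ z)
      ((ht.1.abs.const_mul c2).fun_add (ht2.1.abs.const_mul c1)) (ae_of_all _ fun z => ?_)).trans ?_
    · refine (norm_add_le _ _).trans (add_le_add ?_ ?_)
      · rw [norm_mul, mul_comm, Real.norm_eq_abs (f _ _ _)]
        exact mul_le_mul_of_nonneg_right (hb1 z) (abs_nonneg _)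
      · rw [norm_mul, mul_comm, Real.norm_eq_abs (_ * _)]
        exact mul_le_mul_of_nonneg_right (hc1 z) (abs_nonneg _)
    · rw [integral_add (ht.1.abs.const_mul c2) (ht2.1.abs.const_mul c1), integral_const_mul,
        integral_const_mul]
      exact add_le_add (mul_le_mul_of_nonneg_left ht.2 hc20) (mul_le_mul_of_nonneg_left ht2.2 hc10)
  have hm1 : Measurable fun p : ℝ × (E d × E d) => f p.1 p.2.1 p.2.2 * ψ p.2 := h.measurable.mul hψm
  have hm2 : Measurable fun p : ℝ × (E d × E d) => f p.1 p.2.1 p.2.2 *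
        fderiv ℝ ψ p.2 (vel ε⁻¹ (fun x => ε⁻¹ • F p.1 x) p.2)
          + (ε ^ 2)⁻¹ * collision D (f p.1) p.2 * ψ p.2 :=
    (h.measurable.mul hvm).add (hSm.mul hψm)
  refine ae_eq_primitive_of_weak hT
    (a := fun t => ∫ z : E d × E d, f t z.1 z.2 * ψ z)
    (b := fun s => ∫ z : E d × E d, (f s z.1 z.2 *
      fderiv ℝ ψ z (vel ε⁻¹ (fun x => ε⁻¹ • F s x) z) + (ε ^ 2)⁻¹ * collision D (f s) z * ψ z))
    ?_ ?_ fun θ hθ hθc hθT => ?_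
  · refine (integrable_const (c1 * K)).mono' ?_ (hI1.mono fun t ht => ht.2)
    exact hm1.stronglyMeasurable.integral_prod_right'.aestronglyMeasurable
  · refine (integrable_const (c2 * K + c1 * K)).mono' ?_ (hI2.mono fun t ht => ht.2)
    exact hm2.stronglyMeasurable.integral_prod_right'.aestronglyMeasurable
  -- Tensor products reduce the space-time formulation to a weak equation in time for the single
  -- number ∫ f ψ, to which `ae_eq_primitive_of_weak` applies. The value θ(0) carries the initial
  -- datum.
  set φ : ℝ × E d × E d → ℝ := fun p => θ p.1 * ψ p.2 with hφ
  have hφs : ContDiff ℝ ∞ φ := (hθ.comp contDiff_fst).mul (hψ.comp contDiff_snd)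
  have hsupp : tsupport φ ⊆ tsupport θ ×ˢ tsupport ψ := by
    refine closure_minimal (fun p hp => ?_) ((isClosed_tsupport _).prod (isClosed_tsupport _))
    rw [Function.mem_support] at hp
    exact ⟨subset_tsupport _ (left_ne_zero_of_mul hp), subset_tsupport _ (right_ne_zero_of_mul hp)⟩
  have hφc : HasCompactSupport φ :=
    (hθc.isCompact.prod hψc.isCompact).of_isClosed_subset (isClosed_tsupport _) hsupp
  have hφT : tsupport φ ⊆ Iio T ×ˢ univ := fun p hp => ⟨hθT (hsupp hp).1, mem_univ _⟩
  have hw := h.weak φ hφs hφc hφT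
  have hφd : ∀ (p : ℝ × E d × E d) (v : ℝ × E d × E d),
      fderiv ℝ φ p v = deriv θ p.1 * v.1 * ψ p.2 + θ p.1 * fderiv ℝ ψ p.2 v.2 := by
    intro p v
    have h1 : HasFDerivAt (fun p : ℝ × E d × E d => θ p.1)
        ((deriv θ p.1) • ContinuousLinearMap.fst ℝ ℝ (E d × E d)) p :=
      HasDerivAt.comp_hasFDerivAt (h₂ := θ) (f := Prod.fst) p
        (hθ.differentiable (by simp) p.1).hasDerivAt hasFDerivAt_fst
    have h2 : HasFDerivAt (fun p : ℝ × E d × E d => ψ p.2)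
        ((fderiv ℝ ψ p.2).comp (ContinuousLinearMap.snd ℝ ℝ (E d × E d))) p :=
      HasFDerivAt.comp (g := ψ) (f := Prod.snd) p
        (hψ.differentiable (by simp) p.2).hasFDerivAt hasFDerivAt_snd
    rw [(h1.fun_mul h2).fderiv]
    simp only [add_apply, smul_apply, ContinuousLinearMap.comp_apply, ContinuousLinearMap.coe_fst',
      ContinuousLinearMap.coe_snd', smul_eq_mul]
    ring
  have hFp : ∀ᵐ p ∂(timePhase d T), F p.1 = force α ωL ωS (density (f p.1)) :=
    (Measure.quasiMeasurePreserving_fst (μ := volume.restrict (Ioo 0 T))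
      (ν := (volume : Measure (E d × E d)))).ae (hFt.mono fun t ht => ht.1)
  have hiε : ε ^ 2 ≠ 0 := by positivity
  have e1 : ∫ p, (f p.1 p.2.1 p.2.2 *
        fderiv ℝ φ p (ε ^ 2, ε • p.2.2, ε • force α ωL ωS (density (f p.1)) p.2.1)
      + (density (f p.1) p.2.1 * maxwellian D p.2.2 - f p.1 p.2.1 p.2.2) * φ p) ∂(timePhase d T)
      = ∫ p, (ε ^ 2 * (deriv θ p.1 * (f p.1 p.2.1 p.2.2 * ψ p.2)) + ε ^ 2 * (θ p.1 *
        (f p.1 p.2.1 p.2.2 * fderiv ℝ ψ p.2 (vel ε⁻¹ (fun x => ε⁻¹ • F p.1 x) p.2)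
          + (ε ^ 2)⁻¹ * collision D (f p.1) p.2 * ψ p.2))) ∂(timePhase d T) := by
    refine integral_congr_ae (hFp.mono fun p hp => ?_)
    simp only
    rw [hφd, ← hp]
    have e2 : ((ε • p.2.2, ε • F p.1 p.2.1) : E d × E d)
        = ε ^ 2 • vel ε⁻¹ (fun x => ε⁻¹ • F p.1 x) p.2 := by
      simp only [vel, Prod.smul_mk, smul_smul]
      rw [show ε ^ 2 * ε⁻¹ = ε by field_simp]
    simp only [e2, map_smul, smul_eq_mul, collision, hφ]
    field_simp
    ring
  obtain ⟨k1, hk1⟩ := (hθc.deriv).exists_bound_of_continuous (hθ.continuous_deriv (by simp))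
  obtain ⟨k2, hk2⟩ := hθc.exists_bound_of_continuous hθ.continuous
  have hsl : ∀ {u : ℝ × (E d × E d) → ℝ}, Measurable u → ∀ {c : ℝ},
      (∀ᵐ t ∂(volume.restrict (Ioo 0 T)), Integrable (fun z => u (t, z)) ∧
        ∫ z, ‖u (t, z)‖ ≤ c) → Integrable u (timePhase d T) := fun hu _ hc =>
    integrable_prod_of_bound hu.stronglyMeasurable hc
  have hfi : Integrable (fun p : ℝ × (E d × E d) => f p.1 p.2.1 p.2.2) (timePhase d T) :=
    hsl h.measurable hgb
  have hSi : Integrable (fun p : ℝ × (E d × E d) => (ε ^ 2)⁻¹ * collision D (f p.1) p.2)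
    (timePhase d T) := hsl hSm hSb
  have i1 : Integrable (fun p : ℝ × (E d × E d) => f p.1 p.2.1 p.2.2 * ψ p.2) (timePhase d T) :=
    hfi.mul_bdd (c := c1) hψm.aestronglyMeasurable (ae_of_all _ fun p => hc1 p.2)
  have i2 : Integrable (fun p : ℝ × (E d × E d) => f p.1 p.2.1 p.2.2 *
        fderiv ℝ ψ p.2 (vel ε⁻¹ (fun x => ε⁻¹ • F p.1 x) p.2)
          + (ε ^ 2)⁻¹ * collision D (f p.1) p.2 * ψ p.2) (timePhase d T) := by
    refine Integrable.add (hfi.mul_bdd (c := c2) hvm.aestronglyMeasurable ?_)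
      (hSi.mul_bdd (c := c1) hψm.aestronglyMeasurable (ae_of_all _ fun p => hc1 p.2))
    have := (Measure.quasiMeasurePreserving_fst (μ := volume.restrict (Ioo 0 T))
      (ν := (volume : Measure (E d × E d)))).ae hFb'
    exact this.mono fun p hp => hc2 p.2 _ (hp.1 p.2.1)
  have i1' := i1.bdd_mul (c := k1) ((hθ.continuous_deriv (by simp)).measurable.comp
    measurable_fst).aestronglyMeasurable (ae_of_all _ fun p => hk1 p.1)
  have i2' := i2.bdd_mul (c := k2) (hθ.continuous.measurable.comp
    measurable_fst).aestronglyMeasurable (ae_of_all _ fun p => hk2 p.1)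
  have i3 : Integrable (fun p : ℝ × (E d × E d) =>
      ε ^ 2 * (deriv θ p.1 * (f p.1 p.2.1 p.2.2 * ψ p.2)) + ε ^ 2 * (θ p.1 *
        (f p.1 p.2.1 p.2.2 * fderiv ℝ ψ p.2 (vel ε⁻¹ (fun x => ε⁻¹ • F p.1 x) p.2)
          + (ε ^ 2)⁻¹ * collision D (f p.1) p.2 * ψ p.2)))
      ((volume.restrict (Ioo 0 T)).prod volume) := (i1'.const_mul _).add (i2'.const_mul _)
  rw [e1, timePhase, integral_prod _ i3] at hw
  have e3 : ∀ᵐ t ∂(volume.restrict (Ioo 0 T)),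
      ∫ z : E d × E d, (ε ^ 2 * (deriv θ t * (f t z.1 z.2 * ψ z)) + ε ^ 2 * (θ t *
        (f t z.1 z.2 * fderiv ℝ ψ z (vel ε⁻¹ (fun x => ε⁻¹ • F t x) z)
          + (ε ^ 2)⁻¹ * collision D (f t) z * ψ z)))
      = ε ^ 2 * ((∫ z : E d × E d, f t z.1 z.2 * ψ z) * deriv θ t
        + (∫ z : E d × E d, (f t z.1 z.2 * fderiv ℝ ψ z (vel ε⁻¹ (fun x => ε⁻¹ • F t x) z)
          + (ε ^ 2)⁻¹ * collision D (f t) z * ψ z)) * θ t) := by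
    filter_upwards [hI1, hI2] with t ht1 ht2
    rw [integral_add ((ht1.1.const_mul _).const_mul _) ((ht2.1.const_mul _).const_mul _)]
    simp only [integral_const_mul]
    ring
  have e4 : ∫ q : E d × E d, f0 q.1 q.2 * φ (0, q.1, q.2)
      = (∫ z : E d × E d, f0 z.1 z.2 * ψ z) * θ 0 := by
    rw [← integral_mul_const]
    refine integral_congr_ae (ae_of_all _ fun q => ?_)
    simp only [hφ]; ring
  rw [integral_congr_ae e3, integral_const_mul, e4, ← mul_add] at hw
  exact (mul_eq_zero.mp hw).resolve_left hiε

end IsSolution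

end

/-! ### Kinetic equation with a given bounded force: mass and kinetic energy -/

section

variable {d : ℕ}

/-- Fatou's lemma for integrals of nonnegative functions. -/
theorem integrable_and_integral_le_of_tendsto {α : Type*} [MeasurableSpace α] {μ : Measure α}
    {u : ℕ → α → ℝ} {v : α → ℝ} {C : ℝ} (hC : 0 ≤ C) (hu : ∀ n, Integrable (u n) μ)
    (h0 : ∀ n, ∀ᵐ x ∂μ, 0 ≤ u n x) (hle : ∀ n, ∫ x, u n x ∂μ ≤ C) (hv : AEStronglyMeasurable v μ)
    (hv0 : ∀ᵐ x ∂μ, 0 ≤ v x) (hlim : ∀ᵐ x ∂μ, Tendsto (fun n => u n x) atTop (𝓝 (v x))) :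
    Integrable v μ ∧ ∫ x, v x ∂μ ≤ C := by
  have h1 : ∫⁻ x, ENNReal.ofReal (v x) ∂μ ≤ ENNReal.ofReal C := by
    calc ∫⁻ x, ENNReal.ofReal (v x) ∂μ
        = ∫⁻ x, liminf (fun n => ENNReal.ofReal (u n x)) atTop ∂μ := by
          refine lintegral_congr_ae (hlim.mono fun x hx => ?_)
          exact ((ENNReal.continuous_ofReal.tendsto _).comp hx).liminf_eq.symm
      _ ≤ liminf (fun n => ∫⁻ x, ENNReal.ofReal (u n x) ∂μ) atTop :=
          lintegral_liminf_le' fun n => (hu n).1.aemeasurable.ennreal_ofReal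
      _ ≤ ENNReal.ofReal C := by
          refine liminf_le_of_le (by isBoundedDefault) fun b hb => ?_
          obtain ⟨n, hn⟩ := hb.exists
          refine hn.trans ?_
          rw [← ofReal_integral_eq_lintegral_ofReal (hu n) (h0 n)]
          exact ENNReal.ofReal_le_ofReal (hle n)
  refine ⟨⟨hv, ?_⟩, ?_⟩
  · rw [hasFiniteIntegral_iff_ofReal hv0]
    exact h1.trans_lt ENNReal.ofReal_lt_top
  · rw [integral_eq_lintegral_of_nonneg_ae hv0 hv]
    exact ENNReal.toReal_le_of_le_ofReal hC h1

namespace IsTransport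

variable {T a B K : ℝ} {L : ℝ≥0} {F : ℝ → E d → E d} {g S : ℝ → E d × E d → ℝ}
  {g₀ : E d × E d → ℝ} {Γ A : E d → ℝ → ℝ} {G : E d → ℝ → E d →L[ℝ] ℝ} {C : ℝ≥0} {w : E d → ℝ}

/-- Complement to `renormalized_of_bounded`: inequalities between rates can be integrated only when
the rates are integrable, as the Bochner integral of a nonintegrable function is zero by convention.
-/
theorem integrable_renormalized_rate (h : IsTransport T a B K L F g S g₀)
    (hΓ : IsRenorm Γ A G C w) {ψ : E d → ℝ} (hψ : ContDiff ℝ 1 ψ) {Kψ : ℝ}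
    (hψb : ∀ x, |ψ x| ≤ Kψ) {W : E d → ℝ} {K' : ℝ} (hwW : ∀ ξ, w ξ ≤ W ξ)
    (hψW : ∀ x ξ, |fderiv ℝ ψ x (a • ξ)| ≤ W ξ)
    (hWg : ∀ᵐ t ∂(volume.restrict (Ioo 0 T)), Integrable (fun z : E d × E d => W z.2 * |g t z|) ∧
      ∫ z : E d × E d, W z.2 * |g t z| ≤ K') :
    (∀ᵐ s ∂(volume.restrict (Ioo 0 T)),
      Integrable fun z : E d × E d => Γ z.2 (g s z) * fderiv ℝ ψ z.1 (a • z.2)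
        + ψ z.1 * (G z.2 (g s z) (F s z.1) + A z.2 (g s z) * S s z)) ∧
    IntegrableOn (fun s => ∫ z : E d × E d, (Γ z.2 (g s z) * fderiv ℝ ψ z.1 (a • z.2)
        + ψ z.1 * (G z.2 (g s z) (F s z.1) + A z.2 (g s z) * S s z))) (Ioo 0 T) := by
  have hW0 : ∀ ξ, 0 ≤ W ξ := fun ξ => (hΓ.weight_nonneg ξ).trans (hwW ξ)
  have hKψ0 : 0 ≤ Kψ := (abs_nonneg _).trans (hψb 0)
  have hψd : Continuous (fderiv ℝ ψ) := hψ.continuous_fderiv one_ne_zero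
  have hQm : Measurable fun p : ℝ × (E d × E d) =>
      Γ p.2.2 (g p.1 p.2) * fderiv ℝ ψ p.2.1 (a • p.2.2)
        + ψ p.2.1 * (G p.2.2 (g p.1 p.2) (F p.1 p.2.1) + A p.2.2 (g p.1 p.2) * S p.1 p.2) := by
    have m2 : Measurable fun p : ℝ × (E d × E d) => p.2.2 := measurable_snd.comp measurable_snd
    have m1 : Measurable fun p : ℝ × (E d × E d) => p.2.1 := measurable_fst.comp measurable_snd
    have mF : Measurable fun p : ℝ × (E d × E d) => F p.1 p.2.1 :=
      h.F_meas.comp (measurable_fst.prodMk m1)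
    have mΓ := hΓ.continuous_uncurry.measurable.comp (m2.prodMk h.g_meas)
    have mA := hΓ.continuous_right.measurable.comp (m2.prodMk h.g_meas)
    have mG := hΓ.continuous_left.measurable.comp ((m2.prodMk h.g_meas).prodMk mF)
    have hdc : Continuous fun q : E d × E d => fderiv ℝ ψ q.1 (a • q.2) := by fun_prop
    exact (mΓ.mul (hdc.measurable.comp measurable_snd)).add
      ((hψ.continuous.measurable.comp m1).mul (mG.add (mA.mul h.S_meas)))
  have key : ∀ᵐ s ∂(volume.restrict (Ioo 0 T)),
      Integrable (fun z : E d × E d => Γ z.2 (g s z) * fderiv ℝ ψ z.1 (a • z.2)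
        + ψ z.1 * (G z.2 (g s z) (F s z.1) + A z.2 (g s z) * S s z)) ∧
      ‖∫ z : E d × E d, (Γ z.2 (g s z) * fderiv ℝ ψ z.1 (a • z.2)
        + ψ z.1 * (G z.2 (g s z) (F s z.1) + A z.2 (g s z) * S s z))‖
        ≤ (C + Kψ * B) * K' + Kψ * C * K := by
    filter_upwards [h.g_bound, h.S_bound, h.F_bound, hWg] with s h1 h2 h3 h4
    have hB0 : 0 ≤ B := (norm_nonneg _).trans (h3.1 0)
    have hD : Integrable fun z : E d × E d => (C + Kψ * B) * (W z.2 * |g s z|) + Kψ * C * |S s z| :=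
      (h4.1.const_mul _).fun_add (h2.1.abs.const_mul _)
    have hle : ∀ᵐ z : E d × E d, ‖Γ z.2 (g s z) * fderiv ℝ ψ z.1 (a • z.2)
        + ψ z.1 * (G z.2 (g s z) (F s z.1) + A z.2 (g s z) * S s z)‖
        ≤ (C + Kψ * B) * (W z.2 * |g s z|) + Kψ * C * |S s z| := by
      refine ae_of_all _ fun z => ?_
      have q2 : |G z.2 (g s z) (F s z.1)| ≤ W z.2 * |g s z| * B := by
        refine ((G z.2 (g s z)).le_opNorm _).trans (mul_le_mul ?_ (h3.1 _) (norm_nonneg _) ?_)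
        · exact (hΓ.norm_left_le _ _).trans (by gcongr; exact hwW _)
        · exact mul_nonneg (hW0 _) (abs_nonneg _)
      have q3 : |A z.2 (g s z) * S s z| ≤ C * |S s z| := by
        rw [abs_mul]; gcongr; exact hΓ.bound _ _
      calc _ ≤ |Γ z.2 (g s z)| * |fderiv ℝ ψ z.1 (a • z.2)|
            + |ψ z.1| * (|G z.2 (g s z) (F s z.1)| + |A z.2 (g s z) * S s z|) := by
            rw [Real.norm_eq_abs]
            refine (abs_add_le _ _).trans ?_
            rw [abs_mul, abs_mul]
            gcongr
            exact abs_add_le _ _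
        _ ≤ (C * |g s z|) * W z.2 + Kψ * (W z.2 * |g s z| * B + C * |S s z|) := by
            gcongr
            · exact hΓ.abs_le _ _
            · exact hψW _ _
            · exact hψb _
        _ = _ := by ring
    refine ⟨hD.mono' (hQm.comp measurable_prodMk_left).aestronglyMeasurable hle, ?_⟩
    refine (norm_integral_le_of_norm_le hD hle).trans ?_
    rw [integral_add (h4.1.const_mul _) (h2.1.abs.const_mul _), integral_const_mul,
      integral_const_mul]
    gcongr
    exacts [h4.2, h2.2]
  refine ⟨key.mono fun s hs => hs.1, ?_⟩
  exact (integrable_const ((C + Kψ * B) * K' + Kψ * C * K)).mono'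
    (hQm.stronglyMeasurable.integral_prod_right').aestronglyMeasurable (key.mono fun s hs => hs.2)

end IsTransport

/-- A nonnegative solution of the kinetic equation with a given bounded force `ε⁻¹ F`. -/
structure IsKinetic (T D ε B K : ℝ) (L : ℝ≥0) (F : ℝ → E d → E d) (f0 : E d → E d → ℝ)
    (f : ℝ → E d → E d → ℝ) : Prop where
  T_pos : 0 < T
  D_pos : 0 < D
  ε_pos : 0 < ε
  ε_lt : ε < 1
  B_nonneg : 0 ≤ B
  datum : IsInitialDatum f0
  nonneg : ∀ t x ξ, 0 ≤ f t x ξ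
  transport : IsTransport T ε⁻¹ (ε⁻¹ * B) K L (fun t x => ε⁻¹ • F t x) (fun t z => f t z.1 z.2)
    (fun t z => (ε ^ 2)⁻¹ * collision D (f t) z) (fun z => f0 z.1 z.2)

/-- The mass of a phase space density. -/
def mass (g : E d → E d → ℝ) : ℝ := ∫ z : E d × E d, g z.1 z.2

namespace IsKinetic

variable {T D ε B K : ℝ} {L : ℝ≥0} {F : ℝ → E d → E d} {f0 : E d → E d → ℝ}
  {f : ℝ → E d → E d → ℝ}

theorem measurable (h : IsKinetic T D ε B K L F f0 f) :
    Measurable fun p : ℝ × E d × E d => f p.1 p.2.1 p.2.2 := h.transport.g_meas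

theorem measurable_slice (h : IsKinetic T D ε B K L F f0 f) (t : ℝ) :
    Measurable fun z : E d × E d => f t z.1 z.2 := h.measurable.comp measurable_prodMk_left

/-- The equation is tested with the constant 1: transport disappears and relaxation has zero
integral. The weight W may be taken to be zero, so no moment bound is needed beforehand. -/
theorem ae_mass_eq (h : IsKinetic T D ε B K L F f0 f) : ∀ᵐ t ∂(volume.restrict (Ioo 0 T)),
    Integrable (fun z : E d × E d => f t z.1 z.2) ∧ mass (f t) = mass f0 := by
  have h1 := h.transport.renormalized_of_bounded (isRenorm_linear (d := d) (ψ := fun _ => 1)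
    contDiff_const (K := 1) (by simp) (w := fun _ => 0) continuous_const (by simp)) h.T_pos
    (ψ := fun _ => 1) contDiff_const (Kψ := 1) (by simp) (W := fun _ => 0) (K' := 0) (by simp)
    (by simp) (by simp)
  filter_upwards [h1, h.transport.g_bound, ae_restrict_mem measurableSet_Ioo] with t ht1 ht2 htT
  refine ⟨ht2.1, ?_⟩
  have hz : ∫ s in Ioc 0 t, ∫ z : E d × E d, (ε ^ 2)⁻¹ * collision D (f s) z = 0 := by
    refine integral_eq_zero_of_ae ?_
    have : Ioc 0 t ⊆ Ioo 0 T := fun s hs => ⟨hs.1, hs.2.trans_lt htT.2⟩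
    filter_upwards [ae_restrict_of_ae_restrict_of_subset this h.transport.g_bound] with s hs
    have := integral_mul_collision h.D_pos hs.1 (φ := fun _ => 1) measurable_const (K := 1) (by simp)
    simp only [one_mul] at this
    simp [integral_const_mul, this]
  simp only [one_mul, fderiv_fun_const, Pi.zero_apply, zero_apply, mul_zero, smul_zero,
    zero_add] at ht1
  rw [hz, add_zero] at ht1
  exact ht1

/-! ### Kinetic energy -/

end IsKinetic

/-- A bounded approximation of `‖ξ‖²`. -/
def energyCut (κ : ℝ) (ξ : E d) : ℝ := ‖ξ‖ ^ 2 / (1 + κ * ‖ξ‖ ^ 2)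

section energyCut

variable {κ : ℝ}

theorem hasFDerivAt_energyCut (hκ : 0 < κ) (ξ : E d) :
    HasFDerivAt (energyCut κ) ((2 / (1 + κ * ‖ξ‖ ^ 2) ^ 2) • innerSL ℝ ξ) ξ := by
  have h1 : HasFDerivAt (fun ξ : E d => ‖ξ‖ ^ 2) (2 • innerSL ℝ ξ) ξ := by
    simpa using (hasStrictFDerivAt_norm_sq ξ).hasFDerivAt
  have hp : (1 + κ * ‖ξ‖ ^ 2) ≠ 0 := by positivity
  have h2 : HasDerivAt (fun s : ℝ => s / (1 + κ * s)) (1 / (1 + κ * ‖ξ‖ ^ 2) ^ 2) (‖ξ‖ ^ 2) := by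
    have h3 := (hasDerivAt_id (‖ξ‖ ^ 2)).fun_div
      (((hasDerivAt_id (‖ξ‖ ^ 2)).const_mul κ).const_add 1) hp
    refine h3.congr_deriv ?_
    simp only [id]
    ring
  refine (h2.comp_hasFDerivAt ξ h1).congr_fderiv ?_
  ext v
  simp
  ring

theorem contDiff_energyCut (hκ : 0 < κ) : ContDiff ℝ 1 (energyCut (d := d) κ) := by
  unfold energyCut
  refine (contDiff_norm_sq ℝ).div (contDiff_const.add (contDiff_const.mul (contDiff_norm_sq ℝ)))
    fun ξ => by positivity

theorem energyCut_nonneg (hκ : 0 < κ) (ξ : E d) : 0 ≤ energyCut κ ξ := by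
  unfold energyCut; positivity

theorem energyCut_le (hκ : 0 < κ) (ξ : E d) : energyCut κ ξ ≤ ‖ξ‖ ^ 2 := by
  unfold energyCut
  exact div_le_self (by positivity) (le_add_of_nonneg_right (by positivity))

theorem energyCut_le_inv (hκ : 0 < κ) (ξ : E d) : energyCut κ ξ ≤ κ⁻¹ := by
  unfold energyCut
  rw [div_le_iff₀ (by positivity)]
  have : κ⁻¹ * (1 + κ * ‖ξ‖ ^ 2) = κ⁻¹ + ‖ξ‖ ^ 2 := by field_simp
  rw [this]
  have := inv_pos.mpr hκ
  linarith

/-- The truncation keeps the relation |∇φ|² ≤ 4φ enjoyed by φ = |ξ|², uniformly in κ. It lets the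
work of a bounded force be absorbed by the energy itself. -/
theorem sq_norm_fderiv_energyCut_le (hκ : 0 < κ) (ξ : E d) :
    ‖fderiv ℝ (energyCut κ) ξ‖ ^ 2 ≤ 4 * energyCut κ ξ := by
  rw [(hasFDerivAt_energyCut hκ ξ).fderiv, norm_smul, innerSL_apply_norm, mul_pow, norm_div,
    Real.norm_ofNat, Real.norm_of_nonneg (by positivity), energyCut, div_pow, ← pow_mul]
  set s := ‖ξ‖ ^ 2
  have hs : 0 ≤ s := by positivity
  have h1 : 1 ≤ 1 + κ * s := le_add_of_nonneg_right (by positivity)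
  have h2 : (1 + κ * s) ≤ (1 + κ * s) ^ 4 := le_self_pow₀ h1 (by norm_num)
  rw [div_mul_eq_mul_div, mul_div_assoc', show (2 : ℝ) ^ 2 = 4 by norm_num]
  exact div_le_div_of_nonneg_left (by positivity) (by positivity) h2

theorem tendsto_energyCut (ξ : E d) :
    Tendsto (fun n : ℕ => energyCut (1 / ((n : ℝ) + 1)) ξ) atTop (𝓝 (‖ξ‖ ^ 2)) := by
  have h1 := (tendsto_one_div_add_atTop_nhds_zero_nat (𝕜 := ℝ)).mul_const (‖ξ‖ ^ 2)
  have h2 := (tendsto_const_nhds (x := ‖ξ‖ ^ 2)).div (h1.const_add 1) (by simp)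
  simp only [zero_mul, add_zero, div_one] at h2
  exact h2

end energyCut

theorem IsInitialDatum.integrable_sq {f0 : E d → E d → ℝ} (h : IsInitialDatum f0) :
    Integrable fun z : E d × E d => ‖z.2‖ ^ 2 * f0 z.1 z.2 := by
  refine h.integrable.mono' (Measurable.aestronglyMeasurable
    ((by fun_prop : Measurable fun z : E d × E d => ‖z.2‖ ^ 2).mul h.measurable))
    (ae_of_all _ fun z => ?_)
  have h0 := h.nonneg z.1 z.2
  rw [Real.norm_of_nonneg (by positivity)]
  have : 0 ≤ (1 + ‖z.1‖ + |Real.log (f0 z.1 z.2)|) * f0 z.1 z.2 := by positivity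
  linarith

theorem IsInitialDatum.integrable_norm {f0 : E d → E d → ℝ} (h : IsInitialDatum f0) :
    Integrable fun z : E d × E d => (1 + ‖z.1‖) * f0 z.1 z.2 := by
  refine h.integrable.mono' (Measurable.aestronglyMeasurable
    ((by fun_prop : Measurable fun z : E d × E d => 1 + ‖z.1‖).mul h.measurable))
    (ae_of_all _ fun z => ?_)
  have h0 := h.nonneg z.1 z.2
  rw [Real.norm_of_nonneg (by positivity)]
  have : 0 ≤ (‖z.2‖ ^ 2 + |Real.log (f0 z.1 z.2)|) * f0 z.1 z.2 := by positivity
  linarith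

/-- The second moment of the Maxwellian. -/
def maxwellianEnergy (d : ℕ) (D : ℝ) : ℝ := ∫ ξ : E d, ‖ξ‖ ^ 2 * maxwellian D ξ

/-- The bound of the kinetic energy. -/
def energyBound (D B : ℝ) (f0 : E d → E d → ℝ) : ℝ :=
  max (∫ z : E d × E d, ‖z.2‖ ^ 2 * f0 z.1 z.2) (2 * (2 * B ^ 2 + maxwellianEnergy d D) * mass f0)

namespace IsKinetic

variable {T D ε B K : ℝ} {L : ℝ≥0} {F : ℝ → E d → E d} {f0 : E d → E d → ℝ}
  {f : ℝ → E d → E d → ℝ}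

theorem norm_force_le (h : IsKinetic T D ε B K L F f0 f) :
    ∀ᵐ t ∂(volume.restrict (Ioo 0 T)), ∀ x, ‖F t x‖ ≤ B := by
  filter_upwards [h.transport.F_bound] with t ht x
  have h1 := ht.1 x
  have h2 := inv_pos.mpr h.ε_pos
  rw [norm_smul, Real.norm_of_nonneg h2.le] at h1
  exact le_of_mul_le_mul_left h1 h2

theorem maxwellianEnergy_nonneg (hD : 0 < D) : 0 ≤ maxwellianEnergy d D :=
  integral_nonneg fun ξ => mul_nonneg (by positivity) (maxwellian_pos hD ξ).le

theorem mass_datum_nonneg (h : IsInitialDatum f0) : 0 ≤ mass f0 :=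
  integral_nonneg fun _ => h.nonneg _ _

theorem energyBound_nonneg (h : IsInitialDatum f0) : 0 ≤ energyBound D B f0 :=
  le_max_of_le_left (integral_nonneg fun z => mul_nonneg (by positivity) (h.nonneg _ _))

/-- The rate of the truncated energy e is at most ε⁻²(2B²m + m∫|ξ|²M − e/2), with m the mass. It is
nonpositive once e exceeds `energyBound`, so the barrier argument gives a bound independent of ε, κ
and T. -/
theorem ae_integral_energyCut_le (h : IsKinetic T D ε B K L F f0 f) {κ : ℝ} (hκ : 0 < κ) :
    ∀ᵐ t ∂(volume.restrict (Ioo 0 T)),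
      ∫ z : E d × E d, energyCut κ z.2 * f t z.1 z.2 ≤ energyBound D B f0 := by
  have hD := h.D_pos
  have hb : ∀ ξ : E d, |energyCut κ ξ| ≤ (Real.toNNReal κ⁻¹ : ℝ) := fun ξ => by
    rw [Real.coe_toNNReal _ (by positivity), abs_of_nonneg (energyCut_nonneg hκ ξ)]
    exact energyCut_le_inv hκ ξ
  have hw : ∀ ξ : E d, ‖fderiv ℝ (energyCut κ) ξ‖ ≤ 1 + 4 * κ⁻¹ := fun ξ => by
    have h1 := sq_norm_fderiv_energyCut_le hκ ξ
    have h2 := energyCut_le_inv hκ ξ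
    nlinarith [sq_nonneg (‖fderiv ℝ (energyCut κ) ξ‖ - 1), norm_nonneg (fderiv ℝ (energyCut κ) ξ)]
  have hR := isRenorm_linear (contDiff_energyCut (d := d) hκ) hb (w := fun _ => 1 + 4 * κ⁻¹)
    continuous_const hw
  have hWg : ∀ᵐ t ∂(volume.restrict (Ioo 0 T)),
      Integrable (fun z : E d × E d => (1 + 4 * κ⁻¹) * |f t z.1 z.2|) ∧
      ∫ z : E d × E d, (1 + 4 * κ⁻¹) * |f t z.1 z.2| ≤ (1 + 4 * κ⁻¹) * K := by
    filter_upwards [h.transport.g_bound] with t ht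
    refine ⟨ht.1.abs.const_mul _, ?_⟩
    rw [integral_const_mul]
    exact mul_le_mul_of_nonneg_left ht.2 (by positivity)
  have hpos : ∀ ξ : E d, (0 : ℝ) ≤ 1 + 4 * κ⁻¹ := fun ξ => by positivity
  have h1 := h.transport.renormalized_of_bounded hR h.T_pos (ψ := fun _ => 1) contDiff_const
    (Kψ := 1) (by simp) (W := fun _ => 1 + 4 * κ⁻¹) (fun ξ => le_rfl)
    (by simpa using hpos) hWg
  have h2 := h.transport.integrable_renormalized_rate hR (ψ := fun _ => 1) contDiff_const
    (Kψ := 1) (by simp) (W := fun _ => 1 + 4 * κ⁻¹) (fun ξ => le_rfl)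
    (by simpa using hpos) hWg
  simp only [fderiv_fun_const, Pi.zero_apply, zero_apply, mul_zero, zero_add, one_mul,
    smul_apply, smul_eq_mul, map_smul] at h1 h2
  set q : ℝ → ℝ := fun s => ∫ z : E d × E d, (ε⁻¹ * (f s z.1 z.2 * fderiv ℝ (energyCut κ) z.2 (F s z.1))
    + energyCut κ z.2 * ((ε ^ 2)⁻¹ * collision D (f s) z)) with hq
  have h1' : ∀ᵐ t ∂(volume.restrict (Ioo 0 T)), ∫ z : E d × E d, energyCut κ z.2 * f t z.1 z.2
      = (∫ z : E d × E d, energyCut κ z.2 * f0 z.1 z.2) + ∫ s in (0 : ℝ)..t, q s := by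
    filter_upwards [h1, ae_restrict_mem measurableSet_Ioo] with t ht htT
    rw [ht, intervalIntegral.integral_of_le htT.1.le]
  have hqi : IntervalIntegrable q volume 0 T := by
    rw [intervalIntegrable_iff_integrableOn_Ioo_of_le h.T_pos.le]; exact h2.2
  have h0 : ∫ z : E d × E d, energyCut κ z.2 * f0 z.1 z.2 ≤ energyBound D B f0 := by
    refine le_trans (integral_mono_of_nonneg (ae_of_all _ fun z => ?_) h.datum.integrable_sq
      (ae_of_all _ fun z => ?_)) (le_max_left _ _)
    · exact mul_nonneg (energyCut_nonneg hκ _) (h.datum.nonneg _ _)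
    · exact mul_le_mul_of_nonneg_right (energyCut_le hκ _) (h.datum.nonneg _ _)
  have hbar : ∀ᵐ s, s ∈ Ioo 0 T → energyBound D B f0 <
      ((∫ z : E d × E d, energyCut κ z.2 * f0 z.1 z.2) + ∫ r in (0 : ℝ)..s, q r) → q s ≤ 0 := by
    rw [← ae_restrict_iff' measurableSet_Ioo]
    filter_upwards [h1', h2.1, h.ae_mass_eq, h.norm_force_le] with s hs1 hs2 hs3 hs4 hlt
    rw [← hs1] at hlt
    have hme : Measurable fun z : E d × E d => energyCut κ z.2 :=
      (contDiff_energyCut hκ).continuous.measurable.comp measurable_snd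
    have i1 : Integrable fun z : E d × E d => energyCut κ z.2 * f s z.1 z.2 :=
      hs3.1.bdd_mul (c := (Real.toNNReal κ⁻¹ : ℝ)) hme.aestronglyMeasurable
        (ae_of_all _ fun z => hb z.2)
    have i2 : Integrable fun z : E d × E d => density (f s) z.1 * (‖z.2‖ ^ 2 * maxwellian D z.2) :=
      integrable_density_mul hs3.1 (integrable_sq_mul_maxwellian hD)
    have hεi : 1 ≤ ε⁻¹ := (one_le_inv₀ h.ε_pos).mpr h.ε_lt.le
    have hle : q s ≤ ∫ z : E d × E d, (ε ^ 2)⁻¹ * (2 * B ^ 2 * f s z.1 z.2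
        + density (f s) z.1 * (‖z.2‖ ^ 2 * maxwellian D z.2)
        - 1 / 2 * (energyCut κ z.2 * f s z.1 z.2)) := by
      refine integral_mono hs2 (((((hs3.1.const_mul (2 * B ^ 2)).fun_add i2).sub
        (i1.const_mul (1 / 2)))).const_mul _) fun z => ?_
      have hf := h.nonneg s z.1 z.2
      have hρ := density_nonneg (h.nonneg s) z.1
      have hM := (maxwellian_pos hD z.2).le
      -- Young's inequality, balanced so that only half of the damping is spent: 8B|∇φ| ≤ |∇φ|² +
      -- 16B² ≤ 4φ + 16B².
      have a1 : fderiv ℝ (energyCut κ) z.2 (F s z.1) ≤ 1 / 2 * energyCut κ z.2 + 2 * B ^ 2 := by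
        have b1 := (le_abs_self _).trans ((fderiv ℝ (energyCut κ) z.2).le_opNorm (F s z.1))
        have b2 := mul_le_mul_of_nonneg_left (hs4 z.1) (norm_nonneg (fderiv ℝ (energyCut κ) z.2))
        have b3 := sq_norm_fderiv_energyCut_le hκ z.2
        nlinarith [sq_nonneg (‖fderiv ℝ (energyCut κ) z.2‖ - 4 * B)]
      -- Here ε < 1 is used: the work of the force carries ε⁻¹ ≤ ε⁻², the scale of the relaxation.
      have a2 : ε⁻¹ * fderiv ℝ (energyCut κ) z.2 (F s z.1)
          ≤ (ε ^ 2)⁻¹ * (1 / 2 * energyCut κ z.2 + 2 * B ^ 2) := by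
        have b1 : 0 ≤ 1 / 2 * energyCut κ z.2 + 2 * B ^ 2 := by
          have := energyCut_nonneg hκ z.2; positivity
        calc _ ≤ ε⁻¹ * (1 / 2 * energyCut κ z.2 + 2 * B ^ 2) := by gcongr
          _ ≤ _ := by
            refine mul_le_mul_of_nonneg_right ?_ b1
            rw [← inv_pow]; exact le_self_pow₀ hεi two_ne_zero
      have a3 := mul_le_mul_of_nonneg_left a2 hf
      have a4 := mul_le_mul_of_nonneg_right (energyCut_le hκ z.2) (mul_nonneg hρ hM)
      have a5 := mul_le_mul_of_nonneg_left a4 (by positivity : 0 ≤ (ε ^ 2)⁻¹)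
      simp only [collision]
      linarith
    refine hle.trans ?_
    rw [integral_const_mul]
    refine mul_nonpos_of_nonneg_of_nonpos (by positivity) ?_
    rw [integral_sub ((hs3.1.const_mul (2 * B ^ 2)).fun_add i2) (i1.const_mul (1 / 2)),
      integral_add (hs3.1.const_mul (2 * B ^ 2)) i2, integral_const_mul, integral_const_mul,
      integral_density_mul hs3.1 (fun ξ => ‖ξ‖ ^ 2 * maxwellian D ξ)]
    have e1 : ∫ z : E d × E d, f s z.1 z.2 = mass f0 := hs3.2
    have e2 : ∫ ξ : E d, ‖ξ‖ ^ 2 * maxwellian D ξ = maxwellianEnergy d D := rfl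
    rw [e1, e2]
    have := (le_max_right _ _).trans_lt hlt
    linarith
  filter_upwards [h1', ae_restrict_mem measurableSet_Ioo] with t ht htT
  rw [ht]
  exact primitive_le_of_barrier hqi h0 hbar htT

theorem ae_energy_le (h : IsKinetic T D ε B K L F f0 f) : ∀ᵐ t ∂(volume.restrict (Ioo 0 T)),
    Integrable (fun z : E d × E d => ‖z.2‖ ^ 2 * f t z.1 z.2) ∧
      ∫ z : E d × E d, ‖z.2‖ ^ 2 * f t z.1 z.2 ≤ energyBound D B f0 := by
  have h1 := ae_all_iff.mpr fun n : ℕ =>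
    h.ae_integral_energyCut_le (κ := 1 / ((n : ℝ) + 1)) (by positivity)
  filter_upwards [h1, h.transport.g_bound] with t ht ht2
  have hm : Measurable fun z : E d × E d => ‖z.2‖ ^ 2 * f t z.1 z.2 :=
    (by fun_prop : Measurable fun z : E d × E d => ‖z.2‖ ^ 2).mul (h.measurable_slice t)
  have hi : ∀ n : ℕ, Integrable fun z : E d × E d =>
      energyCut (1 / ((n : ℝ) + 1)) z.2 * f t z.1 z.2 := by
    intro n
    have hκ : (0 : ℝ) < 1 / ((n : ℝ) + 1) := by positivity
    have hme : Measurable fun z : E d × E d => energyCut (1 / ((n : ℝ) + 1)) z.2 :=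
      (contDiff_energyCut hκ).continuous.measurable.comp measurable_snd
    refine ht2.1.bdd_mul (c := (1 / ((n : ℝ) + 1))⁻¹) hme.aestronglyMeasurable
      (ae_of_all _ fun z => ?_)
    rw [Real.norm_of_nonneg (energyCut_nonneg hκ _)]
    exact energyCut_le_inv hκ _
  have h0 : ∀ n : ℕ, ∀ z : E d × E d, 0 ≤ energyCut (1 / ((n : ℝ) + 1)) z.2 * f t z.1 z.2 :=
    fun n z => mul_nonneg (energyCut_nonneg (by positivity) _) (h.nonneg _ _ _)
  have h0' : ∀ z : E d × E d, 0 ≤ ‖z.2‖ ^ 2 * f t z.1 z.2 :=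
    fun z => mul_nonneg (by positivity) (h.nonneg _ _ _)
  exact integrable_and_integral_le_of_tendsto
    (energyBound_nonneg h.datum) hi (fun n => ae_of_all _ (h0 n)) ht hm.aestronglyMeasurable
    (ae_of_all _ h0') (ae_of_all _ fun z => (tendsto_energyCut z.2).mul_const _)

end IsKinetic

end

section

variable {d : ℕ}

/-! ### Flux and first moment in position -/

section flux

variable {g : E d → E d → ℝ} {ε : ℝ}

theorem integrable_norm_mul (hg : Integrable fun z : E d × E d => g z.1 z.2)
    (hg2 : Integrable fun z : E d × E d => ‖z.2‖ ^ 2 * g z.1 z.2) (hg0 : ∀ x ξ, 0 ≤ g x ξ) :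
    Integrable fun z : E d × E d => ‖z.2‖ * g z.1 z.2 := by
  have hm : AEStronglyMeasurable (fun z : E d × E d => ‖z.2‖) volume := by fun_prop
  refine (hg.add hg2).mono' (hm.mul hg.1) (ae_of_all _ fun z => ?_)
  rw [Real.norm_of_nonneg (mul_nonneg (norm_nonneg _) (hg0 _ _)), Pi.add_apply]
  nlinarith [norm_le_one_add_sq z.2, hg0 z.1 z.2]

theorem integrable_flux_integrand (hg : Integrable fun z : E d × E d => ‖z.2‖ * g z.1 z.2)
    (hgm : AEStronglyMeasurable (fun z : E d × E d => g z.1 z.2) volume) (ε : ℝ) :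
    Integrable fun z : E d × E d => (g z.1 z.2 / ε) • z.2 := by
  have hm : AEStronglyMeasurable (fun z : E d × E d => z.2) volume := by fun_prop
  have hd : AEStronglyMeasurable (fun z : E d × E d => g z.1 z.2 / ε) volume := by
    simpa only [div_eq_mul_inv] using hgm.mul_const ε⁻¹
  refine (hg.norm.const_mul |ε⁻¹|).mono' (hd.smul hm) (ae_of_all _ fun z => ?_)
  rw [norm_smul, norm_mul, norm_norm, div_eq_inv_mul, norm_mul, Real.norm_eq_abs ε⁻¹]
  exact le_of_eq (by ring)

theorem integrable_flux (hg : Integrable fun z : E d × E d => ‖z.2‖ * g z.1 z.2)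
    (hgm : AEStronglyMeasurable (fun z : E d × E d => g z.1 z.2) volume) (ε : ℝ) :
    Integrable (flux ε g) := (integrable_flux_integrand hg hgm ε).integral_prod_left

theorem integral_norm_flux_le (hg : Integrable fun z : E d × E d => ‖z.2‖ * g z.1 z.2)
    (hgm : AEStronglyMeasurable (fun z : E d × E d => g z.1 z.2) volume) (hε : 0 < ε)
    (hg0 : ∀ x ξ, 0 ≤ g x ξ) :
    ∫ x, ‖flux ε g x‖ ≤ ε⁻¹ * ∫ z : E d × E d, ‖z.2‖ * g z.1 z.2 := by
  have h1 := integrable_flux_integrand hg hgm ε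
  calc ∫ x, ‖flux ε g x‖ ≤ ∫ x, ∫ ξ, ‖(g x ξ / ε) • ξ‖ :=
        integral_mono (integrable_flux hg hgm ε).norm h1.norm.integral_prod_left fun x =>
          norm_integral_le_integral_norm _
    _ = ∫ z : E d × E d, ‖(g z.1 z.2 / ε) • z.2‖ := (integral_prod _ h1.norm).symm
    _ = _ := by
        rw [← integral_const_mul]
        refine integral_congr_ae (ae_of_all _ fun z => ?_)
        simp only
        rw [norm_smul, Real.norm_of_nonneg (div_nonneg (hg0 _ _) hε.le)]
        ring

/-- Testing the flux with a bounded covector field. -/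
theorem integral_mul_covector_le (hg : Integrable fun z : E d × E d => ‖z.2‖ * g z.1 z.2)
    (hgm : AEStronglyMeasurable (fun z : E d × E d => g z.1 z.2) volume)
    {ℓ : E d → E d →L[ℝ] ℝ} (hℓc : Continuous ℓ) (hℓ : ∀ x, ‖ℓ x‖ ≤ 1) (ε : ℝ) :
    ∫ z : E d × E d, g z.1 z.2 * ℓ z.1 (ε⁻¹ • z.2) ≤ ∫ x, ‖flux ε g x‖ := by
  have h1 := integrable_flux_integrand hg hgm ε
  have hm : AEStronglyMeasurable (fun z : E d × E d => ℓ z.1 (ε⁻¹ • z.2)) volume := by fun_prop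
  have h2 : Integrable fun z : E d × E d => g z.1 z.2 * ℓ z.1 (ε⁻¹ • z.2) := by
    refine (hg.norm.const_mul |ε⁻¹|).mono' (hgm.mul hm) (ae_of_all _ fun z => ?_)
    rw [norm_mul, norm_mul, norm_norm]
    have h3 := ((ℓ z.1).le_opNorm (ε⁻¹ • z.2)).trans
      (mul_le_mul_of_nonneg_right (hℓ z.1) (norm_nonneg _))
    rw [norm_smul, one_mul, Real.norm_eq_abs] at h3
    calc ‖g z.1 z.2‖ * ‖ℓ z.1 (ε⁻¹ • z.2)‖ ≤ ‖g z.1 z.2‖ * (|ε⁻¹| * ‖z.2‖) := by gcongr; exact h3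
      _ = _ := by ring
  have h4 := h1.prod_right_ae
  calc ∫ z : E d × E d, g z.1 z.2 * ℓ z.1 (ε⁻¹ • z.2)
      = ∫ x, ∫ ξ, g x ξ * ℓ x (ε⁻¹ • ξ) := integral_prod _ h2
    _ = ∫ x, ℓ x (flux ε g x) := by
        refine integral_congr_ae (h4.mono fun x hx => ?_)
        simp only [flux]
        rw [← (ℓ x).integral_comp_comm hx]
        refine integral_congr_ae (ae_of_all _ fun ξ => ?_)
        simp only [map_smul, smul_eq_mul]; ring
    _ ≤ ∫ x, ‖flux ε g x‖ := by
        refine (le_abs_self _).trans (norm_integral_le_of_norm_le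
          (f := fun x => ℓ x (flux ε g x)) (integrable_flux hg hgm ε).norm (ae_of_all _ fun x => ?_))
        exact ((ℓ x).le_opNorm _).trans
          ((mul_le_mul_of_nonneg_right (hℓ x) (norm_nonneg _)).trans_eq (one_mul _))

end flux

theorem stronglyMeasurable_flux (ε : ℝ) {f : ℝ → E d → E d → ℝ}
    (hf : Measurable fun p : ℝ × E d × E d => f p.1 p.2.1 p.2.2) :
    StronglyMeasurable fun p : ℝ × E d => flux ε (f p.1) p.2 := by
  refine StronglyMeasurable.integral_prod_right (f := fun (p : ℝ × E d) ξ => (f p.1 p.2 ξ / ε) • ξ)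
    (Measurable.stronglyMeasurable ?_)
  have h1 : Measurable fun q : (ℝ × E d) × E d => f q.1.1 q.1.2 q.2 :=
    hf.comp ((measurable_fst.comp measurable_fst).prodMk
      ((measurable_snd.comp measurable_fst).prodMk measurable_snd))
  exact (h1.div_const ε).smul measurable_snd

/-- A bounded smooth approximation of `√(1 + ‖x‖²)`. -/
def positionCut (κ : ℝ) (x : E d) : ℝ := √(1 + ‖x‖ ^ 2) / (1 + κ * √(1 + ‖x‖ ^ 2))

section positionCut

variable {κ : ℝ}

theorem hasFDerivAt_positionCut (hκ : 0 < κ) (x : E d) :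
    HasFDerivAt (positionCut κ)
      ((1 / (1 + κ * √(1 + ‖x‖ ^ 2)) ^ 2 / √(1 + ‖x‖ ^ 2)) • innerSL ℝ x) x := by
  have h1 : HasFDerivAt (fun ξ : E d => 1 + ‖ξ‖ ^ 2) (2 • innerSL ℝ x) x := by
    simpa using (hasStrictFDerivAt_norm_sq x).hasFDerivAt.const_add 1
  have hq : 1 + ‖x‖ ^ 2 ≠ 0 := by positivity
  have h1' := h1.sqrt hq
  have hp : (1 + κ * √(1 + ‖x‖ ^ 2)) ≠ 0 := by positivity
  have h2 : HasDerivAt (fun s : ℝ => s / (1 + κ * s)) (1 / (1 + κ * √(1 + ‖x‖ ^ 2)) ^ 2)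
      (√(1 + ‖x‖ ^ 2)) := by
    have h3 := (hasDerivAt_id (√(1 + ‖x‖ ^ 2))).fun_div
      (((hasDerivAt_id (√(1 + ‖x‖ ^ 2))).const_mul κ).const_add 1) hp
    refine h3.congr_deriv ?_
    simp only [id]
    ring
  refine (h2.comp_hasFDerivAt x h1').congr_fderiv ?_
  ext v
  simp
  ring

theorem contDiff_positionCut (hκ : 0 < κ) : ContDiff ℝ 1 (positionCut (d := d) κ) := by
  have h1 : ContDiff ℝ 1 fun x : E d => √(1 + ‖x‖ ^ 2) :=
    (contDiff_const.add (contDiff_norm_sq ℝ)).sqrt fun x => by positivity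
  exact h1.div (contDiff_const.add (contDiff_const.mul h1)) fun x => by positivity

theorem positionCut_nonneg (hκ : 0 < κ) (x : E d) : 0 ≤ positionCut κ x := by
  unfold positionCut; positivity

theorem sqrt_one_add_sq_le (x : E d) : √(1 + ‖x‖ ^ 2) ≤ 1 + ‖x‖ := by
  rw [Real.sqrt_le_left (by positivity)]
  nlinarith [norm_nonneg x]

theorem norm_le_sqrt_one_add_sq (x : E d) : ‖x‖ ≤ √(1 + ‖x‖ ^ 2) :=
  Real.le_sqrt_of_sq_le (by linarith)

theorem positionCut_le (hκ : 0 < κ) (x : E d) : positionCut κ x ≤ 1 + ‖x‖ := by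
  refine le_trans ?_ (sqrt_one_add_sq_le x)
  unfold positionCut
  exact div_le_self (by positivity) (le_add_of_nonneg_right (by positivity))

theorem positionCut_le_inv (hκ : 0 < κ) (x : E d) : positionCut κ x ≤ κ⁻¹ := by
  unfold positionCut
  rw [div_le_iff₀ (by positivity)]
  have : κ⁻¹ * (1 + κ * √(1 + ‖x‖ ^ 2)) = κ⁻¹ + √(1 + ‖x‖ ^ 2) := by field_simp
  rw [this]
  have := inv_pos.mpr hκ
  linarith

/-- A gradient bound free of κ, so that the growth of the truncated moment is controlled by the
total flux uniformly in the truncation. -/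
theorem norm_fderiv_positionCut_le (hκ : 0 < κ) (x : E d) :
    ‖fderiv ℝ (positionCut κ) x‖ ≤ 1 := by
  rw [(hasFDerivAt_positionCut hκ x).fderiv, norm_smul, innerSL_apply_norm,
    Real.norm_of_nonneg (by positivity)]
  have h0 := norm_le_sqrt_one_add_sq x
  have hp : 0 < √(1 + ‖x‖ ^ 2) := by positivity
  have h1 : 1 ≤ (1 + κ * √(1 + ‖x‖ ^ 2)) ^ 2 :=
    one_le_pow₀ (le_add_of_nonneg_right (by positivity))
  rw [div_mul_eq_mul_div, div_le_one hp]
  refine le_trans ?_ h0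
  exact mul_le_of_le_one_left (norm_nonneg _) ((div_le_one (by positivity)).mpr h1)

theorem tendsto_positionCut (x : E d) :
    Tendsto (fun n : ℕ => positionCut (1 / ((n : ℝ) + 1)) x) atTop (𝓝 (√(1 + ‖x‖ ^ 2))) := by
  have h1 := (tendsto_one_div_add_atTop_nhds_zero_nat (𝕜 := ℝ)).mul_const (√(1 + ‖x‖ ^ 2))
  have h2 := (tendsto_const_nhds (x := √(1 + ‖x‖ ^ 2))).div (h1.const_add 1) (by simp)
  simp only [zero_mul, add_zero, div_one] at h2
  exact h2

end positionCut

/-- The total flux over `(0,T)`. -/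
def totalFlux (T ε : ℝ) (f : ℝ → E d → E d → ℝ) : ℝ :=
  ∫ p, ‖flux ε (f p.1) p.2‖ ∂(timeSpace d T)

/-- The bound of the first moment in position of the initial datum. -/
def positionMoment (f0 : E d → E d → ℝ) : ℝ := ∫ z : E d × E d, (1 + ‖z.1‖) * f0 z.1 z.2

namespace IsKinetic

variable {T D ε B K : ℝ} {L : ℝ≥0} {F : ℝ → E d → E d} {f0 : E d → E d → ℝ}
  {f : ℝ → E d → E d → ℝ}

theorem ae_norm_mul (h : IsKinetic T D ε B K L F f0 f) : ∀ᵐ t ∂(volume.restrict (Ioo 0 T)),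
    Integrable (fun z : E d × E d => ‖z.2‖ * f t z.1 z.2) ∧
      ∫ z : E d × E d, ‖z.2‖ * f t z.1 z.2 ≤ mass f0 + energyBound D B f0 := by
  filter_upwards [h.ae_mass_eq, h.ae_energy_le] with t h1 h2
  have h3 := integrable_norm_mul h1.1 h2.1 (h.nonneg t)
  refine ⟨h3, ?_⟩
  calc _ ≤ ∫ z : E d × E d, (f t z.1 z.2 + ‖z.2‖ ^ 2 * f t z.1 z.2) := by
        refine integral_mono h3 (h1.1.add h2.1) fun z => ?_
        simp only
        nlinarith [norm_le_one_add_sq z.2, h.nonneg t z.1 z.2]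
    _ = mass f0 + ∫ z : E d × E d, ‖z.2‖ ^ 2 * f t z.1 z.2 := by
        rw [integral_add h1.1 h2.1, ← h1.2]; rfl
    _ ≤ _ := by linarith [h2.2]

/-- The energy gives this with a factor ε⁻¹. Only finiteness is kept; it makes `totalFlux`
meaningful in the argument that later bounds it uniformly. -/
theorem integrable_flux (h : IsKinetic T D ε B K L F f0 f) :
    Integrable (fun p : ℝ × E d => flux ε (f p.1) p.2) (timeSpace d T) := by
  refine integrable_prod_of_bound (stronglyMeasurable_flux ε h.measurable)
    (K := ε⁻¹ * (mass f0 + energyBound D B f0)) ?_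
  filter_upwards [h.ae_norm_mul] with t ht
  have hm := (h.measurable_slice t).aestronglyMeasurable (μ := volume)
  refine ⟨VCH.integrable_flux ht.1 hm ε, ?_⟩
  refine (integral_norm_flux_le ht.1 hm h.ε_pos (h.nonneg t)).trans ?_
  exact mul_le_mul_of_nonneg_left ht.2 (inv_nonneg.mpr h.ε_pos.le)

theorem totalFlux_nonneg : 0 ≤ totalFlux T ε f := integral_nonneg fun _ => norm_nonneg _

/-- For a function of x alone the collision term drops out and the transport term is ∫ ∇φ·J. Since
|∇φ| ≤ 1, the moment gains at most ∫|J|. -/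
theorem ae_integral_positionCut_le (h : IsKinetic T D ε B K L F f0 f) {κ : ℝ} (hκ : 0 < κ) :
    ∀ᵐ t ∂(volume.restrict (Ioo 0 T)),
      ∫ z : E d × E d, positionCut κ z.1 * f t z.1 z.2 ≤ positionMoment f0 + totalFlux T ε f := by
  have hb : ∀ x : E d, |positionCut κ x| ≤ κ⁻¹ := fun ξ => by
    rw [abs_of_nonneg (positionCut_nonneg hκ ξ)]
    exact positionCut_le_inv hκ ξ
  have hεi := inv_pos.mpr h.ε_pos
  have hdx : ∀ x ξ : E d, |fderiv ℝ (positionCut κ) x (ε⁻¹ • ξ)| ≤ ε⁻¹ * ‖ξ‖ := by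
    intro x ξ
    have h3 := ((fderiv ℝ (positionCut κ) x).le_opNorm (ε⁻¹ • ξ)).trans
      (mul_le_mul_of_nonneg_right (norm_fderiv_positionCut_le hκ x) (norm_nonneg _))
    rwa [norm_smul, one_mul, Real.norm_of_nonneg hεi.le] at h3
  have hWg : ∀ᵐ t ∂(volume.restrict (Ioo 0 T)),
      Integrable (fun z : E d × E d => ε⁻¹ * ‖z.2‖ * |f t z.1 z.2|) ∧
      ∫ z : E d × E d, ε⁻¹ * ‖z.2‖ * |f t z.1 z.2| ≤ ε⁻¹ * (mass f0 + energyBound D B f0) := by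
    filter_upwards [h.ae_norm_mul] with t ht
    simp_rw [abs_of_nonneg (h.nonneg t _ _), mul_assoc]
    refine ⟨ht.1.const_mul _, ?_⟩
    rw [integral_const_mul]
    exact mul_le_mul_of_nonneg_left ht.2 hεi.le
  have hR := isRenorm_linear (d := d) (ψ := fun _ => 1)
    contDiff_const (K := 1) (by simp) (w := fun _ => 0) continuous_const (by simp)
  have hw0 : ∀ ξ : E d, (0 : ℝ) ≤ ε⁻¹ * ‖ξ‖ := fun ξ => by positivity
  have h1 := h.transport.renormalized_of_bounded hR h.T_pos (contDiff_positionCut hκ) hb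
    (W := fun ξ => ε⁻¹ * ‖ξ‖) hw0 hdx hWg
  simp only [fderiv_fun_const, Pi.zero_apply, zero_apply, one_mul, smul_zero, zero_add] at h1
  have hJt : Integrable (fun s => ∫ x, ‖flux ε (f s) x‖) (volume.restrict (Ioo 0 T)) :=
    h.integrable_flux.norm.integral_prod_left
  filter_upwards [h1, ae_restrict_mem measurableSet_Ioo] with t ht htT
  rw [ht]
  have hsub : Ioc 0 t ⊆ Ioo 0 T := fun s hs => ⟨hs.1, hs.2.trans_lt htT.2⟩
  refine add_le_add ?_ ?_
  · refine integral_mono_of_nonneg (ae_of_all _ fun z => ?_) h.datum.integrable_norm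
      (ae_of_all _ fun z => ?_)
    · exact mul_nonneg (positionCut_nonneg hκ _) (h.datum.nonneg _ _)
    · exact mul_le_mul_of_nonneg_right (positionCut_le hκ _) (h.datum.nonneg _ _)
  · have hle : ∀ᵐ s ∂(volume.restrict (Ioo 0 T)),
        ∫ z : E d × E d, (f s z.1 z.2 * fderiv ℝ (positionCut κ) z.1 (ε⁻¹ • z.2)
          + positionCut κ z.1 * ((ε ^ 2)⁻¹ * collision D (f s) z)) ≤ ∫ x, ‖flux ε (f s) x‖ := by
      filter_upwards [h.ae_norm_mul, h.ae_mass_eq] with s hs hs2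
      have hm := (h.measurable_slice s).aestronglyMeasurable (μ := volume)
      have hdc : Continuous (fderiv ℝ (positionCut (d := d) κ)) :=
        (contDiff_positionCut hκ).continuous_fderiv one_ne_zero
      have hme : Measurable fun z : E d × E d => positionCut κ z.1 :=
        (contDiff_positionCut hκ).continuous.measurable.comp measurable_fst
      have i1 : Integrable fun z : E d × E d =>
          f s z.1 z.2 * fderiv ℝ (positionCut κ) z.1 (ε⁻¹ • z.2) := by
        have hmd : AEStronglyMeasurable (fun z : E d × E d =>
          fderiv ℝ (positionCut κ) z.1 (ε⁻¹ • z.2)) volume := by fun_prop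
        refine (hs.1.const_mul ε⁻¹).mono' (hm.mul hmd) (ae_of_all _ fun z => ?_)
        rw [norm_mul, Real.norm_of_nonneg (h.nonneg s _ _)]
        calc _ ≤ f s z.1 z.2 * (ε⁻¹ * ‖z.2‖) :=
              mul_le_mul_of_nonneg_left (hdx _ _) (h.nonneg s _ _)
          _ = _ := by ring
      have i2 : Integrable fun z : E d × E d =>
          positionCut κ z.1 * ((ε ^ 2)⁻¹ * collision D (f s) z) :=
        ((integrable_collision h.D_pos hs2.1).const_mul _).bdd_mul (c := κ⁻¹)
          hme.aestronglyMeasurable (ae_of_all _ fun z => hb z.1)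
      rw [integral_add i1 i2]
      have e1 : ∫ z : E d × E d, positionCut κ z.1 * ((ε ^ 2)⁻¹ * collision D (f s) z) = 0 := by
        simp_rw [mul_left_comm]
        rw [integral_const_mul, integral_mul_collision h.D_pos hs2.1
          (contDiff_positionCut hκ).continuous.measurable hb, mul_zero]
      rw [e1, add_zero]
      exact integral_mul_covector_le hs.1 hm hdc (norm_fderiv_positionCut_le hκ) ε
    have hq := (h.transport.integrable_renormalized_rate hR (contDiff_positionCut hκ) hb
      (W := fun ξ => ε⁻¹ * ‖ξ‖) hw0 hdx hWg).2
    simp only [fderiv_fun_const, Pi.zero_apply, zero_apply, one_mul, smul_zero, zero_add] at hq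
    calc _ ≤ ∫ s in Ioc 0 t, ∫ x, ‖flux ε (f s) x‖ :=
          integral_mono_ae (hq.mono_set hsub) (IntegrableOn.mono_set hJt hsub)
            (ae_restrict_of_ae_restrict_of_subset hsub hle)
      _ ≤ ∫ s in Ioo 0 T, ∫ x, ‖flux ε (f s) x‖ :=
          setIntegral_mono_set hJt (ae_of_all _ fun s => integral_nonneg fun _ => norm_nonneg _)
            (Eventually.of_forall hsub)
      _ = _ := (integral_prod _ h.integrable_flux.norm).symm

theorem ae_position_le (h : IsKinetic T D ε B K L F f0 f) : ∀ᵐ t ∂(volume.restrict (Ioo 0 T)),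
    Integrable (fun z : E d × E d => ‖z.1‖ * f t z.1 z.2) ∧
      ∫ z : E d × E d, ‖z.1‖ * f t z.1 z.2 ≤ positionMoment f0 + totalFlux T ε f := by
  have h1 := ae_all_iff.mpr fun n : ℕ =>
    h.ae_integral_positionCut_le (κ := 1 / ((n : ℝ) + 1)) (by positivity)
  filter_upwards [h1, h.transport.g_bound] with t ht ht2
  have hsm : Measurable fun z : E d × E d => √(1 + ‖z.1‖ ^ 2) := by fun_prop
  have hm : Measurable fun z : E d × E d => √(1 + ‖z.1‖ ^ 2) * f t z.1 z.2 :=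
    hsm.mul (h.measurable_slice t)
  have hi : ∀ n : ℕ, Integrable fun z : E d × E d =>
      positionCut (1 / ((n : ℝ) + 1)) z.1 * f t z.1 z.2 := by
    intro n
    have hκ : (0 : ℝ) < 1 / ((n : ℝ) + 1) := by positivity
    have hme : Measurable fun z : E d × E d => positionCut (1 / ((n : ℝ) + 1)) z.1 :=
      (contDiff_positionCut hκ).continuous.measurable.comp measurable_fst
    refine ht2.1.bdd_mul (c := (1 / ((n : ℝ) + 1))⁻¹) hme.aestronglyMeasurable
      (ae_of_all _ fun z => ?_)
    rw [Real.norm_of_nonneg (positionCut_nonneg hκ _)]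
    exact positionCut_le_inv hκ _
  have h0 : ∀ n : ℕ, ∀ z : E d × E d, 0 ≤ positionCut (1 / ((n : ℝ) + 1)) z.1 * f t z.1 z.2 :=
    fun n z => mul_nonneg (positionCut_nonneg (by positivity) _) (h.nonneg _ _ _)
  have h0' : ∀ z : E d × E d, 0 ≤ √(1 + ‖z.1‖ ^ 2) * f t z.1 z.2 :=
    fun z => mul_nonneg (by positivity) (h.nonneg _ _ _)
  have hC : 0 ≤ positionMoment f0 + totalFlux T ε f := by
    refine add_nonneg (integral_nonneg fun z => mul_nonneg (by positivity) (h.datum.nonneg _ _)) ?_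
    exact totalFlux_nonneg
  have key := integrable_and_integral_le_of_tendsto
    hC hi (fun n => ae_of_all _ (h0 n)) ht hm.aestronglyMeasurable
    (ae_of_all _ h0') (ae_of_all _ fun z => (tendsto_positionCut z.1).mul_const _)
  have hle : ∀ z : E d × E d, ‖z.1‖ * f t z.1 z.2 ≤ √(1 + ‖z.1‖ ^ 2) * f t z.1 z.2 := fun z =>
    mul_le_mul_of_nonneg_right (norm_le_sqrt_one_add_sq _) (h.nonneg _ _ _)
  have hnm : Measurable fun z : E d × E d => ‖z.1‖ * f t z.1 z.2 :=
    (by fun_prop : Measurable fun z : E d × E d => ‖z.1‖).mul (h.measurable_slice t)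
  have hi2 : Integrable fun z : E d × E d => ‖z.1‖ * f t z.1 z.2 := by
    refine key.1.mono' hnm.aestronglyMeasurable (ae_of_all _ fun z => ?_)
    rw [Real.norm_of_nonneg (mul_nonneg (norm_nonneg _) (h.nonneg _ _ _))]
    exact hle z
  exact ⟨hi2, (integral_mono hi2 key.1 hle).trans key.2⟩

end IsKinetic

end

section

variable {d : ℕ}

/-! ### Entropy inequality -/

/-- A bound for the primitive passes to the end point. -/
theorem setIntegral_Ioo_le_of_ae {T C : ℝ} (hT : 0 < T) {q : ℝ → ℝ}
    (hq : IntegrableOn q (Ioo 0 T))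
    (h : ∀ᵐ t ∂(volume.restrict (Ioo 0 T)), ∫ s in Ioc 0 t, q s ≤ C) :
    ∫ s in Ioo 0 T, q s ≤ C := by
  have hqi : IntervalIntegrable q volume 0 T := by
    rw [intervalIntegrable_iff_integrableOn_Ioo_of_le hT.le]; exact hq
  have hcont : ContinuousOn (fun t => ∫ s in (0 : ℝ)..t, q s) (Icc 0 T) := by
    have := intervalIntegral.continuousOn_primitive_interval' hqi (a := 0) (by simp)
    rwa [uIcc_of_le hT.le] at this
  rw [ae_restrict_iff' measurableSet_Ioo] at h
  -- Good times have full measure, hence are dense, so some sequence of them increases to T from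
  -- within the interval; the primitive is continuous up to T.
  have hd := Measure.dense_of_ae h
  have hlt : ∀ n : ℕ, T - T / ((n : ℝ) + 1) < T := fun n => by
    have : 0 < T / ((n : ℝ) + 1) := by positivity
    linarith
  choose u hu hu2 using fun n : ℕ => hd.exists_between (hlt n)
  have hmem : ∀ n, u n ∈ Ioo 0 T := fun n => by
    refine ⟨lt_of_le_of_lt ?_ (hu2 n).1, (hu2 n).2⟩
    rw [sub_nonneg]
    exact div_le_self hT.le (by simp)
  have hlim : Tendsto u atTop (𝓝 T) := by
    have h1 : Tendsto (fun n : ℕ => T - T / ((n : ℝ) + 1)) atTop (𝓝 T) := by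
      have := (tendsto_one_div_add_atTop_nhds_zero_nat (𝕜 := ℝ)).const_mul T
      simpa [div_eq_mul_inv] using this.const_sub T
    exact tendsto_of_tendsto_of_tendsto_of_le_of_le h1 tendsto_const_nhds
      (fun n => (hu2 n).1.le) fun n => (hu2 n).2.le
  have h2 : Tendsto (fun n => ∫ s in (0 : ℝ)..u n, q s) atTop (𝓝 (∫ s in (0 : ℝ)..T, q s)) :=
    (hcont T ⟨hT.le, le_rfl⟩).tendsto.comp (tendsto_nhdsWithin_iff.mpr
      ⟨hlim, Eventually.of_forall fun n => Ioo_subset_Icc_self (hmem n)⟩)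
  rw [integral_Ioc_eq_integral_Ioo.symm, ← intervalIntegral.integral_of_le hT.le]
  refine le_of_tendsto h2 (Eventually.of_forall fun n => ?_)
  rw [intervalIntegral.integral_of_le (hmem n).1.le]
  exact hu n (hmem n)

/-- Mξ is odd in ξ. In the entropy estimate this allows the local equilibrium to be subtracted from
f in the force term at no cost. -/
theorem integral_inner_maxwellian {D : ℝ} (hD : 0 < D) {φ : E d → E d} (hφ : Integrable φ) :
    Integrable (fun z : E d × E d => maxwellian D z.2 * inner ℝ z.2 (φ z.1)) ∧
      ∫ z : E d × E d, maxwellian D z.2 * inner ℝ z.2 (φ z.1) = 0 := by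
  have hM := integrable_smul_maxwellian (d := d) hD
  have e : ∀ z : E d × E d, maxwellian D z.2 * inner ℝ z.2 (φ z.1)
      = inner ℝ (maxwellian D z.2 • z.2) (φ z.1) := fun z => by
    rw [real_inner_smul_left]
  have hi : Integrable (fun z : E d × E d => maxwellian D z.2 * inner ℝ z.2 (φ z.1)) := by
    have h1 : Integrable (fun z : E d × E d => ‖φ z.1‖ * ‖maxwellian D z.2 • z.2‖) :=
      hφ.norm.mul_prod hM.norm
    simp_rw [e]
    have m1 : AEStronglyMeasurable (fun z : E d × E d => φ z.1) volume := hφ.1.comp_fst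
    have m2 : AEStronglyMeasurable (fun z : E d × E d => maxwellian D z.2 • z.2) volume :=
      hM.1.comp_snd
    refine h1.mono' (m2.inner m1) (ae_of_all _ fun z => ?_)
    rw [mul_comm]
    exact norm_inner_le_norm _ _
  refine ⟨hi, ?_⟩
  rw [Measure.volume_eq_prod] at hi ⊢
  rw [integral_prod _ hi]
  refine integral_eq_zero_of_ae (ae_of_all _ fun x => ?_)
  simp only [Pi.zero_apply]
  have h2 : ∀ ξ : E d, maxwellian D ξ * inner ℝ ξ (φ x)
      = inner ℝ (φ x) (maxwellian D ξ • ξ) := fun ξ => by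
    rw [real_inner_smul_right, real_inner_comm]
  simp_rw [h2]
  rw [integral_inner hM, integral_smul_maxwellian, inner_zero_right]

/-- The dissipation of the truncated entropy. -/
def dissTrunc (k D : ℝ) (g : E d → E d → ℝ) (z : E d × E d) : ℝ :=
  collision D g z * (Real.log (clamp k (density g z.1))
    - Real.log (clamp k (g z.1 z.2 / maxwellian D z.2)))

section dissTrunc

variable {k D : ℝ} {g : E d → E d → ℝ}

theorem collision_eq (hD : 0 < D) (g : E d → E d → ℝ) (z : E d × E d) : collision D g z
    = maxwellian D z.2 * (density g z.1 - g z.1 z.2 / maxwellian D z.2) := by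
  have := (maxwellian_pos hD z.2).ne'
  rw [collision]; field_simp

theorem dissTrunc_nonneg (hk : 1 ≤ k) (hD : 0 < D) (g : E d → E d → ℝ) (z : E d × E d) :
    0 ≤ dissTrunc k D g z := by
  rw [dissTrunc, collision_eq hD, mul_assoc]
  exact mul_nonneg (maxwellian_pos hD z.2).le (clamp_mul_log_nonneg hk _ _)

theorem dissTrunc_le (hk : 1 ≤ k) (D : ℝ) (g : E d → E d → ℝ) (z : E d × E d) :
    |dissTrunc k D g z| ≤ 2 * Real.log k * |collision D g z| := by
  rw [dissTrunc, abs_mul, mul_comm]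
  refine mul_le_mul_of_nonneg_right ?_ (abs_nonneg _)
  refine (abs_sub _ _).trans ?_
  linarith [abs_log_clamp_le hk (density g z.1),
    abs_log_clamp_le hk (g z.1 z.2 / maxwellian D z.2)]

theorem measurable_log_clamp (hk : 1 ≤ k) : Measurable fun s => Real.log (clamp k s) :=
  (continuous_log_clamp hk).measurable

theorem measurable_dissTrunc (hk : 1 ≤ k) (D : ℝ) {f : ℝ → E d → E d → ℝ}
    (hf : Measurable fun p : ℝ × E d × E d => f p.1 p.2.1 p.2.2) :
    Measurable fun p : ℝ × E d × E d => dissTrunc k D (f p.1) p.2 := by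
  have h1 := (measurable_density hf).comp
    (measurable_fst.prodMk (measurable_fst.comp measurable_snd) :
      Measurable fun p : ℝ × E d × E d => (p.1, p.2.1))
  have h2 := (continuous_maxwellian (d := d) D).measurable.comp
    (measurable_snd.comp measurable_snd : Measurable fun p : ℝ × E d × E d => p.2.2)
  exact (measurable_collision D hf).mul (((measurable_log_clamp hk).comp h1).sub
    ((measurable_log_clamp hk).comp (hf.div h2)))

/-- The clamp of 0 is 1/(n+1), whose logarithm tends to −∞. When exactly one of ρM and f vanishes
the truncated dissipation therefore diverges, in agreement with the value +∞; otherwise it is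
eventually constant. -/
theorem tendsto_dissTrunc {c : ℝ} (hc : 0 < c) (hD : 0 < D) (hg : ∀ x ξ, 0 ≤ g x ξ)
    (z : E d × E d) :
    Tendsto (fun n : ℕ => ENNReal.ofReal (c * dissTrunc ((n : ℝ) + 1) D g z)) atTop
      (𝓝 (ENNReal.ofReal c *
        entropyProduction (density g z.1 * maxwellian D z.2) (g z.1 z.2))) := by
  have hM := maxwellian_pos hD z.2
  have hlog : Tendsto (fun n : ℕ => Real.log ((n : ℝ) + 1)) atTop atTop :=
    Real.tendsto_log_atTop.comp (tendsto_atTop_add_const_right _ _ tendsto_natCast_atTop_atTop)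
  have hk : ∀ n : ℕ, (1 : ℝ) ≤ (n : ℝ) + 1 := fun n => by simp
  have hlogc : ∀ n : ℕ, Real.log (clamp ((n : ℝ) + 1) 0) = -Real.log ((n : ℝ) + 1) := fun n => by
    rw [clamp_zero (hk n), Real.log_inv]
  have hc' : ENNReal.ofReal c ≠ 0 := by simpa using hc
  rcases (density_nonneg hg z.1).eq_or_lt with hρ | hρ <;>
    rcases (hg z.1 z.2).eq_or_lt with hf | hf
  · simp [dissTrunc, collision, entropyProduction, ← hρ, ← hf]
  · have hne : ¬(density g z.1 * maxwellian D z.2 = 0 ↔ g z.1 z.2 = 0) := by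
      simp [← hρ, hf.ne']
    rw [entropyProduction, if_neg hne, ENNReal.mul_top hc']
    refine ENNReal.tendsto_ofReal_atTop.comp ?_
    have h1 : Tendsto (fun n : ℕ => c * g z.1 z.2 * (Real.log ((n : ℝ) + 1)
        + Real.log (g z.1 z.2 / maxwellian D z.2))) atTop atTop :=
      (tendsto_atTop_add_const_right _ _ hlog).const_mul_atTop (mul_pos hc hf)
    refine h1.congr' ?_
    filter_upwards [clamp_eventually_eq (div_pos hf hM)] with n hn
    rw [dissTrunc, hn, ← hρ, hlogc, collision, ← hρ]
    ring
  · have hne : ¬(density g z.1 * maxwellian D z.2 = 0 ↔ g z.1 z.2 = 0) := by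
      simp [← hf, hρ.ne', hM.ne']
    rw [entropyProduction, if_neg hne, ENNReal.mul_top hc']
    refine ENNReal.tendsto_ofReal_atTop.comp ?_
    have h1 : Tendsto (fun n : ℕ => c * (density g z.1 * maxwellian D z.2) *
        (Real.log ((n : ℝ) + 1) + Real.log (density g z.1))) atTop atTop :=
      (tendsto_atTop_add_const_right _ _ hlog).const_mul_atTop (mul_pos hc (mul_pos hρ hM))
    refine h1.congr' ?_
    filter_upwards [clamp_eventually_eq hρ] with n hn
    rw [dissTrunc, hn, collision, ← hf, zero_div, hlogc]
    ring
  · have hne : density g z.1 * maxwellian D z.2 = 0 ↔ g z.1 z.2 = 0 := by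
      simp [hf.ne', hρ.ne', hM.ne']
    rw [entropyProduction, if_pos hne, ← ENNReal.ofReal_mul hc.le]
    refine tendsto_const_nhds.congr' ?_
    filter_upwards [clamp_eventually_eq hρ, clamp_eventually_eq (div_pos hf hM)] with n hn hn'
    rw [dissTrunc, hn, hn', collision, Real.log_mul hρ.ne' hM.ne', Real.log_div hf.ne' hM.ne']
    congr 2
    ring

end dissTrunc

/-- The truncated relative entropy. -/
def entropyK (k D : ℝ) (g : E d → E d → ℝ) : ℝ :=
  ∫ z : E d × E d, maxwellian D z.2 * entropyTrunc k (g z.1 z.2 / maxwellian D z.2)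

/-- The growth rate in the entropy inequality. -/
def entropyRate (D B : ℝ) (f0 : E d → E d → ℝ) : ℝ :=
  1 / 2 * (B / D) ^ 2 * (energyBound D B f0 + mass f0 * maxwellianEnergy d D)

namespace IsKinetic

variable {T D ε B K k : ℝ} {L : ℝ≥0} {F : ℝ → E d → E d} {f0 : E d → E d → ℝ}
  {f : ℝ → E d → E d → ℝ}

theorem clamp_sub_inv_mem (hk : 1 ≤ k) {s : ℝ} (hs : 0 ≤ s) : |clamp k s - k⁻¹| ≤ s := by
  have := abs_clamp_sub_le k s 0
  rwa [clamp_zero hk, sub_zero, abs_of_nonneg hs] at this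

/-- Two terms of zero integral are subtracted, the force term and the relaxation term with f/M
replaced by ρ. What remains is the dissipation and a force term proportional to clamp(f/M) −
clamp(ρ); Cauchy–Schwarz against the dissipation costs half of it, and the factor ε⁻¹ squares to
exactly ε⁻². The integrand I is a variable so that the rate from the renormalized equation can be
inserted together with its own integrability proof. -/
theorem ae_entropy_rate_le (h : IsKinetic T D ε B K L F f0 f) (hk : 1 ≤ k) :
    ∀ᵐ s ∂(volume.restrict (Ioo 0 T)),
      Integrable (dissTrunc k D (f s)) ∧ ∀ I : E d × E d → ℝ, Integrable I →
      (∀ z, I z = (maxwellian D z.2 * (clamp k (f s z.1 z.2 / maxwellian D z.2) - k⁻¹) / D)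
          * inner ℝ z.2 (ε⁻¹ • F s z.1)
        + Real.log (clamp k (f s z.1 z.2 / maxwellian D z.2)) * ((ε ^ 2)⁻¹ * collision D (f s) z)) →
      ∫ z, I z ≤ -(1 / 2 * (ε ^ 2)⁻¹ * ∫ z, dissTrunc k D (f s) z) + entropyRate D B f0 := by
  have hD := h.D_pos
  filter_upwards [h.ae_mass_eq, h.ae_energy_le, h.norm_force_le, h.transport.F_bound] with
    s hs1 hs2 hs3 hs4
  have hρm : Measurable (density (f s)) :=
    (measurable_density h.measurable).comp measurable_prodMk_left
  have hρ0 := density_nonneg (h.nonneg s)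
  have hcol := integrable_collision hD hs1.1
  have hdm : Measurable (dissTrunc k D (f s)) :=
    (measurable_dissTrunc hk D h.measurable).comp measurable_prodMk_left
  have hdi : Integrable (dissTrunc k D (f s)) :=
    (hcol.abs.const_mul (2 * Real.log k)).mono' hdm.aestronglyMeasurable
      (ae_of_all _ fun z => dissTrunc_le hk D (f s) z)
  refine ⟨hdi, fun I hI hIeq => ?_⟩
  have hFm : Measurable fun x => ε⁻¹ • F s x := h.transport.F_meas.comp measurable_prodMk_left
  -- two terms with vanishing integral
  have hφ : Integrable fun x => ((clamp k (density (f s) x) - k⁻¹) / D) • (ε⁻¹ • F s x) := by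
    refine ((integrable_density hs1.1).mul_const (1 / D * (ε⁻¹ * B))).mono'
      (((((continuous_clamp.measurable.comp hρm).sub_const _).div_const D).smul
        hFm).aestronglyMeasurable) (ae_of_all _ fun x => ?_)
    rw [norm_smul, norm_div, Real.norm_eq_abs, Real.norm_of_nonneg hD.le, div_eq_mul_one_div,
      mul_assoc]
    have := clamp_sub_inv_mem hk (hρ0 x)
    gcongr
    · exact hρ0 x
    · exact hs4.1 x
  obtain ⟨i1, e1⟩ := integral_inner_maxwellian hD hφ
  have hlogm : Measurable fun x => Real.log (clamp k (density (f s) x)) :=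
    (measurable_log_clamp hk).comp hρm
  have e2 := integral_mul_collision hD hs1.1 hlogm (K := Real.log k)
    fun x => abs_log_clamp_le hk _
  have i2 : Integrable fun z => Real.log (clamp k (density (f s) z.1)) * collision D (f s) z :=
    hcol.bdd_mul (c := Real.log k) (hlogm.comp measurable_fst).aestronglyMeasurable
      (ae_of_all _ fun z => abs_log_clamp_le hk _)
  have i3 : Integrable fun z : E d × E d =>
      density (f s) z.1 * (‖z.2‖ ^ 2 * maxwellian D z.2) :=
    integrable_density_mul hs1.1 (integrable_sq_mul_maxwellian hD)
  have hpt : ∀ z : E d × E d, I z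
      - maxwellian D z.2 * inner ℝ z.2 (((clamp k (density (f s) z.1) - k⁻¹) / D) • (ε⁻¹ • F s z.1))
      - (ε ^ 2)⁻¹ * (Real.log (clamp k (density (f s) z.1)) * collision D (f s) z)
      ≤ 1 / 2 * (B / D) ^ 2 * (‖z.2‖ ^ 2 * f s z.1 z.2
          + density (f s) z.1 * (‖z.2‖ ^ 2 * maxwellian D z.2))
        - 1 / 2 * (ε ^ 2)⁻¹ * dissTrunc k D (f s) z := by
    intro z
    have hM := maxwellian_pos hD z.2
    set M := maxwellian D z.2 with hMdef
    set ρ := density (f s) z.1 with hρdef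
    set η := f s z.1 z.2 / M with hη
    have hf0 : 0 ≤ η := div_nonneg (h.nonneg _ _ _) hM.le
    have hfη : f s z.1 z.2 = M * η := by rw [hη]; field_simp
    have hdis : dissTrunc k D (f s) z
        = M * ((η - ρ) * (Real.log (clamp k η) - Real.log (clamp k ρ))) := by
      rw [dissTrunc, collision_eq hD]; ring
    have hd0 := dissTrunc_nonneg hk hD (f s) z
    -- P is the pointwise size of the force term after subtraction. Its square is at most the
    -- dissipation density, with factor ε⁻², times a density of second moments, and 2P is at most
    -- their sum.
    set P := ε⁻¹ * (B / D) * (‖z.2‖ * (M * |clamp k η - clamp k ρ|)) with hP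
    have hPsq : P ^ 2 ≤ ((ε ^ 2)⁻¹ * dissTrunc k D (f s) z)
        * ((B / D) ^ 2 * (‖z.2‖ ^ 2 * f s z.1 z.2 + ρ * (‖z.2‖ ^ 2 * M))) := by
      have h1 := sq_clamp_sub_le hk hf0 (hρ0 z.1)
      rw [hP, hdis, hfη, mul_pow, mul_pow, mul_pow, mul_pow, sq_abs, inv_pow]
      calc _ = (ε ^ 2)⁻¹ * (B / D) ^ 2 * ‖z.2‖ ^ 2 * M ^ 2 * (clamp k η - clamp k ρ) ^ 2 := by ring
        _ ≤ (ε ^ 2)⁻¹ * (B / D) ^ 2 * ‖z.2‖ ^ 2 * M ^ 2 *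
            ((η - ρ) * (Real.log (clamp k η) - Real.log (clamp k ρ)) * (η + ρ)) := by gcongr
        _ = _ := by ring
    have hP2 := two_mul_le_add_of_sq_le (by positivity)
      (mul_nonneg (by positivity) (add_nonneg (mul_nonneg (by positivity) (h.nonneg _ _ _))
        (mul_nonneg (hρ0 z.1) (by positivity)))) hPsq
    have hin : M * ((clamp k η - clamp k ρ) / D * inner ℝ z.2 (ε⁻¹ • F s z.1)) ≤ P := by
      have h1 : |inner ℝ z.2 (ε⁻¹ • F s z.1)| ≤ ‖z.2‖ * (ε⁻¹ * B) :=
        (abs_real_inner_le_norm _ _).trans (mul_le_mul_of_nonneg_left (hs4.1 z.1) (norm_nonneg _))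
      calc _ ≤ M * (|clamp k η - clamp k ρ| / D * (‖z.2‖ * (ε⁻¹ * B))) := by
            refine mul_le_mul_of_nonneg_left ?_ hM.le
            refine (le_abs_self _).trans ?_
            rw [abs_mul, abs_div, abs_of_pos hD]
            gcongr
        _ = P := by rw [hP]; ring
    have hI1 : I z - M * inner ℝ z.2 (((clamp k ρ - k⁻¹) / D) • (ε⁻¹ • F s z.1))
      - (ε ^ 2)⁻¹ * (Real.log (clamp k ρ) * collision D (f s) z)
      = M * ((clamp k η - clamp k ρ) / D * inner ℝ z.2 (ε⁻¹ • F s z.1))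
        - (ε ^ 2)⁻¹ * dissTrunc k D (f s) z := by
      rw [hIeq, real_inner_smul_right z.2 _ ((clamp k ρ - k⁻¹) / D), dissTrunc]; ring
    rw [hI1]
    linarith
  have hint := integral_mono ((hI.sub i1).sub (i2.const_mul (ε ^ 2)⁻¹))
    (((hs2.1.fun_add i3).const_mul (1 / 2 * (B / D) ^ 2)).sub
      (hdi.const_mul (1 / 2 * (ε ^ 2)⁻¹))) hpt
  have eL : ∫ z, (I z - maxwellian D z.2 * inner ℝ z.2 (((clamp k (density (f s) z.1) - k⁻¹) / D) •
      (ε⁻¹ • F s z.1)) - (ε ^ 2)⁻¹ * (Real.log (clamp k (density (f s) z.1)) * collision D (f s) z))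
      = ∫ z, I z := by
    rw [integral_sub (integrable_fun_sub hI i1) (i2.const_mul (ε ^ 2)⁻¹), integral_sub hI i1, e1,
      integral_const_mul, e2]
    ring
  have eR : ∫ z : E d × E d, (1 / 2 * (B / D) ^ 2 * (‖z.2‖ ^ 2 * f s z.1 z.2
          + density (f s) z.1 * (‖z.2‖ ^ 2 * maxwellian D z.2))
        - 1 / 2 * (ε ^ 2)⁻¹ * dissTrunc k D (f s) z)
      = 1 / 2 * (B / D) ^ 2 * ((∫ z : E d × E d, ‖z.2‖ ^ 2 * f s z.1 z.2)
        + mass f0 * maxwellianEnergy d D) - 1 / 2 * (ε ^ 2)⁻¹ * ∫ z, dissTrunc k D (f s) z := by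
    rw [integral_sub ((hs2.1.fun_add i3).const_mul (1 / 2 * (B / D) ^ 2))
      (hdi.const_mul (1 / 2 * (ε ^ 2)⁻¹)), integral_const_mul, integral_const_mul,
      integral_add hs2.1 i3, integral_density_mul hs1.1 (fun ξ => ‖ξ‖ ^ 2 * maxwellian D ξ),
      ← hs1.2]
    rfl
  have hint' := eL.symm.trans_le (hint.trans_eq eR)
  have : 1 / 2 * (B / D) ^ 2 * ((∫ z : E d × E d, ‖z.2‖ ^ 2 * f s z.1 z.2)
        + mass f0 * maxwellianEnergy d D) ≤ entropyRate D B f0 := by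
    unfold entropyRate
    gcongr
    exact hs2.2
  linarith

theorem integrable_dissTrunc (h : IsKinetic T D ε B K L F f0 f) (hk : 1 ≤ k) :
    Integrable (fun p : ℝ × E d × E d => dissTrunc k D (f p.1) p.2) (timePhase d T) := by
  refine integrable_prod_of_bound (measurable_dissTrunc hk D h.measurable).stronglyMeasurable
    (K := 2 * Real.log k * (2 * mass f0)) ?_
  filter_upwards [h.ae_mass_eq, h.ae_entropy_rate_le hk] with t ht ht2
  refine ⟨ht2.1, ?_⟩
  have hlog := Real.log_nonneg hk
  calc ∫ z, ‖dissTrunc k D (f t) z‖ ≤ ∫ z, 2 * Real.log k * |collision D (f t) z| :=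
        integral_mono ht2.1.norm ((integrable_collision h.D_pos ht.1).abs.const_mul _) fun z =>
          dissTrunc_le hk D (f t) z
    _ ≤ _ := by
        rw [integral_const_mul]
        refine mul_le_mul_of_nonneg_left ?_ (by positivity)
        refine (integral_abs_collision_le h.D_pos ht.1 (h.nonneg t)).trans_eq ?_
        rw [← ht.2]; rfl

/-- The entropy inequality at a finite level of truncation. -/
theorem ae_entropyK_le (h : IsKinetic T D ε B K L F f0 f) (hk : 1 ≤ k) :
    ∀ᵐ t ∂(volume.restrict (Ioo 0 T)), entropyK k D (f t)
      + 1 / 2 * (ε ^ 2)⁻¹ * ∫ s in Ioc 0 t, ∫ z, dissTrunc k D (f s) z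
      ≤ entropyK k D f0 + T * entropyRate D B f0 := by
  have hD := h.D_pos
  have hWg : ∀ᵐ t ∂(volume.restrict (Ioo 0 T)),
      Integrable (fun z : E d × E d => ‖z.2‖ / D * |f t z.1 z.2|) ∧
      ∫ z : E d × E d, ‖z.2‖ / D * |f t z.1 z.2| ≤ 1 / D * (mass f0 + energyBound D B f0) := by
    filter_upwards [h.ae_norm_mul] with t ht
    have e : ∀ z : E d × E d, ‖z.2‖ / D * |f t z.1 z.2| = 1 / D * (‖z.2‖ * f t z.1 z.2) := fun z => by
      rw [abs_of_nonneg (h.nonneg t _ _)]; ring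
    simp_rw [e]
    refine ⟨ht.1.const_mul _, ?_⟩
    rw [integral_const_mul]
    exact mul_le_mul_of_nonneg_left ht.2 (by positivity)
  have hw0 : ∀ ξ : E d, (0 : ℝ) ≤ ‖ξ‖ / D := fun ξ => by positivity
  have h1 := h.transport.renormalized_of_bounded (isRenorm_entropy hD hk) h.T_pos
    (ψ := fun _ => 1) contDiff_const (Kψ := 1) (by simp) (W := fun ξ => ‖ξ‖ / D)
    (fun ξ => le_rfl) (by simpa using hw0) hWg
  have h2 := h.transport.integrable_renormalized_rate (isRenorm_entropy hD hk)
    (ψ := fun _ => 1) contDiff_const (Kψ := 1) (by simp) (W := fun ξ => ‖ξ‖ / D)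
    (fun ξ => le_rfl) (by simpa using hw0) hWg
  simp only [fderiv_fun_const, Pi.zero_apply, zero_apply, mul_zero, zero_add, one_mul,
    smul_apply, innerSL_apply_apply, smul_eq_mul] at h1 h2
  have hDt : Integrable (fun s => ∫ z, dissTrunc k D (f s) z) (volume.restrict (Ioo 0 T)) :=
    (h.integrable_dissTrunc hk).integral_prod_left
  have hER : 0 ≤ entropyRate D B f0 := by
    unfold entropyRate
    have a1 := energyBound_nonneg (D := D) (B := B) h.datum
    have a2 := mass_datum_nonneg h.datum
    have a3 := maxwellianEnergy_nonneg (d := d) hD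
    positivity
  filter_upwards [h1, ae_restrict_mem measurableSet_Ioo] with t ht htT
  have hsub : Ioc 0 t ⊆ Ioo 0 T := fun s hs => ⟨hs.1, hs.2.trans_lt htT.2⟩
  rw [entropyK, ht, entropyK, add_assoc]
  refine add_le_add le_rfl ?_
  have hDt' : IntegrableOn (fun s => ∫ z, dissTrunc k D (f s) z) (Ioc 0 t) :=
    IntegrableOn.mono_set hDt hsub
  have hle := integral_mono_ae (h2.2.mono_set hsub)
    ((hDt'.const_mul (1 / 2 * (ε ^ 2)⁻¹)).fun_neg.fun_add (integrable_const (entropyRate D B f0))) (by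
      refine ae_restrict_of_ae_restrict_of_subset hsub ?_
      filter_upwards [h2.1, h.ae_entropy_rate_le hk] with s hs1 hs2
      exact hs2.2 _ hs1 fun z => rfl)
  have e1 : ∫ s in Ioc 0 t, (-(1 / 2 * (ε ^ 2)⁻¹ * ∫ z, dissTrunc k D (f s) z)
      + entropyRate D B f0)
      = -(1 / 2 * (ε ^ 2)⁻¹ * ∫ s in Ioc 0 t, ∫ z, dissTrunc k D (f s) z)
        + t * entropyRate D B f0 := by
    rw [integral_add (hDt'.const_mul (1 / 2 * (ε ^ 2)⁻¹)).fun_neg (integrable_const _),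
      integral_neg, integral_const_mul]
    simp [htT.1.le]
  rw [e1] at hle
  have : t * entropyRate D B f0 ≤ T * entropyRate D B f0 :=
    mul_le_mul_of_nonneg_right htT.2.le hER
  linarith

end IsKinetic

end

section

variable {d : ℕ}

/-! ### Bounds of the dissipation and of the flux -/

/-- The logarithm of the normalization constant of the Maxwellian, in absolute value. -/
def logConst (d : ℕ) (D : ℝ) : ℝ := |(d : ℝ) / 2 * Real.log (1 / (2 * Real.pi * D))|

theorem mul_abs_log_div_le {s M : ℝ} (hs : 0 ≤ s) (hM : 0 < M) :
    s * |Real.log (s / M)| ≤ s * |Real.log s| + s * |Real.log M| := by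
  rcases hs.eq_or_lt with rfl | hs'
  · simp
  rw [Real.log_div hs'.ne' hM.ne', ← mul_add]
  exact mul_le_mul_of_nonneg_left (abs_sub _ _) hs

theorem mul_abs_log_maxwellian_le {D : ℝ} (hD : 0 < D) {s : ℝ} (hs : 0 ≤ s) (ξ : E d) :
    s * |Real.log (maxwellian D ξ)| ≤ logConst d D * s + 1 / (2 * D) * (‖ξ‖ ^ 2 * s) := by
  refine (mul_le_mul_of_nonneg_left (abs_log_maxwellian_le hD ξ) hs).trans_eq ?_
  rw [logConst]; ring

theorem IsInitialDatum.integrable_log {f0 : E d → E d → ℝ} (h : IsInitialDatum f0) :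
    Integrable fun z : E d × E d => f0 z.1 z.2 * |Real.log (f0 z.1 z.2)| := by
  refine h.integrable.mono' (h.measurable.mul (h.measurable.log.abs)).aestronglyMeasurable
    (ae_of_all _ fun z => ?_)
  have h0 := h.nonneg z.1 z.2
  rw [Real.norm_of_nonneg (by positivity)]
  have : 0 ≤ (1 + ‖z.1‖ + ‖z.2‖ ^ 2) * f0 z.1 z.2 := by positivity
  linarith

/-- A bound of the initial relative entropy. -/
def initialEntropy (D : ℝ) (f0 : E d → E d → ℝ) : ℝ :=
  (∫ z : E d × E d, f0 z.1 z.2 * |Real.log (f0 z.1 z.2)|) + (logConst d D + 1) * mass f0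
    + 1 / (2 * D) * ∫ z : E d × E d, ‖z.2‖ ^ 2 * f0 z.1 z.2

/-- The integral of `exp (-‖x‖)`. -/
def expConst (d : ℕ) : ℝ := ∫ x : E d, Real.exp (-‖x‖)

section entropyK

variable {D k : ℝ} {g : E d → E d → ℝ}

theorem integrable_entropyTrunc (hD : 0 < D) (hk : 1 ≤ k)
    (hg : Integrable fun z : E d × E d => g z.1 z.2) :
    Integrable fun z : E d × E d =>
      maxwellian D z.2 * entropyTrunc k (g z.1 z.2 / maxwellian D z.2) := by
  have hR := isRenorm_entropy (d := d) hD hk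
  have h1 : AEMeasurable (fun z : E d × E d => maxwellian D z.2) :=
    ((continuous_maxwellian D).measurable.comp measurable_snd).aemeasurable
  have h2 : AEMeasurable fun z : E d × E d => entropyTrunc k (g z.1 z.2 / maxwellian D z.2) :=
    (contDiff_entropyTrunc hk).continuous.measurable.comp_aemeasurable (hg.1.aemeasurable.div h1)
  generalize Real.toNNReal (Real.log k) = C at hR
  have h3 : ∀ z : E d × E d, |maxwellian D z.2 * entropyTrunc k (g z.1 z.2 / maxwellian D z.2)|
      ≤ C * |g z.1 z.2| := fun z => hR.abs_le z.2 (g z.1 z.2)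
  exact (hg.abs.const_mul (C : ℝ)).mono' (h1.mul h2).aestronglyMeasurable (ae_of_all _ h3)

theorem entropyK_le (hD : 0 < D) (hk : 1 ≤ k) (h : IsInitialDatum g) :
    entropyK k D g ≤ initialEntropy D g := by
  have i1 := h.integrable_log
  have i2 := h.integrable_self.const_mul (logConst d D + 1)
  have i3 := h.integrable_sq.const_mul (1 / (2 * D))
  have e : initialEntropy D g = ∫ z : E d × E d, (g z.1 z.2 * |Real.log (g z.1 z.2)|
      + (logConst d D + 1) * g z.1 z.2 + 1 / (2 * D) * (‖z.2‖ ^ 2 * g z.1 z.2)) := by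
    rw [integral_add (i1.fun_add i2) i3, integral_add i1 i2, integral_const_mul, integral_const_mul]
    rfl
  rw [e, entropyK]
  refine integral_mono (integrable_entropyTrunc hD hk h.integrable_self) ((i1.fun_add i2).fun_add i3)
    fun z => ?_
  have hM := maxwellian_pos hD z.2
  have h0 := h.nonneg z.1 z.2
  have h1 := (le_abs_self _).trans (abs_entropyTrunc_le hk (div_nonneg h0 hM.le))
  have h2 := mul_le_mul_of_nonneg_left h1 hM.le
  have h3 : maxwellian D z.2 * (g z.1 z.2 / maxwellian D z.2 *
      |Real.log (g z.1 z.2 / maxwellian D z.2)| + g z.1 z.2 / maxwellian D z.2)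
      = g z.1 z.2 * |Real.log (g z.1 z.2 / maxwellian D z.2)| + g z.1 z.2 := by field_simp
  have h4 := mul_abs_log_div_le h0 hM
  have h5 := mul_abs_log_maxwellian_le hD h0 z.2
  simp only
  linarith

theorem integrable_exp_mul_maxwellian_prod (hD : 0 < D) :
    Integrable (fun z : E d × E d => Real.exp (-‖z.1‖) * maxwellian D z.2) ∧
      ∫ z : E d × E d, Real.exp (-‖z.1‖) * maxwellian D z.2 = expConst d := by
  refine ⟨integrable_exp_neg_norm.mul_prod (integrable_maxwellian hD), ?_⟩
  have := integral_prod_mul (μ := (volume : Measure (E d))) (ν := (volume : Measure (E d)))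
    (fun x => Real.exp (-‖x‖)) (maxwellian D)
  rw [integral_maxwellian hD, mul_one] at this
  exact this

/-- On the unbounded space the entropy relative to M alone has no lower bound by the mass; the
weight exp(−|x|) restores one, at the price of the first moment in x. -/
theorem le_entropyK (hD : 0 < D) (hk : 1 ≤ k) (hg : Integrable fun z : E d × E d => g z.1 z.2)
    (hgx : Integrable fun z : E d × E d => ‖z.1‖ * g z.1 z.2) (hg0 : ∀ x ξ, 0 ≤ g x ξ) :
    -(∫ z : E d × E d, ‖z.1‖ * g z.1 z.2) - expConst d ≤ entropyK k D g := by
  obtain ⟨i1, e1⟩ := integrable_exp_mul_maxwellian_prod (d := d) hD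
  rw [← e1, ← integral_neg, ← integral_sub hgx.fun_neg i1]
  refine integral_mono (integrable_fun_sub hgx.fun_neg i1) (integrable_entropyTrunc hD hk hg)
    fun z => ?_
  have hM := maxwellian_pos hD z.2
  have h1 := le_entropyTrunc hk (div_nonneg (hg0 z.1 z.2) hM.le) (norm_nonneg z.1)
  have h2 := mul_le_mul_of_nonneg_left h1 hM.le
  have h3 : maxwellian D z.2 * (-(g z.1 z.2 / maxwellian D z.2 * ‖z.1‖) - Real.exp (-‖z.1‖))
      = -(‖z.1‖ * g z.1 z.2) - Real.exp (-‖z.1‖) * maxwellian D z.2 := by field_simp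
  simp only
  linarith

end entropyK

/-- The constant in the bound of the dissipation by the flux. -/
def entropyConst (T D B : ℝ) (f0 : E d → E d → ℝ) : ℝ :=
  initialEntropy D f0 + T * entropyRate D B f0 + positionMoment f0 + expConst d

/-- The entropy dissipation. -/
def dissipation (T D ε : ℝ) (f : ℝ → E d → E d → ℝ) : ℝ≥0∞ :=
  ∫⁻ p, ENNReal.ofReal (1 / ε ^ 2) *
    entropyProduction (density (f p.1) p.2.1 * maxwellian D p.2.2) (f p.1 p.2.1 p.2.2)
    ∂(timePhase d T)

theorem measurable_entropyProduction :
    Measurable fun q : ℝ × ℝ => entropyProduction q.1 q.2 := by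
  unfold entropyProduction
  refine Measurable.ite ?_ (Measurable.ennreal_ofReal (by fun_prop)) measurable_const
  have h1 : MeasurableSet {q : ℝ × ℝ | q.1 = 0} := measurable_fst (measurableSet_singleton 0)
  have h2 : MeasurableSet {q : ℝ × ℝ | q.2 = 0} := measurable_snd (measurableSet_singleton 0)
  have : {q : ℝ × ℝ | q.1 = 0 ↔ q.2 = 0} = ({q | q.1 = 0} ∩ {q | q.2 = 0}) ∪
      ({q | q.1 = 0}ᶜ ∩ {q | q.2 = 0}ᶜ) := by
    ext q; simp only [mem_ofPred_eq, mem_union, mem_inter_iff, mem_compl_iff]; tauto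
  rw [this]
  exact (h1.inter h2).union (h1.compl.inter h2.compl)

namespace IsKinetic

variable {T D ε B K k : ℝ} {L : ℝ≥0} {F : ℝ → E d → E d} {f0 : E d → E d → ℝ}
  {f : ℝ → E d → E d → ℝ}

/-- Only half of the dissipation survives in the entropy inequality, hence the factor 2. The lower
bound of the entropy involves the moment in x, and through it the total flux. No constant depends on
k. -/
theorem integral_dissTrunc_le (h : IsKinetic T D ε B K L F f0 f) (hk : 1 ≤ k) :
    ∫ p : ℝ × E d × E d, (ε ^ 2)⁻¹ * dissTrunc k D (f p.1) p.2 ∂(timePhase d T)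
      ≤ 2 * (entropyConst T D B f0 + totalFlux T ε f) := by
  have hD := h.D_pos
  have hε := h.ε_pos
  have hi := h.integrable_dissTrunc hk
  have hDt : IntegrableOn (fun s => ∫ z, dissTrunc k D (f s) z) (Ioo 0 T) := hi.integral_prod_left
  have key := setIntegral_Ioo_le_of_ae h.T_pos hDt
    (C := 2 * ε ^ 2 * (entropyConst T D B f0 + totalFlux T ε f)) (by
      filter_upwards [h.ae_entropyK_le hk, h.ae_mass_eq, h.ae_position_le] with t h1 h2 h3
      have h4 := le_entropyK hD hk h2.1 h3.1 (h.nonneg t)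
      have h5 := entropyK_le hD hk h.datum
      have h6 : 1 / 2 * (ε ^ 2)⁻¹ * ∫ s in Ioc 0 t, ∫ z, dissTrunc k D (f s) z
          ≤ entropyConst T D B f0 + totalFlux T ε f := by
        unfold entropyConst
        linarith [h3.2]
      have h7 : 1 / 2 * (ε ^ 2)⁻¹ * ∫ s in Ioc 0 t, ∫ z, dissTrunc k D (f s) z
          = (2 * ε ^ 2)⁻¹ * ∫ s in Ioc 0 t, ∫ z, dissTrunc k D (f s) z := by
        rw [mul_inv, one_div]
      rw [h7] at h6
      exact (inv_mul_le_iff₀ (by positivity)).mp h6)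
  rw [integral_const_mul, timePhase, integral_prod _ hi, inv_mul_le_iff₀ (by positivity)]
  linarith

/-- Fatou's lemma as the truncation is removed. It is applied to extended nonnegative functions, so
finiteness shows in particular that the value +∞ is taken only on a null set. -/
theorem dissipation_le (h : IsKinetic T D ε B K L F f0 f) :
    dissipation T D ε f ≤ ENNReal.ofReal (2 * (entropyConst T D B f0 + totalFlux T ε f)) := by
  have hε := h.ε_pos
  have hk : ∀ n : ℕ, (1 : ℝ) ≤ (n : ℝ) + 1 := fun n => by simp
  have hc : 0 < 1 / ε ^ 2 := by positivity
  calc dissipation T D ε f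
      = ∫⁻ p, liminf (fun n : ℕ => ENNReal.ofReal (1 / ε ^ 2 *
          dissTrunc ((n : ℝ) + 1) D (f p.1) p.2)) atTop ∂(timePhase d T) := by
        refine lintegral_congr fun p => ?_
        exact (tendsto_dissTrunc hc h.D_pos (h.nonneg p.1) p.2).liminf_eq.symm
    _ ≤ liminf (fun n : ℕ => ∫⁻ p, ENNReal.ofReal (1 / ε ^ 2 *
          dissTrunc ((n : ℝ) + 1) D (f p.1) p.2) ∂(timePhase d T)) atTop :=
        lintegral_liminf_le fun n =>
          ((measurable_dissTrunc (hk n) D h.measurable).const_mul _).ennreal_ofReal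
    _ ≤ _ := by
        refine liminf_le_of_le (by isBoundedDefault) fun b hb => ?_
        obtain ⟨n, hn⟩ := hb.exists
        refine hn.trans ?_
        rw [← ofReal_integral_eq_lintegral_ofReal ((h.integrable_dissTrunc (hk n)).const_mul _)
          (ae_of_all _ fun p => mul_nonneg hc.le (dissTrunc_nonneg (hk n) h.D_pos _ _))]
        refine ENNReal.ofReal_le_ofReal ?_
        have := h.integral_dissTrunc_le (hk n)
        rwa [← one_div] at this

end IsKinetic

/-! ### Pointwise bound of the flux -/

/-- The Cauchy–Schwarz inequality for integrals, in a form adapted to pointwise bounds. -/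
theorem sq_integral_le_of_sq_le {α : Type*} [MeasurableSpace α] {μ : Measure α} {u p q : α → ℝ}
    (hu : Integrable u μ) (hp : Integrable p μ) (hq : Integrable q μ) (hu0 : ∀ᵐ x ∂μ, 0 ≤ u x)
    (hp0 : ∀ᵐ x ∂μ, 0 ≤ p x) (hq0 : ∀ᵐ x ∂μ, 0 ≤ q x) (h : ∀ᵐ x ∂μ, u x ^ 2 ≤ p x * q x) :
    (∫ x, u x ∂μ) ^ 2 ≤ (∫ x, p x ∂μ) * ∫ x, q x ∂μ := by
  have hj := integral_nonneg_of_ae hu0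
  have ha := integral_nonneg_of_ae hp0
  have hb := integral_nonneg_of_ae hq0
  -- The weighted arithmetic–geometric inequality, integrated with a free parameter. Choosing c =
  -- (∫u)/(∫p) gives the result; if ∫p = 0, a large c forces ∫u = 0.
  have key : ∀ c : ℝ, 0 < c → 2 * ∫ x, u x ∂μ ≤ c * (∫ x, p x ∂μ) + c⁻¹ * ∫ x, q x ∂μ := by
    intro c hc
    rw [← integral_const_mul, ← integral_const_mul, ← integral_const_mul,
      ← integral_add (hp.const_mul c) (hq.const_mul c⁻¹)]
    refine integral_mono_ae (hu.const_mul 2) ((hp.const_mul c).add (hq.const_mul c⁻¹)) ?_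
    filter_upwards [hu0, hp0, hq0, h] with x h1 h2 h3 h4
    refine two_mul_le_add_of_sq_le (by positivity) (by positivity) ?_
    rwa [mul_mul_mul_comm, mul_inv_cancel₀ hc.ne', one_mul]
  set j := ∫ x, u x ∂μ
  set a := ∫ x, p x ∂μ
  set b := ∫ x, q x ∂μ
  rcases hj.eq_or_lt with hj' | hj'
  · rw [← hj']; simpa using mul_nonneg ha hb
  rcases ha.eq_or_lt with ha' | ha'
  · exfalso
    have h1 := key ((b + 1) / j) (by positivity)
    rw [← ha', mul_zero, zero_add, inv_div, div_mul_eq_mul_div, le_div_iff₀ (by positivity)] at h1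
    nlinarith
  · have h1 := key (j / a) (by positivity)
    rw [div_mul_cancel₀ _ ha'.ne', inv_div, div_mul_eq_mul_div] at h1
    have h2 : j ≤ a * b / j := by linarith
    rw [le_div_iff₀ hj'] at h2
    linarith

/-- An exponential moment of the Maxwellian. -/
def maxwellianExp (d : ℕ) (D : ℝ) : ℝ := ∫ ξ : E d, Real.exp (‖ξ‖ ^ 2 / (4 * D)) * maxwellian D ξ

/-- The constant in the pointwise bound of the flux. -/
def fluxConst (d : ℕ) (D : ℝ) : ℝ := 4 * D * (1 + maxwellianExp d D) + maxwellianEnergy d D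

theorem maxwellianExp_nonneg {D : ℝ} (hD : 0 < D) : 0 ≤ maxwellianExp d D :=
  integral_nonneg fun ξ => mul_nonneg (Real.exp_pos _).le (maxwellian_pos hD ξ).le

theorem fluxConst_nonneg {D : ℝ} (hD : 0 < D) : 0 ≤ fluxConst d D := by
  have h1 := maxwellianExp_nonneg (d := d) hD
  have h2 := IsKinetic.maxwellianEnergy_nonneg (d := d) hD
  unfold fluxConst
  positivity

/-- The dissipation controls the flux. -/
theorem sq_norm_flux_le {D ε : ℝ} (hD : 0 < D) (hε : 0 < ε) {g : E d → ℝ} (hgm : Measurable g)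
    (hg0 : ∀ ξ, 0 ≤ g ξ) (hg : Integrable g) (hg2 : Integrable fun ξ => ‖ξ‖ ^ 2 * g ξ)
    (hΔ : ∫⁻ ξ, ENNReal.ofReal (1 / ε ^ 2) *
      entropyProduction ((∫ ξ, g ξ) * maxwellian D ξ) (g ξ) ≠ ⊤) :
    ‖∫ ξ, (g ξ / ε) • ξ‖ ^ 2 ≤ fluxConst d D * (∫⁻ ξ, ENNReal.ofReal (1 / ε ^ 2) *
      entropyProduction ((∫ ξ, g ξ) * maxwellian D ξ) (g ξ)).toReal * ∫ ξ, g ξ := by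
  set ρ := ∫ ξ, g ξ with hρ
  have hρ0 : 0 ≤ ρ := integral_nonneg hg0
  set M := maxwellian (d := d) D with hM
  have hMpos : ∀ ξ, 0 < M ξ := maxwellian_pos hD
  have hMm : Measurable M := (continuous_maxwellian D).measurable
  have hMi : Integrable M := integrable_maxwellian hD
  have hepm : Measurable fun ξ => entropyProduction (ρ * M ξ) (g ξ) :=
    measurable_entropyProduction.comp ((hMm.const_mul ρ).prodMk hgm)
  have hc : 0 < 1 / ε ^ 2 := by positivity
  rw [lintegral_const_mul _ hepm] at hΔ ⊢
  set δ := ∫⁻ ξ, entropyProduction (ρ * M ξ) (g ξ) with hδ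
  have hδtop : δ ≠ ⊤ := by
    intro htop
    rw [htop, ENNReal.mul_top (by simpa using hε.ne')] at hΔ
    exact hΔ rfl
  have hfin : ∀ᵐ ξ, entropyProduction (ρ * M ξ) (g ξ) < ⊤ := ae_lt_top hepm hδtop
  rw [ENNReal.toReal_mul, ENNReal.toReal_ofReal hc.le]
  have hJ : ‖∫ ξ, (g ξ / ε) • ξ‖ = ε⁻¹ * ‖∫ ξ, g ξ • ξ‖ := by
    rw [← Real.norm_of_nonneg (inv_nonneg.mpr hε.le), ← norm_smul, ← integral_smul]
    congr 2
    ext1 ξ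
    rw [smul_smul]
    congr 1
    ring
  rw [hJ]
  rcases hρ0.eq_or_lt with hρz | hρpos
  · have hgz : g =ᵐ[volume] 0 := (integral_eq_zero_iff_of_nonneg hg0 hg).mp (hρ ▸ hρz.symm)
    have : ∫ ξ, g ξ • ξ = 0 := integral_eq_zero_of_ae (hgz.mono fun ξ hξ => by simp [hξ])
    rw [this, ← hρz]; simp
  set e : E d → ℝ := fun ξ => (entropyProduction (ρ * M ξ) (g ξ)).toReal with he
  have hei : Integrable e := integrable_toReal_of_lintegral_ne_top hepm.aemeasurable hδtop
  have heint : ∫ ξ, e ξ = δ.toReal := integral_toReal hepm.aemeasurable hfin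
  -- Since ρ > 0 and the dissipation is finite, g cannot vanish on a set of positive measure: the
  -- production would be infinite there.
  have hpos : ∀ᵐ ξ, 0 < g ξ ∧
      e ξ = (ρ * M ξ - g ξ) * (Real.log (ρ * M ξ) - Real.log (g ξ)) := by
    filter_upwards [hfin] with ξ hξ
    have hr : 0 < ρ * M ξ := mul_pos hρpos (hMpos ξ)
    have hiff : ρ * M ξ = 0 ↔ g ξ = 0 := by
      by_contra hne
      rw [entropyProduction, if_neg hne] at hξ
      exact lt_irrefl _ hξ
    have hgp : 0 < g ξ := (hg0 ξ).lt_of_ne fun h0 => hr.ne' (hiff.mpr h0.symm)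
    refine ⟨hgp, ?_⟩
    simp only [he]
    rw [entropyProduction, if_pos hiff, ENNReal.toReal_ofReal]
    rcases le_total (ρ * M ξ) (g ξ) with hle | hle
    · exact mul_nonneg_of_nonpos_of_nonpos (by linarith)
        (sub_nonpos.mpr (Real.log_le_log hr hle))
    · exact mul_nonneg (by linarith) (sub_nonneg.mpr (Real.log_le_log hgp hle))
  have he0 : ∀ ξ, 0 ≤ e ξ := fun ξ => ENNReal.toReal_nonneg
  set κ := ∫ ξ, ‖ξ‖ ^ 2 * g ξ with hκ
  have hκ0 : 0 ≤ κ := integral_nonneg fun ξ => mul_nonneg (by positivity) (hg0 ξ)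
  set Δ := δ.toReal with hΔdef
  have hΔ0 : 0 ≤ Δ := ENNReal.toReal_nonneg
  have c1 := IsKinetic.maxwellianEnergy_nonneg (d := d) hD
  have c2 := maxwellianExp_nonneg (d := d) hD
  -- energy
  have hE : κ ≤ 4 * D * (Δ + maxwellianExp d D * ρ) := by
    have i1 := (integrable_exp_mul_maxwellian (d := d) hD).const_mul ρ
    have h1 : ∫ ξ, 1 / (4 * D) * (‖ξ‖ ^ 2 * g ξ)
        ≤ ∫ ξ, (e ξ + ρ * (Real.exp (‖ξ‖ ^ 2 / (4 * D)) * M ξ)) := by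
      refine integral_mono_ae (hg2.const_mul _) (hei.add i1) ?_
      filter_upwards [hpos] with ξ hξ
      -- Entropy duality with y = |ξ|²/(4D), whose exponential is integrable against M: the second
      -- moment of g is bounded by the dissipation and the density alone.
      have h2 := mul_le_entropy_add (y := ‖ξ‖ ^ 2 / (4 * D)) hξ.1 (mul_pos hρpos (hMpos ξ))
      rw [hξ.2]
      calc _ = ‖ξ‖ ^ 2 / (4 * D) * g ξ := by ring
        _ ≤ _ := h2
        _ = _ := by ring
    rw [integral_const_mul, integral_add hei i1, heint, integral_const_mul, one_div,
      inv_mul_le_iff₀ (by positivity)] at h1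
    calc κ ≤ _ := h1
      _ = _ := by rw [maxwellianExp]; ring
  -- first bound
  have hn1 : Integrable fun ξ => ‖ξ‖ * g ξ := by
    refine (hg.add hg2).mono' (measurable_norm.mul hgm).aestronglyMeasurable
      (ae_of_all _ fun ξ => ?_)
    rw [Real.norm_of_nonneg (mul_nonneg (norm_nonneg _) (hg0 _)), Pi.add_apply]
    nlinarith [norm_le_one_add_sq ξ, hg0 ξ]
  have hB1 : ‖∫ ξ, g ξ • ξ‖ ^ 2 ≤ κ * ρ := by
    have h1 : ‖∫ ξ, g ξ • ξ‖ ≤ ∫ ξ, ‖ξ‖ * g ξ := by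
      refine norm_integral_le_of_norm_le hn1 (ae_of_all _ fun ξ => ?_)
      rw [norm_smul, Real.norm_of_nonneg (hg0 ξ), mul_comm]
    have h2 := sq_integral_le_of_sq_le hn1 hg2 hg
      (ae_of_all _ fun ξ => mul_nonneg (norm_nonneg _) (hg0 ξ))
      (ae_of_all _ fun ξ => mul_nonneg (by positivity) (hg0 ξ)) (ae_of_all _ hg0)
      (ae_of_all _ fun ξ => le_of_eq (by ring))
    exact (pow_le_pow_left₀ (norm_nonneg _) h1 2).trans h2
  -- second bound
  have hB2 : ‖∫ ξ, g ξ • ξ‖ ^ 2 ≤ Δ * (κ + maxwellianEnergy d D * ρ) := by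
    have hn2 : Integrable fun ξ : E d => ‖ξ‖ * (ρ * M ξ) := by
      refine ((integrable_smul_maxwellian (d := d) hD).norm.const_mul ρ).congr
        (ae_of_all _ fun ξ => ?_)
      simp only
      rw [norm_smul, Real.norm_of_nonneg (hMpos ξ).le]; ring
    have hs1 : Integrable fun ξ : E d => g ξ • ξ := by
      refine hn1.mono' (hgm.smul measurable_id).aestronglyMeasurable (ae_of_all _ fun ξ => ?_)
      rw [norm_smul, Real.norm_of_nonneg (hg0 ξ), mul_comm]
    have hs2 : Integrable fun ξ : E d => ρ • (M ξ • ξ) := (integrable_smul_maxwellian hD).smul ρ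
    have hz : ∫ ξ : E d, g ξ • ξ = ∫ ξ : E d, (g ξ • ξ - ρ • (M ξ • ξ)) := by
      rw [integral_sub hs1 hs2, integral_smul, integral_smul_maxwellian, smul_zero, sub_zero]
    have hn3 : Integrable fun ξ => ‖ξ‖ * |g ξ - ρ * M ξ| := by
      refine (hn1.sub hn2).norm.congr (ae_of_all _ fun ξ => ?_)
      simp only [Pi.sub_apply]
      rw [← mul_sub, norm_mul, norm_norm, Real.norm_eq_abs]
    have h1 : ‖∫ ξ, g ξ • ξ‖ ≤ ∫ ξ, ‖ξ‖ * |g ξ - ρ * M ξ| := by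
      rw [hz]
      refine norm_integral_le_of_norm_le hn3 (ae_of_all _ fun ξ => ?_)
      rw [smul_smul, ← sub_smul, norm_smul, Real.norm_eq_abs, mul_comm]
    have hs3 : Integrable fun ξ : E d => ρ * (‖ξ‖ ^ 2 * M ξ) :=
      (integrable_sq_mul_maxwellian hD).const_mul ρ
    have h2 := sq_integral_le_of_sq_le hn3 hei (hg2.add hs3)
      (ae_of_all _ fun ξ => mul_nonneg (norm_nonneg _) (abs_nonneg _)) (ae_of_all _ he0)
      (ae_of_all _ fun ξ => add_nonneg (mul_nonneg (by positivity) (hg0 ξ))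
        (mul_nonneg hρ0 (mul_nonneg (by positivity) (hMpos ξ).le))) (by
        filter_upwards [hpos] with ξ hξ
        have h3 := sq_sub_le_mul_log (mul_pos hρpos (hMpos ξ)) hξ.1
        rw [hξ.2, mul_pow, sq_abs, Pi.add_apply]
        calc ‖ξ‖ ^ 2 * (g ξ - ρ * M ξ) ^ 2 = ‖ξ‖ ^ 2 * (ρ * M ξ - g ξ) ^ 2 := by ring
          _ ≤ ‖ξ‖ ^ 2 * ((ρ * M ξ - g ξ) * (Real.log (ρ * M ξ) - Real.log (g ξ))
              * (ρ * M ξ + g ξ)) := by gcongr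
          _ = _ := by ring)
    refine (pow_le_pow_left₀ (norm_nonneg _) h1 2).trans (h2.trans_eq ?_)
    rw [heint]
    congr 1
    simp only [Pi.add_apply]
    rw [integral_add hg2 hs3, integral_const_mul, maxwellianEnergy, mul_comm ρ]
  -- combination
  have hfinal : ‖∫ ξ, g ξ • ξ‖ ^ 2 ≤ fluxConst d D * Δ * ρ := by
    unfold fluxConst
    -- Near equilibrium, where Δ ≤ ρ, the second bound is used and the energy is a multiple of ρ.
    -- Far from equilibrium the first bound is used and the energy is a multiple of Δ. Both give a
    -- multiple of Δρ.
    rcases le_total Δ ρ with hle | hle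
    · have := mul_le_mul_of_nonneg_left hE hΔ0
      nlinarith [mul_nonneg hD.le (mul_nonneg hΔ0 (sub_nonneg.mpr hle))]
    · have := mul_le_mul_of_nonneg_right hE hρ0
      nlinarith [mul_nonneg (mul_nonneg hD.le c2) (mul_nonneg hρ0 (sub_nonneg.mpr hle)),
        mul_nonneg c1 (mul_nonneg hΔ0 hρ0)]
  calc (ε⁻¹ * ‖∫ ξ, g ξ • ξ‖) ^ 2 = 1 / ε ^ 2 * ‖∫ ξ, g ξ • ξ‖ ^ 2 := by
        rw [mul_pow, inv_pow, one_div]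
    _ ≤ 1 / ε ^ 2 * (fluxConst d D * Δ * ρ) := by gcongr
    _ = _ := by ring

end

/-! ### Uniform bounds on dissipation, flux and position -/

section

variable {d : ℕ}

theorem lintegral_ofReal_le_of_le {α : Type*} [MeasurableSpace α] {μ : Measure α} {u v : α → ℝ}
    {C : ℝ} (hv : Integrable v μ) (hv0 : ∀ᵐ x ∂μ, 0 ≤ v x) (huv : ∀ᵐ x ∂μ, u x ≤ v x)
    (hC : ∫ x, v x ∂μ ≤ C) : ∫⁻ x, ENNReal.ofReal (u x) ∂μ ≤ ENNReal.ofReal C := by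
  calc ∫⁻ x, ENNReal.ofReal (u x) ∂μ ≤ ∫⁻ x, ENNReal.ofReal (v x) ∂μ :=
        lintegral_mono_ae (huv.mono fun x hx => ENNReal.ofReal_le_ofReal hx)
    _ = ENNReal.ofReal (∫ x, v x ∂μ) := (ofReal_integral_eq_lintegral_ofReal hv hv0).symm
    _ ≤ _ := ENNReal.ofReal_le_ofReal hC

theorem lintegral_timePhase (T : ℝ) {G : ℝ × E d × E d → ℝ≥0∞} (hG : Measurable G) :
    ∫⁻ p, G p ∂(timePhase d T) = ∫⁻ q, (∫⁻ ξ, G (q.1, q.2, ξ)) ∂(timeSpace d T) := by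
  have h1 : Measurable fun r : (ℝ × E d) × E d => G (r.1.1, r.1.2, r.2) :=
    hG.comp ((measurable_fst.comp measurable_fst).prodMk
      ((measurable_snd.comp measurable_fst).prodMk measurable_snd))
  rw [timePhase, timeSpace, lintegral_prod _ hG.aemeasurable,
    lintegral_prod _ h1.lintegral_prod_right'.aemeasurable]
  refine lintegral_congr fun t => ?_
  have h2 : Measurable fun z : E d × E d => G (t, z) := hG.comp measurable_prodMk_left
  rw [Measure.volume_eq_prod, lintegral_prod _ h2.aemeasurable]

/-- The dissipation at a point in time and space. -/
def localDiss (D ε : ℝ) (f : ℝ → E d → E d → ℝ) (q : ℝ × E d) : ℝ≥0∞ :=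
  ∫⁻ ξ, ENNReal.ofReal (1 / ε ^ 2) *
    entropyProduction (density (f q.1) q.2 * maxwellian D ξ) (f q.1 q.2 ξ)

theorem measurable_dissipation_integrand (D ε : ℝ) {f : ℝ → E d → E d → ℝ}
    (hf : Measurable fun p : ℝ × E d × E d => f p.1 p.2.1 p.2.2) :
    Measurable fun p : ℝ × E d × E d => ENNReal.ofReal (1 / ε ^ 2) *
      entropyProduction (density (f p.1) p.2.1 * maxwellian D p.2.2) (f p.1 p.2.1 p.2.2) := by
  have h1 := (measurable_density hf).comp
    (measurable_fst.prodMk (measurable_fst.comp measurable_snd) :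
      Measurable fun p : ℝ × E d × E d => (p.1, p.2.1))
  have h2 := (continuous_maxwellian (d := d) D).measurable.comp
    (measurable_snd.comp measurable_snd : Measurable fun p : ℝ × E d × E d => p.2.2)
  exact (measurable_entropyProduction.comp ((h1.mul h2).prodMk hf)).const_mul _

theorem measurable_localDiss (D ε : ℝ) {f : ℝ → E d → E d → ℝ}
    (hf : Measurable fun p : ℝ × E d × E d => f p.1 p.2.1 p.2.2) :
    Measurable (localDiss D ε f) := by
  have h1 : Measurable fun r : (ℝ × E d) × E d => ENNReal.ofReal (1 / ε ^ 2) *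
      entropyProduction (density (f r.1.1) r.1.2 * maxwellian D r.2) (f r.1.1 r.1.2 r.2) :=
    (measurable_dissipation_integrand D ε hf).comp ((measurable_fst.comp measurable_fst).prodMk
      ((measurable_snd.comp measurable_fst).prodMk measurable_snd))
  exact h1.lintegral_prod_right'

theorem dissipation_eq (T D ε : ℝ) {f : ℝ → E d → E d → ℝ}
    (hf : Measurable fun p : ℝ × E d × E d => f p.1 p.2.1 p.2.2) :
    dissipation T D ε f = ∫⁻ q, localDiss D ε f q ∂(timeSpace d T) :=
  lintegral_timePhase T (measurable_dissipation_integrand D ε hf)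

/-- The uniform bound of the dissipation. -/
def dissBound (T D B : ℝ) (f0 : E d → E d → ℝ) : ℝ :=
  4 * (entropyConst T D B f0 + fluxConst d D * (T * mass f0))

/-- The uniform bound of the flux. -/
def fluxBound (T D B : ℝ) (f0 : E d → E d → ℝ) : ℝ :=
  1 / 4 * dissBound T D B f0 + fluxConst d D * (T * mass f0)

/-- The uniform bound of the first moment in position. -/
def positionBound (T D B : ℝ) (f0 : E d → E d → ℝ) : ℝ := positionMoment f0 + fluxBound T D B f0

namespace IsKinetic

variable {T D ε B K : ℝ} {L : ℝ≥0} {F : ℝ → E d → E d} {f0 : E d → E d → ℝ}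
  {f : ℝ → E d → E d → ℝ}

theorem ae_integrable_slice {w : E d → ℝ} (hw : Measurable w)
    (hf : Measurable fun p : ℝ × E d × E d => f p.1 p.2.1 p.2.2) {C : ℝ}
    (h : ∀ᵐ t ∂(volume.restrict (Ioo 0 T)), Integrable (fun z : E d × E d => w z.2 * f t z.1 z.2) ∧
      ∫ z : E d × E d, ‖w z.2 * f t z.1 z.2‖ ≤ C) :
    ∀ᵐ q ∂(timeSpace d T), Integrable fun ξ => w ξ * f q.1 q.2 ξ := by
  have hm : Measurable fun p : ℝ × E d × E d => w p.2.2 * f p.1 p.2.1 p.2.2 :=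
    (hw.comp (measurable_snd.comp measurable_snd)).mul hf
  have hi : Integrable (fun p : ℝ × E d × E d => w p.2.2 * f p.1 p.2.1 p.2.2) (timePhase d T) :=
    integrable_prod_of_bound hm.stronglyMeasurable h
  have h1 := hi.hasFiniteIntegral
  have hm2 : Measurable fun r : (ℝ × E d) × E d => ‖w r.2 * f r.1.1 r.1.2 r.2‖ₑ :=
    (hm.comp ((measurable_fst.comp measurable_fst).prodMk
      ((measurable_snd.comp measurable_fst).prodMk measurable_snd))).enorm
  rw [HasFiniteIntegral, lintegral_timePhase T hm.enorm] at h1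
  filter_upwards [ae_lt_top hm2.lintegral_prod_right' h1.ne] with q hq
  refine ⟨?_, hq⟩
  exact (hm.comp (measurable_prodMk_left.comp measurable_prodMk_left :
    Measurable fun ξ : E d => (q.1, q.2, ξ))).aestronglyMeasurable

theorem ae_integrable (h : IsKinetic T D ε B K L F f0 f) : ∀ᵐ q ∂(timeSpace d T),
    Integrable (f q.1 q.2) ∧ Integrable fun ξ => ‖ξ‖ ^ 2 * f q.1 q.2 ξ := by
  have h1 := ae_integrable_slice (T := T) (w := fun _ => 1) measurable_const h.measurable
    (C := mass f0) (by
      filter_upwards [h.ae_mass_eq] with t ht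
      simp only [one_mul, Real.norm_of_nonneg (h.nonneg t _ _)]
      exact ⟨ht.1, ht.2.le⟩)
  have h2 := ae_integrable_slice (T := T) (w := fun ξ => ‖ξ‖ ^ 2) (by fun_prop) h.measurable
    (C := energyBound D B f0) (by
      filter_upwards [h.ae_energy_le] with t ht
      have e : ∀ z : E d × E d, ‖‖z.2‖ ^ 2 * f t z.1 z.2‖ = ‖z.2‖ ^ 2 * f t z.1 z.2 := fun z =>
        Real.norm_of_nonneg (mul_nonneg (by positivity) (h.nonneg t _ _))
      simp_rw [e]
      exact ht)
  filter_upwards [h1, h2] with q hq1 hq2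
  simp only [one_mul] at hq1
  exact ⟨hq1, hq2⟩

theorem dissipation_ne_top (h : IsKinetic T D ε B K L F f0 f) : dissipation T D ε f ≠ ⊤ :=
  (h.dissipation_le.trans_lt ENNReal.ofReal_lt_top).ne

theorem ae_localDiss_lt_top (h : IsKinetic T D ε B K L F f0 f) :
    ∀ᵐ q ∂(timeSpace d T), localDiss D ε f q < ⊤ := by
  refine ae_lt_top (measurable_localDiss D ε h.measurable) ?_
  rw [← dissipation_eq T D ε h.measurable]
  exact h.dissipation_ne_top

theorem integrable_localDiss (h : IsKinetic T D ε B K L F f0 f) :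
    Integrable (fun q => (localDiss D ε f q).toReal) (timeSpace d T) ∧
      ∫ q, (localDiss D ε f q).toReal ∂(timeSpace d T) = (dissipation T D ε f).toReal := by
  have hm := (measurable_localDiss D ε h.measurable).aemeasurable (μ := timeSpace d T)
  refine ⟨integrable_toReal_of_lintegral_ne_top hm ?_, ?_⟩
  · rw [← dissipation_eq T D ε h.measurable]
    exact h.dissipation_ne_top
  · rw [integral_toReal hm h.ae_localDiss_lt_top, dissipation_eq T D ε h.measurable]

/-- The dissipation controls the flux at almost every point. -/
theorem ae_sq_norm_flux_le (h : IsKinetic T D ε B K L F f0 f) : ∀ᵐ q ∂(timeSpace d T),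
    ‖flux ε (f q.1) q.2‖ ^ 2
      ≤ fluxConst d D * (localDiss D ε f q).toReal * density (f q.1) q.2 := by
  filter_upwards [h.ae_integrable, h.ae_localDiss_lt_top] with q h1 h2
  have hm : Measurable (f q.1 q.2) := h.measurable.comp
    (measurable_prodMk_left.comp measurable_prodMk_left : Measurable fun ξ : E d => (q.1, q.2, ξ))
  exact sq_norm_flux_le h.D_pos h.ε_pos hm (h.nonneg q.1 q.2) h1.1 h1.2 h2.ne

theorem integrable_density (h : IsKinetic T D ε B K L F f0 f) :
    Integrable (fun q : ℝ × E d => density (f q.1) q.2) (timeSpace d T) ∧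
      ∫ q : ℝ × E d, density (f q.1) q.2 ∂(timeSpace d T) = T * mass f0 := by
  have hi : Integrable (fun q : ℝ × E d => density (f q.1) q.2) (timeSpace d T) := by
    refine integrable_prod_of_bound (measurable_density h.measurable).stronglyMeasurable
      (K := mass f0) ?_
    filter_upwards [h.ae_mass_eq] with t ht
    simp only [Real.norm_of_nonneg (density_nonneg (h.nonneg t) _)]
    exact ⟨VCH.integrable_density ht.1, ((integral_density ht.1).trans ht.2).le⟩
  refine ⟨hi, ?_⟩
  rw [timeSpace, integral_prod _ hi]
  have : ∀ᵐ t ∂(volume.restrict (Ioo 0 T)), ∫ x, density (f t) x = mass f0 := by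
    filter_upwards [h.ae_mass_eq] with t ht
    exact (integral_density ht.1).trans ht.2
  rw [integral_congr_ae this]
  simp [h.T_pos.le]

/-- Young's inequality applied to |J|² ≤ CΔρ. The weight 1/4 is chosen so that, multiplied by the
factor 2 in the bound of the dissipation by the flux, it leaves 1/2 < 1. -/
theorem totalFlux_le (h : IsKinetic T D ε B K L F f0 f) : totalFlux T ε f
    ≤ 1 / 4 * (dissipation T D ε f).toReal + fluxConst d D * (T * mass f0) := by
  obtain ⟨i1, e1⟩ := h.integrable_localDiss
  obtain ⟨i2, e2⟩ := h.integrable_density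
  rw [← e1, ← e2, ← integral_const_mul, ← integral_const_mul,
    ← integral_add (i1.const_mul _) (i2.const_mul _)]
  refine integral_mono_ae h.integrable_flux.norm ((i1.const_mul _).add (i2.const_mul _)) ?_
  filter_upwards [h.ae_sq_norm_flux_le] with q hq
  have hρ := density_nonneg (h.nonneg q.1) q.2
  have hC := fluxConst_nonneg (d := d) h.D_pos
  have := two_mul_le_add_of_sq_le (p := 1 / 2 * (localDiss D ε f q).toReal)
    (q := 2 * (fluxConst d D * density (f q.1) q.2))
    (mul_nonneg (by norm_num) ENNReal.toReal_nonneg) (by positivity)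
    (hq.trans_eq (by ring))
  linarith

theorem entropyConst_add_nonneg (h : IsKinetic T D ε B K L F f0 f) :
    0 ≤ entropyConst T D B f0 + totalFlux T ε f := by
  have := h.integral_dissTrunc_le (le_refl (1 : ℝ))
  have h2 : 0 ≤ ∫ p : ℝ × E d × E d, (ε ^ 2)⁻¹ * dissTrunc 1 D (f p.1) p.2 ∂(timePhase d T) :=
    integral_nonneg fun p => mul_nonneg (by have := h.ε_pos; positivity)
      (dissTrunc_nonneg le_rfl h.D_pos _ _)
  linarith

/-- The loop closes: the dissipation is at most a constant plus twice the flux, and twice the flux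
at most a constant plus half of the dissipation. Finiteness, known beforehand though not uniformly,
allows the absorption. -/
theorem dissipation_toReal_le (h : IsKinetic T D ε B K L F f0 f) :
    (dissipation T D ε f).toReal ≤ dissBound T D B f0 := by
  have h1 := ENNReal.toReal_le_of_le_ofReal (by linarith [h.entropyConst_add_nonneg])
    h.dissipation_le
  have h2 := h.totalFlux_le
  unfold dissBound
  linarith

theorem dissipation_le_dissBound (h : IsKinetic T D ε B K L F f0 f) :
    dissipation T D ε f ≤ ENNReal.ofReal (dissBound T D B f0) :=
  ENNReal.le_ofReal_iff_toReal_le h.dissipation_ne_top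
    (ENNReal.toReal_nonneg.trans h.dissipation_toReal_le) |>.mpr h.dissipation_toReal_le

theorem totalFlux_le_fluxBound (h : IsKinetic T D ε B K L F f0 f) :
    totalFlux T ε f ≤ fluxBound T D B f0 := by
  have h1 := h.totalFlux_le
  have h2 := h.dissipation_toReal_le
  unfold fluxBound
  linarith

theorem ae_position_le_bound (h : IsKinetic T D ε B K L F f0 f) :
    ∀ᵐ t ∂(volume.restrict (Ioo 0 T)),
    Integrable (fun z : E d × E d => ‖z.1‖ * f t z.1 z.2) ∧
      ∫ z : E d × E d, ‖z.1‖ * f t z.1 z.2 ≤ positionBound T D B f0 := by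
  filter_upwards [h.ae_position_le] with t ht
  refine ⟨ht.1, ht.2.trans ?_⟩
  unfold positionBound
  linarith [h.totalFlux_le_fluxBound]

end IsKinetic

/-! ### Entropy bounds -/

/-- The relative entropy density, shifted to be nonnegative. -/
def shiftedEntropy (D : ℝ) (g : E d → E d → ℝ) (z : E d × E d) : ℝ :=
  maxwellian D z.2 * (g z.1 z.2 / maxwellian D z.2 * Real.log (g z.1 z.2 / maxwellian D z.2)
    - g z.1 z.2 / maxwellian D z.2) + ‖z.1‖ * g z.1 z.2 + Real.exp (-‖z.1‖) * maxwellian D z.2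

/-- The uniform bound of the shifted entropy. -/
def shiftedBound (T D B : ℝ) (f0 : E d → E d → ℝ) : ℝ :=
  initialEntropy D f0 + T * entropyRate D B f0 + positionBound T D B f0 + expConst d

/-- The uniform bound of `f |log f|`. -/
def entropyBound (T D B : ℝ) (f0 : E d → E d → ℝ) : ℝ :=
  shiftedBound T D B f0 + mass f0 + positionBound T D B f0 + expConst d
    + (logConst d D * mass f0 + 1 / (2 * D) * energyBound D B f0)

section shiftedEntropy

variable {D : ℝ} {g : E d → E d → ℝ}

theorem shiftedEntropy_eq (hD : 0 < D) (g : E d → E d → ℝ) (z : E d × E d) :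
    shiftedEntropy D g z = g z.1 z.2 * Real.log (g z.1 z.2 / maxwellian D z.2) - g z.1 z.2
      + ‖z.1‖ * g z.1 z.2 + Real.exp (-‖z.1‖) * maxwellian D z.2 := by
  have := (maxwellian_pos hD z.2).ne'
  unfold shiftedEntropy
  field_simp

/-- The logarithm of g is split into those of g/M and of M. The first is handled by `mul_abs_log_le`
with a = |x|; the second grows quadratically in ξ and is paid for by mass and energy. -/
theorem mul_abs_log_le_shifted (hD : 0 < D) (hg0 : ∀ x ξ, 0 ≤ g x ξ) (z : E d × E d) :
    g z.1 z.2 * |Real.log (g z.1 z.2)| ≤ shiftedEntropy D g z + g z.1 z.2 + ‖z.1‖ * g z.1 z.2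
      + Real.exp (-‖z.1‖) * maxwellian D z.2
      + (logConst d D * g z.1 z.2 + 1 / (2 * D) * (‖z.2‖ ^ 2 * g z.1 z.2)) := by
  have hM := maxwellian_pos hD z.2
  have h0 := hg0 z.1 z.2
  have h5 := mul_abs_log_maxwellian_le hD h0 z.2
  have h1 := mul_le_mul_of_nonneg_left
    (mul_abs_log_le (div_nonneg h0 hM.le) (norm_nonneg z.1)) hM.le
  have h2 : g z.1 z.2 * |Real.log (g z.1 z.2)| ≤ g z.1 z.2 * |Real.log (g z.1 z.2 / maxwellian D z.2)|
      + g z.1 z.2 * |Real.log (maxwellian D z.2)| := by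
    rcases h0.eq_or_lt with h0' | h0'
    · rw [← h0']; simp
    rw [← mul_add]
    refine mul_le_mul_of_nonneg_left ?_ h0
    have : Real.log (g z.1 z.2) = Real.log (g z.1 z.2 / maxwellian D z.2)
        + Real.log (maxwellian D z.2) := by rw [Real.log_div h0'.ne' hM.ne']; ring
    rw [this]
    exact abs_add_le _ _
  rw [shiftedEntropy_eq hD]
  have e1 : maxwellian D z.2 * (g z.1 z.2 / maxwellian D z.2 *
      |Real.log (g z.1 z.2 / maxwellian D z.2)|)
      = g z.1 z.2 * |Real.log (g z.1 z.2 / maxwellian D z.2)| := by field_simp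
  have e2 : maxwellian D z.2 * (g z.1 z.2 / maxwellian D z.2 *
      Real.log (g z.1 z.2 / maxwellian D z.2) + 2 * (g z.1 z.2 / maxwellian D z.2 * ‖z.1‖
        + Real.exp (-‖z.1‖)))
      = g z.1 z.2 * Real.log (g z.1 z.2 / maxwellian D z.2)
        + 2 * (‖z.1‖ * g z.1 z.2 + Real.exp (-‖z.1‖) * maxwellian D z.2) := by field_simp
  linarith

/-- Jensen's inequality for the probability M dξ, in the form of the tangent line of s log s − s at
s = ρ applied to s = g/M: the entropy of ρ at x is at most the relative entropy of the slice. -/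
theorem density_mul_abs_log_le (hD : 0 < D) (hg0 : ∀ x ξ, 0 ≤ g x ξ) {x : E d}
    (hg : Integrable (g x)) (hs : Integrable fun ξ => shiftedEntropy D g (x, ξ)) :
    density g x * |Real.log (density g x)| ≤ (∫ ξ, shiftedEntropy D g (x, ξ)) + density g x
      + ‖x‖ * density g x + Real.exp (-‖x‖) := by
  have hρ0 := density_nonneg hg0 x
  have hMi := integrable_maxwellian (d := d) hD
  have i0 : Integrable fun ξ => g x ξ * Real.log (density g x) - maxwellian D ξ * density g x :=
    (hg.mul_const _).sub (hMi.mul_const _)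
  have i1 := hg.const_mul ‖x‖
  have i2 := hMi.const_mul (Real.exp (-‖x‖))
  have key : ∫ ξ, (g x ξ * Real.log (density g x) - maxwellian D ξ * density g x + ‖x‖ * g x ξ
      + Real.exp (-‖x‖) * maxwellian D ξ) ≤ ∫ ξ, shiftedEntropy D g (x, ξ) := by
    refine integral_mono_ae ((i0.add i1).add i2) hs ?_
    rcases hρ0.eq_or_lt with hz | hpos
    · have hgz : g x =ᵐ[volume] 0 :=
        (integral_eq_zero_iff_of_nonneg (hg0 x) hg).mp hz.symm
      filter_upwards [hgz] with ξ hξ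
      rw [shiftedEntropy_eq hD, ← hz]
      simp only [Pi.zero_apply] at hξ
      simp [hξ]
    · refine ae_of_all _ fun ξ => ?_
      have hM := maxwellian_pos hD ξ
      have h1 := mul_le_mul_of_nonneg_left
        (mul_log_sub_le (div_nonneg (hg0 x ξ) hM.le) hpos) hM.le
      have e1 : maxwellian D ξ * (g x ξ / maxwellian D ξ * Real.log (density g x) - density g x)
          = g x ξ * Real.log (density g x) - maxwellian D ξ * density g x := by field_simp
      simp only [shiftedEntropy]
      linarith
  rw [integral_add (i0.fun_add i1) i2, integral_add i0 i1, integral_sub (hg.mul_const _)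
    (hMi.mul_const _), integral_mul_const, integral_mul_const, integral_const_mul,
    integral_const_mul, integral_maxwellian hD] at key
  have e : ∫ ξ, g x ξ = density g x := rfl
  rw [e] at key
  have := mul_abs_log_le hρ0 (norm_nonneg x)
  linarith

end shiftedEntropy

namespace IsKinetic

variable {T D ε B K : ℝ} {L : ℝ≥0} {F : ℝ → E d → E d} {f0 : E d → E d → ℝ}
  {f : ℝ → E d → E d → ℝ}

/-- Fatou's lemma in the truncation. The added terms |x| f and exp(−|x|) M make every truncated
integrand nonnegative, by `le_entropyTrunc`, and the dissipation is discarded because of its sign.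
-/
theorem ae_shiftedEntropy_le (h : IsKinetic T D ε B K L F f0 f) :
    ∀ᵐ t ∂(volume.restrict (Ioo 0 T)), Integrable (shiftedEntropy D (f t)) ∧
      (∀ z, 0 ≤ shiftedEntropy D (f t) z) ∧
      ∫ z, shiftedEntropy D (f t) z ≤ shiftedBound T D B f0 := by
  have hD := h.D_pos
  have hk : ∀ n : ℕ, (1 : ℝ) ≤ (n : ℝ) + 1 := fun n => by simp
  have h1 := ae_all_iff.mpr fun n : ℕ => h.ae_entropyK_le (hk n)
  filter_upwards [h1, h.ae_mass_eq, h.ae_position_le_bound] with t ht hm hx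
  obtain ⟨ie, ee⟩ := integrable_exp_mul_maxwellian_prod (d := d) hD
  have hi : ∀ n : ℕ, Integrable fun z : E d × E d =>
      maxwellian D z.2 * entropyTrunc ((n : ℝ) + 1) (f t z.1 z.2 / maxwellian D z.2)
        + ‖z.1‖ * f t z.1 z.2 + Real.exp (-‖z.1‖) * maxwellian D z.2 := fun n =>
    ((integrable_entropyTrunc hD (hk n) hm.1).fun_add hx.1).fun_add ie
  have h0 : ∀ (n : ℕ) (z : E d × E d), 0 ≤
      maxwellian D z.2 * entropyTrunc ((n : ℝ) + 1) (f t z.1 z.2 / maxwellian D z.2)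
        + ‖z.1‖ * f t z.1 z.2 + Real.exp (-‖z.1‖) * maxwellian D z.2 := fun n z => by
    have hM := maxwellian_pos hD z.2
    have h1 := le_entropyTrunc (hk n) (div_nonneg (h.nonneg t z.1 z.2) hM.le) (norm_nonneg z.1)
    have h2 := mul_le_mul_of_nonneg_left h1 hM.le
    have h3 : maxwellian D z.2 * (-(f t z.1 z.2 / maxwellian D z.2 * ‖z.1‖) - Real.exp (-‖z.1‖))
        = -(‖z.1‖ * f t z.1 z.2) - Real.exp (-‖z.1‖) * maxwellian D z.2 := by field_simp
    linarith
  have hlim : ∀ z : E d × E d, Tendsto (fun n : ℕ =>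
      maxwellian D z.2 * entropyTrunc ((n : ℝ) + 1) (f t z.1 z.2 / maxwellian D z.2)
        + ‖z.1‖ * f t z.1 z.2 + Real.exp (-‖z.1‖) * maxwellian D z.2) atTop
      (𝓝 (shiftedEntropy D (f t) z)) := fun z =>
    (((tendsto_entropyTrunc (div_nonneg (h.nonneg t z.1 z.2)
      (maxwellian_pos hD z.2).le)).const_mul _).add_const _).add_const _
  have hs0 : ∀ z, 0 ≤ shiftedEntropy D (f t) z := fun z =>
    ge_of_tendsto' (hlim z) fun n => h0 n z
  have hle : ∀ n : ℕ, ∫ z : E d × E d,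
      (maxwellian D z.2 * entropyTrunc ((n : ℝ) + 1) (f t z.1 z.2 / maxwellian D z.2)
        + ‖z.1‖ * f t z.1 z.2 + Real.exp (-‖z.1‖) * maxwellian D z.2) ≤ shiftedBound T D B f0 := by
    intro n
    rw [integral_add ((integrable_entropyTrunc hD (hk n) hm.1).fun_add hx.1) ie,
      integral_add (integrable_entropyTrunc hD (hk n) hm.1) hx.1, ee]
    have h2 := ht n
    have h3 := entropyK_le hD (hk n) h.datum
    have h4 : 0 ≤ 1 / 2 * (ε ^ 2)⁻¹ * ∫ s in Ioc 0 t, ∫ z, dissTrunc ((n : ℝ) + 1) D (f s) z :=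
      mul_nonneg (by have := h.ε_pos; positivity) (integral_nonneg fun s => integral_nonneg fun z =>
        dissTrunc_nonneg (hk n) hD _ _)
    have h5 : ∫ z : E d × E d, maxwellian D z.2 * entropyTrunc ((n : ℝ) + 1)
        (f t z.1 z.2 / maxwellian D z.2) = entropyK ((n : ℝ) + 1) D (f t) := rfl
    unfold shiftedBound
    linarith [hx.2]
  have hC : 0 ≤ shiftedBound T D B f0 := (integral_nonneg (h0 0)).trans (hle 0)
  have hmeas : AEStronglyMeasurable (shiftedEntropy D (f t)) volume :=
    aestronglyMeasurable_of_tendsto_ae atTop (fun n => (hi n).1) (ae_of_all _ hlim)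
  have key := integrable_and_integral_le_of_tendsto hC hi (fun n => ae_of_all _ (h0 n)) hle hmeas
    (ae_of_all _ hs0) (ae_of_all _ hlim)
  exact ⟨key.1, hs0, key.2⟩

theorem ae_entropy_f_le (h : IsKinetic T D ε B K L F f0 f) :
    ∀ᵐ t ∂(volume.restrict (Ioo 0 T)),
      ∫⁻ p : E d × E d, ENNReal.ofReal (f t p.1 p.2 * |Real.log (f t p.1 p.2)|)
        ≤ ENNReal.ofReal (entropyBound T D B f0) := by
  have hD := h.D_pos
  filter_upwards [h.ae_shiftedEntropy_le, h.ae_mass_eq, h.ae_position_le_bound, h.ae_energy_le] with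
    t hs hm hx he
  obtain ⟨ie, ee⟩ := integrable_exp_mul_maxwellian_prod (d := d) hD
  have i5 := (hm.1.const_mul (logConst d D)).fun_add (he.1.const_mul (1 / (2 * D)))
  have i4 := ((hs.1.fun_add hm.1).fun_add hx.1).fun_add ie
  refine lintegral_ofReal_le_of_le (i4.fun_add i5) (ae_of_all _ fun z => ?_)
    (ae_of_all _ fun z => mul_abs_log_le_shifted hD (h.nonneg t) z) ?_
  · exact (mul_nonneg (h.nonneg t _ _) (abs_nonneg _)).trans
      (mul_abs_log_le_shifted hD (h.nonneg t) z)
  · rw [integral_add i4 i5, integral_add ((hs.1.fun_add hm.1).fun_add hx.1) ie,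
      integral_add (hs.1.fun_add hm.1) hx.1, integral_add hs.1 hm.1,
      integral_add (hm.1.const_mul _) (he.1.const_mul _), integral_const_mul, integral_const_mul, ee]
    have e : ∫ z : E d × E d, f t z.1 z.2 = mass f0 := hm.2
    rw [e]
    unfold entropyBound
    have : 1 / (2 * D) * ∫ z : E d × E d, ‖z.2‖ ^ 2 * f t z.1 z.2
        ≤ 1 / (2 * D) * energyBound D B f0 := mul_le_mul_of_nonneg_left he.2 (by positivity)
    linarith [hs.2.2, hx.2]

theorem ae_entropy_rho_le (h : IsKinetic T D ε B K L F f0 f) :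
    ∀ᵐ t ∂(volume.restrict (Ioo 0 T)),
      ∫⁻ x, ENNReal.ofReal (density (f t) x * |Real.log (density (f t) x)|)
        ≤ ENNReal.ofReal (entropyBound T D B f0) := by
  have hD := h.D_pos
  filter_upwards [h.ae_shiftedEntropy_le, h.ae_mass_eq, h.ae_position_le_bound] with t hs hm hx
  have hs1 : Integrable (shiftedEntropy D (f t)) (volume.prod volume) := hs.1
  have i1 : Integrable fun x => ∫ ξ, shiftedEntropy D (f t) (x, ξ) := hs1.integral_prod_left
  have i2 := VCH.integrable_density hm.1
  have e3 : (fun x => ∫ ξ, ‖x‖ * f t x ξ) = fun x => ‖x‖ * density (f t) x := by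
    ext x; rw [integral_const_mul]; rfl
  have i3 : Integrable fun x => ‖x‖ * density (f t) x := by
    have : Integrable (fun z : E d × E d => ‖z.1‖ * f t z.1 z.2) (volume.prod volume) := hx.1
    rw [← e3]; exact this.integral_prod_left
  have hle : ∀ᵐ x, density (f t) x * |Real.log (density (f t) x)|
      ≤ (∫ ξ, shiftedEntropy D (f t) (x, ξ)) + density (f t) x + ‖x‖ * density (f t) x
        + Real.exp (-‖x‖) := by
    have hm1 : Integrable (fun z : E d × E d => f t z.1 z.2) (volume.prod volume) := hm.1
    filter_upwards [hs1.prod_right_ae, hm1.prod_right_ae] with x h1 h2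
    exact density_mul_abs_log_le hD (h.nonneg t) h2 h1
  refine lintegral_ofReal_le_of_le (((i1.fun_add i2).fun_add i3).fun_add integrable_exp_neg_norm)
    (ae_of_all _ fun x => ?_) hle ?_
  · have hρ := density_nonneg (h.nonneg t) x
    have : 0 ≤ ∫ ξ, shiftedEntropy D (f t) (x, ξ) := integral_nonneg fun ξ => hs.2.1 (x, ξ)
    positivity
  · rw [integral_add ((i1.fun_add i2).fun_add i3) integrable_exp_neg_norm,
      integral_add (i1.fun_add i2) i3, integral_add i1 i2, integral_density hm.1]
    have e1 : ∫ x, ∫ ξ, shiftedEntropy D (f t) (x, ξ) = ∫ z, shiftedEntropy D (f t) z :=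
      (integral_prod _ hs1).symm
    have e2 : ∫ x, ‖x‖ * density (f t) x = ∫ z : E d × E d, ‖z.1‖ * f t z.1 z.2 := by
      rw [← e3]; exact (integral_prod _ hx.1).symm
    have e4 : ∫ z : E d × E d, f t z.1 z.2 = mass f0 := hm.2
    have e5 : ∫ x : E d, Real.exp (-‖x‖) = expConst d := rfl
    rw [e1, e2, e4, e5]
    have h1 : 0 ≤ logConst d D * mass f0 + 1 / (2 * D) * energyBound D B f0 := by
      have a1 := energyBound_nonneg (D := D) (B := B) h.datum
      have a2 := mass_datum_nonneg h.datum
      have a3 : 0 ≤ logConst d D := abs_nonneg _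
      positivity
    unfold entropyBound
    linarith [hs.2.2, hx.2]

end IsKinetic

end

section

variable {d : ℕ}

/-! ### The uniform estimates -/

/-- Write Ψ for the logarithmic factor; it is zero for j ≤ e and satisfies Ψ² ≤ (log j)/2 beyond. If
j ≤ ρ², then Ψ² ≤ |log ρ| and (jΨ)² ≤ Cδ · ρ|log ρ|. If j ≥ ρ², the hypothesis squared gives j³ ≤
(Cδ)², and Ψ² ≤ j gives jΨ ≤ Cδ. -/
theorem mul_sqrtLogSqrtLog_le {j C δ ρ : ℝ} (hCδ : 0 ≤ C * δ) (hρ : 0 ≤ ρ)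
    (h : j ^ 2 ≤ C * δ * ρ) : j * sqrtLogSqrtLog j ≤ 2 * (C * δ) + ρ * |Real.log ρ| := by
  have hn : 0 ≤ ρ * |Real.log ρ| := mul_nonneg hρ (abs_nonneg _)
  rcases le_total j (Real.exp 1) with he | he
  · rw [sqrtLogSqrtLog, max_eq_right he]
    simp only [Real.log_exp, Real.sqrt_one, Real.log_one, Real.sqrt_zero, mul_zero]
    linarith
  have hj0 : 0 < j := (Real.exp_pos 1).trans_le he
  have hL : 1 ≤ Real.log j := by rwa [Real.le_log_iff_exp_le hj0]
  have hΨ0 : 0 ≤ sqrtLogSqrtLog j := Real.sqrt_nonneg _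
  have hΨ : sqrtLogSqrtLog j ^ 2 ≤ 1 / 2 * Real.log j := by
    rw [sqrtLogSqrtLog, max_eq_left he, Real.sq_sqrt (Real.log_nonneg (Real.one_le_sqrt.mpr hL)),
      Real.log_sqrt (by linarith)]
    linarith [Real.log_le_sub_one_of_pos (by linarith : 0 < Real.log j)]
  rcases le_total j (ρ ^ 2) with hle | hle
  · have h1 : Real.log j ≤ 2 * Real.log ρ := by
      have := Real.log_le_log hj0 hle
      rwa [Real.log_pow] at this
    have h2 : sqrtLogSqrtLog j ^ 2 ≤ |Real.log ρ| := by linarith [le_abs_self (Real.log ρ)]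
    have h3 : (j * sqrtLogSqrtLog j) ^ 2 ≤ (C * δ) * (ρ * |Real.log ρ|) := by
      rw [mul_pow, ← mul_assoc]
      exact mul_le_mul h h2 (by positivity) (mul_nonneg hCδ hρ)
    have h4 := two_mul_le_add_of_sq_le hCδ hn h3
    linarith
  · have h1 : sqrtLogSqrtLog j ^ 2 ≤ j := by
      linarith [Real.log_le_sub_one_of_pos hj0]
    have h2 : j * j ^ 3 ≤ j * (C * δ) ^ 2 := by
      calc j * j ^ 3 = (j ^ 2) ^ 2 := by ring
        _ ≤ (C * δ * ρ) ^ 2 := by gcongr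
        _ = (C * δ) ^ 2 * ρ ^ 2 := by ring
        _ ≤ (C * δ) ^ 2 * j := by gcongr
        _ = _ := by ring
    have h3 := le_of_mul_le_mul_left h2 hj0
    have h4 : (j * sqrtLogSqrtLog j) ^ 2 ≤ (C * δ) ^ 2 := by
      calc (j * sqrtLogSqrtLog j) ^ 2 = j ^ 2 * sqrtLogSqrtLog j ^ 2 := by ring
        _ ≤ j ^ 2 * j := by gcongr
        _ = j ^ 3 := by ring
        _ ≤ _ := h3
    have h5 := abs_le_of_sq_le_sq' h4 hCδ
    linarith [h5.2]

/-- By `sq_sub_le_mul_log`, the square of (a − b)/ε is at most the scaled production times a + b;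
then the arithmetic–geometric inequality. If exactly one of a, b vanishes the right-hand side is
infinite. -/
theorem deviation_le {ε : ℝ} (hε : 0 < ε) {a b : ℝ} (ha : 0 ≤ a) (hb : 0 ≤ b) :
    ENNReal.ofReal |(a - b) / ε|
      ≤ ENNReal.ofReal (1 / ε ^ 2) * entropyProduction a b + ENNReal.ofReal (a + b) := by
  have hc : 0 < 1 / ε ^ 2 := by positivity
  rcases ha.eq_or_lt with ha' | ha' <;> rcases hb.eq_or_lt with hb' | hb'
  · simp [← ha', ← hb']
  · have : ¬(a = 0 ↔ b = 0) := by simp [← ha', hb'.ne']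
    rw [entropyProduction, if_neg this, ENNReal.mul_top (by simpa using hε.ne'), top_add]
    exact le_top
  · have : ¬(a = 0 ↔ b = 0) := by simp [← hb', ha'.ne']
    rw [entropyProduction, if_neg this, ENNReal.mul_top (by simpa using hε.ne'), top_add]
    exact le_top
  · have hiff : a = 0 ↔ b = 0 := by simp [hb'.ne', ha'.ne']
    have h0 : 0 ≤ (a - b) * (Real.log a - Real.log b) := by
      rcases le_total a b with hle | hle
      · exact mul_nonneg_of_nonpos_of_nonpos (by linarith)
          (sub_nonpos.mpr (Real.log_le_log ha' hle))
      · exact mul_nonneg (by linarith) (sub_nonneg.mpr (Real.log_le_log hb' hle))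
    have hp : 0 ≤ 1 / ε ^ 2 * ((a - b) * (Real.log a - Real.log b)) := mul_nonneg hc.le h0
    rw [entropyProduction, if_pos hiff, ← ENNReal.ofReal_mul hc.le,
      ← ENNReal.ofReal_add hp (by positivity)]
    refine ENNReal.ofReal_le_ofReal ?_
    have h1 : |(a - b) / ε| ^ 2
        ≤ 1 / ε ^ 2 * ((a - b) * (Real.log a - Real.log b)) * (a + b) := by
      rw [sq_abs, div_pow, div_eq_mul_one_div, mul_comm, mul_assoc]
      exact mul_le_mul_of_nonneg_left (sq_sub_le_mul_log ha' hb') hc.le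
    have := two_mul_le_add_of_sq_le hp (by positivity : 0 ≤ a + b) h1
    linarith [abs_nonneg ((a - b) / ε)]

namespace IsKinetic

variable {T D ε B K : ℝ} {L : ℝ≥0} {F : ℝ → E d → E d} {f0 : E d → E d → ℝ}
  {f : ℝ → E d → E d → ℝ}

theorem lintegral_timeSpace_le {G : ℝ × E d → ℝ≥0∞} (hG : Measurable G) {C : ℝ≥0∞}
    (h : ∀ᵐ t ∂(volume.restrict (Ioo 0 T)), ∫⁻ x, G (t, x) ≤ C) :
    ∫⁻ q, G q ∂(timeSpace d T) ≤ ENNReal.ofReal T * C := by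
  rw [timeSpace, lintegral_prod _ hG.aemeasurable]
  refine (lintegral_mono_ae h).trans ?_
  simp [mul_comm]

theorem lintegral_entropy_rho_le (h : IsKinetic T D ε B K L F f0 f) :
    ∫⁻ q : ℝ × E d, ENNReal.ofReal (density (f q.1) q.2 * |Real.log (density (f q.1) q.2)|)
      ∂(timeSpace d T) ≤ ENNReal.ofReal T * ENNReal.ofReal (entropyBound T D B f0) := by
  have hm := measurable_density h.measurable
  exact lintegral_timeSpace_le (hm.mul hm.log.abs).ennreal_ofReal h.ae_entropy_rho_le

theorem ae_position_rho_le (h : IsKinetic T D ε B K L F f0 f) :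
    ∀ᵐ t ∂(volume.restrict (Ioo 0 T)), ∫⁻ x, ENNReal.ofReal (density (f t) x * ‖x‖)
      ≤ ENNReal.ofReal (positionBound T D B f0) := by
  filter_upwards [h.ae_position_le_bound] with t hx
  have e3 : (fun x => ∫ ξ, ‖x‖ * f t x ξ) = fun x => ‖x‖ * density (f t) x := by
    ext x; rw [integral_const_mul]; rfl
  have hx1 : Integrable (fun z : E d × E d => ‖z.1‖ * f t z.1 z.2) (volume.prod volume) := hx.1
  have i3 : Integrable fun x => ‖x‖ * density (f t) x := by
    rw [← e3]; exact hx1.integral_prod_left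
  have e2 : ∫ x, ‖x‖ * density (f t) x = ∫ z : E d × E d, ‖z.1‖ * f t z.1 z.2 := by
    rw [← e3]; exact (integral_prod _ hx1).symm
  refine lintegral_ofReal_le_of_le i3 (ae_of_all _ fun x => mul_nonneg (norm_nonneg _)
    (density_nonneg (h.nonneg t) x)) (ae_of_all _ fun x => (mul_comm _ _).le) ?_
  rw [e2]
  exact hx.2

theorem lintegral_flux_log_le (h : IsKinetic T D ε B K L F f0 f) :
    ∫⁻ q : ℝ × E d, ENNReal.ofReal
      (‖flux ε (f q.1) q.2‖ * sqrtLogSqrtLog ‖flux ε (f q.1) q.2‖) ∂(timeSpace d T)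
      ≤ ENNReal.ofReal (2 * (fluxConst d D * dissBound T D B f0))
        + ENNReal.ofReal T * ENNReal.ofReal (entropyBound T D B f0) := by
  obtain ⟨i1, e1⟩ := h.integrable_localDiss
  have hC := fluxConst_nonneg (d := d) h.D_pos
  have hm := (measurable_localDiss D ε h.measurable).ennreal_toReal
  calc _ ≤ ∫⁻ q : ℝ × E d, (ENNReal.ofReal (2 * (fluxConst d D * (localDiss D ε f q).toReal))
        + ENNReal.ofReal (density (f q.1) q.2 * |Real.log (density (f q.1) q.2)|))
        ∂(timeSpace d T) := by
        refine lintegral_mono_ae ?_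
        filter_upwards [h.ae_sq_norm_flux_le] with q hq
        have hρ := density_nonneg (h.nonneg q.1) q.2
        have hδ : 0 ≤ fluxConst d D * (localDiss D ε f q).toReal :=
          mul_nonneg hC ENNReal.toReal_nonneg
        rw [← ENNReal.ofReal_add (by positivity) (by positivity)]
        exact ENNReal.ofReal_le_ofReal (mul_sqrtLogSqrtLog_le hδ hρ hq)
    _ = (∫⁻ q : ℝ × E d, ENNReal.ofReal (2 * (fluxConst d D * (localDiss D ε f q).toReal))
        ∂(timeSpace d T)) + ∫⁻ q : ℝ × E d,
        ENNReal.ofReal (density (f q.1) q.2 * |Real.log (density (f q.1) q.2)|)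
        ∂(timeSpace d T) :=
        lintegral_add_left ((hm.const_mul _).const_mul _).ennreal_ofReal _
    _ ≤ _ := by
        refine add_le_add ?_ h.lintegral_entropy_rho_le
        refine lintegral_ofReal_le_of_le ((i1.const_mul _).const_mul _)
          (ae_of_all _ fun q => mul_nonneg two_pos.le (mul_nonneg hC ENNReal.toReal_nonneg))
          (ae_of_all _ fun q => le_rfl) ?_
        rw [integral_const_mul, integral_const_mul, e1]
        have := h.dissipation_toReal_le
        gcongr

theorem lintegral_deviation_le (h : IsKinetic T D ε B K L F f0 f) :
    ∫⁻ p, ENNReal.ofReal |(density (f p.1) p.2.1 * maxwellian D p.2.2 - f p.1 p.2.1 p.2.2) / ε|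
      ∂(timePhase d T)
      ≤ ENNReal.ofReal (dissBound T D B f0) + ENNReal.ofReal T * ENNReal.ofReal (2 * mass f0) := by
  have hD := h.D_pos
  have h1 := (measurable_density h.measurable).comp
    (measurable_fst.prodMk (measurable_fst.comp measurable_snd) :
      Measurable fun p : ℝ × E d × E d => (p.1, p.2.1))
  have h2 := (continuous_maxwellian (d := d) D).measurable.comp
    (measurable_snd.comp measurable_snd : Measurable fun p : ℝ × E d × E d => p.2.2)
  have hm : Measurable fun p : ℝ × E d × E d => ENNReal.ofReal
      (density (f p.1) p.2.1 * maxwellian D p.2.2 + f p.1 p.2.1 p.2.2) :=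
    ((h1.mul h2).add h.measurable).ennreal_ofReal
  calc _ ≤ ∫⁻ p, (ENNReal.ofReal (1 / ε ^ 2) * entropyProduction
          (density (f p.1) p.2.1 * maxwellian D p.2.2) (f p.1 p.2.1 p.2.2)
        + ENNReal.ofReal (density (f p.1) p.2.1 * maxwellian D p.2.2 + f p.1 p.2.1 p.2.2))
        ∂(timePhase d T) :=
        lintegral_mono fun p => deviation_le h.ε_pos
          (mul_nonneg (density_nonneg (h.nonneg _) _) (maxwellian_pos hD _).le) (h.nonneg _ _ _)
    _ = dissipation T D ε f + ∫⁻ p, ENNReal.ofReal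
          (density (f p.1) p.2.1 * maxwellian D p.2.2 + f p.1 p.2.1 p.2.2) ∂(timePhase d T) :=
        lintegral_add_right _ hm
    _ ≤ _ := by
        refine add_le_add h.dissipation_le_dissBound ?_
        rw [timePhase, lintegral_prod _ hm.aemeasurable]
        have h3 : ∀ᵐ t ∂(volume.restrict (Ioo 0 T)), ∫⁻ z : E d × E d, ENNReal.ofReal
            (density (f t) z.1 * maxwellian D z.2 + f t z.1 z.2) ≤ ENNReal.ofReal (2 * mass f0) := by
          filter_upwards [h.ae_mass_eq] with t ht
          have i1 := integrable_density_mul ht.1 (integrable_maxwellian hD)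
          refine lintegral_ofReal_le_of_le (i1.fun_add ht.1) (ae_of_all _ fun z => ?_)
            (ae_of_all _ fun z => le_rfl) ?_
          · exact add_nonneg (mul_nonneg (density_nonneg (h.nonneg _) _) (maxwellian_pos hD _).le)
              (h.nonneg _ _ _)
          · rw [integral_add i1 ht.1, integral_density_mul ht.1, integral_maxwellian hD, mul_one]
            have : ∫ z : E d × E d, f t z.1 z.2 = mass f0 := ht.2
            rw [this]
            linarith
        refine (lintegral_mono_ae h3).trans ?_
        simp [mul_comm]

/-- All the estimates, with an explicit constant. -/
theorem uniformEstimates (h : IsKinetic T D ε B K L F f0 f) {C : ℝ≥0}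
    (c1 : ENNReal.ofReal (mass f0) ≤ C) (c2 : ENNReal.ofReal (entropyBound T D B f0) ≤ C)
    (c3 : ENNReal.ofReal (energyBound D B f0) ≤ C)
    (c4 : ENNReal.ofReal (dissBound T D B f0)
      + ENNReal.ofReal T * ENNReal.ofReal (2 * mass f0) ≤ C)
    (c5 : ENNReal.ofReal (fluxBound T D B f0) ≤ C)
    (c6 : ENNReal.ofReal (2 * (fluxConst d D * dissBound T D B f0))
        + ENNReal.ofReal T * ENNReal.ofReal (entropyBound T D B f0) ≤ C)
    (c7 : ENNReal.ofReal (positionBound T D B f0) ≤ C) : UniformEstimates T D ε f C where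
  mass_f := by
    filter_upwards [h.ae_mass_eq] with t ht
    exact (lintegral_ofReal_le_of_le ht.1 (ae_of_all _ fun z => h.nonneg _ _ _)
      (ae_of_all _ fun z => le_rfl) ht.2.le).trans c1
  mass_rho := by
    filter_upwards [h.ae_mass_eq] with t ht
    exact (lintegral_ofReal_le_of_le (VCH.integrable_density ht.1)
      (ae_of_all _ fun x => density_nonneg (h.nonneg t) x)
      (ae_of_all _ fun z => le_rfl) ((integral_density ht.1).trans ht.2).le).trans c1
  entropy_f := h.ae_entropy_f_le.mono fun t ht => ht.trans c2
  kinetic := by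
    filter_upwards [h.ae_energy_le] with t ht
    exact (lintegral_ofReal_le_of_le ht.1
      (ae_of_all _ fun z => mul_nonneg (by positivity) (h.nonneg _ _ _))
      (ae_of_all _ fun z => (mul_comm _ _).le) ht.2).trans c3
  entropy_rho := h.ae_entropy_rho_le.mono fun t ht => ht.trans c2
  dissipation := h.dissipation_le_dissBound.trans (le_self_add.trans c4)
  deviation := h.lintegral_deviation_le.trans c4
  flux_L1 := (lintegral_ofReal_le_of_le h.integrable_flux.norm
    (ae_of_all _ fun q => norm_nonneg _) (ae_of_all _ fun q => le_rfl)
    h.totalFlux_le_fluxBound).trans c5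
  flux_log := h.lintegral_flux_log_le.trans c6
  position_f := by
    filter_upwards [h.ae_position_le_bound] with t ht
    exact (lintegral_ofReal_le_of_le ht.1
      (ae_of_all _ fun z => mul_nonneg (norm_nonneg _) (h.nonneg _ _ _))
      (ae_of_all _ fun z => (mul_comm _ _).le) ht.2).trans c7
  position_rho := h.ae_position_rho_le.mono fun t ht => ht.trans c7

end IsKinetic

theorem exists_nnreal_ge (s : Finset ℝ≥0∞) (hs : ∀ c ∈ s, c ≠ ⊤) : ∃ C : ℝ≥0, ∀ c ∈ s, c ≤ C := by
  refine ⟨(s.sup id).toNNReal, fun c hc => ?_⟩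
  rw [ENNReal.coe_toNNReal]
  · exact Finset.le_sup (f := id) hc
  · exact ((Finset.sup_lt_iff (by simp)).mpr fun c hc => (hs c hc).lt_top).ne

/-- All explicit bounds depend on d, T, D, B and f⁰ only. The Lipschitz constant L and the bound K,
which may degenerate with ε and α, enter none of them. -/
theorem exists_uniformEstimates (T D B : ℝ) (f0 : E d → E d → ℝ) : ∃ C : ℝ≥0,
    ∀ {ε K : ℝ} {L : ℝ≥0} {F : ℝ → E d → E d} {f : ℝ → E d → E d → ℝ},
      IsKinetic T D ε B K L F f0 f → UniformEstimates T D ε f C := by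
  classical
  obtain ⟨C, hC⟩ := exists_nnreal_ge {ENNReal.ofReal (mass f0),
    ENNReal.ofReal (entropyBound T D B f0), ENNReal.ofReal (energyBound D B f0),
    ENNReal.ofReal (dissBound T D B f0) + ENNReal.ofReal T * ENNReal.ofReal (2 * mass f0),
    ENNReal.ofReal (fluxBound T D B f0),
    ENNReal.ofReal (2 * (fluxConst d D * dissBound T D B f0))
        + ENNReal.ofReal T * ENNReal.ofReal (entropyBound T D B f0),
    ENNReal.ofReal (positionBound T D B f0)} (by
      intro c hc
      simp only [Finset.mem_insert, Finset.mem_singleton] at hc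
      rcases hc with rfl | rfl | rfl | rfl | rfl | rfl | rfl
      all_goals first
        | exact ENNReal.ofReal_ne_top
        | exact ENNReal.add_ne_top.mpr ⟨ENNReal.ofReal_ne_top,
            ENNReal.mul_ne_top ENNReal.ofReal_ne_top ENNReal.ofReal_ne_top⟩)
  refine ⟨C, fun h => h.uniformEstimates ?_ ?_ ?_ ?_ ?_ ?_ ?_⟩
  all_goals exact hC _ (by simp)

/-- Solutions of the Vlasov equation satisfy the kinetic equation with a uniformly bounded force. -/
theorem IsSolution.exists_isKinetic {T D δ : ℝ} {ωL ωS : E d → ℝ} {f0 : E d → E d → ℝ} (hT : 0 < T)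
    (hD : 0 < D) (hωL : IsLongRangeKernel ωL δ) (hωS : IsShortRangeKernel ωS)
    (hf0 : IsInitialDatum f0) : ∃ B : ℝ, ∀ ε ∈ Ioo (0 : ℝ) 1, ∀ α ∈ Ioc (0 : ℝ) 1,
      ∀ f : ℝ → E d → E d → ℝ, IsSolution T D ε α ωL ωS f0 f →
        ∃ K L F, IsKinetic T D ε B K L F f0 f := by
  obtain ⟨B, hB0, hB⟩ := exists_force_bound hωL hωS (mass f0) (IsKinetic.mass_datum_nonneg hf0)
  refine ⟨B, fun ε hε α hα f hf => ?_⟩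
  obtain ⟨F, hFm, hF⟩ := exists_measurable_force hωL hωS hα
    (ρ := fun t => density (f t)) (measurable_density hf.measurable)
  -- Two passes are made. The solution comes with some bound K₁ on its mass, not uniform; the
  -- resulting force bound is enough for renormalization, hence for conservation of mass. The mass
  -- being then that of f⁰, the force bound can be taken to be the uniform B.
  obtain ⟨K₁, hK₁⟩ := hf.exists_mass_bound
  obtain ⟨B₁, hB₁0, hB₁⟩ := exists_force_bound hωL hωS K₁ K₁.2
  obtain ⟨L₁, hL₁⟩ := hB₁ α hα
  obtain ⟨L, hL⟩ := hB α hα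
  have h1 : IsKinetic T D ε B₁ _ _ F f0 f := ⟨hT, hD, hε.1, hε.2, hB₁0, hf0, hf.nonneg,
    hf.isTransport hT hD hε.1 hf0 hFm hF hK₁ hL₁⟩
  exact ⟨_, _, F, hT, hD, hε.1, hε.2, hB0, hf0, hf.nonneg,
    hf.isTransport hT hD hε.1 hf0 hFm hF (h1.ae_mass_eq.mono fun t ht => ⟨ht.1, ht.2.le⟩) hL⟩

end

section

/-! ### A criterion for weak sequential compactness in `L¹` -/

/-- Simultaneous extraction of weakly convergent subsequences from countably many bounded sequences
in a separable Hilbert space. -/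
theorem exists_subseq_tendsto_inner {H : Type*} [NormedAddCommGroup H] [InnerProductSpace ℝ H]
    [CompleteSpace H] [TopologicalSpace.SeparableSpace H] {x : ℕ → ℕ → H} {R : ℕ → ℝ}
    (hx : ∀ j n, ‖x j n‖ ≤ R j) : ∃ σ : ℕ → ℕ, StrictMono σ ∧ ∃ y : ℕ → H,
      ∀ j φ, Tendsto (fun n => inner ℝ (x j (σ n)) φ) atTop (𝓝 (inner ℝ (y j) φ)) := by
  -- Banach–Alaoglu: weak-star closed balls are compact, and metrizable by separability. Their
  -- countable product is then sequentially compact, which performs the diagonal extraction.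
  let K : ℕ → Set (WeakDual ℝ H) := fun j =>
    WeakDual.toStrongDual ⁻¹' Metric.closedBall (0 : StrongDual ℝ H) (R j)
  have hK : ∀ j, IsCompact (K j) := fun j => WeakDual.isCompact_closedBall (𝕜 := ℝ) (0 : StrongDual ℝ H) (R j)
  have : ∀ j, CompactSpace (K j) := fun j => isCompact_iff_compactSpace.mp (hK j)
  have : ∀ j, TopologicalSpace.MetrizableSpace (K j) := fun j =>
    WeakDual.metrizable_of_isCompact ℝ H _ (hK j)
  let X : ℕ → ∀ j, K j := fun n j =>
    ⟨StrongDual.toWeakDual (InnerProductSpace.toDual ℝ H (x j n)), by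
      simpa [K] using hx j n⟩
  obtain ⟨Y, σ, hσ, hY⟩ := CompactSpace.tendsto_subseq X
  refine ⟨σ, hσ, fun j => (InnerProductSpace.toDual ℝ H).symm (WeakDual.toStrongDual (Y j).1),
    fun j φ => ?_⟩
  have h1 := tendsto_pi_nhds.mp hY j
  have h2 := (continuous_subtype_val.tendsto (Y j)).comp h1
  have h3 := ((WeakDual.eval_continuous φ).tendsto (Y j).1).comp h2
  rw [InnerProductSpace.toDual_symm_apply]
  exact h3

variable {Ω G : Type*} [MeasurableSpace Ω] {μ : Measure Ω} [NormedAddCommGroup G]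

theorem integrable_of_memLp_two_of_eq_zero {v : Ω → G} (hv : MemLp v 2 μ) {S : Set Ω}
    (hSμ : μ S ≠ ⊤) (h0 : ∀ z, z ∉ S → v z = 0) : Integrable v μ := by
  have : IsFiniteMeasure (μ.restrict S) := ⟨by simpa using hSμ.lt_top⟩
  have h1 : IntegrableOn v S μ := (hv.restrict S).integrable one_le_two
  exact (integrableOn_iff_integrable_of_support_subset fun z hz => by
    by_contra hzS
    exact hz (h0 z hzS)).mp h1

variable [InnerProductSpace ℝ G]

theorem integrable_inner_of_bound {g v : Ω → G} (hg : AEStronglyMeasurable g μ) {M : ℝ}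
    (hM : ∀ᵐ z ∂μ, ‖g z‖ ≤ M) (hv : Integrable v μ) :
    Integrable (fun z => inner ℝ (g z) (v z)) μ := by
  refine (hv.norm.const_mul M).mono' (hg.inner hv.aestronglyMeasurable) ?_
  filter_upwards [hM] with z hz
  exact (norm_inner_le_norm _ _).trans (by gcongr)

theorem abs_integral_inner_le {g v : Ω → G} {M : ℝ}
    (hM : ∀ᵐ z ∂μ, ‖g z‖ ≤ M) (hv : Integrable v μ) :
    |∫ z, inner ℝ (g z) (v z) ∂μ| ≤ M * ∫ z, ‖v z‖ ∂μ := by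
  rw [← integral_const_mul, ← Real.norm_eq_abs]
  refine norm_integral_le_of_norm_le (hv.norm.const_mul M) ?_
  filter_upwards [hM] with z hz
  exact (norm_inner_le_norm _ _).trans (by gcongr)

theorem abs_integral_inner_sub_le {g v w : Ω → G} (hg : AEStronglyMeasurable g μ) {M : ℝ}
    (hM : ∀ᵐ z ∂μ, ‖g z‖ ≤ M) (hv : Integrable v μ) (hw : Integrable w μ) :
    |∫ z, inner ℝ (g z) (v z) ∂μ - ∫ z, inner ℝ (g z) (w z) ∂μ| ≤ M * ∫ z, ‖v z - w z‖ ∂μ := by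
  rw [← integral_sub (integrable_inner_of_bound hg hM hv) (integrable_inner_of_bound hg hM hw)]
  simp_rw [← inner_sub_right]
  exact abs_integral_inner_le hM (hv.sub hw)

/-- The `L¹` norm is lower semicontinuous for the weak convergence against bounded functions. -/
theorem integral_norm_le_of_tendsto_inner {v : ℕ → Ω → G} {w : Ω → G} (hv : ∀ n, Integrable (v n) μ)
    (hw : Integrable w μ)
    (h : ∀ g : Ω → G, AEStronglyMeasurable g μ → (∀ᵐ z ∂μ, ‖g z‖ ≤ 1) →
      Tendsto (fun n => ∫ z, inner ℝ (g z) (v n z) ∂μ) atTop (𝓝 (∫ z, inner ℝ (g z) (w z) ∂μ)))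
    {C : ℝ} (hC : ∀ n, ∫ z, ‖v n z‖ ∂μ ≤ C) : ∫ z, ‖w z‖ ∂μ ≤ C := by
  -- The bounded test field is the direction of the limit itself; it is zero where w vanishes.
  have hg : AEStronglyMeasurable (fun z => ‖w z‖⁻¹ • w z) μ :=
    (hw.aestronglyMeasurable.norm.aemeasurable.inv.aestronglyMeasurable).smul
      hw.aestronglyMeasurable
  have h1 : ∀ᵐ z ∂μ, ‖‖w z‖⁻¹ • w z‖ ≤ 1 := ae_of_all _ fun z => by
    rw [norm_smul, norm_inv, norm_norm]
    exact inv_mul_le_one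
  have h2 : ∀ z, inner ℝ (‖w z‖⁻¹ • w z) (w z) = ‖w z‖ := fun z => by
    rw [real_inner_smul_left, real_inner_self_eq_norm_sq]
    rcases eq_or_ne ‖w z‖ 0 with h | h
    · simp [h]
    · field_simp
  have h3 := h _ hg h1
  simp_rw [h2] at h3
  refine le_of_tendsto h3 (Eventually.of_forall fun n => (le_abs_self _).trans ?_)
  exact (abs_integral_inner_le h1 (hv n)).trans (by simpa using hC n)

variable [FiniteDimensional ℝ G]

/-- Weak compactness in L². A bounded test field need not be in L², but the functions at level j
live on the set S j of finite measure, so it may be truncated to that set. -/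
theorem exists_subseq_tendsto_integral_inner [IsSeparable μ] {v : ℕ → ℕ → Ω → G} {S : ℕ → Set Ω}
    {R : ℕ → ℝ≥0} (hS : ∀ j, MeasurableSet (S j)) (hSμ : ∀ j, μ (S j) ≠ ⊤)
    (hv : ∀ j n, MemLp (v j n) 2 μ) (hR : ∀ j n, eLpNorm (v j n) 2 μ ≤ R j)
    (h0 : ∀ j n z, z ∉ S j → v j n z = 0) :
    ∃ σ : ℕ → ℕ, StrictMono σ ∧ ∃ w : ℕ → Ω → G, (∀ j, Integrable (w j) μ) ∧
      ∀ j (g : Ω → G), AEStronglyMeasurable g μ → ∀ M, (∀ᵐ z ∂μ, ‖g z‖ ≤ M) →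
        Tendsto (fun n => ∫ z, inner ℝ (g z) (v j (σ n) z) ∂μ) atTop
          (𝓝 (∫ z, inner ℝ (g z) (w j z) ∂μ)) := by
  have : Fact ((2 : ℝ≥0∞) ≠ ⊤) := ⟨by simp⟩
  have : CompleteSpace G := FiniteDimensional.complete ℝ G
  have : ProperSpace G := FiniteDimensional.proper ℝ G
  obtain ⟨σ, hσ, y, hy⟩ := exists_subseq_tendsto_inner (H := Lp G 2 μ)
    (x := fun j n => (hv j n).toLp (v j n)) (R := fun j => (R j : ℝ)) (fun j n => by
      rw [Lp.norm_toLp]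
      exact ENNReal.toReal_le_of_le_ofReal (R j).2 (by simpa using hR j n))
  refine ⟨σ, hσ, fun j => (S j).indicator (y j), fun j => ?_, fun j g hg M hM => ?_⟩
  · exact integrable_of_memLp_two_of_eq_zero ((Lp.memLp (y j)).indicator (hS j)) (hSμ j)
      fun z hz => indicator_of_notMem hz _
  · have hg2 : MemLp ((S j).indicator g) 2 μ := by
      have : IsFiniteMeasure (μ.restrict (S j)) := ⟨by simpa using (hSμ j).lt_top⟩
      rw [memLp_indicator_iff_restrict (hS j)]
      exact MemLp.of_bound hg.restrict M (ae_restrict_of_ae hM)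
    have h1 := hy j (hg2.toLp _)
    simp only [L2.inner_def] at h1
    have h2 : ∀ n, ∫ z, inner ℝ (((hv j (σ n)).toLp (v j (σ n)) : Lp G 2 μ) z)
        ((hg2.toLp _ : Lp G 2 μ) z) ∂μ = ∫ z, inner ℝ (g z) (v j (σ n) z) ∂μ := by
      intro n
      refine integral_congr_ae ?_
      filter_upwards [(hv j (σ n)).coeFn_toLp, hg2.coeFn_toLp] with z h3 h4
      rw [h3, h4, real_inner_comm]
      by_cases hz : z ∈ S j
      · rw [indicator_of_mem hz]
      · rw [indicator_of_notMem hz, h0 j _ z hz, inner_zero_left, inner_zero_right]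
    have h5 : ∫ z, inner ℝ ((y j : Lp G 2 μ) z) ((hg2.toLp _ : Lp G 2 μ) z) ∂μ
        = ∫ z, inner ℝ (g z) ((S j).indicator (y j) z) ∂μ := by
      refine integral_congr_ae ?_
      filter_upwards [hg2.coeFn_toLp] with z h4
      rw [h4, real_inner_comm]
      by_cases hz : z ∈ S j
      · rw [indicator_of_mem hz, indicator_of_mem hz]
      · rw [indicator_of_notMem hz, indicator_of_notMem hz, inner_zero_left, inner_zero_right]
    simp_rw [h2, h5] at h1
    exact h1

theorem tendsto_of_forall_tendsto_inner {x : ℕ → G} {y : G}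
    (h : ∀ c : G, Tendsto (fun n => inner ℝ c (x n)) atTop (𝓝 (inner ℝ c y))) :
    Tendsto x atTop (𝓝 y) := by
  have h1 : Tendsto (fun n => ∑ i, inner ℝ (stdOrthonormalBasis ℝ G i) (x n) •
      stdOrthonormalBasis ℝ G i) atTop
      (𝓝 (∑ i, inner ℝ (stdOrthonormalBasis ℝ G i) y • stdOrthonormalBasis ℝ G i)) :=
    tendsto_finsetSum _ fun i _ => (h _).smul_const _
  simpa only [OrthonormalBasis.sum_repr'] using h1

/-- A sequence in `L¹` which is, uniformly and up to arbitrarily small errors in `L¹`, bounded in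
`L²` of a set of finite measure has a weakly convergent subsequence. -/
theorem exists_subseq_tendsto_integral_smul [IsSeparable μ] {u : ℕ → Ω → G}
    (hu : ∀ n, Integrable (u n) μ)
    (H : ∀ η : ℝ, 0 < η → ∃ S, MeasurableSet S ∧ μ S ≠ ⊤ ∧ ∃ R : ℝ≥0, ∀ n, ∃ v : Ω → G,
      MemLp v 2 μ ∧ eLpNorm v 2 μ ≤ R ∧ (∀ z, z ∉ S → v z = 0) ∧ ∫ z, ‖u n z - v z‖ ∂μ ≤ η) :
    ∃ σ : ℕ → ℕ, StrictMono σ ∧ ∃ w : Ω → G, Integrable w μ ∧ ∀ ψ : Ω → ℝ, MemLp ψ ⊤ μ →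
      Tendsto (fun n => ∫ z, ψ z • u (σ n) z ∂μ) atTop (𝓝 (∫ z, ψ z • w z ∂μ)) := by
  have : CompleteSpace G := FiniteDimensional.complete ℝ G
  have hη : ∀ j : ℕ, (0 : ℝ) < (1 / 2) ^ j := fun j => by positivity
  have hη0 : Tendsto (fun j : ℕ => ((1 : ℝ) / 2) ^ j) atTop (𝓝 0) :=
    tendsto_pow_atTop_nhds_zero_of_lt_one (by norm_num) (by norm_num)
  choose S hS hSμ R v hv hR h0 huv using fun j : ℕ => H _ (hη j)
  obtain ⟨σ, hσ, w, hw, hlim⟩ := exists_subseq_tendsto_integral_inner hS hSμ hv hR h0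
  have hvi : ∀ j n, Integrable (v j n) μ := fun j n =>
    integrable_of_memLp_two_of_eq_zero (hv j n) (hSμ j) (h0 j n)
  -- Both approximations of u are close to it in L¹, and this passes to the weak limits by lower
  -- semicontinuity of the norm. The limits at the successive levels are thus Cauchy in L¹.
  have hdist : ∀ i j, ∫ z, ‖w i z - w j z‖ ∂μ ≤ (1 / 2) ^ i + (1 / 2) ^ j := by
    intro i j
    refine integral_norm_le_of_tendsto_inner
      (v := fun n z => v i (σ n) z - v j (σ n) z) (w := fun z => w i z - w j z)
      (fun n => (hvi i _).sub (hvi j _)) ((hw i).sub (hw j)) (fun g hg hg1 => ?_) fun n => ?_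
    · have h1 := (hlim i g hg 1 hg1).sub (hlim j g hg 1 hg1)
      simp_rw [inner_sub_right]
      rw [integral_sub (integrable_inner_of_bound hg hg1 (hw i))
        (integrable_inner_of_bound hg hg1 (hw j))]
      refine h1.congr fun n => ?_
      rw [integral_sub (integrable_inner_of_bound hg hg1 (hvi i _))
        (integrable_inner_of_bound hg hg1 (hvi j _))]
    · have hi := ((hu (σ n)).sub (hvi i (σ n))).norm
      have hj := ((hu (σ n)).sub (hvi j (σ n))).norm
      refine (integral_mono ((hvi i _).sub (hvi j _)).norm (hi.add hj) fun z => ?_).trans ?_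
      · have := norm_sub_le_norm_sub_add_norm_sub (v i (σ n) z) (u (σ n) z) (v j (σ n) z)
        rw [norm_sub_rev (v i (σ n) z) (u (σ n) z)] at this
        exact this
      · rw [integral_add' hi hj]
        exact add_le_add (huv i _) (huv j _)
  let W : ℕ → Lp G 1 μ := fun j => (hw j).toL1 (w j)
  have hWdist : ∀ i j, dist (W i) (W j) = ∫ z, ‖w i z - w j z‖ ∂μ := fun i j => by
    rw [dist_eq_norm, ← Integrable.toL1_sub, L1.norm_of_fun_eq_integral_norm]
    rfl
  have hC : CauchySeq W := by
    refine cauchySeq_of_le_geometric (1 / 2) 2 (by norm_num) fun j => ?_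
    rw [hWdist]
    refine (hdist j (j + 1)).trans ?_
    have := hη j
    rw [pow_succ]
    linarith
  obtain ⟨W0, hW0⟩ := cauchySeq_tendsto_of_complete hC
  have hWi : Integrable W0 μ := L1.integrable_coeFn W0
  have hW : Tendsto (fun j => ∫ z, ‖w j z - W0 z‖ ∂μ) atTop (𝓝 0) := by
    refine (tendsto_iff_dist_tendsto_zero.mp hW0).congr fun j => ?_
    rw [dist_eq_norm, L1.norm_eq_integral_norm]
    refine integral_congr_ae ?_
    filter_upwards [Lp.coeFn_sub (W j) W0, (hw j).coeFn_toL1] with z h1 h2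
    rw [h1, Pi.sub_apply, h2]
  refine ⟨σ, hσ, W0, hWi, fun ψ hψ => tendsto_of_forall_tendsto_inner fun c => ?_⟩
  have hψb : ∀ᵐ z ∂μ, ‖ψ z‖ ≤ (eLpNorm ψ ⊤ μ).toReal := by
    filter_upwards [ae_le_eLpNormEssSup (f := ψ) (μ := μ)] with z hz
    rw [← eLpNorm_exponent_top] at hz
    rw [← toReal_enorm]
    exact ENNReal.toReal_mono hψ.2.ne hz
  set M : ℝ := (eLpNorm ψ ⊤ μ).toReal * ‖c‖
  have hM0 : 0 ≤ M := by positivity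
  have hg : AEStronglyMeasurable (fun z => ψ z • c) μ := hψ.1.smul_const c
  have hgM : ∀ᵐ z ∂μ, ‖ψ z • c‖ ≤ M := by
    filter_upwards [hψb] with z hz
    rw [norm_smul]
    exact mul_le_mul_of_nonneg_right hz (norm_nonneg c)
  have hψi : ∀ {f : Ω → G}, Integrable f μ →
      inner ℝ c (∫ z, ψ z • f z ∂μ) = ∫ z, inner ℝ (ψ z • c) (f z) ∂μ := fun {f} hf => by
    rw [← integral_inner (f := fun z => ψ z • f z) (hf.smul_of_top_right hψ)]
    simp_rw [real_inner_smul_left, real_inner_smul_right]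
  simp_rw [hψi hWi, hψi (hu _)]
  rw [Metric.tendsto_atTop]
  intro ε hε
  -- The level j is fixed first, making both approximation errors together smaller than ε/2
  -- uniformly in n; the weak convergence at that level then takes care of the other half.
  have h1 : Tendsto (fun j : ℕ => M * (1 / 2) ^ j + M * ∫ z, ‖w j z - W0 z‖ ∂μ) atTop (𝓝 0) := by
    simpa using (hη0.const_mul M).add (hW.const_mul M)
  obtain ⟨j, hj⟩ := (h1.eventually (gt_mem_nhds (half_pos hε))).exists
  obtain ⟨N, hN⟩ := Metric.tendsto_atTop.mp (hlim j _ hg M hgM) (ε / 2) (half_pos hε)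
  refine ⟨N, fun n hn => ?_⟩
  have e1 := hN n hn
  have e2 := abs_integral_inner_sub_le hg hgM (hu (σ n)) (hvi j (σ n))
  have e3 := abs_integral_inner_sub_le hg hgM (hw j) hWi
  have e4 := mul_le_mul_of_nonneg_left (huv j (σ n)) hM0
  rw [Real.dist_eq] at e1 ⊢
  rw [abs_lt] at e1 ⊢
  rw [abs_le] at e2 e3
  constructor <;> linarith [e1.1, e1.2, e2.1, e2.2, e3.1, e3.2]

end

section

variable {d : ℕ}

/-! ### Weak compactness of the densities and of the fluxes -/

theorem eLpNorm_two_le_of_sq_le {Ω G : Type*} [MeasurableSpace Ω] {μ : Measure Ω}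
    [NormedAddCommGroup G] {v : Ω → G} {p : Ω → ℝ} (hp : Integrable p μ)
    (h : ∀ᵐ z ∂μ, ‖v z‖ ^ 2 ≤ p z) {C : ℝ} (hC : ∫ z, p z ∂μ ≤ C) :
    eLpNorm v 2 μ ≤ ENNReal.ofReal C ^ (1 / 2 : ℝ) := by
  rw [eLpNorm_eq_lintegral_rpow_enorm_toReal (by norm_num) (by norm_num)]
  simp only [ENNReal.toReal_ofNat]
  refine ENNReal.rpow_le_rpow ?_ (by norm_num)
  refine le_trans (lintegral_mono_ae ?_) (lintegral_ofReal_le_of_le hp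
    (h.mono fun z hz => (sq_nonneg _).trans hz) (ae_of_all _ fun z => le_rfl) hC)
  filter_upwards [h] with z hz
  rw [← ofReal_norm, ENNReal.ofReal_rpow_of_nonneg (norm_nonneg _) (by norm_num)]
  exact ENNReal.ofReal_le_ofReal (by simpa using hz)

/-- The approximation of u is its restriction to the complement of A. The square is bounded by an
integrable p depending on u, not by a constant: for the flux only the integral of such a p is
controlled, being a multiple of the dissipation. -/
theorem isWeaklyPrecompactL1_of_truncation {Ω G : Type*} [MeasurableSpace Ω] {μ : Measure Ω}
    [IsSeparable μ] [NormedAddCommGroup G] [InnerProductSpace ℝ G] [FiniteDimensional ℝ G]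
    {U : Set (Ω → G)} (hU : ∀ u ∈ U, Integrable u μ)
    (H : ∀ η : ℝ, 0 < η → ∃ S, MeasurableSet S ∧ μ S ≠ ⊤ ∧ ∃ C : ℝ, ∀ u ∈ U, ∃ A : Set Ω,
      MeasurableSet A ∧ Aᶜ ⊆ S ∧ ∫ z in A, ‖u z‖ ∂μ ≤ η ∧ ∃ p : Ω → ℝ, Integrable p μ ∧
        (∀ z, 0 ≤ p z) ∧ (∀ᵐ z ∂μ, z ∉ A → ‖u z‖ ^ 2 ≤ p z) ∧ ∫ z, p z ∂μ ≤ C) :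
    IsWeaklyPrecompactL1 μ U := by
  refine ⟨hU, fun u hu => exists_subseq_tendsto_integral_smul (fun n => hU _ (hu n))
    fun η hη => ?_⟩
  obtain ⟨S, hS, hSμ, C, hC⟩ := H η hη
  have htop : ENNReal.ofReal C ^ (1 / 2 : ℝ) ≠ ⊤ :=
    ENNReal.rpow_ne_top_of_nonneg (by norm_num) ENNReal.ofReal_ne_top
  refine ⟨S, hS, hSμ, (ENNReal.ofReal C ^ (1 / 2 : ℝ)).toNNReal, fun n => ?_⟩
  obtain ⟨A, hA, hAS, hAη, p, hp, hp0, hup, hpC⟩ := hC _ (hu n)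
  have hle : eLpNorm (Aᶜ.indicator (u n)) 2 μ ≤ ENNReal.ofReal C ^ (1 / 2 : ℝ) := by
    refine eLpNorm_two_le_of_sq_le hp ?_ hpC
    filter_upwards [hup] with z hz
    by_cases hzA : z ∈ A
    · rw [indicator_of_notMem (notMem_compl_iff.mpr hzA)]
      simpa using hp0 z
    · rw [indicator_of_mem hzA]
      exact hz hzA
  refine ⟨Aᶜ.indicator (u n), ⟨(hU _ (hu n)).aestronglyMeasurable.indicator hA.compl,
    hle.trans_lt htop.lt_top⟩, by rwa [ENNReal.coe_toNNReal htop],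
    fun z hz => indicator_of_notMem (fun h => hz (hAS h)) _, le_of_eq_of_le ?_ hAη⟩
  rw [← integral_indicator hA]
  refine integral_congr_ae (ae_of_all _ fun z => ?_)
  by_cases hzA : z ∈ A
  · simp [hzA]
  · simp [hzA]

instance isSeparable_timeSpace (d : ℕ) (T : ℝ) : IsSeparable (timeSpace d T) := by
  unfold timeSpace
  infer_instance

theorem timeSpace_univ_prod_closedBall_ne_top (d : ℕ) (T m : ℝ) :
    timeSpace d T (univ ×ˢ Metric.closedBall 0 m) ≠ ⊤ := by
  rw [timeSpace, Measure.prod_prod]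
  exact ENNReal.mul_ne_top (by simp) measure_closedBall_lt_top.ne

/-- The set where the density is large or the position is far away. -/
def tailSet (m : ℝ) (f : ℝ → E d → E d → ℝ) : Set (ℝ × E d) :=
  {q | Real.exp m < density (f q.1) q.2 ∨ m < ‖q.2‖}

theorem compl_tailSet_subset (m : ℝ) (f : ℝ → E d → E d → ℝ) :
    (tailSet m f)ᶜ ⊆ univ ×ˢ Metric.closedBall 0 m := fun q hq => by
  simp only [tailSet, mem_compl_iff, mem_ofPred_eq, not_or, not_lt] at hq
  exact ⟨mem_univ _, by simpa using hq.2⟩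

/-- The numerator in the bound for the mass of the density on the tail set. -/
def tailConst (T D B : ℝ) (f0 : E d → E d → ℝ) : ℝ :=
  (ENNReal.ofReal T * ENNReal.ofReal (entropyBound T D B f0)
    + ENNReal.ofReal T * ENNReal.ofReal (positionBound T D B f0)).toReal

namespace IsKinetic

variable {T D ε B K : ℝ} {L : ℝ≥0} {F : ℝ → E d → E d} {f0 : E d → E d → ℝ}
  {f : ℝ → E d → E d → ℝ}

theorem measurableSet_tailSet (h : IsKinetic T D ε B K L F f0 f) (m : ℝ) :
    MeasurableSet (tailSet m f) :=
  (measurableSet_lt measurable_const (measurable_density h.measurable)).union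
    (measurableSet_lt measurable_const measurable_snd.norm)

/-- Chebyshev's inequality: on the tail set |log ρ| + |x| exceeds m, and the integral of ρ(|log ρ| +
|x|) is bounded uniformly. -/
theorem setIntegral_density_tailSet_le (h : IsKinetic T D ε B K L F f0 f) {m : ℝ} (hm : 0 < m) :
    ∫ q in tailSet m f, density (f q.1) q.2 ∂(timeSpace d T) ≤ tailConst T D B f0 / m := by
  have hρ : ∀ q : ℝ × E d, 0 ≤ density (f q.1) q.2 := fun q => density_nonneg (h.nonneg q.1) q.2
  have hρm := measurable_density h.measurable
  have hA := h.measurableSet_tailSet m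
  set c1 := ENNReal.ofReal T * ENNReal.ofReal (entropyBound T D B f0)
  set c2 := ENNReal.ofReal T * ENNReal.ofReal (positionBound T D B f0)
  have hpos : ∫⁻ q : ℝ × E d, ENNReal.ofReal (density (f q.1) q.2 * ‖q.2‖) ∂(timeSpace d T) ≤ c2 :=
    lintegral_timeSpace_le (hρm.mul measurable_snd.norm).ennreal_ofReal h.ae_position_rho_le
  have hint : ∫⁻ q : ℝ × E d, (tailSet m f).indicator
      (fun q => ENNReal.ofReal (density (f q.1) q.2)) q ∂(timeSpace d T)
      ≤ ENNReal.ofReal m⁻¹ * (c1 + c2) := by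
    calc _ ≤ ∫⁻ q : ℝ × E d, ENNReal.ofReal m⁻¹ *
          (ENNReal.ofReal (density (f q.1) q.2 * |Real.log (density (f q.1) q.2)|)
            + ENNReal.ofReal (density (f q.1) q.2 * ‖q.2‖)) ∂(timeSpace d T) := by
          refine lintegral_mono fun q => ?_
          by_cases hq : q ∈ tailSet m f
          · rw [indicator_of_mem hq, ← ENNReal.ofReal_add (mul_nonneg (hρ q) (abs_nonneg _))
              (mul_nonneg (hρ q) (norm_nonneg _)), ← ENNReal.ofReal_mul (by positivity)]
            refine ENNReal.ofReal_le_ofReal ?_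
            rw [← mul_add, inv_mul_eq_div, le_div_iff₀ hm]
            refine mul_le_mul_of_nonneg_left ?_ (hρ q)
            rcases hq with hq | hq
            · have h1 := Real.log_lt_log (Real.exp_pos m) hq
              rw [Real.log_exp] at h1
              linarith [le_abs_self (Real.log (density (f q.1) q.2)), norm_nonneg q.2]
            · linarith [abs_nonneg (Real.log (density (f q.1) q.2))]
          · rw [indicator_of_notMem hq]
            exact bot_le
      _ = ENNReal.ofReal m⁻¹ *
          ((∫⁻ q : ℝ × E d, ENNReal.ofReal (density (f q.1) q.2 *
            |Real.log (density (f q.1) q.2)|) ∂(timeSpace d T))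
            + ∫⁻ q : ℝ × E d, ENNReal.ofReal (density (f q.1) q.2 * ‖q.2‖) ∂(timeSpace d T)) := by
          rw [lintegral_const_mul' _ _ ENNReal.ofReal_ne_top,
            lintegral_add_left (f := fun q : ℝ × E d =>
              ENNReal.ofReal (density (f q.1) q.2 * |Real.log (density (f q.1) q.2)|))
              (hρm.mul hρm.log.abs).ennreal_ofReal]
      _ ≤ _ := by
          gcongr
          exact h.lintegral_entropy_rho_le
  have hc : c1 + c2 ≠ ⊤ := by simp [c1, c2, ENNReal.mul_eq_top]
  rw [integral_eq_lintegral_of_nonneg_ae (ae_of_all _ hρ) hρm.aestronglyMeasurable,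
    ← lintegral_indicator hA]
  refine (ENNReal.toReal_mono (ENNReal.mul_ne_top ENNReal.ofReal_ne_top hc) hint).trans_eq ?_
  rw [ENNReal.toReal_mul, ENNReal.toReal_ofReal (by positivity), inv_mul_eq_div]
  rfl

/-- Cauchy–Schwarz for |J|² ≤ CΔρ on A. Smallness of the mass of ρ on a set is inherited by |J|,
with a constant uniform in ε. -/
theorem setIntegral_norm_flux_le (h : IsKinetic T D ε B K L F f0 f) {A : Set (ℝ × E d)} :
    (∫ q in A, ‖flux ε (f q.1) q.2‖ ∂(timeSpace d T)) ^ 2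
      ≤ fluxConst d D * dissBound T D B f0
        * ∫ q in A, density (f q.1) q.2 ∂(timeSpace d T) := by
  obtain ⟨i1, e1⟩ := h.integrable_localDiss
  have hC := fluxConst_nonneg (d := d) h.D_pos
  have hρ : ∀ q : ℝ × E d, 0 ≤ density (f q.1) q.2 := fun q => density_nonneg (h.nonneg q.1) q.2
  refine (sq_integral_le_of_sq_le (u := fun q => ‖flux ε (f q.1) q.2‖)
    (p := fun q => fluxConst d D * (localDiss D ε f q).toReal)
    (q := fun q => density (f q.1) q.2) h.integrable_flux.norm.restrict (i1.const_mul _).restrict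
    h.integrable_density.1.restrict (ae_of_all _ fun q => norm_nonneg _)
    (ae_of_all _ fun q => mul_nonneg hC ENNReal.toReal_nonneg)
    (ae_of_all _ hρ) (ae_restrict_of_ae h.ae_sq_norm_flux_le)).trans ?_
  refine mul_le_mul_of_nonneg_right ?_ (integral_nonneg hρ)
  refine (setIntegral_le_integral (i1.const_mul _)
    (ae_of_all _ fun q => mul_nonneg hC ENNReal.toReal_nonneg)).trans ?_
  rw [integral_const_mul, e1]
  exact mul_le_mul_of_nonneg_left h.dissipation_toReal_le hC

end IsKinetic

/-- `f` solves a kinetic equation, with parameter `ε`, for some force bounded by `B`. -/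
def IsKineticFamily (T D B : ℝ) (f0 : E d → E d → ℝ) (ε : ℝ) (f : ℝ → E d → E d → ℝ) : Prop :=
  ∃ K L F, IsKinetic T D ε B K L F f0 f

theorem exists_pos_div_le {c η : ℝ} (hη : 0 < η) : ∃ m : ℝ, 0 < m ∧ c / m ≤ η := by
  refine ⟨max 1 (c / η), by positivity, ?_⟩
  rw [div_le_iff₀ (by positivity)]
  calc c = η * (c / η) := by field_simp
    _ ≤ η * max 1 (c / η) := by gcongr; exact le_max_right _ _

/-- Off the tail set ρ ≤ exp m, so ρ² ≤ exp(m) ρ, whose integral is fixed by conservation of mass.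
-/
theorem isWeaklyPrecompactL1_density (T D B : ℝ) (f0 : E d → E d → ℝ) :
    IsWeaklyPrecompactL1 (timeSpace d T) {u : ℝ × E d → ℝ | ∃ ε f,
      IsKineticFamily T D B f0 ε f ∧ u = fun q => density (f q.1) q.2} := by
  refine isWeaklyPrecompactL1_of_truncation ?_ fun η hη => ?_
  · rintro _ ⟨ε, f, ⟨K, L, F, h⟩, rfl⟩
    exact h.integrable_density.1
  obtain ⟨m, hm, hmη⟩ := exists_pos_div_le (c := tailConst T D B f0) hη
  refine ⟨univ ×ˢ Metric.closedBall 0 m,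
    MeasurableSet.univ.prod Metric.isClosed_closedBall.measurableSet,
    timeSpace_univ_prod_closedBall_ne_top d T m, Real.exp m * (T * mass f0), ?_⟩
  rintro _ ⟨ε, f, ⟨K, L, F, h⟩, rfl⟩
  have hρ : ∀ q : ℝ × E d, 0 ≤ density (f q.1) q.2 := fun q => density_nonneg (h.nonneg q.1) q.2
  refine ⟨tailSet m f, h.measurableSet_tailSet m, compl_tailSet_subset m f, ?_,
    fun q => Real.exp m * density (f q.1) q.2, h.integrable_density.1.const_mul _,
    fun q => mul_nonneg (Real.exp_pos m).le (hρ q), ae_of_all _ fun q hq => ?_, ?_⟩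
  · simp_rw [Real.norm_of_nonneg (hρ _)]
    exact (h.setIntegral_density_tailSet_le hm).trans hmη
  · rw [Real.norm_of_nonneg (hρ _), sq]
    exact mul_le_mul_of_nonneg_right (not_lt.mp fun h => hq (Or.inl h)) (hρ q)
  · rw [integral_const_mul, h.integrable_density.2]

/-- Off the tail set of the density, |J|² ≤ CΔρ is at most exp(m) CΔ, whose integral is bounded by
the dissipation. On the tail set |J| is small with ρ. -/
theorem isWeaklyPrecompactL1_flux (T D B : ℝ) (f0 : E d → E d → ℝ) :
    IsWeaklyPrecompactL1 (timeSpace d T) {u : ℝ × E d → E d | ∃ ε f,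
      IsKineticFamily T D B f0 ε f ∧ u = fun q => flux ε (f q.1) q.2} := by
  refine isWeaklyPrecompactL1_of_truncation ?_ fun η hη => ?_
  · rintro _ ⟨ε, f, ⟨K, L, F, h⟩, rfl⟩
    exact h.integrable_flux
  -- The target is η² because the tail estimate bounds the square of the integral of |J|.
  obtain ⟨m, hm, hmη⟩ := exists_pos_div_le
    (c := fluxConst d D * dissBound T D B f0 * tailConst T D B f0) (by positivity : 0 < η ^ 2)
  refine ⟨univ ×ˢ Metric.closedBall 0 m,
    MeasurableSet.univ.prod Metric.isClosed_closedBall.measurableSet,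
    timeSpace_univ_prod_closedBall_ne_top d T m,
    Real.exp m * (fluxConst d D * dissBound T D B f0), ?_⟩
  rintro _ ⟨ε, f, ⟨K, L, F, h⟩, rfl⟩
  obtain ⟨i1, e1⟩ := h.integrable_localDiss
  have hC := fluxConst_nonneg (d := d) h.D_pos
  have hdiss := h.dissipation_toReal_le
  have hδ : ∀ q, 0 ≤ fluxConst d D * (localDiss D ε f q).toReal := fun q =>
    mul_nonneg hC ENNReal.toReal_nonneg
  refine ⟨tailSet m f, h.measurableSet_tailSet m, compl_tailSet_subset m f, ?_,
    fun q => Real.exp m * (fluxConst d D * (localDiss D ε f q).toReal),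
    (i1.const_mul _).const_mul _, fun q => mul_nonneg (Real.exp_pos m).le (hδ q), ?_, ?_⟩
  · refine le_of_sq_le_sq ?_ hη.le
    refine h.setIntegral_norm_flux_le.trans (le_trans ?_ hmη)
    rw [mul_div_assoc]
    exact mul_le_mul_of_nonneg_left (h.setIntegral_density_tailSet_le hm)
      (mul_nonneg hC (ENNReal.toReal_nonneg.trans hdiss))
  · filter_upwards [h.ae_sq_norm_flux_le] with q hq hqA
    refine hq.trans ?_
    rw [mul_comm]
    exact mul_le_mul_of_nonneg_right (not_lt.mp fun h => hqA (Or.inl h)) (hδ q)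
  · rw [integral_const_mul, integral_const_mul, e1]
    gcongr

theorem IsWeaklyPrecompactL1.mono {Ω G : Type*} [MeasurableSpace Ω] {μ : Measure Ω}
    [NormedAddCommGroup G] [NormedSpace ℝ G] {U V : Set (Ω → G)} (hV : IsWeaklyPrecompactL1 μ V)
    (h : U ⊆ V) : IsWeaklyPrecompactL1 μ U :=
  ⟨fun u hu => hV.1 u (h hu), fun u hu => hV.2 u fun n => h (hu n)⟩

end

end VCH

end

theorem theorem2p1 (d : ℕ) (hd : 1 ≤ d) (T D δ : ℝ) (hT : 0 < T) (hD : 0 < D)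
    (ωL ωS : VCH.E d → ℝ) (hωL : VCH.IsLongRangeKernel ωL δ) (hωS : VCH.IsShortRangeKernel ωS)
    (f0 : VCH.E d → VCH.E d → ℝ) (hf0 : VCH.IsInitialDatum f0)
    (henergy : (⨆ α ∈ Ioc (0 : ℝ) 1,
      VCH.interactionEnergy α ωL ωS (VCH.density f0)) < ⊤) :
    (∃ C : ℝ≥0, ∀ ε ∈ Ioo (0 : ℝ) 1, ∀ α ∈ Ioc (0 : ℝ) 1, ∀ f : ℝ → VCH.E d → VCH.E d → ℝ,
      VCH.IsSolution T D ε α ωL ωS f0 f → VCH.UniformEstimates T D ε f C) ∧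
    VCH.IsWeaklyPrecompactL1 (VCH.timeSpace d T)
      {u : ℝ × VCH.E d → ℝ | ∃ ε ∈ Ioo (0 : ℝ) 1, ∃ α ∈ Ioc (0 : ℝ) 1,
        ∃ f : ℝ → VCH.E d → VCH.E d → ℝ, VCH.IsSolution T D ε α ωL ωS f0 f ∧
          u = fun p => VCH.density (f p.1) p.2} ∧
    VCH.IsWeaklyPrecompactL1 (VCH.timeSpace d T)
      {u : ℝ × VCH.E d → VCH.E d | ∃ ε ∈ Ioo (0 : ℝ) 1, ∃ α ∈ Ioc (0 : ℝ) 1,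
        ∃ f : ℝ → VCH.E d → VCH.E d → ℝ, VCH.IsSolution T D ε α ωL ωS f0 f ∧
          u = fun p => VCH.flux ε (f p.1) p.2} := by
  -- B is fixed before ε, α and the solution. The three conclusions are statements about all kinetic
  -- solutions with force bounded by B, and the families considered are subsets of that larger
  -- class.
  obtain ⟨B, hB⟩ := VCH.IsSolution.exists_isKinetic hT hD hωL hωS hf0
  obtain ⟨C, hC⟩ := VCH.exists_uniformEstimates T D B f0
  refine ⟨⟨C, fun ε hε α hα f hf => ?_⟩, (VCH.isWeaklyPrecompactL1_density T D B f0).mono ?_,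
    (VCH.isWeaklyPrecompactL1_flux T D B f0).mono ?_⟩
  · obtain ⟨K, L, F, h⟩ := hB ε hε α hα f hf
    exact hC h
  · rintro u ⟨ε, hε, α, hα, f, hf, hu⟩
    exact ⟨ε, f, hB ε hε α hα f hf, hu⟩
  · rintro u ⟨ε, hε, α, hα, f, hf, hu⟩
    exact ⟨ε, f, hB ε hε α hα f hf, hu⟩
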